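/- Let $k$ be a field and $T\in k$. Let $\underline{\mathrm{Re}}\mathrm{p}_k(S_T)$ be Deligne's category: the idempotent completion of the additive closure of the $k$-linear symmetric monoidal category with objects $[n]$, $n\ge 0$, in which $\mathrm{Hom}([m],[n])$ is the free $k$-module on the partitions of the set $\{1,\dots,m,1',\dots,n'\}$, composition stacks partitions and replaces each connected component that lies entirely in the middle by a factor $T$, the tensor product is $[m]\otimes[n]=[m+n]$ with juxtaposition of partitions, and the symmetry is the block permutation. Filter it by the full subcategories $\mathcal D_n$ of direct summands of finite direct sums of the objects $[0],\dots,[n]$, with $\mathcal D_{-1}=\{0\}$. Let $\operatorname{gr}(\underline{\mathrm{Re}}\mathrm{p}_k(S_T))=\bigoplus_{n\ge0}\mathcal D_n/\mathcal D_{n-1}$ (where $\mathcal D_n/\mathcal D_{n-1}$ is the quotient of $\mathcal D_n$ by the morphisms that factor through an object of $\mathcal D_{n-1}$), with the induced $k$-linear symmetric monoidal structure and grading. Let $\bigoplus_{n\ge0}\operatorname{proj}k[S_n]$ be the direct sum of the categories of finitely generated projective right $k[S_n]$-modules, with the tensor product given by induction, $(P,Q)\mapsto (P\boxtimes Q)\otimes_{k[S_m]\otimes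 k[S_n]}k[S_{m+n}]$, where $S_m$ acts on the first $m$ and $S_n$ on the last $n$ elements of $\{1,\dots,m+n\}$, and with the symmetry given by interchanging the factors and the two blocks. (1) There is an equivalence of $k$-linear symmetric monoidal categories $$F:\operatorname{gr}(\underline{\mathrm{Re}}\mathrm{p}_k(S_T))\ \simeq\ \bigoplus_{n\ge0}\operatorname{proj}k[S_n]$$ that is compatible with the gradings: an object $X$ is concentrated in degree $n$ if and only if $F(X)$ is. (2) Let $K_0$ denote the split Grothendieck group, and let $\operatorname{gr}K_0(\underline{\mathrm{Re}}\mathrm{p}_k(S_T))$ be the associated graded ring of the ring $K_0(\underline{\mathrm{Re}}\mathrm{p}_k(S_T))$ for the filtration whose $n$-th step is the subgroup generated by the classes of the objects of $\mathcal D_n$. Then $F$ induces an isomorphism of graded rings $$\operatorname{gr}K_0(\underline{\mathrm{Re}}\mathrm{p}_k(S_T))\ \cong\ \bigoplus_{n\ge0}K_0(\operatorname{proj}k[S_n]),$$ where the product on the right is given by induction; it maps the class in degree $n$ of the $n$-th component of an object $X$ of $\operatorname{gr}(\underline{\mathrm{Re}}\mathrm{p}_k(S_T))$ to the class of the $n$-th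 component of $F(X)$. (3) The graded ring $\bigoplus_{n\ge0}K_0(\operatorname{proj}k[S_n])$ depends, up to isomorphism of graded rings, only on the characteristic of $k$: if $k'$ is a field with $\operatorname{char}k'=\operatorname{char}k$, then $\bigoplus_{n\ge0}K_0(\operatorname{proj}k[S_n])\cong\bigoplus_{n\ge0}K_0(\operatorname{proj}k'[S_n])$ as graded rings. -/

import Mathlib

universe v u w

noncomputable section

section

open CategoryTheory

namespace Deligne

open scoped Classical in
/-- The equivalence relation on `A ⊔ B ⊔ C` generated by a partition of `A ⊔ B` and one of `B ⊔ C`: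
the connected components of the stacked diagram. -/
def glue {A B C : Type} (p : Setoid (A ⊕ B)) (q : Setoid (B ⊕ C)) : Setoid (A ⊕ (B ⊕ C)) :=
  Setoid.map p (Sum.map id Sum.inl) ⊔ Setoid.map q Sum.inr

/-- The partition of `A ⊔ C` that the stacked diagram defines. -/
def compPart {A B C : Type} (p : Setoid (A ⊕ B)) (q : Setoid (B ⊕ C)) : Setoid (A ⊕ C) :=
  (glue p q).comap (Sum.map id Sum.inr)

/-- The number of connected components of the stacked diagram that contain no point of `A ⊔ C`. -/
def loops {A B C : Type} (p : Setoid (A ⊕ B)) (q : Setoid (B ⊕ C)) : ℕ :=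
  Nat.card {c : Quotient (glue p q) // ∀ x : A ⊕ C, Quotient.mk _ (Sum.map id Sum.inr x) ≠ c}

/-- The partition with blocks `{a, e a}`. -/
def permPart {A B : Type} (e : A ≃ B) : Setoid (A ⊕ B) := Setoid.ker (Sum.elim e id)

/-- Horizontal juxtaposition of partitions. -/
def tensorPart {A B A' B' : Type} (p : Setoid (A ⊕ B)) (p' : Setoid (A' ⊕ B')) :
    Setoid ((A ⊕ A') ⊕ (B ⊕ B')) :=
  Setoid.map p (Sum.map Sum.inl Sum.inl) ⊔ Setoid.map p' (Sum.map Sum.inr Sum.inr)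

open scoped Classical in
/-- Auxiliary matrix of a partition, used for the proofs of the category axioms only. -/
def mat {A B : Type} (p : Setoid (A ⊕ B)) (f : A → Bool) (g : B → Bool) : ℕ :=
  if p ≤ Setoid.ker (Sum.elim f g) then 1 else 0

theorem map_le_ker {X Y Z : Type} (r : Setoid X) (i : X → Y) (w : Y → Z) :
    Setoid.map r i ≤ Setoid.ker w ↔ r ≤ Setoid.ker (w ∘ i) := by
  constructor
  · intro h x y hxy
    exact h (Relation.EqvGen.rel _ _ ⟨x, y, hxy, rfl, rfl⟩)
  · intro h
    refine Setoid.eqvGen_le ?_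
    rintro _ _ ⟨x, y, hxy, rfl, rfl⟩
    exact h hxy

theorem card_extensions {X Y : Type} [Finite X] (r : Setoid X) (i : Y → X) (u : Y → Bool)
    (hu : r.comap i ≤ Setoid.ker u) :
    Nat.card {w : X → Bool // r ≤ Setoid.ker w ∧ w ∘ i = u} =
      2 ^ Nat.card {c : Quotient r // ∀ x : Y, Quotient.mk _ (i x) ≠ c} := by
  classical
  have e : {w : X → Bool // r ≤ Setoid.ker w ∧ w ∘ i = u} ≃
      ({c : Quotient r // ∀ x : Y, Quotient.mk _ (i x) ≠ c} → Bool) :=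
    { toFun := fun w c => Quotient.lift w.1 (fun a b hab => w.2.1 hab) c.1
      invFun := fun φ => ⟨fun x => if h : ∀ y : Y, Quotient.mk r (i y) ≠ Quotient.mk r x
          then φ ⟨_, h⟩ else u (not_forall.mp h).choose, by
        intro a b hab
        have hq : Quotient.mk r a = Quotient.mk r b := Quotient.sound hab
        simp only [Setoid.ker_def, hq], by
        funext y
        have h : ¬ ∀ z : Y, Quotient.mk r (i z) ≠ Quotient.mk r (i y) := fun h => h y rfl
        simp only [Function.comp, dif_neg h]
        have h2 := Quotient.exact (not_ne_iff.mp (not_forall.mp h).choose_spec)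
        exact hu h2⟩
      left_inv := by
        rintro ⟨w, hw, rfl⟩
        ext x
        by_cases h : ∀ y : Y, Quotient.mk r (i y) ≠ Quotient.mk r x
        · simp [h]
        · simp only [dif_neg h]
          rw [show (w ∘ i) (not_forall.mp h).choose = w x from
            hw (Quotient.exact (not_ne_iff.mp (not_forall.mp h).choose_spec))]
      right_inv := by
        intro φ
        ext ⟨c, hc⟩
        induction c using Quotient.inductionOn with
        | h x => simp [hc] }
  rw [Nat.card_congr e, Nat.card_fun]
  simp

theorem mat_mul {A B C : Type} [Finite A] [Finite B] [Finite C] [Fintype (B → Bool)]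
    (p : Setoid (A ⊕ B)) (q : Setoid (B ⊕ C)) (f : A → Bool) (g : C → Bool) :
    ∑ h : B → Bool, mat p f h * mat q h g = 2 ^ loops p q * mat (compPart p q) f g := by
  classical
  have key : ∀ h : B → Bool, mat p f h * mat q h g =
      if glue p q ≤ Setoid.ker (Sum.elim f (Sum.elim h g)) then 1 else 0 := by
    intro h
    have h1 : Sum.elim f (Sum.elim h g) ∘ Sum.map id Sum.inl = Sum.elim f h := by
      ext (x | x) <;> rfl
    have h2 : Sum.elim f (Sum.elim h g) ∘ Sum.inr = Sum.elim h g := by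
      ext (x | x) <;> rfl
    simp only [glue, sup_le_iff, map_le_ker, h1, h2, mat]
    split_ifs <;> simp_all
  simp only [key, Finset.sum_boole, Nat.cast_id]
  by_cases hu : compPart p q ≤ Setoid.ker (Sum.elim f g)
  · rw [mat, if_pos hu, mul_one, loops, ← card_extensions (glue p q) _ (Sum.elim f g) hu,
      ← Fintype.card_subtype, ← Nat.card_eq_fintype_card]
    refine Nat.card_congr
      { toFun := fun h => ⟨Sum.elim f (Sum.elim h.1 g), h.2, by ext (x | x) <;> rfl⟩
        invFun := fun w => ⟨fun b => w.1 (Sum.inr (Sum.inl b)), ?_⟩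
        left_inv := fun h => rfl
        right_inv := ?_ }
    · obtain ⟨w, hw, hw'⟩ := w
      convert hw
      ext (x | x | x)
      · exact (congrFun hw' (Sum.inl x)).symm
      · rfl
      · exact (congrFun hw' (Sum.inr x)).symm
    · rintro ⟨w, hw, hw'⟩
      ext (x | x | x)
      · exact (congrFun hw' (Sum.inl x)).symm
      · rfl
      · exact (congrFun hw' (Sum.inr x)).symm
  · rw [mat, if_neg hu, mul_zero, Finset.card_eq_zero, Finset.filter_eq_empty_iff]
    intro h _ hh
    refine hu fun x y hxy => ?_
    have := hh hxy
    rcases x with x | x <;> rcases y with y | y <;> exact this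

theorem mat_const {A B : Type} (p : Setoid (A ⊕ B)) :
    mat p (fun _ => true) (fun _ => true) = 1 := by
  rw [mat, if_pos]
  rintro (x | x) (y | y) _ <;> rfl

theorem mat_inj {A B : Type} {p q : Setoid (A ⊕ B)} {a b : ℕ}
    (h : ∀ f g, 2 ^ a * mat p f g = 2 ^ b * mat q f g) : p = q ∧ a = b := by
  classical
  have hab : a = b := by
    have := h (fun _ => true) (fun _ => true)
    rw [mat_const, mat_const, mul_one, mul_one] at this
    exact Nat.pow_right_injective (le_refl 2) this
  subst hab
  have hpq : ∀ w : A ⊕ B → Bool, p ≤ Setoid.ker w ↔ q ≤ Setoid.ker w := by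
    intro w
    have := Nat.eq_of_mul_eq_mul_left (by positivity) (h (w ∘ Sum.inl) (w ∘ Sum.inr))
    simp only [mat, Sum.elim_comp_inl_inr] at this
    split_ifs at this <;> simp_all
  have aux : ∀ p q : Setoid (A ⊕ B), (∀ w : A ⊕ B → Bool, p ≤ Setoid.ker w ↔ q ≤ Setoid.ker w) →
      p ≤ q := by
    intro p q hw x y hxy
    have := (hw (fun z => decide (q x z))).2 (by
      intro a b hab
      simp only [Setoid.ker_def, decide_eq_decide]
      exact ⟨fun h => q.trans' h hab, fun h => q.trans' h (q.symm' hab)⟩) hxy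
    simp only [Setoid.ker_def, decide_eq_decide] at this
    exact this.1 (q.refl' x)
  exact ⟨le_antisymm (aux _ _ hpq) (aux _ _ fun w => (hpq w).symm), rfl⟩

theorem comp_eq_of_mat {A B C : Type} [Finite A] [Finite B] [Finite C] [Fintype (B → Bool)]
    {p : Setoid (A ⊕ B)} {q : Setoid (B ⊕ C)} {r : Setoid (A ⊕ C)} {a : ℕ}
    (h : ∀ f g, ∑ h : B → Bool, mat p f h * mat q h g = 2 ^ a * mat r f g) :
    compPart p q = r ∧ loops p q = a :=
  mat_inj fun f g => by rw [← mat_mul, h]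

theorem mat_perm {A B : Type} (e : A ≃ B) (f : A → Bool) (g : B → Bool) [Decidable (f = g ∘ e)] :
    mat (permPart e) f g = if f = g ∘ e then 1 else 0 := by
  rw [mat]
  congr 1
  simp only [eq_iff_iff]
  constructor
  · intro h
    funext a
    exact h (show Sum.elim e id (Sum.inl a) = Sum.elim e id (Sum.inr (e a)) from rfl)
  · rintro rfl (x | x) (y | y) h <;> exact congrArg g h

theorem mat_perm' {A B : Type} (e : A ≃ B) (f : A → Bool) (g : B → Bool)
    [Decidable (g = f ∘ e.symm)] :
    mat (permPart e) f g = if g = f ∘ e.symm then 1 else 0 := by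
  classical
  rw [mat_perm]
  congr 1
  rw [eq_iff_iff, Equiv.eq_comp_symm]
  exact eq_comm

theorem mat_tensor {A B A' B' : Type} (p : Setoid (A ⊕ B)) (p' : Setoid (A' ⊕ B'))
    (f : A ⊕ A' → Bool) (g : B ⊕ B' → Bool) :
    mat (tensorPart p p') f g =
      mat p (f ∘ Sum.inl) (g ∘ Sum.inl) * mat p' (f ∘ Sum.inr) (g ∘ Sum.inr) := by
  classical
  have h1 : Sum.elim f g ∘ Sum.map Sum.inl Sum.inl =
      Sum.elim (f ∘ Sum.inl) (g ∘ Sum.inl) := by ext (x | x) <;> rfl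
  have h2 : Sum.elim f g ∘ Sum.map Sum.inr Sum.inr =
      Sum.elim (f ∘ Sum.inr) (g ∘ Sum.inr) := by ext (x | x) <;> rfl
  simp only [mat, tensorPart, sup_le_iff, map_le_ker, h1, h2]
  split_ifs <;> simp_all

section
variable {A B C D A' B' C' : Type} [Finite A] [Finite B] [Finite C] [Finite D]
  [Finite A'] [Finite B'] [Finite C']

theorem perm_comp (e : A ≃ B) (q : Setoid (B ⊕ C)) (r : Setoid (A ⊕ C))
    (h : ∀ f g, mat q (f ∘ e.symm) g = mat r f g) :
    compPart (permPart e) q = r ∧ loops (permPart e) q = 0 := by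
  classical
  have := Fintype.ofFinite (B → Bool)
  exact comp_eq_of_mat fun f g => by simp [mat_perm', h]

theorem comp_perm (p : Setoid (A ⊕ B)) (e : B ≃ C) (r : Setoid (A ⊕ C))
    (h : ∀ f g, mat p f (g ∘ e) = mat r f g) :
    compPart p (permPart e) = r ∧ loops p (permPart e) = 0 := by
  classical
  have := Fintype.ofFinite (B → Bool)
  exact comp_eq_of_mat fun f g => by simp [mat_perm, h]

theorem part_assoc (p : Setoid (A ⊕ B)) (q : Setoid (B ⊕ C)) (r : Setoid (C ⊕ D)) :
    compPart (compPart p q) r = compPart p (compPart q r) ∧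
      loops p q + loops (compPart p q) r = loops q r + loops p (compPart q r) := by
  have := Fintype.ofFinite (B → Bool)
  have := Fintype.ofFinite (C → Bool)
  refine mat_inj fun f g => ?_
  rw [pow_add, pow_add, mul_assoc, mul_assoc, ← mat_mul, ← mat_mul, Finset.mul_sum, Finset.mul_sum]
  simp_rw [← mul_assoc, ← mat_mul, mul_comm (2 ^ _) (mat p _ _), mul_assoc, ← mat_mul,
    Finset.sum_mul, Finset.mul_sum]
  rw [Finset.sum_comm]
  simp_rw [mul_assoc]

theorem part_interchange (p : Setoid (A ⊕ B)) (q : Setoid (B ⊕ C)) (p' : Setoid (A' ⊕ B'))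
    (q' : Setoid (B' ⊕ C')) :
    compPart (tensorPart p p') (tensorPart q q') = tensorPart (compPart p q) (compPart p' q') ∧
      loops (tensorPart p p') (tensorPart q q') = loops p q + loops p' q' := by
  have := Fintype.ofFinite (B → Bool)
  have := Fintype.ofFinite (B' → Bool)
  have := Fintype.ofFinite (B ⊕ B' → Bool)
  refine comp_eq_of_mat fun f g => ?_
  rw [mat_tensor, pow_add, mul_mul_mul_comm, ← mat_mul, ← mat_mul, Finset.sum_mul_sum,
    ← Finset.sum_product', Finset.univ_product_univ,
    ← (Equiv.sumArrowEquivProdArrow B B' Bool).sum_comp]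
  refine Finset.sum_congr rfl fun h _ => ?_
  rw [mat_tensor, mat_tensor]
  exact mul_mul_mul_comm _ _ _ _

end

end Deligne

end

section

open CategoryTheory MonoidalCategory

namespace Deligne

section
variable {A B C D A' B' C' A'' B'' : Type} [Finite A] [Finite B] [Finite C] [Finite D]
  [Finite A'] [Finite B'] [Finite C'] [Finite A''] [Finite B'']

theorem part_slide (p : Setoid (A ⊕ B)) (p' : Setoid (A' ⊕ B')) (e : A ≃ A') (e' : B ≃ B')
    (h : ∀ f g, mat p (f ∘ e) (g ∘ e') = mat p' f g) :
    compPart p (permPart e') = compPart (permPart e) p' ∧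
      loops p (permPart e') = 0 ∧ loops (permPart e) p' = 0 := by
  have hr : ∀ f g, mat p f (g ∘ e') = mat (p.comap (Sum.map id e'.symm)) f g := by
    intro f g
    have : p ≤ Setoid.ker (Sum.elim f (g ∘ e')) ↔
        p.comap (Sum.map id e'.symm) ≤ Setoid.ker (Sum.elim f g) := by
      have h1 : Sum.elim f g ∘ Sum.map id e' = Sum.elim f (g ∘ e') := by ext (x | x) <;> rfl
      have h2 : ∀ x, Sum.map id e' (Sum.map id e'.symm x) = (x : A ⊕ B') := by
        rintro (x | x) <;> simp
      have h3 : ∀ x, Sum.map id e'.symm (Sum.map id e' x) = (x : A ⊕ B) := by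
        rintro (x | x) <;> simp
      rw [← h1]
      constructor
      · intro h x y hxy
        have := h hxy
        simp only [Setoid.ker_def, Function.comp, h2] at this
        exact this
      · intro h x y hxy
        exact h (show p _ _ by rwa [h3, h3])
    simp only [mat]
    split_ifs <;> simp_all
  have h1 := comp_perm p e' _ hr
  have h2 := perm_comp e p' (p.comap (Sum.map id e'.symm)) fun f g => by
    rw [← hr, ← h]
    congr 1
    ext x
    simp
  exact ⟨h1.1.trans h2.1.symm, h1.2, h2.2⟩

end

/-- The free `k`-module over the set of partitions of `A ⊔ B`. -/
abbrev PMor (k : Type u) [CommRing k] (A B : Type) : Type u := Setoid (A ⊕ B) →₀ k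

namespace PMor

variable {k : Type u} [CommRing k] (T : k)
variable {A B C D A' B' C' A'' B'' : Type}

/-- Composition: `q ∘ p` is `T ^ loops p q` times the stacked partition. -/
def comp : PMor k A B →ₗ[k] PMor k B C →ₗ[k] PMor k A C :=
  Finsupp.linearCombination k fun p => Finsupp.linearCombination k fun q =>
    Finsupp.single (compPart p q) (T ^ loops p q)

/-- Tensor product of morphisms, by juxtaposition. -/
def tensor : PMor k A B →ₗ[k] PMor k A' B' →ₗ[k] PMor k (A ⊕ A') (B ⊕ B') :=
  Finsupp.linearCombination k fun p => Finsupp.linearCombination k fun q =>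
    Finsupp.single (tensorPart p q) 1

/-- The morphism given by the partition with blocks `{a, e a}`. -/
def perm (e : A ≃ B) : PMor k A B := Finsupp.single (permPart e) 1

theorem comp_single (p : Setoid (A ⊕ B)) (q : Setoid (B ⊕ C)) (a b : k) :
    comp T (Finsupp.single p a) (Finsupp.single q b) =
      Finsupp.single (compPart p q) (a * b * T ^ loops p q) := by
  simp only [comp, Finsupp.linearCombination_single, LinearMap.smul_apply, Finsupp.smul_single,
    smul_eq_mul, mul_assoc]

theorem tensor_single (p : Setoid (A ⊕ B)) (q : Setoid (A' ⊕ B')) (a b : k) :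
    tensor (Finsupp.single p a) (Finsupp.single q b) =
      Finsupp.single (tensorPart p q) (a * b) := by
  simp only [tensor, Finsupp.linearCombination_single, LinearMap.smul_apply, Finsupp.smul_single,
    smul_eq_mul, mul_one]

variable [Finite A] [Finite B] [Finite C] [Finite D]
  [Finite A'] [Finite B'] [Finite C'] [Finite A''] [Finite B'']

theorem comp_assoc (f : PMor k A B) (g : PMor k B C) (h : PMor k C D) :
    comp T (comp T f g) h = comp T f (comp T g h) := by
  induction f using Finsupp.induction_linear with
  | zero => simp
  | add f f' hf hf' => simp [hf, hf']
  | single p a =>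
  induction g using Finsupp.induction_linear with
  | zero => simp
  | add f f' hf hf' => simp [hf, hf']
  | single q b =>
  induction h using Finsupp.induction_linear with
  | zero => simp
  | add f f' hf hf' => simp [hf, hf']
  | single r c =>
  simp only [comp_single, (part_assoc p q r).1]
  congr 1
  calc _ = a * b * c * T ^ (loops p q + loops (compPart p q) r) := by ring
    _ = _ := by rw [(part_assoc p q r).2]; ring

theorem interchange (f : PMor k A B) (g : PMor k B C) (f' : PMor k A' B') (g' : PMor k B' C') :
    comp T (tensor f f') (tensor g g') = tensor (comp T f g) (comp T f' g') := by
  induction f using Finsupp.induction_linear with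
  | zero => simp
  | add f f' hf hf' => simp [hf, hf']
  | single p a =>
  induction g using Finsupp.induction_linear with
  | zero => simp
  | add f f' hf hf' => simp [hf, hf']
  | single q b =>
  induction f' using Finsupp.induction_linear with
  | zero => simp
  | add f f' hf hf' => simp [hf, hf']
  | single p' c =>
  induction g' using Finsupp.induction_linear with
  | zero => simp
  | add f f' hf hf' => simp [hf, hf']
  | single q' d =>
  simp only [comp_single, tensor_single, (part_interchange p q p' q').1,
    (part_interchange p q p' q').2]
  congr 1
  ring

theorem slide (p : Setoid (A ⊕ B)) (p' : Setoid (A' ⊕ B')) (e : A ≃ A') (e' : B ≃ B') (a : k)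
    (h : ∀ f g, mat p (f ∘ e) (g ∘ e') = mat p' f g) :
    comp T (Finsupp.single p a) (perm e') = comp T (perm e) (Finsupp.single p' a) := by
  have := part_slide p p' e e' h
  simp [perm, comp_single, this]

theorem perm_perm (e : A ≃ B) (e' : B ≃ C) :
    comp T (perm e) (perm e') = perm (e.trans e') := by
  classical
  have := perm_comp e (permPart e') (permPart (e.trans e')) fun f g => by
    simp only [mat_perm]
    congr 1
    rw [eq_iff_iff, Equiv.comp_symm_eq]
    rfl
  simp [perm, comp_single, this]

theorem tensor_perm (e : A ≃ B) (e' : A' ≃ B') :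
    tensor (k := k) (perm e) (perm e') = perm (e.sumCongr e') := by
  classical
  have : tensorPart (permPart e) (permPart e') = permPart (e.sumCongr e') :=
    (mat_inj (a := 0) (b := 0) fun f g => by
      simp only [mat_tensor, mat_perm, pow_zero, ← ite_and, mul_ite, mul_one, mul_zero]
      congr 1
      rw [eq_iff_iff]
      constructor
      · rintro ⟨h1, h2⟩
        ext (x | x)
        · simpa using congrArg (· = true) (congrFun h2 x)
        · simpa using congrArg (· = true) (congrFun h1 x)
      · rintro rfl
        exact ⟨rfl, rfl⟩).1
  simp [perm, tensor_single, this]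

theorem id_comp (f : PMor k A B) : comp T (perm (Equiv.refl A)) f = f := by
  induction f using Finsupp.induction_linear with
  | zero => simp
  | add f f' hf hf' => simp [hf, hf']
  | single p a =>
  have := perm_comp (Equiv.refl A) p p fun f g => rfl
  simp [perm, comp_single, this]

theorem comp_id (f : PMor k A B) : comp T f (perm (Equiv.refl B)) = f := by
  induction f using Finsupp.induction_linear with
  | zero => simp
  | add f f' hf hf' => simp [hf, hf']
  | single p a =>
  have := comp_perm p (Equiv.refl B) p fun f g => rfl
  simp [perm, comp_single, this]

theorem assoc_natural (f : PMor k A B) (g : PMor k A' B') (h : PMor k A'' B'') :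
    comp T (tensor (tensor f g) h) (perm (Equiv.sumAssoc B B' B'')) =
      comp T (perm (Equiv.sumAssoc A A' A'')) (tensor f (tensor g h)) := by
  induction f using Finsupp.induction_linear with
  | zero => simp
  | add f f' hf hf' => simp [hf, hf']
  | single p a =>
  induction g using Finsupp.induction_linear with
  | zero => simp
  | add f f' hf hf' => simp [hf, hf']
  | single q b =>
  induction h using Finsupp.induction_linear with
  | zero => simp
  | add f f' hf hf' => simp [hf, hf']
  | single r c =>
  simp only [tensor_single, ← mul_assoc]
  refine slide T _ _ _ _ _ fun f g => ?_
  simp only [mat_tensor, ← mul_assoc]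
  rfl

theorem left_natural (f : PMor k A B) :
    comp T (tensor (perm (Equiv.refl Empty)) f) (perm (Equiv.emptySum Empty B)) =
      comp T (perm (Equiv.emptySum Empty A)) f := by
  induction f using Finsupp.induction_linear with
  | zero => simp
  | add f f' hf hf' => simp [hf, hf']
  | single p a =>
  rw [perm, tensor_single, one_mul]
  refine slide T _ _ _ _ _ fun f g => ?_
  classical
  rw [mat_tensor, mat_perm, if_pos (Subsingleton.elim _ _), one_mul]
  rfl

theorem right_natural (f : PMor k A B) :
    comp T (tensor f (perm (Equiv.refl Empty))) (perm (Equiv.sumEmpty B Empty)) =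
      comp T (perm (Equiv.sumEmpty A Empty)) f := by
  induction f using Finsupp.induction_linear with
  | zero => simp
  | add f f' hf hf' => simp [hf, hf']
  | single p a =>
  rw [perm, tensor_single, mul_one]
  refine slide T _ _ _ _ _ fun f g => ?_
  classical
  rw [mat_tensor, mat_perm, if_pos (Subsingleton.elim _ _), mul_one]
  rfl

theorem comm_natural (f : PMor k A B) (g : PMor k A' B') :
    comp T (tensor f g) (perm (Equiv.sumComm B B')) =
      comp T (perm (Equiv.sumComm A A')) (tensor g f) := by
  induction f using Finsupp.induction_linear with
  | zero => simp
  | add f f' hf hf' => simp [hf, hf']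
  | single p a =>
  induction g using Finsupp.induction_linear with
  | zero => simp
  | add f f' hf hf' => simp [hf, hf']
  | single q b =>
  rw [tensor_single, tensor_single, mul_comm b a]
  refine slide T _ _ _ _ _ fun f g => ?_
  rw [mat_tensor, mat_tensor, mul_comm]
  rfl

end PMor

/-- The partition category with finite sets as objects. -/
structure FinPart (k : Type u) (T : k) where
  carrier : Type
  [fin : Finite carrier]

attribute [instance] FinPart.fin

namespace FinPart

variable {k : Type u} [CommRing k] {T : k}

instance : Category.{u} (FinPart k T) where
  Hom X Y := PMor k X.carrier Y.carrier
  id X := PMor.perm (Equiv.refl X.carrier)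
  comp f g := PMor.comp T f g
  id_comp f := PMor.id_comp T f
  comp_id f := PMor.comp_id T f
  assoc f g h := PMor.comp_assoc T f g h

instance : Preadditive (FinPart k T) where
  homGroup X Y := inferInstanceAs (AddCommGroup (PMor k X.carrier Y.carrier))
  add_comp _ _ _ f f' g := LinearMap.map_add₂ (PMor.comp T) f f' g
  comp_add X Y Z f g g' := (PMor.comp (A := X.carrier) (C := Z.carrier) T f).map_add g g'

instance : Linear k (FinPart k T) where
  homModule X Y := inferInstanceAs (Module k (PMor k X.carrier Y.carrier))
  smul_comp _ _ _ r f g := LinearMap.map_smul₂ (PMor.comp T) r f g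
  comp_smul X Y Z f r g := (PMor.comp (A := X.carrier) (C := Z.carrier) T f).map_smul r g

/-- The isomorphism given by a bijection. -/
def isoOfEquiv {X Y : FinPart k T} (e : X.carrier ≃ Y.carrier) : X ≅ Y where
  hom := (PMor.perm e : PMor k X.carrier Y.carrier)
  inv := (PMor.perm e.symm : PMor k Y.carrier X.carrier)
  hom_inv_id := (PMor.perm_perm T e e.symm).trans (by rw [Equiv.self_trans_symm]; rfl)
  inv_hom_id := (PMor.perm_perm T e.symm e).trans (by rw [Equiv.symm_trans_self]; rfl)

instance : MonoidalCategoryStruct (FinPart k T) where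
  tensorObj X Y := ⟨X.carrier ⊕ Y.carrier⟩
  tensorUnit := ⟨Empty⟩
  tensorHom f g := PMor.tensor f g
  whiskerLeft X _ _ f := PMor.tensor (PMor.perm (Equiv.refl X.carrier)) f
  whiskerRight f X := PMor.tensor f (PMor.perm (Equiv.refl X.carrier))
  associator X Y Z := isoOfEquiv (Equiv.sumAssoc X.carrier Y.carrier Z.carrier)
  leftUnitor X := isoOfEquiv (Equiv.emptySum Empty X.carrier)
  rightUnitor X := isoOfEquiv (Equiv.sumEmpty X.carrier Empty)

instance : MonoidalCategory (FinPart k T) := .ofTensorHom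
  (id_tensorHom_id := fun X Y => (PMor.tensor_perm _ _).trans (by rw [Equiv.sumCongr_refl]; rfl))
  (id_tensorHom := fun _ _ _ _ => rfl)
  (tensorHom_id := fun _ _ => rfl)
  (tensorHom_comp_tensorHom := fun f f' g g' => PMor.interchange T f g f' g')
  (associator_naturality := fun f g h => PMor.assoc_natural T f g h)
  (leftUnitor_naturality := fun f => PMor.left_natural T f)
  (rightUnitor_naturality := fun f => PMor.right_natural T f)
  (pentagon := fun W X Y Z => by
    change PMor.comp T (PMor.tensor (PMor.perm _) (PMor.perm _)) (PMor.comp T (PMor.perm _)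
      (PMor.tensor (PMor.perm _) (PMor.perm _))) = PMor.comp T (PMor.perm _) (PMor.perm _)
    simp only [PMor.tensor_perm, PMor.perm_perm]
    congr 1
    ext (((x | x) | x) | x) <;> rfl)
  (triangle := fun X Y => by
    change PMor.comp T (PMor.perm _) (PMor.tensor (PMor.perm _) (PMor.perm _)) =
      PMor.tensor (PMor.perm _) (PMor.perm _)
    simp only [PMor.tensor_perm, PMor.perm_perm]
    congr 1
    ext ((x | ⟨⟨⟩⟩) | x) <;> rfl)

instance : SymmetricCategory (FinPart k T) where
  braiding X Y := isoOfEquiv (Equiv.sumComm X.carrier Y.carrier)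
  braiding_naturality_left f Z := PMor.comm_natural T f _
  braiding_naturality_right X _ _ f := PMor.comm_natural T _ f
  hexagon_forward X Y Z := by
    change PMor.comp T (PMor.perm _) (PMor.comp T (PMor.perm _) (PMor.perm _)) =
      PMor.comp T (PMor.tensor (PMor.perm _) (PMor.perm _)) (PMor.comp T (PMor.perm _)
        (PMor.tensor (PMor.perm _) (PMor.perm _)))
    simp only [PMor.tensor_perm, PMor.perm_perm]
    congr 1
    ext ((x | x) | x) <;> rfl
  hexagon_reverse X Y Z := by
    change PMor.comp T (PMor.perm _) (PMor.comp T (PMor.perm _) (PMor.perm _)) =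
      PMor.comp T (PMor.tensor (PMor.perm _) (PMor.perm _)) (PMor.comp T (PMor.perm _)
        (PMor.tensor (PMor.perm _) (PMor.perm _)))
    simp only [PMor.tensor_perm, PMor.perm_perm]
    congr 1
    ext (x | (x | x)) <;> rfl
  symmetry X Y := by
    change PMor.comp T (PMor.perm _) (PMor.perm _) = PMor.perm _
    simp only [PMor.perm_perm]
    congr 1
    ext (x | x) <;> rfl

instance : MonoidalPreadditive (FinPart k T) where
  whiskerLeft_zero := map_zero (PMor.tensor _)
  zero_whiskerRight := LinearMap.map_zero₂ PMor.tensor _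
  whiskerLeft_add f g := map_add (PMor.tensor _) f g
  add_whiskerRight f g := LinearMap.map_add₂ PMor.tensor f g _

instance : MonoidalLinear k (FinPart k T) where
  whiskerLeft_smul _ _ _ r f := map_smul (PMor.tensor _) r f
  smul_whiskerRight r _ _ f _ := LinearMap.map_smul₂ PMor.tensor r f _

end FinPart

/-- The category with objects `[n]`, `n ≥ 0`, and `Hom([m], [n])` the free `k`-module over the set
of partitions of `{1, …, m, 1', …, n'}`. -/
abbrev PartCat (k : Type u) [CommRing k] (T : k) : Type :=
  InducedCategory (FinPart k T) (fun n : ℕ => (⟨Fin n⟩ : FinPart k T))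

namespace PartCat

variable {k : Type u} [CommRing k] {T : k}

/-- The inclusion of `PartCat k T` in the partition category on all finite sets. -/
abbrev incl : PartCat k T ⥤ FinPart k T := inducedFunctor _

/-- `[m] ⊗ [n] = [m + n]`. -/
def μIso (m n : PartCat k T) : incl.obj m ⊗ incl.obj n ≅ incl.obj (Nat.add m n) :=
  FinPart.isoOfEquiv finSumFinEquiv

/-- The unit is `[0]`. -/
def εIso : 𝟙_ (FinPart k T) ≅ (incl (k := k) (T := T)).obj (0 : ℕ) :=
  FinPart.isoOfEquiv (Equiv.equivOfIsEmpty Empty (Fin 0))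

instance : MonoidalCategoryStruct (PartCat k T) where
  tensorObj m n := Nat.add m n
  tensorUnit := (0 : ℕ)
  tensorHom f g := ⟨(μIso _ _).inv ≫ (incl.map f ⊗ₘ incl.map g) ≫ (μIso _ _).hom⟩
  whiskerLeft X _ _ f := ⟨(μIso _ _).inv ≫ (incl.obj X ◁ incl.map f) ≫ (μIso _ _).hom⟩
  whiskerRight f X := ⟨(μIso _ _).inv ≫ (incl.map f ▷ incl.obj X) ≫ (μIso _ _).hom⟩
  associator X Y Z := InducedCategory.isoMk
    (((μIso _ _).symm ≪≫ ((μIso _ _).symm ⊗ᵢ .refl _)) ≪≫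
      α_ (incl.obj X) (incl.obj Y) (incl.obj Z) ≪≫ ((.refl _ ⊗ᵢ μIso _ _) ≪≫ μIso _ _))
  leftUnitor X := InducedCategory.isoMk
    (((μIso _ _).symm ≪≫ (εIso.symm ⊗ᵢ .refl _)) ≪≫ λ_ (incl.obj X))
  rightUnitor X := InducedCategory.isoMk
    (((μIso _ _).symm ≪≫ (.refl _ ⊗ᵢ εIso.symm)) ≪≫ ρ_ (incl.obj X))

/-- The monoidal structure on `PartCat k T` is induced by that on finite sets. -/
def inducingData : Monoidal.InducingFunctorData (incl (k := k) (T := T)) where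
  μIso := μIso
  εIso := εIso
  whiskerLeft_eq _ _ _ _ := rfl
  whiskerRight_eq _ _ := rfl
  tensorHom_eq _ _ := rfl
  associator_eq _ _ _ := rfl
  leftUnitor_eq _ := rfl
  rightUnitor_eq _ := rfl

instance : MonoidalCategory (PartCat k T) := Monoidal.induced incl inducingData

instance : (incl (k := k) (T := T)).Monoidal := Monoidal.fromInducedMonoidal incl inducingData

instance : SymmetricCategory (PartCat k T) := SymmetricCategory.ofFullyFaithful incl

instance : MonoidalPreadditive (PartCat k T) := monoidalPreadditive_of_faithful incl

instance : MonoidalLinear k (PartCat k T) := MonoidalLinear.ofFaithful k incl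

end PartCat

end Deligne

end

section

open CategoryTheory MonoidalCategory

namespace Deligne

namespace MatCat

variable {C : Type u} [Category.{v} C] [Preadditive C]

/-- The morphism between tuples given by a map of the index sets and morphisms between
corresponding entries; all other matrix entries are zero. -/
def mono {M N : Mat_ C} (e : M.ι → N.ι) (φ : ∀ i, M.X i ⟶ N.X (e i)) : M ⟶ N :=
  fun i j => φ i ≫ (𝟙 N : N ⟶ N) (e i) j

theorem mono_comp {M N K : Mat_ C} (e : M.ι → N.ι) (φ : ∀ i, M.X i ⟶ N.X (e i)) (g : N ⟶ K)
    (i : M.ι) (k : K.ι) : (mono e φ ≫ g) i k = φ i ≫ g (e i) k := by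
  have : g (e i) k = (𝟙 N ≫ g) (e i) k := by rw [Category.id_comp]
  rw [this, Mat_.comp_apply, Mat_.comp_apply, Preadditive.comp_sum]
  simp only [mono, Category.assoc]

theorem comp_mono {M N K : Mat_ C} (f : M ⟶ N) (e : N.ι → K.ι) (φ : ∀ i, N.X i ⟶ K.X (e i))
    (he : Function.Injective e) (i : M.ι) (j : N.ι) :
    (f ≫ mono e φ) i (e j) = f i j ≫ φ j := by
  rw [Mat_.comp_apply, Finset.sum_eq_single j]
  · rw [mono, Mat_.id_apply_self, Category.comp_id]
  · intro j' _ hj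
    rw [mono, Mat_.id_apply_of_ne _ _ _ (fun h => hj (he h)), Limits.comp_zero, Limits.comp_zero]
  · simp

theorem mono_mono {M N K : Mat_ C} (e : M.ι → N.ι) (φ : ∀ i, M.X i ⟶ N.X (e i)) (e' : N.ι → K.ι)
    (φ' : ∀ i, N.X i ⟶ K.X (e' i)) :
    mono e φ ≫ mono e' φ' = mono (fun i => e' (e i)) fun i => φ i ≫ φ' (e i) := by
  ext i k
  rw [mono_comp, mono, mono, Category.assoc]

theorem id_eq_mono (M : Mat_ C) : 𝟙 M = mono (fun i => i) fun i => 𝟙 (M.X i) := by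
  ext i j
  rw [mono, Category.id_comp]

theorem mono_congr {M N : Mat_ C} (e : M.ι → N.ι) (φ φ' : ∀ i, M.X i ⟶ N.X (e i))
    (h : ∀ i, φ i = φ' i) : mono e φ = mono e φ' := by
  rw [funext h]

variable [MonoidalCategory C]

/-- Tuples are tensored entrywise, and so are matrices. -/
instance : MonoidalCategoryStruct (Mat_ C) where
  tensorObj M N := ⟨M.ι × N.ι, fun x => M.X x.1 ⊗ N.X x.2⟩
  tensorUnit := ⟨Unit, fun _ => 𝟙_ C⟩
  tensorHom f g := fun x y => f x.1 y.1 ⊗ₘ g x.2 y.2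
  whiskerLeft X _ _ g := fun x y => (𝟙 X : X ⟶ X) x.1 y.1 ⊗ₘ g x.2 y.2
  whiskerRight f X := fun x y => f x.1 y.1 ⊗ₘ (𝟙 X : X ⟶ X) x.2 y.2
  associator M N K :=
    { hom := mono (fun x => (x.1.1, (x.1.2, x.2))) fun x => (α_ (M.X x.1.1) (N.X x.1.2) (K.X x.2)).hom
      inv := mono (fun x => ((x.1, x.2.1), x.2.2)) fun x => (α_ (M.X x.1) (N.X x.2.1) (K.X x.2.2)).inv
      hom_inv_id := by
        rw [mono_mono, id_eq_mono]
        exact mono_congr _ _ _ fun x => Iso.hom_inv_id _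
      inv_hom_id := by
        rw [mono_mono, id_eq_mono]
        exact mono_congr _ _ _ fun x => Iso.inv_hom_id _ }
  leftUnitor M :=
    { hom := mono (fun x => x.2) fun x => (λ_ (M.X x.2)).hom
      inv := mono (fun x => ((), x)) fun x => (λ_ (M.X x)).inv
      hom_inv_id := by
        rw [mono_mono, id_eq_mono]
        exact mono_congr _ _ _ fun x => Iso.hom_inv_id _
      inv_hom_id := by
        rw [mono_mono, id_eq_mono]
        exact mono_congr _ _ _ fun x => Iso.inv_hom_id _ }
  rightUnitor M :=
    { hom := mono (fun x => x.1) fun x => (ρ_ (M.X x.1)).hom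
      inv := mono (fun x => (x, ())) fun x => (ρ_ (M.X x)).inv
      hom_inv_id := by
        rw [mono_mono, id_eq_mono]
        exact mono_congr _ _ _ fun x => Iso.hom_inv_id _
      inv_hom_id := by
        rw [mono_mono, id_eq_mono]
        exact mono_congr _ _ _ fun x => Iso.inv_hom_id _ }

theorem assoc_eq (M N K : Mat_ C) : (α_ M N K).hom =
    mono (M := (M ⊗ N) ⊗ K) (N := M ⊗ N ⊗ K) (fun x => (x.1.1, (x.1.2, x.2)))
      fun x => (α_ (M.X x.1.1) (N.X x.1.2) (K.X x.2)).hom := rfl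

theorem left_eq (M : Mat_ C) : (λ_ M).hom =
    mono (M := 𝟙_ (Mat_ C) ⊗ M) (N := M) (fun x => x.2) fun x => (λ_ (M.X x.2)).hom := rfl

theorem right_eq (M : Mat_ C) : (ρ_ M).hom =
    mono (M := M ⊗ 𝟙_ (Mat_ C)) (N := M) (fun x => x.1) fun x => (ρ_ (M.X x.1)).hom := rfl

theorem tensorHom_apply {M N M' N' : Mat_ C} (f : M ⟶ N) (g : M' ⟶ N') (x : (M ⊗ M').ι)
    (y : (N ⊗ N').ι) : (f ⊗ₘ g) x y = f x.1 y.1 ⊗ₘ g x.2 y.2 := rfl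

variable [MonoidalPreadditive C]

theorem id_tensor_id (M N : Mat_ C) : 𝟙 M ⊗ₘ 𝟙 N = 𝟙 (M ⊗ N) := by
  ext ⟨i, i'⟩ ⟨j, j'⟩
  rw [tensorHom_apply]
  by_cases h : i = j
  · by_cases h' : i' = j'
    · subst h h'
      rw [Mat_.id_apply_self, Mat_.id_apply_self, Mat_.id_apply_self]
      exact id_tensorHom_id _ _
    · rw [Mat_.id_apply_of_ne N _ _ h', Mat_.id_apply_of_ne (M ⊗ N) _ _ (fun hh : (i, i') = (j, j') => h' (congrArg Prod.snd hh)),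
        MonoidalPreadditive.tensor_zero]
  · rw [Mat_.id_apply_of_ne M _ _ h, Mat_.id_apply_of_ne (M ⊗ N) _ _ (fun hh : (i, i') = (j, j') => h (congrArg Prod.fst hh)),
      MonoidalPreadditive.zero_tensor]

theorem mono_tensor {M N M' N' : Mat_ C} (e : M.ι → N.ι) (φ : ∀ i, M.X i ⟶ N.X (e i))
    (e' : M'.ι → N'.ι) (φ' : ∀ i, M'.X i ⟶ N'.X (e' i)) :
    mono e φ ⊗ₘ mono e' φ' = mono (M := M ⊗ M') (N := N ⊗ N') (fun x => (e x.1, e' x.2))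
      fun x => φ x.1 ⊗ₘ φ' x.2 := by
  ext x y
  rw [tensorHom_apply, mono, mono, mono, ← id_tensor_id, tensorHom_apply,
    tensorHom_comp_tensorHom]

instance : MonoidalCategory (Mat_ C) := .ofTensorHom
  (id_tensorHom_id := fun M N => id_tensor_id M N)
  (id_tensorHom := fun _ _ _ _ => rfl)
  (tensorHom_id := fun _ _ => rfl)
  (tensorHom_comp_tensorHom := fun {X₁ Y₁ Z₁ X₂ Y₂ Z₂} f f' g g' => by
    ext x z
    simp only [Mat_.comp_apply, tensorHom_apply]
    rw [sum_tensor]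
    simp_rw [tensor_sum, ← tensorHom_comp_tensorHom]
    exact Fintype.sum_prod_type _)
  (associator_naturality := fun {X₁ X₂ X₃ Y₁ Y₂ Y₃} f g h => by
    ext x y
    rw [assoc_eq, assoc_eq, mono_comp]
    have := comp_mono (M := (X₁ ⊗ X₂) ⊗ X₃) (N := (Y₁ ⊗ Y₂) ⊗ Y₃) (K := Y₁ ⊗ Y₂ ⊗ Y₃)
      ((f ⊗ₘ g) ⊗ₘ h) (fun x => (x.1.1, (x.1.2, x.2)))
      (fun x => (α_ (Y₁.X x.1.1) (Y₂.X x.1.2) (Y₃.X x.2)).hom)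
      (fun x y h => Prod.ext (Prod.ext (congrArg (·.1) h) (congrArg (·.2.1) h))
        (congrArg (·.2.2) h)) x ((y.1, y.2.1), y.2.2)
    exact this.trans (associator_naturality _ _ _))
  (leftUnitor_naturality := fun {X Y} f => by
    ext x y
    rw [left_eq, left_eq, mono_comp]
    have := comp_mono (M := 𝟙_ (Mat_ C) ⊗ X) (N := 𝟙_ (Mat_ C) ⊗ Y) (K := Y)
      (𝟙 (𝟙_ (Mat_ C)) ⊗ₘ f) (fun x => x.2) (fun x => (λ_ (Y.X x.2)).hom)
      (fun x y h => Prod.ext rfl h) x ((), y)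
    refine this.trans ?_
    rw [tensorHom_apply, show x.1 = () from rfl, Mat_.id_apply_self, id_tensorHom]
    exact leftUnitor_naturality _)
  (rightUnitor_naturality := fun {X Y} f => by
    ext x y
    rw [right_eq, right_eq, mono_comp]
    have := comp_mono (M := X ⊗ 𝟙_ (Mat_ C)) (N := Y ⊗ 𝟙_ (Mat_ C)) (K := Y)
      (f ⊗ₘ 𝟙 (𝟙_ (Mat_ C))) (fun x => x.1) (fun x => (ρ_ (Y.X x.1)).hom)
      (fun x y h => Prod.ext h rfl) x (y, ())
    refine this.trans ?_
    rw [tensorHom_apply, show x.2 = () from rfl, Mat_.id_apply_self, tensorHom_id]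
    exact rightUnitor_naturality _)
  (pentagon := fun W X Y Z => by
    rw [id_eq_mono, id_eq_mono, assoc_eq, assoc_eq, assoc_eq, assoc_eq, assoc_eq,
      mono_tensor, mono_tensor, mono_mono, mono_mono, mono_mono]
    refine mono_congr _ _ _ fun i => ?_
    rw [tensorHom_id, id_tensorHom]
    exact MonoidalCategory.pentagon _ _ _ _)
  (triangle := fun X Y => by
    rw [id_eq_mono, id_eq_mono, assoc_eq, left_eq, right_eq, mono_tensor, mono_tensor, mono_mono]
    refine mono_congr _ _ _ fun i => ?_
    rw [tensorHom_id, id_tensorHom]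
    exact MonoidalCategory.triangle _ _)

/-- The braiding is the entrywise one. -/
def braid [SymmetricCategory C] (M N : Mat_ C) : M ⊗ N ≅ N ⊗ M where
  hom := mono (fun x => (x.2, x.1)) fun x => (β_ (M.X x.1) (N.X x.2)).hom
  inv := mono (fun x => (x.2, x.1)) fun x => (β_ (M.X x.2) (N.X x.1)).inv
  hom_inv_id := by
    rw [mono_mono, id_eq_mono]
    exact mono_congr _ _ _ fun x => Iso.hom_inv_id _
  inv_hom_id := by
    rw [mono_mono, id_eq_mono]
    exact mono_congr _ _ _ fun x => Iso.inv_hom_id _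

theorem braid_natural [SymmetricCategory C] {X X' Y Y' : Mat_ C} (f : X ⟶ X') (g : Y ⟶ Y') :
    (f ⊗ₘ g) ≫ (braid X' Y').hom = (braid X Y).hom ≫ (g ⊗ₘ f) := by
  ext x y
  rw [braid, braid, mono_comp]
  have := comp_mono (M := X ⊗ Y) (N := X' ⊗ Y') (K := Y' ⊗ X') (f ⊗ₘ g) (fun x => (x.2, x.1))
    (fun x => (β_ (X'.X x.1) (Y'.X x.2)).hom)
    (fun x y h => Prod.ext (congrArg Prod.snd h) (congrArg Prod.fst h)) x (y.2, y.1)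
  exact this.trans (BraidedCategory.braiding_naturality _ _)

instance [SymmetricCategory C] : SymmetricCategory (Mat_ C) where
  braiding := braid
  braiding_naturality_left f Z := by
    rw [← tensorHom_id, ← id_tensorHom]
    exact braid_natural _ _
  braiding_naturality_right X _ _ f := by
    rw [← tensorHom_id, ← id_tensorHom]
    exact braid_natural _ _
  hexagon_forward X Y Z := by
    rw [← tensorHom_id, ← id_tensorHom, id_eq_mono, id_eq_mono, assoc_eq, assoc_eq, assoc_eq,
      braid, braid, braid, mono_tensor, mono_tensor, mono_mono, mono_mono, mono_mono, mono_mono]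
    refine mono_congr _ _ _ fun i => ?_
    rw [tensorHom_id, id_tensorHom]
    exact BraidedCategory.hexagon_forward _ _ _
  hexagon_reverse X Y Z := by
    have inv_eq : ∀ M N K : Mat_ C, (α_ M N K).inv =
      mono (M := M ⊗ N ⊗ K) (N := (M ⊗ N) ⊗ K) (fun x => ((x.1, x.2.1), x.2.2))
        fun x => (α_ (M.X x.1) (N.X x.2.1) (K.X x.2.2)).inv := fun _ _ _ => rfl
    rw [← tensorHom_id, ← id_tensorHom, id_eq_mono, id_eq_mono, inv_eq, inv_eq, inv_eq,
      braid, braid, braid, mono_tensor, mono_tensor, mono_mono, mono_mono, mono_mono, mono_mono]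
    refine mono_congr _ _ _ fun i => ?_
    rw [tensorHom_id, id_tensorHom]
    exact BraidedCategory.hexagon_reverse _ _ _
  symmetry X Y := by
    rw [braid, braid, mono_mono, id_eq_mono]
    exact mono_congr _ _ _ fun x => SymmetricCategory.symmetry _ _

instance : MonoidalPreadditive (Mat_ C) where
  whiskerLeft_zero := by intros; ext; exact MonoidalPreadditive.tensor_zero _
  zero_whiskerRight := by intros; ext; exact MonoidalPreadditive.zero_tensor _
  whiskerLeft_add _ _ := by ext; exact MonoidalPreadditive.tensor_add _ _ _
  add_whiskerRight _ _ := by ext; exact MonoidalPreadditive.add_tensor _ _ _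

end MatCat

namespace MatCat

variable {C : Type u} [Category.{v} C] [Preadditive C] (k : Type w) [Field k] [Linear k C]

instance (M N : Mat_ C) : Module k (M ⟶ N) :=
  inferInstanceAs (Module k (∀ (i : M.ι) (j : N.ι), M.X i ⟶ N.X j))

theorem smul_apply {M N : Mat_ C} (r : k) (f : M ⟶ N) (i : M.ι) (j : N.ι) :
    (r • f) i j = r • f i j := rfl

instance : Linear k (Mat_ C) where
  smul_comp X Y Z r f g := by
    ext i j
    simp only [Mat_.comp_apply, smul_apply, Linear.smul_comp, Finset.smul_sum]
  comp_smul X Y Z f r g := by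
    ext i j
    simp only [Mat_.comp_apply, smul_apply, Linear.comp_smul, Finset.smul_sum]

variable [MonoidalCategory C] [MonoidalPreadditive C] [MonoidalLinear k C]

instance : MonoidalLinear k (Mat_ C) where
  whiskerLeft_smul X Y Z r f := by
    ext x y
    have h : ∀ (A B A' B' : C) (g : A ⟶ B) (f : A' ⟶ B'), g ⊗ₘ (r • f) = r • (g ⊗ₘ f) := by
      intros
      simp [MonoidalCategory.tensorHom_def]
    exact h _ _ _ _ _ _
  smul_whiskerRight r Y Z f X := by
    ext x y
    have h : ∀ (A B A' B' : C) (g : A ⟶ B) (f : A' ⟶ B'), (r • g) ⊗ₘ f = r • (g ⊗ₘ f) := by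
      intros
      simp [MonoidalCategory.tensorHom_def]
    exact h _ _ _ _ _ _

end MatCat

end Deligne

end

section

open CategoryTheory MonoidalCategory Idempotents

namespace Deligne

namespace KarCat

variable {C : Type u} [Category.{v} C]

/-- A morphism compatible with the idempotents induces one between the formal images. -/
def ofComm {P Q : Karoubi C} (f : P.X ⟶ Q.X) (h : P.p ≫ f = f ≫ Q.p) : P ⟶ Q :=
  ⟨P.p ≫ f, by rw [h, Category.assoc, Q.idem, ← h, ← Category.assoc, P.idem]⟩

theorem ofComm_comp {P Q R : Karoubi C} (f : P.X ⟶ Q.X) (h : P.p ≫ f = f ≫ Q.p) (g : Q.X ⟶ R.X)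
    (h' : Q.p ≫ g = g ≫ R.p) : ofComm f h ≫ ofComm g h' =
      ofComm (f ≫ g) (by rw [← Category.assoc, h, Category.assoc, h', Category.assoc]) := by
  ext
  simp only [Karoubi.comp_f, ofComm, Category.assoc]
  rw [← reassoc_of% h, Karoubi.idem_assoc]

theorem id_eq_ofComm (P : Karoubi C) :
    𝟙 P = ofComm (𝟙 P.X) (by rw [Category.id_comp, Category.comp_id]) := by
  ext
  simp [ofComm]

theorem ofComm_congr {P Q : Karoubi C} {f g : P.X ⟶ Q.X} (h : P.p ≫ f = f ≫ Q.p)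
    (h' : P.p ≫ g = g ≫ Q.p) (hfg : f = g) : ofComm f h = ofComm g h' := by
  subst hfg
  rfl

/-- An isomorphism compatible with the idempotents induces one between the formal images. -/
def isoMk {P Q : Karoubi C} (e : P.X ≅ Q.X) (h : P.p ≫ e.hom = e.hom ≫ Q.p) : P ≅ Q where
  hom := ofComm e.hom h
  inv := ofComm e.inv (by rw [Iso.eq_inv_comp, ← Category.assoc, ← h, Category.assoc,
    Iso.hom_inv_id, Category.comp_id])
  hom_inv_id := by rw [ofComm_comp, id_eq_ofComm]; exact ofComm_congr _ _ e.hom_inv_id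
  inv_hom_id := by rw [ofComm_comp, id_eq_ofComm]; exact ofComm_congr _ _ e.inv_hom_id

variable [MonoidalCategory C]

/-- `(X, p) ⊗ (Y, q) = (X ⊗ Y, p ⊗ q)`. -/
instance : MonoidalCategoryStruct (Karoubi C) where
  tensorObj P Q := ⟨P.X ⊗ Q.X, P.p ⊗ₘ Q.p, by simp [tensorHom_comp_tensorHom]⟩
  tensorUnit := ⟨𝟙_ C, 𝟙 _, Category.id_comp _⟩
  tensorHom f g := ⟨f.f ⊗ₘ g.f, by simp [tensorHom_comp_tensorHom]⟩
  whiskerLeft P _ _ g := ⟨P.p ⊗ₘ g.f, by simp [tensorHom_comp_tensorHom]⟩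
  whiskerRight f P := ⟨f.f ⊗ₘ P.p, by simp [tensorHom_comp_tensorHom]⟩
  associator P Q R := isoMk (α_ P.X Q.X R.X) (associator_naturality _ _ _)
  leftUnitor P := isoMk (λ_ P.X) (by simp)
  rightUnitor P := isoMk (ρ_ P.X) (by simp)

theorem tensorHom_f {P Q P' Q' : Karoubi C} (f : P ⟶ Q) (g : P' ⟶ Q') :
    (f ⊗ₘ g).f = f.f ⊗ₘ g.f := rfl

theorem ofComm_tensor {P Q P' Q' : Karoubi C} (f : P.X ⟶ Q.X) (h : P.p ≫ f = f ≫ Q.p)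
    (f' : P'.X ⟶ Q'.X) (h' : P'.p ≫ f' = f' ≫ Q'.p) :
    ofComm f h ⊗ₘ ofComm f' h' = ofComm (P := P ⊗ P') (Q := Q ⊗ Q') (f ⊗ₘ f') (by
      change (_ ⊗ₘ _) ≫ _ = _ ≫ (_ ⊗ₘ _)
      rw [tensorHom_comp_tensorHom, tensorHom_comp_tensorHom, h, h']) := by
  ext
  rw [tensorHom_f]
  exact (tensorHom_comp_tensorHom _ _ _ _).symm

theorem assoc_eq (P Q R : Karoubi C) : (α_ P Q R).hom =
    ofComm (P := (P ⊗ Q) ⊗ R) (Q := P ⊗ Q ⊗ R) (α_ P.X Q.X R.X).hom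
      (associator_naturality _ _ _) := rfl

theorem left_eq (P : Karoubi C) : (λ_ P).hom =
    ofComm (P := 𝟙_ (Karoubi C) ⊗ P) (Q := P) (λ_ P.X).hom
      ((congrArg (· ≫ _) (id_tensorHom _ _)).trans (leftUnitor_naturality _)) := rfl

theorem right_eq (P : Karoubi C) : (ρ_ P).hom =
    ofComm (P := P ⊗ 𝟙_ (Karoubi C)) (Q := P) (ρ_ P.X).hom
      ((congrArg (· ≫ _) (tensorHom_id _ _)).trans (rightUnitor_naturality _)) := rfl

theorem ofComm_natural {P P' Q Q' : Karoubi C} (f : P ⟶ P') (g : Q ⟶ Q') (a : P.X ⟶ Q.X)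
    (ha : P.p ≫ a = a ≫ Q.p) (b : P'.X ⟶ Q'.X) (hb : P'.p ≫ b = b ≫ Q'.p)
    (h : f.f ≫ b = a ≫ g.f) : f ≫ ofComm b hb = ofComm a ha ≫ g := by
  ext
  simp only [Karoubi.comp_f, ofComm, Karoubi.comp_p_assoc, Category.assoc, ← h,
    Karoubi.p_comp_assoc]

instance : MonoidalCategory (Karoubi C) := .ofTensorHom
  (id_tensorHom_id := fun P Q => rfl)
  (id_tensorHom := fun _ _ _ _ => rfl)
  (tensorHom_id := fun _ _ => rfl)
  (tensorHom_comp_tensorHom := fun f f' g g' => by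
    ext
    simp [tensorHom_f, tensorHom_comp_tensorHom])
  (associator_naturality := fun f g h => by
    rw [assoc_eq, assoc_eq]
    exact ofComm_natural _ _ _ _ _ _ (associator_naturality _ _ _))
  (leftUnitor_naturality := fun f => by
    rw [left_eq, left_eq]
    exact ofComm_natural _ _ _ _ _ _
      ((congrArg (· ≫ _) (id_tensorHom _ _)).trans (leftUnitor_naturality _)))
  (rightUnitor_naturality := fun f => by
    rw [right_eq, right_eq]
    exact ofComm_natural _ _ _ _ _ _
      ((congrArg (· ≫ _) (tensorHom_id _ _)).trans (rightUnitor_naturality _)))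
  (pentagon := fun W X Y Z => by
    rw [id_eq_ofComm, id_eq_ofComm, assoc_eq, assoc_eq, assoc_eq, assoc_eq, assoc_eq,
      ofComm_tensor, ofComm_tensor, ofComm_comp, ofComm_comp, ofComm_comp]
    refine ofComm_congr _ _ ?_
    rw [tensorHom_id, id_tensorHom]
    exact MonoidalCategory.pentagon _ _ _ _)
  (triangle := fun X Y => by
    rw [id_eq_ofComm, id_eq_ofComm, assoc_eq, left_eq, right_eq, ofComm_tensor, ofComm_tensor,
      ofComm_comp]
    refine ofComm_congr _ _ ?_
    rw [tensorHom_id, id_tensorHom]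
    exact MonoidalCategory.triangle _ _)

/-- The braiding is induced by that of `C`. -/
def braid [SymmetricCategory C] (P Q : Karoubi C) : P ⊗ Q ≅ Q ⊗ P :=
  isoMk (P := P ⊗ Q) (Q := Q ⊗ P) (β_ P.X Q.X) (BraidedCategory.braiding_naturality _ _)

theorem braid_eq [SymmetricCategory C] (P Q : Karoubi C) : (braid P Q).hom =
    ofComm (P := P ⊗ Q) (Q := Q ⊗ P) (β_ P.X Q.X).hom
      (BraidedCategory.braiding_naturality _ _) := rfl

instance [SymmetricCategory C] : SymmetricCategory (Karoubi C) where
  braiding := braid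
  braiding_naturality_left f Z := by
    rw [← tensorHom_id, ← id_tensorHom, braid_eq, braid_eq]
    exact ofComm_natural _ _ _ _ _ _ (BraidedCategory.braiding_naturality _ _)
  braiding_naturality_right X _ _ f := by
    rw [← tensorHom_id, ← id_tensorHom, braid_eq, braid_eq]
    exact ofComm_natural _ _ _ _ _ _ (BraidedCategory.braiding_naturality _ _)
  hexagon_forward X Y Z := by
    rw [← tensorHom_id, ← id_tensorHom, id_eq_ofComm, id_eq_ofComm, assoc_eq, assoc_eq, assoc_eq,
      braid_eq, braid_eq, braid_eq, ofComm_tensor, ofComm_tensor, ofComm_comp, ofComm_comp,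
      ofComm_comp, ofComm_comp]
    refine ofComm_congr _ _ ?_
    rw [tensorHom_id, id_tensorHom]
    exact BraidedCategory.hexagon_forward _ _ _
  hexagon_reverse X Y Z := by
    have inv_eq : ∀ P Q R : Karoubi C, (α_ P Q R).inv =
      ofComm (P := P ⊗ Q ⊗ R) (Q := (P ⊗ Q) ⊗ R) (α_ P.X Q.X R.X).inv
        (associator_inv_naturality _ _ _) := fun _ _ _ => rfl
    rw [← tensorHom_id, ← id_tensorHom, id_eq_ofComm, id_eq_ofComm, inv_eq, inv_eq, inv_eq,
      braid_eq, braid_eq, braid_eq, ofComm_tensor, ofComm_tensor, ofComm_comp, ofComm_comp,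
      ofComm_comp, ofComm_comp]
    refine ofComm_congr _ _ ?_
    rw [tensorHom_id, id_tensorHom]
    exact BraidedCategory.hexagon_reverse _ _ _
  symmetry X Y := by
    rw [braid_eq, braid_eq, ofComm_comp, id_eq_ofComm]
    exact ofComm_congr _ _ (SymmetricCategory.symmetry _ _)

variable [Preadditive C] [MonoidalPreadditive C]

instance : MonoidalPreadditive (Karoubi C) where
  whiskerLeft_zero := by intros; ext; exact MonoidalPreadditive.tensor_zero _
  zero_whiskerRight := by intros; ext; exact MonoidalPreadditive.zero_tensor _
  whiskerLeft_add _ _ := by ext; exact MonoidalPreadditive.tensor_add _ _ _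
  add_whiskerRight _ _ := by ext; exact MonoidalPreadditive.add_tensor _ _ _

end KarCat

namespace KarCat

variable {C : Type u} [Category.{v} C] [Preadditive C] (k : Type w) [Field k] [Linear k C]

instance (P Q : Karoubi C) : SMul k (P ⟶ Q) where
  smul r f := ⟨r • f.f, by simp⟩

theorem smul_f {P Q : Karoubi C} (r : k) (f : P ⟶ Q) : (r • f).f = r • f.f := rfl

instance : Linear k (Karoubi C) where
  homModule P Q :=
    { one_smul := fun f => by ext; simp [smul_f]
      mul_smul := fun r s f => by ext; simp [smul_f, mul_smul]
      smul_zero := fun r => by ext; simp [smul_f]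
      smul_add := fun r f g => by ext; simp [smul_f]
      add_smul := fun r s f => by ext; simp [smul_f, add_smul]
      zero_smul := fun f => by ext; simp [smul_f] }
  smul_comp P Q R r f g := by ext; exact Linear.smul_comp _ _ _ r f.f g.f
  comp_smul P Q R f r g := by ext; exact Linear.comp_smul _ _ _ f.f r g.f

variable [MonoidalCategory C] [MonoidalPreadditive C] [MonoidalLinear k C]

instance : MonoidalLinear k (Karoubi C) where
  whiskerLeft_smul X Y Z r f := by
    ext
    change _ ⊗ₘ (r • f.f) = r • (_ ⊗ₘ _)
    simp [MonoidalCategory.tensorHom_def]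
  smul_whiskerRight r Y Z f X := by
    ext
    change (r • f.f) ⊗ₘ _ = r • (_ ⊗ₘ _)
    simp [MonoidalCategory.tensorHom_def]

end KarCat

end Deligne

end

section

open CategoryTheory MonoidalCategory

namespace Deligne

/-- A congruence compatible with the tensor product. -/
class IsTensorCongruence {C : Type u} [Category.{v} C] [MonoidalCategory C] (r : HomRel C) :
    Prop where
  left : ∀ (X : C) {Y Z : C} (f g : Y ⟶ Z), r f g → r (X ◁ f) (X ◁ g)
  right : ∀ {Y Z : C} (f g : Y ⟶ Z) (X : C), r f g → r (f ▷ X) (g ▷ X)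

namespace QuotCat

open CategoryTheory.Quotient

variable {C : Type u} [Category.{v} C] [MonoidalCategory C] (r : HomRel C) [Congruence r]
  [IsTensorCongruence r]

/-- The class of a morphism in the quotient category. -/
abbrev cls {X Y : CategoryTheory.Quotient r} (f : X.as ⟶ Y.as) : X ⟶ Y :=
  (functor r).map f

/-- The tensor product of a quotient category, induced by that of the category. -/
instance : MonoidalCategoryStruct (CategoryTheory.Quotient r) where
  tensorObj X Y := ⟨X.as ⊗ Y.as⟩
  tensorUnit := ⟨𝟙_ C⟩
  whiskerLeft X _ _ f := Quot.map (fun f => X.as ◁ f) (fun _ _ h => by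
    rw [HomRel.compClosure_eq_self] at h ⊢
    exact IsTensorCongruence.left _ _ _ h) f
  whiskerRight f X := Quot.map (fun f => f ▷ X.as) (fun _ _ h => by
    rw [HomRel.compClosure_eq_self] at h ⊢
    exact IsTensorCongruence.right _ _ _ h) f
  associator X Y Z := (functor r).mapIso (α_ X.as Y.as Z.as)
  leftUnitor X := (functor r).mapIso (λ_ X.as)
  rightUnitor X := (functor r).mapIso (ρ_ X.as)

instance : MonoidalCategory (CategoryTheory.Quotient r) where
  tensorHom_def _ _ := rfl
  id_tensorHom_id X Y := by
    have h := MonoidalCategory.id_tensorHom_id X.as Y.as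
    rw [MonoidalCategory.tensorHom_def] at h
    exact congrArg (functor r).map h
  tensorHom_comp_tensorHom := by
    rintro X₁ Y₁ Z₁ X₂ Y₂ Z₂ ⟨f₁⟩ ⟨f₂⟩ ⟨g₁⟩ ⟨g₂⟩
    have h := tensorHom_comp_tensorHom f₁ f₂ g₁ g₂
    rw [MonoidalCategory.tensorHom_def, MonoidalCategory.tensorHom_def,
      MonoidalCategory.tensorHom_def] at h
    exact congrArg (functor r).map h
  whiskerLeft_id X Y := congrArg (functor r).map (MonoidalCategory.whiskerLeft_id X.as Y.as)
  id_whiskerRight X Y := congrArg (functor r).map (MonoidalCategory.id_whiskerRight X.as Y.as)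
  associator_naturality := by
    rintro X₁ Y₁ Z₁ X₂ Y₂ Z₂ ⟨f₁⟩ ⟨f₂⟩ ⟨f₃⟩
    have h := associator_naturality f₁ f₂ f₃
    rw [MonoidalCategory.tensorHom_def, MonoidalCategory.tensorHom_def,
      MonoidalCategory.tensorHom_def, MonoidalCategory.tensorHom_def] at h
    exact congrArg (functor r).map h
  leftUnitor_naturality := by
    rintro X Y ⟨f⟩
    exact congrArg (functor r).map (leftUnitor_naturality f)
  rightUnitor_naturality := by
    rintro X Y ⟨f⟩
    exact congrArg (functor r).map (rightUnitor_naturality f)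
  pentagon W X Y Z := congrArg (functor r).map (pentagon W.as X.as Y.as Z.as)
  triangle X Y := congrArg (functor r).map (triangle X.as Y.as)

instance [SymmetricCategory C] : SymmetricCategory (CategoryTheory.Quotient r) where
  braiding X Y := (functor r).mapIso (β_ X.as Y.as)
  braiding_naturality_left := by
    rintro X Y ⟨f⟩ Z
    exact congrArg (functor r).map (BraidedCategory.braiding_naturality_left f Z.as)
  braiding_naturality_right := by
    rintro X Y Z ⟨f⟩
    exact congrArg (functor r).map (BraidedCategory.braiding_naturality_right X.as f)
  hexagon_forward X Y Z :=
    congrArg (functor r).map (BraidedCategory.hexagon_forward X.as Y.as Z.as)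
  hexagon_reverse X Y Z :=
    congrArg (functor r).map (BraidedCategory.hexagon_reverse X.as Y.as Z.as)
  symmetry X Y := congrArg (functor r).map (SymmetricCategory.symmetry X.as Y.as)

end QuotCat

end Deligne

end

section

open CategoryTheory MonoidalCategory Limits

namespace Deligne

/-- A morphism factors through an object with the property `P`. -/
def FactorsThrough {C : Type u} [Category.{v} C] (P : ObjectProperty C) {X Y : C} (f : X ⟶ Y) :
    Prop :=
  ∃ (Z : C) (a : X ⟶ Z) (b : Z ⟶ Y), P Z ∧ a ≫ b = f

/-- An exhaustive filtration of a symmetric monoidal additive category by full subcategories that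
are closed under finite direct sums and direct summands, and that is compatible with the
tensor product. -/
structure TensorFiltration (C : Type u) [Category.{v} C] [Preadditive C]
    [HasFiniteBiproducts C] [MonoidalCategory C] where
  /-- The full subcategory in filtration degree `n`. -/
  sub : ℕ → ObjectProperty C
  mono : ∀ {m n : ℕ} {X : C}, m ≤ n → sub m X → sub n X
  retract : ∀ {n : ℕ} {X Y : C}, Retract X Y → sub n Y → sub n X
  sum : ∀ {n : ℕ} {J : Type} [Finite J] (f : J → C), (∀ j, sub n (f j)) → sub n (⨁ f)
  exhaustive : ∀ X : C, ∃ n, sub n X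
  unit : sub 0 (𝟙_ C)
  tensor : ∀ {m n : ℕ} {X Y : C}, sub m X → sub n Y → sub (m + n) (X ⊗ Y)

namespace TensorFiltration

variable {C : Type u} [Category.{v} C] [Preadditive C] [HasFiniteBiproducts C]
  [MonoidalCategory C] (D : TensorFiltration C)

/-- The preceding step of the filtration: `low n` is the step `n - 1`, where the step `-1`
consists of the zero objects. -/
def low : ℕ → ObjectProperty C
  | 0 => fun X => IsZero X
  | n + 1 => D.sub n

variable {D}

theorem low_retract : ∀ {n : ℕ} {X Y : C}, Retract X Y → D.low n Y → D.low n X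
  | 0, _, _, r, h => (IsZero.iff_id_eq_zero _).2 (by
      rw [← r.retract, h.eq_of_tgt r.i 0, zero_comp])
  | _ + 1, _, _, r, h => D.retract r h

theorem low_sum : ∀ {n : ℕ} {J : Type} [Finite J] (f : J → C), (∀ j, D.low n (f j)) →
    D.low n (⨁ f)
  | 0, _, _, f, h => (IsZero.iff_id_eq_zero _).2 (by
      ext j
      exact (h _).eq_of_src _ _)
  | _ + 1, _, _, f, h => D.sum f h

theorem low_cofan {n : ℕ} {J : Type} [Finite J] {f : J → C} (c : Cofan f) (hc : IsColimit c)
    (h : ∀ j, D.low n (f j)) : D.low n c.pt :=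
  low_retract (Retract.ofIso (hc.coconePointUniqueUpToIso (biproduct.isColimit f))) (low_sum f h)

theorem sub_cofan {n : ℕ} {J : Type} [Finite J] {f : J → C} (c : Cofan f) (hc : IsColimit c)
    (h : ∀ j, D.sub n (f j)) : D.sub n c.pt :=
  low_cofan (n := n + 1) c hc h

theorem sub_of_isZero {n : ℕ} {X : C} (h : IsZero X) : D.sub n X :=
  D.retract (Retract.mk (0 : X ⟶ _) 0 (h.eq_of_src _ _))
    (D.sum (n := n) (fun j : Empty => j.elim) (fun j => j.elim))

theorem low_of_isZero : ∀ {n : ℕ} {X : C}, IsZero X → D.low n X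
  | 0, _, h => h
  | _ + 1, _, h => sub_of_isZero h

/-- Morphisms that factor through a step of the filtration are closed under addition. -/
theorem factors_add {n : ℕ} {X Y : C} {f g : X ⟶ Y} (hf : FactorsThrough (D.low n) f)
    (hg : FactorsThrough (D.low n) g) : FactorsThrough (D.low n) (f + g) := by
  obtain ⟨Z, a, b, hZ, rfl⟩ := hf
  obtain ⟨W, a', b', hW, rfl⟩ := hg
  refine ⟨⨁ fun t : Bool => cond t Z W,
    biproduct.lift fun t => match t with | true => a | false => a',
    biproduct.desc fun t => match t with | true => b | false => b', low_sum _ ?_, ?_⟩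
  · rintro (_ | _)
    exacts [hW, hZ]
  · rw [biproduct.lift_desc, Fintype.sum_bool]

theorem factors_comp_left {n : ℕ} {W X Y : C} (h : W ⟶ X) {f : X ⟶ Y}
    (hf : FactorsThrough (D.low n) f) : FactorsThrough (D.low n) (h ≫ f) := by
  obtain ⟨Z, a, b, hZ, rfl⟩ := hf
  exact ⟨Z, h ≫ a, b, hZ, Category.assoc _ _ _⟩

theorem factors_comp_right {n : ℕ} {X Y W : C} (h : Y ⟶ W) {f : X ⟶ Y}
    (hf : FactorsThrough (D.low n) f) : FactorsThrough (D.low n) (f ≫ h) := by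
  obtain ⟨Z, a, b, hZ, rfl⟩ := hf
  exact ⟨Z, a, b ≫ h, hZ, (Category.assoc _ _ _).symm⟩

theorem factors_neg {n : ℕ} {X Y : C} {f : X ⟶ Y}
    (hf : FactorsThrough (D.low n) f) : FactorsThrough (D.low n) (-f) := by
  obtain ⟨Z, a, b, hZ, rfl⟩ := hf
  exact ⟨Z, a, -b, hZ, Preadditive.comp_neg _ _⟩

theorem factors_zero (n : ℕ) (X Y : C) : FactorsThrough (D.low n) (0 : X ⟶ Y) :=
  ⟨⨁ fun j : Empty => j.elim, 0, 0, low_sum _ fun j => j.elim, zero_comp⟩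

theorem low_tensor_right [MonoidalPreadditive C] {m : ℕ} {X Y : C} (hX : D.sub m X) :
    ∀ {n : ℕ}, D.low n Y → D.low (m + n) (X ⊗ Y)
  | 0, h => low_of_isZero ((IsZero.iff_id_eq_zero _).2 (by
      rw [← MonoidalCategory.whiskerLeft_id, (IsZero.iff_id_eq_zero _).1 h,
        MonoidalPreadditive.whiskerLeft_zero]))
  | _ + 1, h => D.tensor hX h

theorem low_tensor_left [MonoidalPreadditive C] {n : ℕ} {X Y : C} (hY : D.sub n Y) :
    ∀ {m : ℕ}, D.low m X → D.low (m + n) (X ⊗ Y)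
  | 0, h => low_of_isZero ((IsZero.iff_id_eq_zero _).2 (by
      rw [← MonoidalCategory.id_whiskerRight, (IsZero.iff_id_eq_zero _).1 h,
        MonoidalPreadditive.zero_whiskerRight]))
  | m + 1, h => by
      have := D.tensor h hY
      rw [show m + 1 + n = (m + n) + 1 by omega]
      exact this

end TensorFiltration

section Graded

variable {C : Type u} [Category.{v} C] [Preadditive C]

instance : Preadditive (GradedObject ℕ C) where
  homGroup X Y := inferInstanceAs (AddCommGroup (∀ i, X i ⟶ Y i))
  add_comp X Y Z f f' g := by
    funext i
    exact Preadditive.add_comp _ _ _ (f i) (f' i) (g i)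
  comp_add X Y Z f g g' := by
    funext i
    exact Preadditive.comp_add _ _ _ (f i) (g i) (g' i)

theorem graded_add {X Y : GradedObject ℕ C} (f g : X ⟶ Y) (i : ℕ) : (f + g) i = f i + g i := rfl

theorem graded_sub {X Y : GradedObject ℕ C} (f g : X ⟶ Y) (i : ℕ) : (f - g) i = f i - g i := rfl

theorem graded_zero {X Y : GradedObject ℕ C} (i : ℕ) : (0 : X ⟶ Y) i = 0 := rfl

instance (k : Type w) [Field k] [Linear k C] : Linear k (GradedObject ℕ C) where
  homModule X Y := inferInstanceAs (Module k (∀ i, X i ⟶ Y i))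
  smul_comp X Y Z r f g := by
    funext i
    exact Linear.smul_comp _ _ _ r (f i) (g i)
  comp_smul X Y Z f r g := by
    funext i
    exact Linear.comp_smul _ _ _ (f i) r (g i)

variable [HasFiniteBiproducts C] [MonoidalCategory C] [MonoidalPreadditive C]

instance gradedMonoidal : MonoidalCategory (GradedObject ℕ C) := GradedObject.monoidalCategory

instance gradedSymmetric [SymmetricCategory C] : SymmetricCategory (GradedObject ℕ C) :=
  GradedObject.symmetricCategory

instance : MonoidalPreadditive (GradedObject ℕ C) where
  whiskerLeft_zero {X Y Z} := by
    funext n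
    refine GradedObject.Monoidal.tensorObj_ext _ _ fun i j h => ?_
    refine (GradedObject.Monoidal.ι_tensorHom _ _ _ _ _ _).trans ?_
    rw [graded_zero, graded_zero, MonoidalPreadditive.tensor_zero, zero_comp, comp_zero]
  zero_whiskerRight {X Y Z} := by
    funext n
    refine GradedObject.Monoidal.tensorObj_ext _ _ fun i j h => ?_
    refine (GradedObject.Monoidal.ι_tensorHom _ _ _ _ _ _).trans ?_
    rw [graded_zero, graded_zero, MonoidalPreadditive.zero_tensor, zero_comp, comp_zero]
  whiskerLeft_add {X Y Z} f g := by
    funext n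
    refine GradedObject.Monoidal.tensorObj_ext _ _ fun i j h => ?_
    refine (GradedObject.Monoidal.ι_tensorHom _ _ _ _ _ _).trans ?_
    rw [graded_add, graded_add, MonoidalPreadditive.tensor_add, Preadditive.add_comp,
      Preadditive.comp_add]
    congr 1
    · exact (GradedObject.Monoidal.ι_tensorHom _ _ _ _ _ _).symm
    · exact (GradedObject.Monoidal.ι_tensorHom _ _ _ _ _ _).symm
  add_whiskerRight {X Y Z} f g := by
    funext n
    refine GradedObject.Monoidal.tensorObj_ext _ _ fun i j h => ?_
    refine (GradedObject.Monoidal.ι_tensorHom _ _ _ _ _ _).trans ?_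
    rw [graded_add, graded_add, MonoidalPreadditive.add_tensor, Preadditive.add_comp,
      Preadditive.comp_add]
    congr 1
    · exact (GradedObject.Monoidal.ι_tensorHom _ _ _ _ _ _).symm
    · exact (GradedObject.Monoidal.ι_tensorHom _ _ _ _ _ _).symm

end Graded

namespace TensorFiltration

variable {C : Type u} [Category.{v} C] [Preadditive C] [HasFiniteBiproducts C]
  [MonoidalCategory C] [MonoidalPreadditive C] (D : TensorFiltration C)

theorem low_gradedTensor {D : TensorFiltration C} {X Y : GradedObject ℕ C} (n : ℕ)
    (h : ∀ i j, i + j = n → D.low n (X i ⊗ Y j)) : D.low n ((X ⊗ Y : GradedObject ℕ C) n) :=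
  low_cofan (GradedObject.cofanMapObj _ _ n) (GradedObject.isColimitCofanMapObj _ _ n)
    fun ⟨⟨i, j⟩, hij⟩ => h i j hij

theorem sub_gradedTensor {D : TensorFiltration C} {X Y : GradedObject ℕ C} (n : ℕ)
    (h : ∀ i j, i + j = n → D.sub n (X i ⊗ Y j)) : D.sub n ((X ⊗ Y : GradedObject ℕ C) n) :=
  sub_cofan (GradedObject.cofanMapObj _ _ n) (GradedObject.isColimitCofanMapObj _ _ n)
    fun ⟨⟨i, j⟩, hij⟩ => h i j hij

theorem isZero_tensorUnit {i : ℕ} (hi : i ≠ 0) : IsZero ((𝟙_ (GradedObject ℕ C)) i) :=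
  (IsZero.iff_id_eq_zero _).2 ((GradedObject.Monoidal.isInitialTensorUnitApply i hi).hom_ext _ _)

/-- The families `(Xᵢ)` of objects, with `Xᵢ` in the `i`-th step of the filtration, such that almost
all `Xᵢ` become zero modulo the preceding step. -/
def IsGrObject : ObjectProperty (GradedObject ℕ C) := fun X =>
  (∀ i, D.sub i (X i)) ∧ ∃ N, ∀ i, N ≤ i → FactorsThrough (D.low i) (𝟙 (X i))

theorem IsGrObject.exists_factor {D : TensorFiltration C} {X : GradedObject ℕ C}
    (h : D.IsGrObject X) : ∃ (N : ℕ) (Z : GradedObject ℕ C) (a : X ⟶ Z) (b : Z ⟶ X),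
      a ≫ b = 𝟙 X ∧ (∀ i, D.sub i (Z i)) ∧ ∀ i, N ≤ i → D.low i (Z i) := by
  obtain ⟨h, N, hN⟩ := h
  have key : ∀ i, ∃ (Z : C) (a : X i ⟶ Z) (b : Z ⟶ X i), a ≫ b = 𝟙 (X i) ∧ D.sub i Z ∧
      (N ≤ i → D.low i Z) := by
    intro i
    by_cases hi : N ≤ i
    · obtain ⟨Z, a, b, hZ, e⟩ := hN i hi
      refine ⟨Z, a, b, e, ?_, fun _ => hZ⟩
      cases i with
      | zero => exact sub_of_isZero hZ
      | succ i => exact D.mono (Nat.le_succ i) hZ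
    · exact ⟨X i, 𝟙 _, 𝟙 _, Category.comp_id _, h i, fun h => absurd h hi⟩
  choose Z a b e h1 h2 using key
  exact ⟨N, Z, a, b, funext e, h1, h2⟩

instance : D.IsGrObject.IsMonoidal where
  prop_unit := by
    refine ⟨fun i => ?_, 1, fun i hi => ?_⟩
    · by_cases hi : i = 0
      · subst hi
        exact D.retract (Retract.ofIso GradedObject.Monoidal.tensorUnit₀) D.unit
      · exact sub_of_isZero (isZero_tensorUnit hi)
    · rw [(IsZero.iff_id_eq_zero _).1 (isZero_tensorUnit (show i ≠ 0 by omega))]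
      exact factors_zero _ _ _
  prop_tensor X Y hX hY := by
    refine ⟨fun n => sub_gradedTensor n fun i j hij => hij ▸ D.tensor (hX.1 i) (hY.1 j), ?_⟩
    obtain ⟨N, Z, a, b, e, hZ, hZ'⟩ := hX.exists_factor
    obtain ⟨M, W, a', b', e', hW, hW'⟩ := hY.exists_factor
    refine ⟨N + M, fun n hn => ⟨(Z ⊗ W : GradedObject ℕ C) n, (a ⊗ₘ a') n, (b ⊗ₘ b') n, ?_, ?_⟩⟩
    · refine low_gradedTensor n fun i j hij => ?_
      subst hij
      by_cases hi : N ≤ i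
      · exact low_tensor_left (hW j) (hZ' i hi)
      · exact low_tensor_right (hZ i) (hW' j (by omega))
    · change ((a ⊗ₘ a') ≫ (b ⊗ₘ b')) n = _
      rw [MonoidalCategory.tensorHom_comp_tensorHom, e, e', MonoidalCategory.id_tensorHom_id]
      rfl

/-- Two morphisms between such families are identified if in each degree `i` their difference
factors through step `i - 1` of the filtration. -/
def grRel : HomRel D.IsGrObject.FullSubcategory := fun _ _ f g =>
  ∀ i, FactorsThrough (D.low i) (f.hom i - g.hom i)

instance : Congruence D.grRel where
  equivalence :=
    { refl := fun f i => by rw [sub_self]; exact factors_zero _ _ _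
      symm := fun h i => by rw [← neg_sub]; exact factors_neg (h i)
      trans := fun h h' i => by rw [← sub_add_sub_cancel]; exact factors_add (h i) (h' i) }
  comp_left f g g' h i := by
    have := factors_comp_left (f.hom i) (h i)
    rwa [Preadditive.comp_sub] at this
  comp_right {_ _ _ f f'} g h i := by
    have := factors_comp_right (g.hom i) (h i)
    rwa [Preadditive.sub_comp] at this

theorem grRel_iff {D : TensorFiltration C} {X Y : D.IsGrObject.FullSubcategory} {f g : X ⟶ Y}
    (h : D.grRel f g) : ∃ (Z : GradedObject ℕ C) (a : X.obj ⟶ Z) (b : Z ⟶ Y.obj),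
      (∀ i, D.low i (Z i)) ∧ a ≫ b = f.hom - g.hom := by
  choose Z a b h1 h2 using h
  exact ⟨Z, a, b, h1, funext h2⟩

instance : IsTensorCongruence D.grRel where
  left X Y Z f g h n := by
    obtain ⟨W, a, b, hW, e⟩ := grRel_iff h
    refine ⟨(X.obj ⊗ W : GradedObject ℕ C) n, (X.obj ◁ a) n, (X.obj ◁ b) n, ?_, ?_⟩
    · exact low_gradedTensor n fun i j hij => hij ▸ low_tensor_right (X.property.1 i) (hW j)
    · change ((X.obj ◁ a) ≫ (X.obj ◁ b)) n = (X.obj ◁ f.hom - X.obj ◁ g.hom) n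
      rw [← MonoidalCategory.whiskerLeft_comp, e]
      exact congrFun (tensorLeft X.obj).map_sub n
  right {Y Z} f g X h n := by
    obtain ⟨W, a, b, hW, e⟩ := grRel_iff h
    refine ⟨(W ⊗ X.obj : GradedObject ℕ C) n, (a ▷ X.obj) n, (b ▷ X.obj) n, ?_, ?_⟩
    · exact low_gradedTensor n fun i j hij => hij ▸ low_tensor_left (X.property.1 j) (hW i)
    · change ((a ▷ X.obj) ≫ (b ▷ X.obj)) n = (f.hom ▷ X.obj - g.hom ▷ X.obj) n
      rw [← MonoidalCategory.comp_whiskerRight, e]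
      exact congrFun (tensorRight X.obj).map_sub n

/-- The associated graded category: the direct sum of the quotients of each step of the
filtration by the preceding step. -/
abbrev Gr := CategoryTheory.Quotient D.grRel

instance : MonoidalCategory D.Gr := inferInstance

instance [SymmetricCategory C] : SymmetricCategory D.Gr := inferInstance

theorem grRel_add {X Y : D.IsGrObject.FullSubcategory} (f₁ f₂ g₁ g₂ : X ⟶ Y)
    (h : D.grRel f₁ f₂) (h' : D.grRel g₁ g₂) : D.grRel (f₁ + g₁) (f₂ + g₂) := fun i => by
  have := factors_add (h i) (h' i)
  rwa [sub_add_sub_comm] at this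

instance : Preadditive D.Gr := Quotient.preadditive _ fun _ _ => D.grRel_add

instance : (Quotient.functor D.grRel).Additive := Quotient.functor_additive _ fun _ _ => D.grRel_add

instance (k : Type w) [Field k] [Linear k C] : Linear k D.Gr :=
  Quotient.linear k _ fun r X Y f g h i => by
    obtain ⟨Z, a, b, hZ, e⟩ := h i
    refine ⟨Z, a, r • b, hZ, ?_⟩
    rw [Linear.comp_smul, e]
    exact smul_sub _ _ _

/-- The objects of the associated graded category that are concentrated in degree `n`: all other
components are zero in the quotient category they belong to. -/
def grDegree (n : ℕ) : ObjectProperty D.Gr := fun X =>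
  ∀ i, i ≠ n → FactorsThrough (D.low i) (𝟙 (X.as.obj i))

end TensorFiltration

end Deligne

end

section

open CategoryTheory MonoidalCategory Limits Idempotents

namespace Deligne

section Summands

variable {C : Type u} [Category.{v} C] [Preadditive C] [HasFiniteBiproducts C]

/-- The direct summands of finite direct sums of objects with the property `S`. -/
def summands (S : ObjectProperty C) : ObjectProperty C := fun X =>
  ∃ (J : Type) (_ : Finite J) (f : J → C), (∀ j, S (f j)) ∧ Nonempty (Retract X (⨁ f))

variable {S : ObjectProperty C}

theorem summands_intro {X : C} {J : Type} [Fintype J] (f : J → C) (hf : ∀ j, S (f j))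
    (a : ∀ j, X ⟶ f j) (b : ∀ j, f j ⟶ X) (h : ∑ j, a j ≫ b j = 𝟙 X) : summands S X :=
  ⟨J, inferInstance, f, hf, ⟨biproduct.lift a, biproduct.desc b, by
    rw [biproduct.lift_desc, h]⟩⟩

theorem summands_elim {X : C} (h : summands S X) : ∃ (J : Type) (_ : Fintype J) (f : J → C)
    (a : ∀ j, X ⟶ f j) (b : ∀ j, f j ⟶ X), (∀ j, S (f j)) ∧ ∑ j, a j ≫ b j = 𝟙 X := by
  obtain ⟨J, hJ, f, hf, ⟨r⟩⟩ := h
  have := Fintype.ofFinite J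
  refine ⟨J, inferInstance, f, fun j => r.i ≫ biproduct.π f j, fun j => biproduct.ι f j ≫ r.r, hf,
    ?_⟩
  have h : ∑ j, biproduct.π f j ≫ biproduct.ι f j = 𝟙 (⨁ f) := biproduct.total
  calc _ = r.i ≫ (∑ j, biproduct.π f j ≫ biproduct.ι f j) ≫ r.r := by
        simp only [Preadditive.sum_comp, Preadditive.comp_sum, Category.assoc]
    _ = _ := by rw [h, Category.id_comp, r.retract]

theorem summands_of_mem {X : C} (h : S X) : summands S X :=
  summands_intro (J := Unit) (fun _ => X) (fun _ => h) (fun _ => 𝟙 X) (fun _ => 𝟙 X) (by simp)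

theorem summands_mono {S' : ObjectProperty C} (hS : ∀ X, S X → S' X) {X : C}
    (h : summands S X) : summands S' X := by
  obtain ⟨J, hJ, f, hf, r⟩ := h
  exact ⟨J, hJ, f, fun j => hS _ (hf j), r⟩

theorem summands_summands {X : C} (h : summands (summands S) X) : summands S X := by
  obtain ⟨J, hJ, f, a, b, hf, e⟩ := summands_elim h
  choose K hK g c d hg e' using fun j => summands_elim (hf j)
  refine summands_intro (J := Σ j, K j) (fun x => g x.1 x.2) (fun x => hg _ _)
    (fun x => a x.1 ≫ c x.1 x.2) (fun x => d x.1 x.2 ≫ b x.1) ?_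
  rw [Fintype.sum_sigma, ← e]
  refine Finset.sum_congr rfl fun j _ => ?_
  calc _ = a j ≫ (∑ i, c j i ≫ d j i) ≫ b j := by
        simp only [Preadditive.sum_comp, Preadditive.comp_sum, Category.assoc]
    _ = _ := by rw [e', Category.id_comp]

theorem summands_tensor [MonoidalCategory C] [MonoidalPreadditive C] {S' S'' : ObjectProperty C}
    (hS : ∀ X Y, S X → S' Y → summands S'' (X ⊗ Y)) {X Y : C} (hX : summands S X)
    (hY : summands S' Y) : summands S'' (X ⊗ Y) := by
  obtain ⟨J, hJ, f, a, b, hf, e⟩ := summands_elim hX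
  obtain ⟨K, hK, g, c, d, hg, e'⟩ := summands_elim hY
  refine summands_summands (summands_intro (J := J × K) (fun x => f x.1 ⊗ g x.2)
    (fun x => hS _ _ (hf _) (hg _)) (fun x => a x.1 ⊗ₘ c x.2) (fun x => b x.1 ⊗ₘ d x.2) ?_)
  rw [Fintype.sum_prod_type, ← MonoidalCategory.id_tensorHom_id, ← e, ← e']
  simp only [MonoidalCategory.tensorHom_comp_tensorHom, sum_tensor, tensor_sum]
  exact Finset.sum_comm

theorem exists_resolution {X : C} {J : Type} [Fintype J] {f : J → C} (e : X ≅ ⨁ f) :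
    ∃ (a : ∀ j, X ⟶ f j) (b : ∀ j, f j ⟶ X), ∑ j, a j ≫ b j = 𝟙 X := by
  refine ⟨fun j => e.hom ≫ biproduct.π f j, fun j => biproduct.ι f j ≫ e.inv, ?_⟩
  have h : ∑ j, biproduct.π f j ≫ biproduct.ι f j = 𝟙 (⨁ f) := biproduct.total
  calc _ = e.hom ≫ (∑ j, biproduct.π f j ≫ biproduct.ι f j) ≫ e.inv := by
        simp only [Preadditive.sum_comp, Preadditive.comp_sum, Category.assoc]
    _ = _ := by rw [h, Category.id_comp, e.hom_inv_id]

theorem exists_resolution_karoubi {C : Type u} [Category.{v} C] [Preadditive C] (P : Karoubi C)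
    {J : Type} [Fintype J] {f : J → C} (u : ∀ j, P.X ⟶ f j) (v : ∀ j, f j ⟶ P.X)
    (huv : ∑ j, u j ≫ v j = 𝟙 P.X) :
    ∃ (a : ∀ j, P ⟶ (toKaroubi C).obj (f j)) (b : ∀ j, (toKaroubi C).obj (f j) ⟶ P),
      ∑ j, a j ≫ b j = 𝟙 P := by
  refine ⟨fun i => ⟨P.p ≫ u i, ?_⟩, fun i => ⟨v i ≫ P.p, ?_⟩, ?_⟩
  · change P.p ≫ (P.p ≫ u i) ≫ 𝟙 _ = _
    rw [Category.comp_id, ← Category.assoc, P.idem]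
  · change 𝟙 _ ≫ (v i ≫ P.p) ≫ P.p = _
    rw [Category.id_comp, Category.assoc, P.idem]
  · ext1
    rw [Karoubi.sum_hom]
    calc _ = P.p ≫ (∑ i, u i ≫ v i) ≫ P.p := by
          rw [Preadditive.sum_comp, Preadditive.comp_sum]
          exact Finset.sum_congr rfl fun i _ => (Category.assoc _ _ _).trans
            (congrArg (P.p ≫ ·) (Category.assoc _ _ _).symm)
      _ = P.p := by rw [huv, Category.id_comp, P.idem]

end Summands

variable (k : Type u) [Field k] (T : k)

/-- Deligne's category `Rep(S_T)`: the idempotent completion of the additive closure of the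
category of partitions. -/
abbrev RepS := Karoubi (Mat_ (PartCat k T))

/-- The object `[n]` of `Rep(S_T)`. -/
def ob (n : ℕ) : RepS k T :=
  (toKaroubi _).obj ((Mat_.embedding (PartCat k T)).obj n)

variable {k T}

theorem summands_ob_of_bound (n : ℕ) (P : RepS k T) (h : ∀ i, (show ℕ from P.X.X i) ≤ n) :
    summands (fun X => ∃ i ≤ n, X = ob k T i) P := by
  obtain ⟨u, v, huv⟩ := exists_resolution (Mat_.isoBiproductEmbedding P.X)
  obtain ⟨a, b, hab⟩ := exists_resolution_karoubi P u v huv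
  exact summands_intro (J := P.X.ι) _ (fun i => ⟨P.X.X i, h i, rfl⟩) a b hab

variable (k T)

/-- The filtration of `Rep(S_T)` whose `n`-th step consists of the direct summands of the finite
direct sums of the objects `[0], …, [n]`. -/
def repFiltration : TensorFiltration (RepS k T) where
  sub n := summands fun X => ∃ i ≤ n, X = ob k T i
  mono h := summands_mono fun _ ⟨i, hi, e⟩ => ⟨i, hi.trans h, e⟩
  retract {n X Y} r h := summands_summands
    (summands_intro (J := Unit) (fun _ => Y) (fun _ => h) (fun _ => r.i) (fun _ => r.r) (by simp))
  sum {n J _} f h := summands_summands ⟨J, inferInstance, f, h, ⟨Retract.refl _⟩⟩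
  exhaustive X := ⟨∑ i, (show ℕ from X.X.X i), summands_ob_of_bound _ X fun i =>
    Finset.single_le_sum (f := fun i => (show ℕ from X.X.X i)) (fun _ _ => Nat.zero_le _)
      (Finset.mem_univ i)⟩
  unit := summands_ob_of_bound _ _ fun _ => le_rfl
  tensor := summands_tensor (by
    rintro _ _ ⟨i, hi, rfl⟩ ⟨j, hj, rfl⟩
    exact summands_ob_of_bound _ _ fun _ => Nat.add_le_add hi hj)

end Deligne

end

section

open CategoryTheory MonoidalCategory

namespace Deligne

/-- The opposite of the group algebra of the symmetric group `S_n`; its (left) modules are the right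
modules over the group algebra. -/
abbrev GrpAlg (k : Type u) [Field k] (n : ℕ) : Type u :=
  (MonoidAlgebra k (Equiv.Perm (Fin n)))ᵐᵒᵖ

/-- Families `(Xₙ)` of right modules over the group algebras of the symmetric groups. -/
abbrev GMod (k : Type u) [Field k] := ∀ n : ℕ, ModuleCat.{u} (GrpAlg k n)

namespace GMod

variable {k : Type u} [Field k]

/-- The right action of a permutation. -/
def act {n : ℕ} {M : Type w} [AddCommGroup M] [Module (GrpAlg k n) M] (σ : Equiv.Perm (Fin n))
    (x : M) : M :=
  (MulOpposite.op (MonoidAlgebra.single σ 1) : GrpAlg k n) • x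

/-- The action of a scalar. -/
def sc {n : ℕ} {M : Type w} [AddCommGroup M] [Module (GrpAlg k n) M] (c : k) (x : M) : M :=
  (MulOpposite.op (MonoidAlgebra.single 1 c) : GrpAlg k n) • x

section Basic

variable {n : ℕ} {M : Type w} [AddCommGroup M] [Module (GrpAlg k n) M]
  {M' : Type v} [AddCommGroup M'] [Module (GrpAlg k n) M']

theorem act_add (σ : Equiv.Perm (Fin n)) (x y : M) :
    act (k := k) σ (x + y) = act (k := k) σ x + act (k := k) σ y := smul_add _ _ _

theorem act_zero (σ : Equiv.Perm (Fin n)) : act (k := k) σ (0 : M) = 0 := smul_zero _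

theorem sc_add (c : k) (x y : M) : sc (n := n) c (x + y) = sc (n := n) c x + sc (n := n) c y :=
  smul_add _ _ _

theorem sc_zero (c : k) : sc (n := n) c (0 : M) = 0 := smul_zero _

theorem add_sc (c d : k) (x : M) : sc (n := n) (c + d) x = sc (n := n) c x + sc (n := n) d x := by
  rw [sc, MonoidAlgebra.single_add, MulOpposite.op_add, add_smul]
  rfl

theorem zero_sc (x : M) : sc (n := n) (0 : k) x = 0 := by
  rw [sc, MonoidAlgebra.single_zero, MulOpposite.op_zero, zero_smul]

theorem sc_sc (c d : k) (x : M) : sc (n := n) c (sc (n := n) d x) = sc (n := n) (c * d) x := by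
  rw [sc, sc, sc, smul_smul, ← MulOpposite.op_mul, MonoidAlgebra.single_mul_single, one_mul,
    mul_comm]

theorem one_sc (x : M) : sc (n := n) (1 : k) x = x := one_smul _ _

theorem act_one (x : M) : act (k := k) (1 : Equiv.Perm (Fin n)) x = x := one_smul _ _

theorem act_act (σ τ : Equiv.Perm (Fin n)) (x : M) :
    act (k := k) τ (act (k := k) σ x) = act (k := k) (σ * τ) x := by
  rw [act, act, act, smul_smul, ← MulOpposite.op_mul, MonoidAlgebra.single_mul_single, one_mul]

theorem sc_act (c : k) (σ : Equiv.Perm (Fin n)) (x : M) :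
    sc (n := n) c (act (k := k) σ x) = (MulOpposite.op (MonoidAlgebra.single σ c) : GrpAlg k n) • x := by
  rw [act, sc, smul_smul, ← MulOpposite.op_mul, MonoidAlgebra.single_mul_single, one_mul, mul_one]

theorem act_sc (c : k) (σ : Equiv.Perm (Fin n)) (x : M) :
    act (k := k) σ (sc (n := n) c x) = sc (n := n) c (act (k := k) σ x) := by
  rw [sc_act, act, sc, smul_smul, ← MulOpposite.op_mul, MonoidAlgebra.single_mul_single, one_mul,
    mul_one]

theorem algInd {P : GrpAlg k n → Prop} (a : GrpAlg k n) (h0 : P 0)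
    (hadd : ∀ a b, P a → P b → P (a + b))
    (hs : ∀ σ c, P (MulOpposite.op (MonoidAlgebra.single σ c))) : P a := by
  obtain ⟨a, rfl⟩ := MulOpposite.op_surjective a
  induction a using MonoidAlgebra.induction_linear with
  | zero => exact h0
  | add f g hf hg => exact hadd _ _ hf hg
  | single σ c => exact hs σ c

/-- An additive map that commutes with scalars and permutations is linear. -/
def linMk (f : M →+ M') (hs : ∀ c x, f (sc (n := n) (c : k) x) = sc (n := n) c (f x))
    (ha : ∀ σ x, f (act (k := k) (n := n) σ x) = act (k := k) σ (f x)) : M →ₗ[GrpAlg k n] M' where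
  toFun := f
  map_add' := f.map_add
  map_smul' a x := by
    refine algInd (P := fun a => f (a • x) = (RingHom.id (GrpAlg k n)) a • f x) a ?_ ?_ ?_
    · rw [zero_smul, f.map_zero, RingHom.id_apply, zero_smul]
    · intro a b ha hb
      rw [RingHom.id_apply] at *
      rw [add_smul, f.map_add, ha, hb, add_smul]
    · intro σ c
      rw [RingHom.id_apply, ← sc_act, ← sc_act, hs, ha]

end Basic

variable {X Y Z W : GMod k}

/-- The value of a morphism at an element. -/
def ap (f : X ⟶ Y) {n : ℕ} (x : X n) : Y n := (f n).hom x

theorem ap_add (f : X ⟶ Y) {n : ℕ} (x y : X n) : ap f (x + y) = ap f x + ap f y := map_add _ _ _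

theorem ap_act (f : X ⟶ Y) {n : ℕ} (σ : Equiv.Perm (Fin n)) (x : X n) :
    ap f (act (k := k) σ x) = act (k := k) σ (ap f x) := map_smul (f n).hom _ _

theorem ap_sc (f : X ⟶ Y) {n : ℕ} (c : k) (x : X n) :
    ap f (sc (n := n) c x) = sc (n := n) c (ap f x) := map_smul (f n).hom _ _

theorem ap_comp (f : X ⟶ Y) (g : Y ⟶ Z) {n : ℕ} (x : X n) : ap (f ≫ g) x = ap g (ap f x) := rfl

theorem ap_id {n : ℕ} (x : X n) : ap (𝟙 X) x = x := rfl

theorem ap_ext {f g : X ⟶ Y} (h : ∀ (n : ℕ) (x : X n), ap f x = ap g x) : f = g :=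
  funext fun n => ModuleCat.hom_ext (LinearMap.ext (h n))

/-- A family of modules is contravariantly functorial for bijections. -/
def move {m n : ℕ} (e : Fin m ≃ Fin n) (x : X n) : X m :=
  act (k := k) (e.trans (finCongr (Fin.equiv_iff_eq.1 ⟨e⟩).symm))
    ((Fin.equiv_iff_eq.1 ⟨e⟩).symm ▸ x)

theorem eq_of_equiv {m n : ℕ} (e : Fin m ≃ Fin n) : m = n := Fin.equiv_iff_eq.1 ⟨e⟩

theorem move_self {n : ℕ} (e : Fin n ≃ Fin n) (x : X n) : move e x = act (k := k) e x := rfl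

theorem move_refl {n : ℕ} (x : X n) : move (Equiv.refl _) x = x := act_one x

theorem move_move {l m n : ℕ} (e : Fin l ≃ Fin m) (e' : Fin m ≃ Fin n) (x : X n) :
    move e (move e' x) = move (e.trans e') x := by
  obtain rfl := eq_of_equiv e
  obtain rfl := eq_of_equiv e'
  exact act_act e' e x

theorem move_add {m n : ℕ} (e : Fin m ≃ Fin n) (x y : X n) :
    move e (x + y) = move e x + move e y := by
  obtain rfl := eq_of_equiv e
  exact act_add e x y

theorem move_zero {m n : ℕ} (e : Fin m ≃ Fin n) : move e (0 : X n) = 0 := by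
  obtain rfl := eq_of_equiv e
  exact act_zero e

theorem move_sc {m n : ℕ} (e : Fin m ≃ Fin n) (c : k) (x : X n) :
    move e (sc (n := n) c x) = sc (n := m) c (move e x) := by
  obtain rfl := eq_of_equiv e
  exact act_sc c e x

theorem ap_move (f : X ⟶ Y) {m n : ℕ} (e : Fin m ≃ Fin n) (x : X n) :
    ap f (move e x) = move e (ap f x) := by
  obtain rfl := eq_of_equiv e
  exact ap_act f e x

/-- A family of additive maps that commute with scalars and permutations is a morphism. -/
def homMk (f : ∀ n, X n →+ Y n) (hs : ∀ n (c : k) x, f n (sc (n := n) c x) = sc (n := n) c (f n x))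
    (ha : ∀ n (σ : Equiv.Perm (Fin n)) x, f n (act (k := k) σ x) = act (k := k) σ (f n x)) : X ⟶ Y :=
  fun n => ModuleCat.ofHom (linMk (f n) (hs n) (ha n))

end GMod

end Deligne

end

section

open CategoryTheory MonoidalCategory

namespace Deligne

namespace GMod

variable {k : Type u} [Field k] {X Y Z W : GMod k}

/-- The generators `p ⊗ q ⊗ θ` of the induction product: `p ∈ Xₘ`, `q ∈ Yₙ` and a bijection `θ`
of `{1, …, N}` with the disjoint union of `{1, …, m}` and `{1, …, n}`. -/
structure Gen (X Y : GMod k) (N : ℕ) : Type u where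
  {m n : ℕ}
  θ : Fin N ≃ Fin m ⊕ Fin n
  p : X m
  q : Y n

/-- The relations between the generators: additivity and `k`-balancedness in `p` and `q`, and
`pσ ⊗ qτ ⊗ θ = p ⊗ q ⊗ (σ ⊔ τ)θ`. -/
inductive Rel (X Y : GMod k) (N : ℕ) : FreeAbelianGroup (Gen X Y N) → Prop
  | add_left {m n : ℕ} (θ : Fin N ≃ Fin m ⊕ Fin n) (p p' : X m) (q : Y n) :
      Rel X Y N (.of ⟨θ, p + p', q⟩ - (.of ⟨θ, p, q⟩ + .of ⟨θ, p', q⟩))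
  | add_right {m n : ℕ} (θ : Fin N ≃ Fin m ⊕ Fin n) (p : X m) (q q' : Y n) :
      Rel X Y N (.of ⟨θ, p, q + q'⟩ - (.of ⟨θ, p, q⟩ + .of ⟨θ, p, q'⟩))
  | scalar {m n : ℕ} (θ : Fin N ≃ Fin m ⊕ Fin n) (c : k) (p : X m) (q : Y n) :
      Rel X Y N (.of ⟨θ, sc (n := m) c p, q⟩ - .of ⟨θ, p, sc (n := n) c q⟩)
  | perm {m n : ℕ} (θ : Fin N ≃ Fin m ⊕ Fin n) (σ : Equiv.Perm (Fin m)) (τ : Equiv.Perm (Fin n))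
      (p : X m) (q : Y n) :
      Rel X Y N (.of ⟨θ, act (k := k) σ p, act (k := k) τ q⟩ -
        .of ⟨θ.trans (Equiv.sumCongr σ τ), p, q⟩)

/-- The component of degree `N` of the induction product. For fixed `m + n = N`, the bijections `θ`
form a basis of the `k[S_m] ⊗ k[S_n]`-`k[S_N]`-bimodule `k[S_N]`, so this is the direct sum over
`m + n = N` of the right `k[S_N]`-modules `(Xₘ ⊠ Yₙ) ⊗ k[S_N]`, where the last tensor product
is over `k[S_m] ⊗ k[S_n]`. -/
def Tens (X Y : GMod k) (N : ℕ) : Type u :=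
  FreeAbelianGroup (Gen X Y N) ⧸ AddSubgroup.closure {x | Rel X Y N x}

variable {N : ℕ}

instance : AddCommGroup (Tens X Y N) := QuotientAddGroup.Quotient.addCommGroup _

/-- The class of the generator `p ⊗ q ⊗ θ`. -/
def mk {m n : ℕ} (θ : Fin N ≃ Fin m ⊕ Fin n) (p : X m) (q : Y n) : Tens X Y N :=
  QuotientAddGroup.mk (FreeAbelianGroup.of ⟨θ, p, q⟩)

theorem mk_rel {x : FreeAbelianGroup (Gen X Y N)} (h : Rel X Y N x) :
    (QuotientAddGroup.mk x : Tens X Y N) = 0 :=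
  (QuotientAddGroup.eq_zero_iff _).2 (AddSubgroup.subset_closure h)

theorem mk_add_left {m n : ℕ} (θ : Fin N ≃ Fin m ⊕ Fin n) (p p' : X m) (q : Y n) :
    mk θ (p + p') q = mk θ p q + mk θ p' q := by
  rw [← sub_eq_zero]
  exact mk_rel (.add_left θ p p' q)

theorem mk_add_right {m n : ℕ} (θ : Fin N ≃ Fin m ⊕ Fin n) (p : X m) (q q' : Y n) :
    mk θ p (q + q') = mk θ p q + mk θ p q' := by
  rw [← sub_eq_zero]
  exact mk_rel (.add_right θ p q q')

theorem mk_sc {m n : ℕ} (θ : Fin N ≃ Fin m ⊕ Fin n) (c : k) (p : X m) (q : Y n) :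
    mk θ (sc (n := m) c p) q = mk θ p (sc (n := n) c q) := by
  rw [← sub_eq_zero]
  exact mk_rel (.scalar θ c p q)

theorem mk_act {m n : ℕ} (θ : Fin N ≃ Fin m ⊕ Fin n) (σ : Equiv.Perm (Fin m))
    (τ : Equiv.Perm (Fin n)) (p : X m) (q : Y n) :
    mk θ (act (k := k) σ p) (act (k := k) τ q) = mk (θ.trans (Equiv.sumCongr σ τ)) p q := by
  rw [← sub_eq_zero]
  exact mk_rel (.perm θ σ τ p q)

theorem mk_move {m n m' n' : ℕ} (θ : Fin N ≃ Fin m' ⊕ Fin n') (σ : Fin m' ≃ Fin m)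
    (τ : Fin n' ≃ Fin n) (p : X m) (q : Y n) :
    mk θ (move σ p) (move τ q) = mk (θ.trans (Equiv.sumCongr σ τ)) p q := by
  obtain rfl := eq_of_equiv σ
  obtain rfl := eq_of_equiv τ
  exact mk_act θ σ τ p q

theorem mk_zero_left {m n : ℕ} (θ : Fin N ≃ Fin m ⊕ Fin n) (q : Y n) :
    mk θ (0 : X m) q = 0 := by
  have := mk_add_left θ (0 : X m) 0 q
  rwa [add_zero, left_eq_add] at this

theorem mk_zero_right {m n : ℕ} (θ : Fin N ≃ Fin m ⊕ Fin n) (p : X m) :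
    mk θ p (0 : Y n) = 0 := by
  have := mk_add_right θ p (0 : Y n) 0
  rwa [add_zero, left_eq_add] at this

/-- A balanced family of maps. -/
structure Balanced (X Y : GMod k) (N : ℕ) (B : Type w) [AddCommGroup B]
    (γ : ∀ {m n : ℕ}, (Fin N ≃ Fin m ⊕ Fin n) → X m → Y n → B) : Prop where
  add_left : ∀ {m n : ℕ} (θ : Fin N ≃ Fin m ⊕ Fin n) (p p' : X m) (q : Y n),
    γ θ (p + p') q = γ θ p q + γ θ p' q
  add_right : ∀ {m n : ℕ} (θ : Fin N ≃ Fin m ⊕ Fin n) (p : X m) (q q' : Y n),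
    γ θ p (q + q') = γ θ p q + γ θ p q'
  scalar : ∀ {m n : ℕ} (θ : Fin N ≃ Fin m ⊕ Fin n) (c : k) (p : X m) (q : Y n),
    γ θ (sc (n := m) c p) q = γ θ p (sc (n := n) c q)
  perm : ∀ {m n : ℕ} (θ : Fin N ≃ Fin m ⊕ Fin n) (σ : Equiv.Perm (Fin m))
    (τ : Equiv.Perm (Fin n)) (p : X m) (q : Y n),
    γ θ (act (k := k) σ p) (act (k := k) τ q) = γ (θ.trans (Equiv.sumCongr σ τ)) p q

/-- The universal property of the underlying abelian group. -/
def lift {B : Type w} [AddCommGroup B]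
    (γ : ∀ {m n : ℕ}, (Fin N ≃ Fin m ⊕ Fin n) → X m → Y n → B) (h : Balanced X Y N B γ) :
    Tens X Y N →+ B :=
  QuotientAddGroup.lift _ (FreeAbelianGroup.lift fun g => γ g.θ g.p g.q) (by
    rw [AddSubgroup.closure_le]
    rintro _ (⟨θ, p, p', q⟩ | ⟨θ, p, q, q'⟩ | ⟨θ, c, p, q⟩ | ⟨θ, σ, τ, p, q⟩)
    · simp [h.add_left]
    · simp [h.add_right]
    · simp [h.scalar]
    · simp [h.perm])

theorem lift_mk {B : Type w} [AddCommGroup B]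
    (γ : ∀ {m n : ℕ}, (Fin N ≃ Fin m ⊕ Fin n) → X m → Y n → B) (h : Balanced X Y N B γ)
    {m n : ℕ} (θ : Fin N ≃ Fin m ⊕ Fin n) (p : X m) (q : Y n) : lift γ h (mk θ p q) = γ θ p q :=
  FreeAbelianGroup.lift_apply_of _ _

theorem tens_ext {B : Type w} [AddCommGroup B] {f g : Tens X Y N →+ B}
    (h : ∀ {m n : ℕ} (θ : Fin N ≃ Fin m ⊕ Fin n) (p : X m) (q : Y n),
      f (mk θ p q) = g (mk θ p q)) : f = g := by
  refine QuotientAddGroup.addMonoidHom_ext _ (FreeAbelianGroup.lift_ext _ _ ?_)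
  rintro ⟨θ, p, q⟩
  exact h θ p q

/-- Bijections act by precomposition. -/
def actHom {N' : ℕ} (π : Fin N' ≃ Fin N) : Tens X Y N →+ Tens X Y N' :=
  lift (fun θ p q => mk (π.trans θ) p q)
    { add_left := fun _ _ _ _ => mk_add_left _ _ _ _
      add_right := fun _ _ _ _ => mk_add_right _ _ _ _
      scalar := fun _ _ _ _ => mk_sc _ _ _ _
      perm := fun _ _ _ _ _ => mk_act _ _ _ _ _ }

theorem actHom_mk {N' : ℕ} (π : Fin N' ≃ Fin N) {m n : ℕ} (θ : Fin N ≃ Fin m ⊕ Fin n) (p : X m)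
    (q : Y n) : actHom π (mk θ p q) = mk (π.trans θ) p q := lift_mk _ _ _ _ _

/-- Scalars act on the left factor (or, equivalently, on the right factor). -/
def scMap (c : k) : Tens X Y N →+ Tens X Y N :=
  lift (fun {m _} θ p q => mk θ (sc (n := m) c p) q)
    { add_left := fun _ _ _ _ => by rw [sc_add, mk_add_left]
      add_right := fun _ _ _ _ => mk_add_right _ _ _ _
      scalar := fun _ _ _ _ => by rw [sc_sc, mul_comm, ← sc_sc, mk_sc]
      perm := fun _ _ _ _ _ => by rw [← act_sc, mk_act] }

theorem scMap_mk (c : k) {m n : ℕ} (θ : Fin N ≃ Fin m ⊕ Fin n) (p : X m) (q : Y n) :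
    scMap c (mk θ p q) = mk θ (sc (n := m) c p) q := lift_mk _ _ _ _ _

/-- The action of scalars. -/
def scHom : k →+* AddMonoid.End (Tens X Y N) where
  toFun c := scMap c
  map_one' := tens_ext fun θ p q => by
    refine (scMap_mk _ _ _ _).trans ?_
    rw [one_sc]
    rfl
  map_mul' c d := tens_ext fun θ p q => by
    change scMap (c * d) (mk θ p q) = scMap c (scMap d (mk θ p q))
    rw [scMap_mk, scMap_mk, scMap_mk, sc_sc]
  map_zero' := tens_ext fun θ p q => by
    refine (scMap_mk _ _ _ _).trans ?_
    rw [zero_sc, mk_zero_left]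
    rfl
  map_add' c d := tens_ext fun θ p q => by
    change scMap (c + d) (mk θ p q) = scMap c (mk θ p q) + scMap d (mk θ p q)
    rw [scMap_mk, scMap_mk, scMap_mk, add_sc, mk_add_left]

/-- The right action of the symmetric group. -/
def permHom : Equiv.Perm (Fin N) →* (AddMonoid.End (Tens X Y N))ᵐᵒᵖ where
  toFun π := MulOpposite.op (actHom (N' := N) π : Tens X Y N →+ Tens X Y N)
  map_one' := congrArg MulOpposite.op (tens_ext fun θ p q => actHom_mk _ _ _ _)
  map_mul' π ρ := by
    refine congrArg MulOpposite.op (tens_ext fun θ p q => ?_)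
    change actHom (π * ρ) (mk θ p q) = actHom (N' := N) ρ (actHom (N' := N) π (mk θ p q))
    rw [actHom_mk, actHom_mk, actHom_mk]
    rfl

theorem algHom_comm (c : k) (π : Equiv.Perm (Fin N)) :
    Commute (RingHom.toOpposite (scHom (X := X) (Y := Y) (N := N))
      (fun c d => (Commute.all c d).map scHom) c) (permHom π) := by
  refine congrArg MulOpposite.op (tens_ext fun θ p q => ?_)
  change actHom (N' := N) π (scMap c (mk θ p q)) = scMap c (actHom (N' := N) π (mk θ p q))
  rw [actHom_mk, scMap_mk, actHom_mk, scMap_mk]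

/-- The action of the group algebra. -/
def algHom : GrpAlg k N →+* AddMonoid.End (Tens X Y N) :=
  (RingEquiv.opOp (AddMonoid.End (Tens X Y N))).symm.toRingHom.comp
    (RingHom.op (MonoidAlgebra.liftNCRingHom
      ((RingHom.toOpposite scHom fun c d => (Commute.all c d).map scHom))
      permHom algHom_comm))

instance : Module (GrpAlg k N) (Tens X Y N) :=
  Module.compHom _ (algHom : GrpAlg k N →+* AddMonoid.End (Tens X Y N))

theorem smul_tens (σ : Equiv.Perm (Fin N)) (c : k) (x : Tens X Y N) :
    (MulOpposite.op (MonoidAlgebra.single σ c) : GrpAlg k N) • x = actHom σ (scMap c x) := by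
  change (MulOpposite.unop (MonoidAlgebra.liftNCRingHom _ permHom algHom_comm (MonoidAlgebra.single σ c)) :
    AddMonoid.End (Tens X Y N)) x = _
  rw [MonoidAlgebra.liftNCRingHom_single]
  rfl

theorem act_mk (π : Equiv.Perm (Fin N)) {m n : ℕ} (θ : Fin N ≃ Fin m ⊕ Fin n) (p : X m)
    (q : Y n) : act (k := k) π (mk θ p q) = mk (π.trans θ) p q := by
  rw [act, smul_tens, scMap_mk, actHom_mk, one_sc]

theorem sc_mk (c : k) {m n : ℕ} (θ : Fin N ≃ Fin m ⊕ Fin n) (p : X m)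
    (q : Y n) : sc (n := N) c (mk θ p q) = mk θ (sc (n := m) c p) q := by
  rw [sc, smul_tens, scMap_mk, actHom_mk]
  rfl

variable (X Y) in
/-- The induction product of two families of modules. -/
def tens : GMod k := fun N => ModuleCat.of (GrpAlg k N) (Tens X Y N)

/-- The element `p ⊗ q ⊗ θ` of the induction product. -/
def el {m n : ℕ} (θ : Fin N ≃ Fin m ⊕ Fin n) (p : X m) (q : Y n) : tens X Y N := mk θ p q

theorem el_add_left {m n : ℕ} (θ : Fin N ≃ Fin m ⊕ Fin n) (p p' : X m) (q : Y n) :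
    el θ (p + p') q = el θ p q + el θ p' q := mk_add_left _ _ _ _

theorem el_add_right {m n : ℕ} (θ : Fin N ≃ Fin m ⊕ Fin n) (p : X m) (q q' : Y n) :
    el θ p (q + q') = el θ p q + el θ p q' := mk_add_right _ _ _ _

theorem el_zero_left {m n : ℕ} (θ : Fin N ≃ Fin m ⊕ Fin n) (q : Y n) :
    el θ (0 : X m) q = 0 := mk_zero_left _ _

theorem el_zero_right {m n : ℕ} (θ : Fin N ≃ Fin m ⊕ Fin n) (p : X m) :
    el θ p (0 : Y n) = 0 := mk_zero_right _ _

theorem el_sc {m n : ℕ} (θ : Fin N ≃ Fin m ⊕ Fin n) (c : k) (p : X m) (q : Y n) :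
    el θ p (sc (n := n) c q) = el θ (sc (n := m) c p) q := (mk_sc _ _ _ _).symm

theorem el_move {m n m' n' : ℕ} (θ : Fin N ≃ Fin m' ⊕ Fin n') (σ : Fin m' ≃ Fin m)
    (τ : Fin n' ≃ Fin n) (p : X m) (q : Y n) :
    el θ (move σ p) (move τ q) = el (θ.trans (Equiv.sumCongr σ τ)) p q := mk_move _ _ _ _ _

theorem act_el (π : Equiv.Perm (Fin N)) {m n : ℕ} (θ : Fin N ≃ Fin m ⊕ Fin n) (p : X m)
    (q : Y n) : act (k := k) π (el θ p q) = el (π.trans θ) p q := act_mk _ _ _ _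

theorem sc_el (c : k) {m n : ℕ} (θ : Fin N ≃ Fin m ⊕ Fin n) (p : X m) (q : Y n) :
    sc (n := N) c (el θ p q) = el θ (sc (n := m) c p) q := sc_mk _ _ _ _

theorem move_el {N' : ℕ} (π : Fin N' ≃ Fin N) {m n : ℕ} (θ : Fin N ≃ Fin m ⊕ Fin n) (p : X m)
    (q : Y n) : move π (el θ p q) = el (π.trans θ) p q := by
  obtain rfl := eq_of_equiv π
  exact act_mk π θ p q

/-- The universal property of the underlying abelian group of the induction product. -/
def desc {B : Type w} [AddCommGroup B]
    (γ : ∀ {m n : ℕ}, (Fin N ≃ Fin m ⊕ Fin n) → X m → Y n → B) (h : Balanced X Y N B γ) :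
    tens X Y N →+ B := lift γ h

theorem desc_el {B : Type w} [AddCommGroup B]
    (γ : ∀ {m n : ℕ}, (Fin N ≃ Fin m ⊕ Fin n) → X m → Y n → B) (h : Balanced X Y N B γ)
    {m n : ℕ} (θ : Fin N ≃ Fin m ⊕ Fin n) (p : X m) (q : Y n) : desc γ h (el θ p q) = γ θ p q :=
  lift_mk _ _ _ _ _

theorem el_ext {B : Type w} [AddCommGroup B] {f g : tens X Y N →+ B}
    (h : ∀ {m n : ℕ} (θ : Fin N ≃ Fin m ⊕ Fin n) (p : X m) (q : Y n),
      f (el θ p q) = g (el θ p q)) : f = g := tens_ext h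

theorem hom_ext {f g : tens X Y ⟶ Z}
    (h : ∀ {N m n : ℕ} (θ : Fin N ≃ Fin m ⊕ Fin n) (p : X m) (q : Y n),
      ap f (el θ p q) = ap g (el θ p q)) : f = g :=
  ap_ext fun N x => DFunLike.congr_fun
    (el_ext (f := (f N).hom.toAddMonoidHom) (g := (g N).hom.toAddMonoidHom) h) x

theorem hom_ext_left {f g : tens (tens X Y) Z ⟶ W}
    (h : ∀ {N L c a b : ℕ} (θ : Fin N ≃ Fin L ⊕ Fin c) (ψ : Fin L ≃ Fin a ⊕ Fin b) (p : X a)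
      (q : Y b) (r : Z c), ap f (el θ (el ψ p q) r) = ap g (el θ (el ψ p q) r)) : f = g :=
  hom_ext fun {N L c} θ x r => DFunLike.congr_fun
    (el_ext (f := ((f N).hom.toAddMonoidHom).comp
        (AddMonoidHom.mk' (fun x => el θ x r) fun _ _ => el_add_left _ _ _ _))
      (g := ((g N).hom.toAddMonoidHom).comp
        (AddMonoidHom.mk' (fun x => el θ x r) fun _ _ => el_add_left _ _ _ _))
      fun ψ p q => h θ ψ p q r) x

theorem hom_ext_right {f g : tens X (tens Y Z) ⟶ W}
    (h : ∀ {N L a b c : ℕ} (θ : Fin N ≃ Fin a ⊕ Fin L) (ψ : Fin L ≃ Fin b ⊕ Fin c) (p : X a)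
      (q : Y b) (r : Z c), ap f (el θ p (el ψ q r)) = ap g (el θ p (el ψ q r))) : f = g :=
  hom_ext fun {N a L} θ p x => DFunLike.congr_fun
    (el_ext (f := ((f N).hom.toAddMonoidHom).comp
        (AddMonoidHom.mk' (fun x => el θ p x) fun _ _ => el_add_right _ _ _ _))
      (g := ((g N).hom.toAddMonoidHom).comp
        (AddMonoidHom.mk' (fun x => el θ p x) fun _ _ => el_add_right _ _ _ _))
      fun ψ q r => h θ ψ p q r) x

theorem el_el_right {L b c a : ℕ} (θ : Fin N ≃ Fin a ⊕ Fin L) (ψ : Fin L ≃ Fin b ⊕ Fin c)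
    (p : X a) (q : Y b) (r : Z c) :
    el θ p (el ψ q r) =
      el (θ.trans (Equiv.sumCongr (Equiv.refl _) (ψ.trans finSumFinEquiv))) p
        (el finSumFinEquiv.symm q r) := by
  rw [← el_move, move_refl, move_el]
  congr 2
  ext i
  simp

theorem el_el_left {L a b c : ℕ} (θ : Fin N ≃ Fin L ⊕ Fin c) (ψ : Fin L ≃ Fin a ⊕ Fin b)
    (p : X a) (q : Y b) (r : Z c) :
    el θ (el ψ p q) r =
      el (θ.trans (Equiv.sumCongr (ψ.trans finSumFinEquiv) (Equiv.refl _)))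
        (el finSumFinEquiv.symm p q) r := by
  rw [← el_move, move_refl, move_el]
  congr 2
  ext i
  simp

end GMod

end Deligne

end

section

open CategoryTheory MonoidalCategory

namespace Deligne

namespace GMod

variable {k : Type u} [Field k] {X Y Z W X' Y' Z' : GMod k} {N : ℕ}

/-- The action of a scalar as an additive map. -/
def scAdd {X : GMod k} {n : ℕ} (c : k) : X n →+ X n :=
  AddMonoidHom.mk' (sc (n := n) c) (sc_add c)

/-- The action of a permutation as an additive map. -/
def actAdd {X : GMod k} {n : ℕ} (σ : Equiv.Perm (Fin n)) : X n →+ X n :=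
  AddMonoidHom.mk' (act (k := k) σ) (act_add σ)

theorem scAdd_apply {X : GMod k} {n : ℕ} (c : k) (x : X n) : scAdd c x = sc (n := n) c x := rfl

theorem actAdd_apply {X : GMod k} {n : ℕ} (σ : Equiv.Perm (Fin n)) (x : X n) :
    actAdd σ x = act (k := k) σ x := rfl

/-- The universal property of the induction product. -/
def homDesc (γ : ∀ {N m n : ℕ}, (Fin N ≃ Fin m ⊕ Fin n) → X m → Y n → Z N)
    (h : ∀ N, Balanced X Y N (Z N) γ)
    (hs : ∀ {N m n : ℕ} (c : k) (θ : Fin N ≃ Fin m ⊕ Fin n) (p : X m) (q : Y n),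
      γ θ (sc (n := m) c p) q = sc (n := N) c (γ θ p q))
    (ha : ∀ {N m n : ℕ} (π : Equiv.Perm (Fin N)) (θ : Fin N ≃ Fin m ⊕ Fin n) (p : X m) (q : Y n),
      γ (π.trans θ) p q = act (k := k) π (γ θ p q)) : tens X Y ⟶ Z :=
  homMk (fun N => desc γ (h N))
    (fun N c x => DFunLike.congr_fun
      (el_ext (f := (desc γ (h N)).comp (scAdd c))
        (g := (scAdd c).comp (desc γ (h N))) fun θ p q => by
          rw [AddMonoidHom.comp_apply, AddMonoidHom.comp_apply, scAdd_apply, scAdd_apply, sc_el, desc_el, desc_el, hs]) x)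
    (fun N σ x => DFunLike.congr_fun
      (el_ext (f := (desc γ (h N)).comp (actAdd σ))
        (g := (actAdd σ).comp (desc γ (h N))) fun θ p q => by
          rw [AddMonoidHom.comp_apply, AddMonoidHom.comp_apply, actAdd_apply, actAdd_apply, act_el, desc_el, desc_el, ha]) x)

theorem homDesc_el (γ : ∀ {N m n : ℕ}, (Fin N ≃ Fin m ⊕ Fin n) → X m → Y n → Z N) (h) (hs) (ha)
    {m n : ℕ} (θ : Fin N ≃ Fin m ⊕ Fin n) (p : X m) (q : Y n) :
    ap (homDesc γ h hs ha) (el θ p q) = γ θ p q := desc_el _ (h N) _ _ _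

theorem el_act {m n : ℕ} (θ : Fin N ≃ Fin m ⊕ Fin n) (σ : Equiv.Perm (Fin m))
    (τ : Equiv.Perm (Fin n)) (p : X m) (q : Y n) :
    el θ (act (k := k) σ p) (act (k := k) τ q) = el (θ.trans (Equiv.sumCongr σ τ)) p q :=
  el_move θ σ τ p q

/-- The induction product of two morphisms. -/
def map (f : X ⟶ X') (g : Y ⟶ Y') : tens X Y ⟶ tens X' Y' :=
  homDesc (fun θ p q => el θ (ap f p) (ap g q))
    (fun N =>
      { add_left := fun _ _ _ _ => by rw [ap_add, el_add_left]
        add_right := fun _ _ _ _ => by rw [ap_add, el_add_right]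
        scalar := fun _ _ _ _ => by rw [ap_sc, ap_sc, el_sc]
        perm := fun _ _ _ _ _ => by rw [ap_act, ap_act, el_act] })
    (fun _ _ _ _ => by rw [ap_sc, sc_el])
    (fun _ _ _ _ => by rw [act_el])

theorem map_el (f : X ⟶ X') (g : Y ⟶ Y') {m n : ℕ} (θ : Fin N ≃ Fin m ⊕ Fin n) (p : X m) (q : Y n) :
    ap (map f g) (el θ p q) = el θ (ap f p) (ap g q) := homDesc_el _ _ _ _ _ _ _

theorem swap_equiv {m n : ℕ} (θ : Fin N ≃ Fin m ⊕ Fin n) (σ : Equiv.Perm (Fin m))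
    (τ : Equiv.Perm (Fin n)) : (θ.trans (Equiv.sumComm _ _)).trans (Equiv.sumCongr τ σ) =
      (θ.trans (Equiv.sumCongr σ τ)).trans (Equiv.sumComm _ _) := by
  ext i
  simp only [Equiv.trans_apply]
  rcases θ i with _ | _ <;> rfl

/-- The symmetry `p ⊗ q ⊗ θ ↦ q ⊗ p ⊗ θ'`, where `θ'` is `θ` followed by the exchange of the two
parts. -/
def swap (X Y : GMod k) : tens X Y ⟶ tens Y X :=
  homDesc (fun θ p q => el (θ.trans (Equiv.sumComm _ _)) q p)
    (fun N =>
      { add_left := fun _ _ _ _ => by rw [el_add_right]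
        add_right := fun _ _ _ _ => by rw [el_add_left]
        scalar := fun _ _ _ _ => by rw [el_sc]
        perm := fun _ _ _ _ _ => by
          rw [el_act]
          congr 1
          exact swap_equiv _ _ _ })
    (fun _ _ _ _ => by rw [sc_el, el_sc])
    (fun _ _ _ _ => by
      rw [act_el]
      rfl)

theorem swap_el {m n : ℕ} (θ : Fin N ≃ Fin m ⊕ Fin n) (p : X m) (q : Y n) :
    ap (swap X Y) (el θ p q) = el (θ.trans (Equiv.sumComm _ _)) q p := homDesc_el _ _ _ _ _ _ _

theorem swap_swap (X Y : GMod k) : swap X Y ≫ swap Y X = 𝟙 _ := hom_ext fun θ p q => by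
  rw [ap_comp, swap_el, swap_el, ap_id]
  congr 1
  ext i
  simp

/-- The element `p ⊗ (q ⊗ r)` at a decomposition of `{1, …, N}` into three parts. -/
def elr {a b c : ℕ} (Θ : Fin N ≃ Fin a ⊕ (Fin b ⊕ Fin c)) (p : X a) (q : Y b) (r : Z c) :
    tens X (tens Y Z) N :=
  el (Θ.trans (Equiv.sumCongr (Equiv.refl _) finSumFinEquiv)) p (el finSumFinEquiv.symm q r)

theorem el_right {L a b c : ℕ} (θ : Fin N ≃ Fin a ⊕ Fin L) (ψ : Fin L ≃ Fin b ⊕ Fin c)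
    (p : X a) (q : Y b) (r : Z c) :
    el θ p (el ψ q r) = elr (θ.trans (Equiv.sumCongr (Equiv.refl _) ψ)) p q r := by
  rw [el_el_right, elr]
  congr 1
  ext i
  simp

/-- The element `(p ⊗ q) ⊗ r` at a decomposition of `{1, …, N}` into three parts. -/
def ell {a b c : ℕ} (Θ : Fin N ≃ (Fin a ⊕ Fin b) ⊕ Fin c) (p : X a) (q : Y b) (r : Z c) :
    tens (tens X Y) Z N :=
  el (Θ.trans (Equiv.sumCongr finSumFinEquiv (Equiv.refl _))) (el finSumFinEquiv.symm p q) r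

theorem el_left {L a b c : ℕ} (θ : Fin N ≃ Fin L ⊕ Fin c) (ψ : Fin L ≃ Fin a ⊕ Fin b)
    (p : X a) (q : Y b) (r : Z c) :
    el θ (el ψ p q) r = ell (θ.trans (Equiv.sumCongr ψ (Equiv.refl _))) p q r := by
  rw [el_el_left, ell]
  congr 1
  ext i
  simp

theorem el_act_left {m n : ℕ} (θ : Fin N ≃ Fin m ⊕ Fin n) (σ : Equiv.Perm (Fin m)) (p : X m)
    (q : Y n) : el θ (act (k := k) σ p) q =
      el (θ.trans (Equiv.sumCongr σ (Equiv.refl _))) p q := by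
  rw [← el_act θ σ (Equiv.refl _)]
  exact congrArg _ (act_one q).symm

theorem el_act_right {m n : ℕ} (θ : Fin N ≃ Fin m ⊕ Fin n) (τ : Equiv.Perm (Fin n)) (p : X m)
    (q : Y n) : el θ p (act (k := k) τ q) =
      el (θ.trans (Equiv.sumCongr (Equiv.refl _) τ)) p q := by
  rw [← el_act θ (Equiv.refl _) τ]
  exact congrArg (fun x => el θ x _) (act_one p).symm

theorem elr_act {a b c : ℕ} (Θ : Fin N ≃ Fin a ⊕ (Fin b ⊕ Fin c)) (σ : Equiv.Perm (Fin a))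
    (τ : Equiv.Perm (Fin b)) (ρ : Equiv.Perm (Fin c)) (p : X a) (q : Y b) (r : Z c) :
    elr Θ (act (k := k) σ p) (act (k := k) τ q) (act (k := k) ρ r) =
      elr (Θ.trans (Equiv.sumCongr σ (Equiv.sumCongr τ ρ))) p q r := by
  rw [elr, el_act, el_act_left, el_right]
  congr 1
  ext i
  simp only [Equiv.trans_apply, Equiv.sumCongr_apply]
  rcases Θ i with _ | _ <;> simp

theorem ell_act {a b c : ℕ} (Θ : Fin N ≃ (Fin a ⊕ Fin b) ⊕ Fin c) (σ : Equiv.Perm (Fin a))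
    (τ : Equiv.Perm (Fin b)) (ρ : Equiv.Perm (Fin c)) (p : X a) (q : Y b) (r : Z c) :
    ell Θ (act (k := k) σ p) (act (k := k) τ q) (act (k := k) ρ r) =
      ell (Θ.trans (Equiv.sumCongr (Equiv.sumCongr σ τ) ρ)) p q r := by
  rw [ell, el_act, el_act_right, el_left]
  congr 1
  ext i
  simp only [Equiv.trans_apply, Equiv.sumCongr_apply]
  rcases Θ i with _ | _ <;> simp

section Multilinear

variable {a b c : ℕ} (Θ : Fin N ≃ Fin a ⊕ (Fin b ⊕ Fin c)) (Θ' : Fin N ≃ (Fin a ⊕ Fin b) ⊕ Fin c)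
  (x : k) (p p' : X a) (q q' : Y b) (r r' : Z c)

theorem elr_add₁ : elr Θ (p + p') q r = elr Θ p q r + elr Θ p' q r := by
  rw [elr, el_add_left]; rfl

theorem elr_add₂ : elr Θ p (q + q') r = elr Θ p q r + elr Θ p q' r := by
  rw [elr, el_add_left, el_add_right]; rfl

theorem elr_add₃ : elr Θ p q (r + r') = elr Θ p q r + elr Θ p q r' := by
  rw [elr, el_add_right, el_add_right]; rfl

theorem elr_sc₁ : elr Θ (sc (n := a) x p) q r = sc (n := N) x (elr Θ p q r) := by
  rw [elr, elr, sc_el]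

theorem elr_sc₂ : elr Θ p (sc (n := b) x q) r = sc (n := N) x (elr Θ p q r) := by
  rw [elr, elr, sc_el, ← sc_el x _ q r, el_sc]

theorem elr_sc₃ : elr Θ p q (sc (n := c) x r) = sc (n := N) x (elr Θ p q r) := by
  rw [elr, elr, sc_el, el_sc, ← sc_el x _ q r, el_sc]

theorem ell_add₁ : ell Θ' (p + p') q r = ell Θ' p q r + ell Θ' p' q r := by
  rw [ell, el_add_left, el_add_left]; rfl

theorem ell_add₂ : ell Θ' p (q + q') r = ell Θ' p q r + ell Θ' p q' r := by
  rw [ell, el_add_right, el_add_left]; rfl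

theorem ell_add₃ : ell Θ' p q (r + r') = ell Θ' p q r + ell Θ' p q r' := by
  rw [ell, el_add_right]; rfl

theorem ell_sc₁ : ell Θ' (sc (n := a) x p) q r = sc (n := N) x (ell Θ' p q r) := by
  rw [ell, ell, ← sc_el x _ p q]
  exact (sc_el x _ _ _).symm

theorem ell_sc₂ : ell Θ' p (sc (n := b) x q) r = sc (n := N) x (ell Θ' p q r) := by
  rw [← ell_sc₁, ell, el_sc, ell]

theorem ell_sc₃ : ell Θ' p q (sc (n := c) x r) = sc (n := N) x (ell Θ' p q r) := by
  rw [ell, ell, el_sc]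
  exact (sc_el x _ _ _).symm

end Multilinear

/-- The associator for a fixed last factor. -/
def assocAux {L c : ℕ} (θ : Fin N ≃ Fin L ⊕ Fin c) (r : Z c) :
    tens X Y L →+ tens X (tens Y Z) N :=
  desc (fun ψ p q =>
      elr ((θ.trans (Equiv.sumCongr ψ (Equiv.refl _))).trans (Equiv.sumAssoc _ _ _)) p q r)
    { add_left := fun _ _ _ _ => elr_add₁ _ _ _ _ _
      add_right := fun _ _ _ _ => elr_add₂ _ _ _ _ _
      scalar := fun _ _ _ _ => by rw [elr_sc₁, elr_sc₂]
      perm := fun ψ σ τ p q => by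
        refine (congrArg _ (act_one (k := k) r).symm).trans ((elr_act _ σ τ 1 p q r).trans ?_)
        congr 1
        ext i
        simp only [Equiv.trans_apply, Equiv.sumCongr_apply]
        rcases θ i with j | j
        · simp only [Sum.map_inl, Equiv.trans_apply, Equiv.sumCongr_apply]
          rcases ψ j with l | l <;> rfl
        · rfl }

theorem assocAux_el {L a b c : ℕ} (θ : Fin N ≃ Fin L ⊕ Fin c) (r : Z c)
    (ψ : Fin L ≃ Fin a ⊕ Fin b) (p : X a) (q : Y b) :
    assocAux θ r (el ψ p q) = elr
      ((θ.trans (Equiv.sumCongr ψ (Equiv.refl _))).trans (Equiv.sumAssoc _ _ _)) p q r :=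
  desc_el _ _ _ _ _

/-- The associator `(p ⊗ q) ⊗ r ↦ p ⊗ (q ⊗ r)`, for a fixed decomposition of `{1, …, N}` into
three parts. -/
def assocHom (X Y Z : GMod k) : tens (tens X Y) Z ⟶ tens X (tens Y Z) :=
  homDesc (fun θ x r => assocAux θ r x)
    (fun N =>
      { add_left := fun _ _ _ _ => map_add _ _ _
        add_right := fun θ x r r' => DFunLike.congr_fun
          (el_ext (f := assocAux θ (r + r')) (g := assocAux θ r + assocAux θ r') fun ψ p q => by
            rw [AddMonoidHom.add_apply, assocAux_el, assocAux_el, assocAux_el, elr_add₃]) x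
        scalar := fun θ c x r => DFunLike.congr_fun
          (el_ext (f := (assocAux θ r).comp (scAdd c))
            (g := assocAux θ (sc c r)) fun ψ p q => by
            rw [AddMonoidHom.comp_apply, scAdd_apply, sc_el, assocAux_el, assocAux_el, elr_sc₁, elr_sc₃]) x
        perm := fun θ σ τ x r => DFunLike.congr_fun
          (el_ext (f := (assocAux θ (act τ r)).comp (actAdd σ))
            (g := assocAux (θ.trans (Equiv.sumCongr σ τ)) r) fun ψ p q => by
            rw [AddMonoidHom.comp_apply, actAdd_apply, act_el, assocAux_el, assocAux_el]
            refine (congrArg (fun p => elr _ p _ _) (act_one (k := k) p).symm).trans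
              ((congrArg (fun q => elr _ _ q _) (act_one (k := k) q).symm).trans
              ((elr_act _ 1 1 τ p q r).trans ?_))
            congr 1
            ext i
            simp only [Equiv.trans_apply, Equiv.sumCongr_apply]
            rcases θ i with j | j
            · simp only [Sum.map_inl, Equiv.trans_apply, Equiv.sumCongr_apply]
              rcases ψ (σ j) with l | l <;> rfl
            · rfl) x })
    (fun c θ x r => DFunLike.congr_fun
      (el_ext (f := (assocAux θ r).comp (scAdd c))
        (g := (scAdd c).comp (assocAux θ r)) fun ψ p q => by
        rw [AddMonoidHom.comp_apply, AddMonoidHom.comp_apply, scAdd_apply, scAdd_apply, sc_el, assocAux_el, assocAux_el, elr_sc₁]) x)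
    (fun π θ x r => DFunLike.congr_fun
      (el_ext (f := assocAux (π.trans θ) r)
        (g := (actAdd π).comp (assocAux θ r)) fun ψ p q => by
        rw [AddMonoidHom.comp_apply, actAdd_apply, assocAux_el, assocAux_el, elr, elr, act_el]
        rfl) x)

theorem assocHom_el {L a b c : ℕ} (θ : Fin N ≃ Fin L ⊕ Fin c) (ψ : Fin L ≃ Fin a ⊕ Fin b)
    (p : X a) (q : Y b) (r : Z c) :
    ap (assocHom X Y Z) (el θ (el ψ p q) r) = elr
      ((θ.trans (Equiv.sumCongr ψ (Equiv.refl _))).trans (Equiv.sumAssoc _ _ _)) p q r :=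
  (homDesc_el _ _ _ _ _ _ _).trans (assocAux_el _ _ _ _ _)

end GMod

end Deligne

end

section

open CategoryTheory MonoidalCategory

namespace Deligne

namespace GMod

variable {k : Type u} [Field k] {X Y Z W X' Y' Z' : GMod k} {N : ℕ}

theorem assocHom_elr {a b c : ℕ} (Θ : Fin N ≃ (Fin a ⊕ Fin b) ⊕ Fin c) (p : X a) (q : Y b)
    (r : Z c) : ap (assocHom X Y Z) (ell Θ p q r) = elr (Θ.trans (Equiv.sumAssoc _ _ _)) p q r := by
  rw [ell, assocHom_el]
  congr 2
  ext i
  simp only [Equiv.trans_apply, Equiv.sumCongr_apply]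
  rcases Θ i with j | j <;> simp

theorem swap_swap_hom (X Y : GMod k) : swap X Y ≫ swap Y X = 𝟙 _ := swap_swap X Y

/-- The inverse of the associator is obtained from the associator and the symmetry. -/
def assocInv (X Y Z : GMod k) : tens X (tens Y Z) ⟶ tens (tens X Y) Z :=
  swap X (tens Y Z) ≫ map (swap Y Z) (𝟙 X) ≫ assocHom Z Y X ≫ swap Z (tens Y X) ≫
    map (swap Y X) (𝟙 Z)

theorem el_move_right {m n n' : ℕ} (θ : Fin N ≃ Fin m ⊕ Fin n') (τ : Fin n' ≃ Fin n) (p : X m)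
    (q : Y n) : el θ p (move τ q) = el (θ.trans (Equiv.sumCongr (Equiv.refl _) τ)) p q := by
  rw [← el_move, move_refl]

theorem el_move_left {m n m' : ℕ} (θ : Fin N ≃ Fin m' ⊕ Fin n) (σ : Fin m' ≃ Fin m) (p : X m)
    (q : Y n) : el θ (move σ p) q = el (θ.trans (Equiv.sumCongr σ (Equiv.refl _))) p q := by
  rw [← el_move, move_refl]

theorem map_elr {a b c : ℕ} (Θ : Fin N ≃ Fin a ⊕ (Fin b ⊕ Fin c)) (p : X a) (q : Y b)
    (r : Z c) (f : X ⟶ X') (g : Y ⟶ Y') (h : Z ⟶ Z') :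
    ap (map f (map g h)) (elr Θ p q r) = elr Θ (ap f p) (ap g q) (ap h r) := by
  rw [elr, map_el, map_el, elr]

theorem assocInv_elr {a b c : ℕ} (Θ : Fin N ≃ Fin a ⊕ (Fin b ⊕ Fin c)) (p : X a) (q : Y b)
    (r : Z c) : ap (assocInv X Y Z) (elr Θ p q r) =
      ell (Θ.trans (Equiv.sumAssoc _ _ _).symm) p q r := by
  rw [elr, assocInv, ap_comp, ap_comp, ap_comp, ap_comp, swap_el, map_el, swap_el, ap_id,
    assocHom_el, elr, swap_el, map_el, swap_el, ap_id, ell]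
  rw [el_el_left]
  congr 1
  ext i
  simp only [Equiv.trans_apply, Equiv.sumCongr_apply]
  rcases Θ i with j | j | j <;> simp

theorem assocHom_assocInv (X Y Z : GMod k) : assocHom X Y Z ≫ assocInv X Y Z = 𝟙 _ :=
  hom_ext_left fun θ ψ p q r => by
    rw [ap_comp, el_left, assocHom_elr, assocInv_elr, ap_id]
    congr 1
    ext i
    simp

theorem assocInv_assocHom (X Y Z : GMod k) : assocInv X Y Z ≫ assocHom X Y Z = 𝟙 _ :=
  hom_ext_right fun θ ψ p q r => by
    rw [ap_comp, el_right, assocInv_elr, assocHom_elr, ap_id]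
    congr 1
    ext i
    simp

/-- The family with the trivial module `k` in degree `0` and zero in all other degrees. -/
def Unt (k : Type u) [Field k] (n : ℕ) : Type u := PLift (n = 0) → k

instance (n : ℕ) : AddCommGroup (Unt k n) := Pi.addCommGroup

instance (n : ℕ) : Module k (Unt k n) := Pi.module _ _ _

/-- The augmentation of the group algebra. -/
def aug (n : ℕ) : GrpAlg k n →+* k :=
  (RingHom.fromOpposite (MonoidAlgebra.lift k k (Equiv.Perm (Fin n)) 1).toRingHom
    fun _ _ => Commute.all _ _)

instance (n : ℕ) : Module (GrpAlg k n) (Unt k n) := Module.compHom _ (aug n)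

theorem smul_unt {n : ℕ} (σ : Equiv.Perm (Fin n)) (c : k) (f : Unt k n) :
    (MulOpposite.op (MonoidAlgebra.single σ c) : GrpAlg k n) • f = fun h => c * f h := by
  change (MonoidAlgebra.lift k k (Equiv.Perm (Fin n)) 1) (MonoidAlgebra.single σ c) • f = _
  rw [MonoidAlgebra.lift_single]
  funext h
  change (c • (1 : k)) * f h = _
  simp

variable (k) in
/-- The unit of the induction product. -/
def unt : GMod k := fun n => ModuleCat.of (GrpAlg k n) (Unt k n)

/-- The value of an element of the unit, in degree `0`. -/
def uval {n : ℕ} (h : n = 0) (f : unt k n) : k := f ⟨h⟩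

theorem uval_add {n : ℕ} (h : n = 0) (f g : unt k n) : uval h (f + g) = uval h f + uval h g := rfl

theorem uval_sc {n : ℕ} (h : n = 0) (c : k) (f : unt k n) :
    uval h (sc (n := n) c f) = c * uval h f := congrFun (smul_unt _ _ f) _

theorem uval_act {n : ℕ} (h : n = 0) (σ : Equiv.Perm (Fin n)) (f : unt k n) :
    uval h (act (k := k) σ f) = uval h f := (congrFun (smul_unt _ _ f) _).trans (one_mul _)

/-- The element `1` of degree `0`. -/
def u1 : unt k 0 := fun _ => 1

theorem unt_eq (f : unt k 0) : f = sc (n := 0) (uval rfl f) u1 := by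
  refine Eq.trans ?_ (smul_unt _ _ _).symm
  funext h
  exact (mul_one _).symm

theorem unt_zero {n : ℕ} (hn : n ≠ 0) (f : unt k n) : f = 0 := funext fun h => absurd h.down hn

/-- A decomposition with an empty first part. -/
def dropLeft {m n : ℕ} (h : m = 0) (θ : Fin N ≃ Fin m ⊕ Fin n) : Fin N ≃ Fin n :=
  haveI : IsEmpty (Fin m) := by subst h; infer_instance
  θ.trans (Equiv.emptySum (Fin m) (Fin n))

/-- The left unit isomorphism. -/
def leftHom (X : GMod k) : tens (unt k) X ⟶ X :=
  homDesc (fun {N m _} θ f q =>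
      if h : m = 0 then sc (n := N) (uval h f) (move (dropLeft h θ) q) else 0)
    (fun N =>
      { add_left := fun {m n} θ f f' q => by
          by_cases h : m = 0
          · simp only [dif_pos h, uval_add, add_sc]
          · simp only [dif_neg h, add_zero]
        add_right := fun {m n} θ f q q' => by
          by_cases h : m = 0
          · simp only [dif_pos h, move_add, sc_add]
          · simp only [dif_neg h, add_zero]
        scalar := fun {m n} θ c f q => by
          by_cases h : m = 0
          · simp only [dif_pos h]
            rw [move_sc, sc_sc, mul_comm, uval_sc, mul_comm]
          · simp only [dif_neg h]
        perm := fun {m n} θ σ τ f q => by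
          by_cases h : m = 0
          · simp only [dif_pos h]
            rw [← move_self τ, move_move, uval_act]
            subst h
            congr 2
            ext i
            simp only [dropLeft, Equiv.trans_apply]
            rcases θ i with j | j
            · exact j.elim0
            · rfl
          · simp only [dif_neg h] })
    (fun {N m n} c θ f q => by
      by_cases h : m = 0
      · simp only [dif_pos h]
        rw [sc_sc, uval_sc]
      · simp only [dif_neg h, sc_zero])
    (fun {N m n} π θ f q => by
      by_cases h : m = 0
      · simp only [dif_pos h]
        rw [act_sc, ← move_self, move_move]
        rfl
      · simp only [dif_neg h, act_zero])

theorem leftHom_el {n : ℕ} (θ : Fin N ≃ Fin 0 ⊕ Fin n) (f : unt k 0) (q : X n) :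
    ap (leftHom X) (el θ f q) = sc (n := N) (uval rfl f) (move (dropLeft rfl θ) q) :=
  homDesc_el _ _ _ _ _ _ _

/-- The inverse of the left unit isomorphism. -/
def leftInv (X : GMod k) : X ⟶ tens (unt k) X :=
  homMk (fun n => AddMonoidHom.mk' (fun x => el (Equiv.emptySum (Fin 0) (Fin n)).symm u1 x)
      fun _ _ => el_add_right _ _ _ _)
    (fun n c x => by
      change el _ u1 (sc (n := n) c x) = sc (n := n) c (el _ u1 x)
      rw [el_sc, sc_el])
    (fun n σ x => by
      change el _ u1 (act σ x) = act σ (el _ u1 x)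
      rw [act_el, el_act_right]
      congr 1
      exact Equiv.ext fun i => rfl)

theorem leftInv_ap {n : ℕ} (x : X n) : ap (leftInv X) x =
    el (Equiv.emptySum (Fin 0) (Fin n)).symm u1 x := rfl

/-- Morphisms out of the product with the unit are determined by the elements `1 ⊗ q ⊗ θ`. -/
theorem hom_ext_unit {f g : tens (unt k) X ⟶ Z}
    (h : ∀ {N n : ℕ} (θ : Fin N ≃ Fin 0 ⊕ Fin n) (q : X n),
      ap f (el θ u1 q) = ap g (el θ u1 q)) : f = g :=
  hom_ext fun {N m n} θ p q => by
    by_cases hm : m = 0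
    · subst hm
      rw [unt_eq p, ← sc_el, ap_sc, ap_sc, h]
    · rw [unt_zero hm p, el_zero_left]
      exact (map_zero (f N).hom).trans (map_zero (g N).hom).symm

theorem leftHom_leftInv (X : GMod k) : leftHom X ≫ leftInv X = 𝟙 _ :=
  hom_ext_unit fun θ q => by
    rw [ap_comp, leftHom_el, leftInv_ap, ap_id, show uval rfl (u1 (k := k)) = 1 from rfl, one_sc,
      el_move_right]
    congr 1
    ext i
    change Sum.inr (Equiv.emptySum (Fin 0) (Fin _) (θ i)) = θ i
    rcases θ i with j | j
    · exact j.elim0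
    · rfl

theorem leftInv_leftHom (X : GMod k) : leftInv X ≫ leftHom X = 𝟙 _ :=
  ap_ext fun n x => by
    rw [ap_comp, leftInv_ap, leftHom_el, ap_id]
    exact (one_sc _).trans ((congrArg (fun e => move e x) (Equiv.ext fun i => rfl)).trans
      (move_refl x))

theorem swap_natural (f : X ⟶ X') (g : Y ⟶ Y') :
    map f g ≫ swap X' Y' = swap X Y ≫ map g f := hom_ext fun θ p q => by
  rw [ap_comp, ap_comp, map_el, swap_el, swap_el, map_el]

theorem assoc_natural (f : X ⟶ X') (g : Y ⟶ Y') (h : Z ⟶ Z') :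
    map (map f g) h ≫ assocHom X' Y' Z' = assocHom X Y Z ≫ map f (map g h) :=
  hom_ext_left fun θ ψ p q r => by
    rw [ap_comp, ap_comp, map_el, map_el, assocHom_el, assocHom_el, map_elr]

theorem left_natural (f : X ⟶ Y) : map (𝟙 (unt k)) f ≫ leftHom Y = leftHom X ≫ f :=
  hom_ext_unit fun θ q => by
    rw [ap_comp, ap_comp, map_el, ap_id, leftHom_el, leftHom_el, ap_sc, ap_move]

instance : MonoidalCategoryStruct (GMod k) where
  tensorObj := tens
  tensorUnit := unt k
  tensorHom := map
  whiskerLeft X _ _ g := map (𝟙 X) g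
  whiskerRight f X := map f (𝟙 X)
  associator X Y Z := ⟨assocHom X Y Z, assocInv X Y Z, assocHom_assocInv X Y Z,
    assocInv_assocHom X Y Z⟩
  leftUnitor X := ⟨leftHom X, leftInv X, leftHom_leftInv X, leftInv_leftHom X⟩
  rightUnitor X := ⟨swap X (unt k) ≫ leftHom X, leftInv X ≫ swap (unt k) X, by
    rw [Category.assoc, ← Category.assoc (leftHom X), leftHom_leftInv, Category.id_comp,
      swap_swap], by
    rw [Category.assoc, ← Category.assoc (swap _ _) (swap _ _), swap_swap, Category.id_comp,
      leftInv_leftHom]⟩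

theorem hom_ext_four {V : GMod k} {f g : tens (tens (tens W X) Y) Z ⟶ V}
    (h : ∀ {N M L a b c d : ℕ} (θ : Fin N ≃ Fin M ⊕ Fin d) (ψ : Fin M ≃ Fin L ⊕ Fin c)
      (φ : Fin L ≃ Fin a ⊕ Fin b) (p : W a) (q : X b) (r : Y c) (z : Z d),
      ap f (el θ (el ψ (el φ p q) r) z) = ap g (el θ (el ψ (el φ p q) r) z)) : f = g :=
  hom_ext_left fun {N M d L c} θ ψ u r z => DFunLike.congr_fun
    (el_ext (f := ((f N).hom.toAddMonoidHom).comp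
        (AddMonoidHom.mk' (fun u => el θ (el ψ u r) z) fun _ _ => by
          rw [el_add_left, el_add_left]))
      (g := ((g N).hom.toAddMonoidHom).comp
        (AddMonoidHom.mk' (fun u => el θ (el ψ u r) z) fun _ _ => by
          rw [el_add_left, el_add_left]))
      fun φ p q => h θ ψ φ p q r z) u

theorem pentagon' (W X Y Z : GMod k) :
    map (assocHom W X Y) (𝟙 Z) ≫ assocHom W (tens X Y) Z ≫ map (𝟙 W) (assocHom X Y Z) =
      assocHom (tens W X) Y Z ≫ assocHom W X (tens Y Z) :=
  hom_ext_four fun θ ψ φ p q r z => by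
    rw [ap_comp, ap_comp, ap_comp, map_el, assocHom_el, elr, assocHom_el, elr, map_el, assocHom_el,
      elr, el_right, assocHom_el, elr, elr, assocHom_el, elr, ap_id, ap_id]
    congr 1
    ext i
    simp only [Equiv.trans_apply, Equiv.sumCongr_apply]
    rcases θ i with j | j
    · simp only [Sum.map_inl, Equiv.trans_apply, Equiv.sumCongr_apply]
      rcases ψ j with l | l
      · simp only [Sum.map_inl]
        rcases hm : φ l with m | m <;> simp [hm]
      · simp
    · simp

theorem triangle' (X Y : GMod k) :
    assocHom X (unt k) Y ≫ map (𝟙 X) (leftHom Y) = map (swap X (unt k) ≫ leftHom X) (𝟙 Y) :=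
  hom_ext_left fun {N L c a b} θ ψ p f r => by
    by_cases hb : b = 0
    · subst hb
      rw [unt_eq f, el_sc, ← sc_el, ← sc_el, ap_sc, ap_sc]
      congr 1
      rw [ap_comp, assocHom_el, elr, map_el, map_el, leftHom_el, ap_comp, swap_el, leftHom_el,
        show uval rfl (u1 (k := k)) = 1 from rfl, one_sc, one_sc, el_move_left, el_move_right,
        ap_id, ap_id]
      congr 1
      ext i
      simp only [Equiv.trans_apply, Equiv.sumCongr_apply]
      rcases θ i with j | j
      · simp only [Sum.map_inl, Equiv.trans_apply, Equiv.sumCongr_apply, dropLeft]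
        rcases ψ j with l | l
        · simp
        · exact l.elim0
      · change Sum.inr (Equiv.emptySum (Fin 0) (Fin c)
          (finSumFinEquiv.symm (finSumFinEquiv (Sum.inr j)))) = _
        rw [Equiv.symm_apply_apply]
        rfl
    · rw [unt_zero hb f, el_zero_right, el_zero_left]
      exact (map_zero (ModuleCat.Hom.hom _)).trans (map_zero (ModuleCat.Hom.hom _)).symm

instance : MonoidalCategory (GMod k) := .ofTensorHom
  (id_tensorHom_id := fun P Q => hom_ext fun θ p q => map_el _ _ _ _ _)
  (id_tensorHom := fun _ _ _ _ => rfl)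
  (tensorHom_id := fun _ _ => rfl)
  (tensorHom_comp_tensorHom := fun f f' g g' => hom_ext fun θ p q => by
    change ap (map _ _ ≫ map _ _) _ = ap (map _ _) _
    rw [ap_comp, map_el, map_el, map_el]
    rfl)
  (associator_naturality := fun f g h => assoc_natural f g h)
  (leftUnitor_naturality := fun f => left_natural f)
  (rightUnitor_naturality := fun {X Y} f => by
    change map f (𝟙 _) ≫ swap _ _ ≫ leftHom _ = (swap _ _ ≫ leftHom _) ≫ f
    rw [Category.assoc, ← left_natural, ← Category.assoc, ← Category.assoc, swap_natural])
  (pentagon := fun W X Y Z => pentagon' W X Y Z)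
  (triangle := fun X Y => by
    change assocHom X (unt k) Y ≫ map (𝟙 X) (leftHom Y) = map (swap X (unt k) ≫ leftHom X) (𝟙 Y)
    exact triangle' X Y)

instance : SymmetricCategory (GMod k) where
  braiding X Y := ⟨swap X Y, swap Y X, swap_swap X Y, swap_swap Y X⟩
  braiding_naturality_left f Z := swap_natural _ _
  braiding_naturality_right X _ _ f := swap_natural _ _
  hexagon_forward X Y Z := hom_ext_left fun θ ψ p q r => by
    change ap (assocHom X Y Z ≫ swap X (tens Y Z) ≫ assocHom Y Z X) _ =
      ap (map (swap X Y) (𝟙 Z) ≫ assocHom Y X Z ≫ map (𝟙 Y) (swap X Z)) _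
    rw [ap_comp, ap_comp, ap_comp, ap_comp, assocHom_el, map_el, swap_el, assocHom_el, elr,
      swap_el, assocHom_el, elr, elr, map_el, swap_el, ap_id, ap_id]
    rw [el_right, el_right]
    congr 1
    ext i
    simp only [Equiv.trans_apply, Equiv.sumCongr_apply]
    rcases θ i with j | j
    · simp only [Sum.map_inl, Equiv.trans_apply, Equiv.sumCongr_apply]
      rcases ψ j with l | l <;> simp
    · simp
  hexagon_reverse X Y Z := hom_ext_right fun θ ψ p q r => by
    change ap (assocInv X Y Z ≫ swap (tens X Y) Z ≫ assocInv Z X Y) _ =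
      ap (map (𝟙 X) (swap Y Z) ≫ assocInv X Z Y ≫ map (swap X Z) (𝟙 Y)) _
    rw [ap_comp, ap_comp, ap_comp, ap_comp, el_right, assocInv_elr, ell, swap_el, el_right,
      assocInv_elr, ← el_right, map_el, swap_el, el_right, assocInv_elr, ell, ell, map_el, swap_el,
      ap_id, ap_id]
    rw [el_left, el_left]
    congr 1
    ext i
    simp only [Equiv.trans_apply, Equiv.sumCongr_apply]
    rcases θ i with j | j
    · simp
    · simp only [Sum.map_inr, Equiv.trans_apply, Equiv.sumCongr_apply]
      rcases ψ j with l | l <;> simp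
  symmetry X Y := swap_swap X Y

end GMod

end Deligne

end

section

open CategoryTheory MonoidalCategory

namespace Deligne

namespace GMod

variable {k : Type u} [Field k] {X Y Z W X' Y' Z' : GMod k} {N : ℕ}

instance : Preadditive (GMod k) where
  homGroup X Y := inferInstanceAs (AddCommGroup (∀ i, X i ⟶ Y i))
  add_comp X Y Z f f' g := by
    funext i
    exact Preadditive.add_comp _ _ _ (f i) (f' i) (g i)
  comp_add X Y Z f g g' := by
    funext i
    exact Preadditive.comp_add _ _ _ (f i) (g i) (g' i)

instance : Linear k (GMod k) where
  homModule X Y := inferInstanceAs (Module k (∀ i, X i ⟶ Y i))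
  smul_comp X Y Z r f g := by
    funext i
    exact Linear.smul_comp _ _ _ r (f i) (g i)
  comp_smul X Y Z f r g := by
    funext i
    exact Linear.comp_smul _ _ _ (f i) r (g i)

theorem add_ap (f g : X ⟶ Y) {n : ℕ} (x : X n) : ap (f + g) x = ap f x + ap g x := rfl

theorem zero_ap {n : ℕ} (x : X n) : ap (0 : X ⟶ Y) x = 0 := rfl

instance : MonoidalPreadditive (GMod k) where
  whiskerLeft_zero {X Y Z} := hom_ext fun θ p q => by
    refine (map_el _ _ _ _ _).trans ?_
    rw [zero_ap, el_zero_right, zero_ap]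
  zero_whiskerRight {X Y Z} := hom_ext fun θ p q => by
    refine (map_el _ _ _ _ _).trans ?_
    rw [zero_ap, el_zero_left, zero_ap]
  whiskerLeft_add {X Y Z} f g := hom_ext fun θ p q => by
    refine (map_el _ _ _ _ _).trans ?_
    rw [add_ap, el_add_right, add_ap]
    exact congrArg₂ _ (map_el _ _ _ _ _).symm (map_el _ _ _ _ _).symm
  add_whiskerRight {X Y Z} f g := hom_ext fun θ p q => by
    refine (map_el _ _ _ _ _).trans ?_
    rw [add_ap, el_add_left, add_ap]
    exact congrArg₂ _ (map_el _ _ _ _ _).symm (map_el _ _ _ _ _).symm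

section Projective

theorem card_eq {m n : ℕ} (θ : Fin N ≃ Fin m ⊕ Fin n) : m + n = N :=
  eq_of_equiv (finSumFinEquiv.symm.trans θ.symm)

/-- The order preserving decomposition of `{1, …, N}` into two parts of sizes `m` and `n`. -/
def std {m n : ℕ} (h : m + n = N) : Fin N ≃ Fin m ⊕ Fin n :=
  (finCongr h.symm).trans finSumFinEquiv.symm

/-- `S_m` acting on the first `m` elements. -/
def inclLeft {m n : ℕ} (h : m + n = N) : Equiv.Perm (Fin m) →* Equiv.Perm (Fin N) where
  toFun σ := ((std h).trans (Equiv.sumCongr σ (Equiv.refl _))).trans (std h).symm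
  map_one' := by
    ext i
    simp [Equiv.Perm.one_def]
  map_mul' σ τ := by
    ext i
    simp only [Equiv.trans_apply, Equiv.Perm.mul_apply, Equiv.apply_symm_apply]
    rcases std h i with j | j <;> rfl

/-- `S_n` acting on the last `n` elements. -/
def inclRight {m n : ℕ} (h : m + n = N) : Equiv.Perm (Fin n) →* Equiv.Perm (Fin N) where
  toFun σ := ((std h).trans (Equiv.sumCongr (Equiv.refl _) σ)).trans (std h).symm
  map_one' := by
    ext i
    simp [Equiv.Perm.one_def]
  map_mul' σ τ := by
    ext i
    simp only [Equiv.trans_apply, Equiv.Perm.mul_apply, Equiv.apply_symm_apply]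
    rcases std h i with j | j <;> rfl

/-- The induced maps of group algebras. -/
def algLeft {m n : ℕ} (h : m + n = N) : GrpAlg k m →+* GrpAlg k N :=
  RingHom.op (MonoidAlgebra.mapDomainRingHom k (inclLeft h))

/-- The induced maps of group algebras. -/
def algRight {m n : ℕ} (h : m + n = N) : GrpAlg k n →+* GrpAlg k N :=
  RingHom.op (MonoidAlgebra.mapDomainRingHom k (inclRight h))

theorem algLeft_single {m n : ℕ} (h : m + n = N) (σ : Equiv.Perm (Fin m)) (c : k) :
    algLeft h (MulOpposite.op (MonoidAlgebra.single σ c)) =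
      MulOpposite.op (MonoidAlgebra.single (inclLeft h σ) c) := by
  simp [algLeft]

theorem algRight_single {m n : ℕ} (h : m + n = N) (σ : Equiv.Perm (Fin n)) (c : k) :
    algRight h (MulOpposite.op (MonoidAlgebra.single σ c)) =
      MulOpposite.op (MonoidAlgebra.single (inclRight h σ) c) := by
  simp [algRight]

theorem algLeft_smul {m n : ℕ} (h : m + n = N) (a : GrpAlg k m) (p : X m) (q : Y n) :
    algLeft h a • el (std h) p q = el (std h) (a • p) q := by
  refine algInd (P := fun a => algLeft h a • el (std h) p q = el (std h) (a • p) q) a ?_ ?_ ?_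
  · rw [map_zero, zero_smul, zero_smul, el_zero_left]
  · intro a b ha hb
    rw [map_add, add_smul, add_smul, ha, hb, el_add_left]
  · intro σ c
    rw [algLeft_single, ← sc_act, ← sc_act, act_el, sc_el, ← act_sc, el_act_left]
    congr 1
    ext i
    simp [inclLeft]

theorem algRight_smul {m n : ℕ} (h : m + n = N) (a : GrpAlg k n) (p : X m) (q : Y n) :
    algRight h a • el (std h) p q = el (std h) p (a • q) := by
  refine algInd (P := fun a => algRight h a • el (std h) p q = el (std h) p (a • q)) a ?_ ?_ ?_
  · rw [map_zero, zero_smul, zero_smul, el_zero_right]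
  · intro a b ha hb
    rw [map_add, add_smul, add_smul, ha, hb, el_add_right]
  · intro σ c
    rw [algRight_single, ← sc_act, ← sc_act, act_el, sc_el, ← act_sc, el_act_right, el_sc]
    congr 1
    ext i
    simp [inclRight]

/-- The basis element `θ`, times `a` and `b` from the left, in the regular module. -/
def reg {m n : ℕ} (θ : Fin N ≃ Fin m ⊕ Fin n) (a : GrpAlg k m) (b : GrpAlg k n) : GrpAlg k N :=
  act (k := k) (θ.trans (std (card_eq θ)).symm)
    (algRight (card_eq θ) b * algLeft (card_eq θ) a)

theorem reg_smul {m n : ℕ} (θ : Fin N ≃ Fin m ⊕ Fin n) (a : GrpAlg k m) (b : GrpAlg k n)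
    (p : X m) (q : Y n) :
    reg θ a b • el (std (card_eq θ)) p q = el θ (a • p) (b • q) := by
  rw [reg, act, smul_assoc, mul_smul, algLeft_smul, algRight_smul]
  refine (act_el _ _ _ _).trans ?_
  congr 1
  ext i
  simp

theorem reg_add_left {m n : ℕ} (θ : Fin N ≃ Fin m ⊕ Fin n) (a a' : GrpAlg k m)
    (b : GrpAlg k n) : reg θ (a + a') b = reg θ a b + reg θ a' b := by
  rw [reg, map_add, mul_add, act_add]; rfl

theorem reg_add_right {m n : ℕ} (θ : Fin N ≃ Fin m ⊕ Fin n) (a : GrpAlg k m)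
    (b b' : GrpAlg k n) : reg θ a (b + b') = reg θ a b + reg θ a b' := by
  rw [reg, map_add, add_mul, act_add]; rfl

theorem reg_trans {m n : ℕ} (π : Equiv.Perm (Fin N)) (θ : Fin N ≃ Fin m ⊕ Fin n)
    (a : GrpAlg k m) (b : GrpAlg k n) : reg (π.trans θ) a b = act (k := k) π (reg θ a b) := by
  rw [reg, reg, act_act]
  rfl

theorem sc_comm (c : k) (x : GrpAlg k N) : sc (n := N) c x =
    x * MulOpposite.op (MonoidAlgebra.single 1 c) := by
  refine algInd (P := fun x => sc (n := N) c x = x * MulOpposite.op (MonoidAlgebra.single 1 c))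
    x ?_ ?_ ?_
  · rw [sc_zero, zero_mul]
  · intro a b ha hb
    rw [sc_add, ha, hb, add_mul]
  · intro σ d
    rw [sc, smul_eq_mul, ← MulOpposite.op_mul, ← MulOpposite.op_mul,
      MonoidAlgebra.single_mul_single, MonoidAlgebra.single_mul_single, one_mul, mul_one, mul_comm]

theorem reg_sc_left {m n : ℕ} (θ : Fin N ≃ Fin m ⊕ Fin n) (c : k) (a : GrpAlg k m)
    (b : GrpAlg k n) : reg θ (sc (n := m) c a) b = sc (n := N) c (reg θ a b) := by
  rw [reg, reg, ← act_sc, sc_comm, sc_comm, map_mul, algLeft_single, map_one, mul_assoc]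

theorem reg_sc_right {m n : ℕ} (θ : Fin N ≃ Fin m ⊕ Fin n) (c : k) (a : GrpAlg k m)
    (b : GrpAlg k n) : reg θ a (sc (n := n) c b) = sc (n := N) c (reg θ a b) := by
  rw [reg, reg, ← act_sc, sc, smul_eq_mul, map_mul, algRight_single, map_one, mul_assoc]
  rfl

theorem reg_act {m n : ℕ} (θ : Fin N ≃ Fin m ⊕ Fin n) (σ : Equiv.Perm (Fin m))
    (τ : Equiv.Perm (Fin n)) (a : GrpAlg k m) (b : GrpAlg k n) :
    reg θ (act (k := k) σ a) (act (k := k) τ b) = reg (θ.trans (Equiv.sumCongr σ τ)) a b := by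
  have hc : Commute (algRight (k := k) (card_eq θ) b)
      (algLeft (card_eq θ) (MulOpposite.op (MonoidAlgebra.single σ 1))) := by
    refine algInd (P := fun b => Commute (algRight (k := k) (card_eq θ) b)
      (algLeft (card_eq θ) (MulOpposite.op (MonoidAlgebra.single σ 1)))) b ?_ ?_ ?_
    · rw [map_zero]
      exact Commute.zero_left _
    · intro a b ha hb
      rw [map_add]
      exact ha.add_left hb
    · intro τ c
      rw [algRight_single, algLeft_single]
      change _ * _ = _ * _
      rw [← MulOpposite.op_mul, ← MulOpposite.op_mul, MonoidAlgebra.single_mul_single,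
        MonoidAlgebra.single_mul_single, one_mul, mul_one]
      congr 2
      ext i
      simp only [inclLeft, inclRight, Equiv.Perm.mul_apply, MonoidHom.coe_mk, OneHom.coe_mk,
        Equiv.trans_apply, Equiv.apply_symm_apply]
      rcases std (card_eq θ) i with j | j <;> rfl
  have key : algRight (card_eq θ) (act (k := k) τ b) * algLeft (card_eq θ) (act (k := k) σ a) =
      MulOpposite.op (MonoidAlgebra.single (inclLeft (card_eq θ) σ * inclRight (card_eq θ) τ) 1) *
        (algRight (card_eq θ) b * algLeft (card_eq θ) a) := by
    rw [act, act, smul_eq_mul, smul_eq_mul, map_mul, map_mul, mul_assoc,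
      ← mul_assoc (algRight _ b), hc.eq, mul_assoc, algLeft_single, algRight_single, ← mul_assoc,
      ← MulOpposite.op_mul, MonoidAlgebra.single_mul_single, one_mul]
  rw [reg, reg, key]
  refine (act_act _ _ _).trans ?_
  congr 1
  ext i
  simp only [inclLeft, inclRight, Equiv.Perm.mul_apply, MonoidHom.coe_mk, OneHom.coe_mk,
    Equiv.trans_apply, Equiv.apply_symm_apply]
  rcases θ i with j | j <;> rfl

/-- Auxiliary maps for a section of the canonical surjection from a free module. -/
def sect {m n : ℕ} (θ : Fin N ≃ Fin m ⊕ Fin n) :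
    (X m →₀ GrpAlg k m) →+ (Y n →₀ GrpAlg k n) →+ (tens X Y N →₀ GrpAlg k N) :=
  Finsupp.liftAddHom fun x => AddMonoidHom.mk' (fun a => Finsupp.liftAddHom fun y =>
    AddMonoidHom.mk' (fun b => Finsupp.single (el (std (card_eq θ)) x y) (reg θ a b))
      fun b b' => by rw [reg_add_right, Finsupp.single_add]) fun a a' => by
      refine Finsupp.addHom_ext fun y b => ?_
      simp [reg_add_left]

theorem sect_single {m n : ℕ} (θ : Fin N ≃ Fin m ⊕ Fin n) (x : X m) (a : GrpAlg k m) (y : Y n)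
    (b : GrpAlg k n) : sect θ (Finsupp.single x a) (Finsupp.single y b) =
      Finsupp.single (el (std (card_eq θ)) x y) (reg θ a b) := by
  rw [sect, Finsupp.liftAddHom_apply_single]
  exact Finsupp.liftAddHom_apply_single _ _ _

theorem sect_ind {m n : ℕ} {P : (X m →₀ GrpAlg k m) → (Y n →₀ GrpAlg k n) → Prop}
    (h0 : ∀ G, P 0 G) (h0' : ∀ F, P F 0) (h1 : ∀ F F' G, P F G → P F' G → P (F + F') G)
    (h2 : ∀ F G G', P F G → P F G' → P F (G + G'))
    (h : ∀ x a y b, P (Finsupp.single x a) (Finsupp.single y b)) (F) (G) : P F G := by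
  induction F using Finsupp.induction_linear with
  | zero => exact h0 G
  | add F F' hF hF' => exact h1 _ _ _ hF hF'
  | single x a =>
    induction G using Finsupp.induction_linear with
    | zero => exact h0' _
    | add G G' hG hG' => exact h2 _ _ _ hG hG'
    | single y b => exact h x a y b

theorem act_single {M : Type v} {n : ℕ} (σ : Equiv.Perm (Fin n)) (x : M) (a : GrpAlg k n) :
    act (k := k) σ (Finsupp.single x a) = Finsupp.single x (act (k := k) σ a) :=
  Finsupp.smul_single _ _ _

theorem sc_single {M : Type v} {n : ℕ} (c : k) (x : M) (a : GrpAlg k n) :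
    sc (n := n) c (Finsupp.single x a) = Finsupp.single x (sc (n := n) c a) :=
  Finsupp.smul_single _ _ _

theorem sect_act {m n : ℕ} (θ : Fin N ≃ Fin m ⊕ Fin n) (σ : Equiv.Perm (Fin m))
    (τ : Equiv.Perm (Fin n)) (F : X m →₀ GrpAlg k m) (G : Y n →₀ GrpAlg k n) :
    sect θ (act (k := k) σ F) (act (k := k) τ G) = sect (θ.trans (Equiv.sumCongr σ τ)) F G := by
  refine sect_ind (P := fun F G => sect θ (act (k := k) σ F) (act (k := k) τ G) =
    sect (θ.trans (Equiv.sumCongr σ τ)) F G) ?_ ?_ ?_ ?_ ?_ F G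
  · intro G
    simp [act_zero]
  · intro F
    simp [act_zero]
  · intro F F' G h h'
    rw [act_add, map_add, map_add, AddMonoidHom.add_apply, AddMonoidHom.add_apply, h, h']
  · intro F G G' h h'
    rw [act_add, map_add, map_add, h, h']
  · intro x a y b
    rw [act_single, act_single, sect_single, sect_single, reg_act]

theorem sect_trans {m n : ℕ} (π : Equiv.Perm (Fin N)) (θ : Fin N ≃ Fin m ⊕ Fin n)
    (F : X m →₀ GrpAlg k m) (G : Y n →₀ GrpAlg k n) :
    sect (π.trans θ) F G = act (k := k) π (sect θ F G) := by
  refine sect_ind (P := fun F G => sect (π.trans θ) F G = act (k := k) π (sect θ F G))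
    ?_ ?_ ?_ ?_ ?_ F G
  · intro G
    simp [act_zero]
  · intro F
    simp [act_zero]
  · intro F F' G h h'
    rw [map_add, map_add, AddMonoidHom.add_apply, AddMonoidHom.add_apply, h, h', act_add]
  · intro F G G' h h'
    rw [map_add, map_add, h, h', act_add]
  · intro x a y b
    rw [sect_single, sect_single, reg_trans, act_single]

theorem sect_sc {m n : ℕ} (c : k) (θ : Fin N ≃ Fin m ⊕ Fin n)
    (F : X m →₀ GrpAlg k m) (G : Y n →₀ GrpAlg k n) :
    sect θ (sc (n := m) c F) G = sc (n := N) c (sect θ F G) ∧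
      sect θ F (sc (n := n) c G) = sc (n := N) c (sect θ F G) := by
  refine sect_ind (P := fun F G => sect θ (sc (n := m) c F) G = sc (n := N) c (sect θ F G) ∧
      sect θ F (sc (n := n) c G) = sc (n := N) c (sect θ F G)) ?_ ?_ ?_ ?_ ?_ F G
  · intro G
    simp [sc_zero]
  · intro F
    simp [sc_zero]
  · intro F F' G h h'
    rw [sc_add, map_add, map_add, AddMonoidHom.add_apply, AddMonoidHom.add_apply,
      AddMonoidHom.add_apply, h.1, h'.1, h.2, h'.2, sc_add]
    exact ⟨rfl, rfl⟩
  · intro F G G' h h'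
    rw [sc_add, map_add, map_add, map_add, h.1, h'.1, h.2, h'.2, sc_add]
    exact ⟨rfl, rfl⟩
  · intro x a y b
    rw [sc_single, sc_single, sect_single, sect_single, sect_single, reg_sc_left, reg_sc_right,
      sc_single]
    exact ⟨rfl, rfl⟩

theorem sect_total {m n : ℕ} (θ : Fin N ≃ Fin m ⊕ Fin n)
    (F : X m →₀ GrpAlg k m) (G : Y n →₀ GrpAlg k n) :
    Finsupp.linearCombination (GrpAlg k N) id (sect θ F G) =
      el θ (Finsupp.linearCombination (GrpAlg k m) id F)
        (Finsupp.linearCombination (GrpAlg k n) id G) := by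
  refine sect_ind (P := fun F G => Finsupp.linearCombination (GrpAlg k N) id (sect θ F G) =
      el θ (Finsupp.linearCombination (GrpAlg k m) id F)
        (Finsupp.linearCombination (GrpAlg k n) id G)) ?_ ?_ ?_ ?_ ?_ F G
  · intro G
    simp [el_zero_left]
  · intro F
    simp [el_zero_right]
  · intro F F' G h h'
    rw [map_add, AddMonoidHom.add_apply, map_add, map_add, h, h', el_add_left]
  · intro F G G' h h'
    rw [map_add, map_add, map_add, h, h', el_add_right]
  · intro x a y b
    rw [sect_single, Finsupp.linearCombination_single, Finsupp.linearCombination_single,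
      Finsupp.linearCombination_single]
    exact reg_smul θ a b x y

theorem projective_tens (hX : ∀ n, Module.Projective (GrpAlg k n) (X n))
    (hY : ∀ n, Module.Projective (GrpAlg k n) (Y n)) (N : ℕ) :
    Module.Projective (GrpAlg k N) (tens X Y N) := by
  choose s hs using fun n => Module.projective_def.1 (hX n)
  choose t ht using fun n => Module.projective_def.1 (hY n)
  let Z : GMod k := fun N => ModuleCat.of (GrpAlg k N) (tens X Y N →₀ GrpAlg k N)
  have hsc : ∀ {m} (c : k) (p : X m), s m (sc (n := m) c p) = sc (n := m) c (s m p) :=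
    fun c p => map_smul (s _) _ _
  have htc : ∀ {m} (c : k) (p : Y m), t m (sc (n := m) c p) = sc (n := m) c (t m p) :=
    fun c p => map_smul (t _) _ _
  have hsa : ∀ {m} (σ : Equiv.Perm (Fin m)) (p : X m),
      s m (act (k := k) σ p) = act (k := k) σ (s m p) := fun c p => map_smul (s _) _ _
  have hta : ∀ {m} (σ : Equiv.Perm (Fin m)) (p : Y m),
      t m (act (k := k) σ p) = act (k := k) σ (t m p) := fun c p => map_smul (t _) _ _
  let γ : ∀ {N m n : ℕ}, (Fin N ≃ Fin m ⊕ Fin n) → X m → Y n → Z N :=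
    fun {N m n} θ p q => sect (X := X) (Y := Y) θ (s m p) (t n q)
  have hγ : ∀ N, Balanced X Y N (Z N) γ := fun N =>
    { add_left := fun {m n} θ p p' q => by
        change sect θ (s m (p + p')) _ = sect θ (s m p) _ + sect θ (s m p') _
        rw [map_add, map_add, AddMonoidHom.add_apply]
      add_right := fun {m n} θ p q q' => by
        change sect θ _ (t n (q + q')) = sect θ _ (t n q) + sect θ _ (t n q')
        rw [map_add, map_add]
      scalar := fun {m n} θ c p q => by
        change sect θ (s m (sc (n := m) c p)) _ = sect θ _ (t n (sc (n := n) c q))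
        rw [hsc, htc]
        exact (sect_sc _ _ _ _).1.trans (sect_sc _ _ _ _).2.symm
      perm := fun {m n} θ σ τ p q => by
        change sect θ (s m (act (k := k) σ p)) (t n (act (k := k) τ q)) = _
        rw [hsa, hta]
        exact sect_act _ _ _ _ _ }
  let f : tens X Y ⟶ Z := homDesc γ hγ
    (fun {N m n} c θ p q => by
      change sect θ (s m (sc (n := m) c p)) _ = _
      rw [hsc]
      exact (sect_sc _ _ _ _).1)
    (fun π θ p q => sect_trans _ _ _ _)
  refine Module.projective_def.2 ⟨(f N).hom, fun x => ?_⟩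
  refine DFunLike.congr_fun (el_ext
    (f := ((Finsupp.linearCombination (GrpAlg k N) id).comp (f N).hom).toAddMonoidHom)
    (g := AddMonoidHom.id _) fun {m n} θ p q => ?_) x
  refine (congrArg (Finsupp.linearCombination (GrpAlg k N) id) (homDesc_el γ hγ _ _ θ p q)).trans ?_
  refine (sect_total _ _ _).trans ?_
  rw [hs, ht]
  rfl

theorem finite_tens (hX : ∀ n, Module.Finite (GrpAlg k n) (X n))
    (hY : ∀ n, Module.Finite (GrpAlg k n) (Y n)) (N : ℕ) :
    Module.Finite (GrpAlg k N) (tens X Y N) := by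
  choose S hS using fun n => (hX n).fg_top
  choose T hT using fun n => (hY n).fg_top
  let I := Σ (m n : Fin (N + 1)), (Fin N ≃ Fin m ⊕ Fin n) × (S m) × (T n)
  let v : I → tens X Y N := fun i => el i.2.2.1 i.2.2.2.1.1 i.2.2.2.2.1
  have hv : ∀ {m n : ℕ} (θ : Fin N ≃ Fin m ⊕ Fin n) (p : X m) (q : Y n), p ∈ S m → q ∈ T n →
      el θ p q ∈ Submodule.span (GrpAlg k N) (Set.range v) := by
    intro m n θ p q hp hq
    have := card_eq θ
    exact Submodule.subset_span
      ⟨⟨⟨m, by omega⟩, ⟨n, by omega⟩, θ, ⟨p, hp⟩, ⟨q, hq⟩⟩, rfl⟩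
  have key : ∀ {m n : ℕ} (θ : Fin N ≃ Fin m ⊕ Fin n) (p : X m) (q : Y n),
      el θ p q ∈ Submodule.span (GrpAlg k N) (Set.range v) := by
    intro m n θ p q
    have h1 : ∀ (p : X m), p ∈ S m → ∀ (q : Y n) (θ : Fin N ≃ Fin m ⊕ Fin n),
        el θ p q ∈ Submodule.span (GrpAlg k N) (Set.range v) := by
      intro p hp q
      have hq : q ∈ Submodule.span (GrpAlg k n) (T n : Set (Y n)) := hT n ▸ Submodule.mem_top
      induction hq using Submodule.span_induction with
      | mem q hq => exact fun θ => hv θ p q hp hq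
      | zero => exact fun θ => el_zero_right θ p ▸ Submodule.zero_mem _
      | add q q' _ _ h h' =>
        intro θ
        rw [el_add_right]
        exact Submodule.add_mem _ (h θ) (h' θ)
      | smul a q _ h =>
        refine algInd (P := fun a => ∀ θ : Fin N ≃ Fin m ⊕ Fin n,
          el θ p (a • q) ∈ Submodule.span (GrpAlg k N) (Set.range v)) a ?_ ?_ ?_
        · intro θ
          rw [zero_smul, el_zero_right]
          exact Submodule.zero_mem _
        · intro a b ha hb θ
          rw [add_smul, el_add_right]
          exact Submodule.add_mem _ (ha θ) (hb θ)
        · intro σ c θ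
          rw [← sc_act, el_sc, ← sc_el, el_act_right]
          exact Submodule.smul_mem _ _ (h _)
    have hp : p ∈ Submodule.span (GrpAlg k m) (S m : Set (X m)) := hS m ▸ Submodule.mem_top
    induction hp using Submodule.span_induction generalizing θ with
    | mem p hp => exact h1 p hp q θ
    | zero => exact el_zero_left θ q ▸ Submodule.zero_mem _
    | add p p' _ _ h h' =>
      rw [el_add_left]
      exact Submodule.add_mem _ (h θ) (h' θ)
    | smul a p _ h =>
      refine algInd (P := fun a => ∀ θ : Fin N ≃ Fin m ⊕ Fin n,
        el θ (a • p) q ∈ Submodule.span (GrpAlg k N) (Set.range v)) a ?_ ?_ ?_ θ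
      · intro θ
        rw [zero_smul, el_zero_left]
        exact Submodule.zero_mem _
      · intro a b ha hb θ
        rw [add_smul, el_add_left]
        exact Submodule.add_mem _ (ha θ) (hb θ)
      · intro σ c θ
        rw [← sc_act, ← sc_el, el_act_left]
        exact Submodule.smul_mem _ _ (h _)
  have htop : Submodule.span (GrpAlg k N) (Set.range v) = ⊤ := by
    refine (Submodule.eq_top_iff'.2 fun x => (Submodule.Quotient.mk_eq_zero _).1 ?_)
    exact DFunLike.congr_fun (el_ext
      (f := (Submodule.span (GrpAlg k N) (Set.range v)).mkQ.toAddMonoidHom) (g := 0)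
      fun θ p q => (Submodule.Quotient.mk_eq_zero _).2 (key θ p q)) x
  exact ⟨htop ▸ Submodule.fg_span (Set.finite_range v)⟩

end Projective

end GMod

end Deligne

end

section

open CategoryTheory MonoidalCategory

namespace Deligne

section Projective

variable (k : Type u) [Field k]

/-- The finitely generated projective right modules over the group algebra of `S_n`. -/
def projProp (n : ℕ) : ObjectProperty (ModuleCat.{u} (GrpAlg k n)) := fun M =>
  Module.Finite (GrpAlg k n) M ∧ Module.Projective (GrpAlg k n) M

/-- The category of finitely generated projective right modules over the group algebra of
`S_n`. -/
abbrev Proj (n : ℕ) := (projProp k n).FullSubcategory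

/-- The families of finitely generated projective modules of which almost all are zero. -/
def sumProp : ObjectProperty (GMod k) := fun X =>
  (∀ n, projProp k n (X n)) ∧ ∃ N, ∀ n, N ≤ n → Subsingleton (X n)

/-- The direct sum over all `n` of the categories of finitely generated projective right modules
over the group algebras of `S_n`. -/
abbrev SumProj := (sumProp k).FullSubcategory

variable {k}

theorem GMod.subsingleton_tens {X Y : GMod k} {N : ℕ}
    (h : ∀ m n, m + n = N → Subsingleton (X m) ∨ Subsingleton (Y n)) :
    Subsingleton (GMod.tens X Y N) := by
  refine subsingleton_of_forall_eq 0 fun x => ?_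
  refine DFunLike.congr_fun (GMod.el_ext (f := AddMonoidHom.id (GMod.tens X Y N)) (g := 0)
    fun {m n} θ p q => ?_) x
  rcases h m n (GMod.card_eq θ) with h | h
  · rw [Subsingleton.elim p 0, GMod.el_zero_left, map_zero, map_zero]
  · rw [Subsingleton.elim q 0, GMod.el_zero_right, map_zero, map_zero]

theorem projProp_of_subsingleton {n : ℕ} (M : ModuleCat.{u} (GrpAlg k n)) [Subsingleton M] :
    projProp k n M := ⟨inferInstance, inferInstance⟩

/-- In degree `0` the unit of the induction product is the regular module. -/
def GMod.untLin : GrpAlg k 0 →ₗ[GrpAlg k 0] GMod.unt k 0 := LinearMap.toSpanSingleton _ _ GMod.u1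

theorem projProp_unt (n : ℕ) : projProp k n (GMod.unt k n) := by
  by_cases hn : n = 0
  · subst hn
    have hone : ∀ σ : Equiv.Perm (Fin 0), σ = 1 := fun σ => Subsingleton.elim _ _
    let g : GMod.unt k 0 →ₗ[GrpAlg k 0] GrpAlg k 0 := GMod.linMk
      (AddMonoidHom.mk' (fun f => MulOpposite.op (MonoidAlgebra.single 1 (GMod.uval rfl f)))
        fun f f' => by
          rw [GMod.uval_add, MonoidAlgebra.single_add, MulOpposite.op_add])
      (fun c f => by
        change MulOpposite.op (MonoidAlgebra.single 1 (GMod.uval rfl (GMod.sc (n := 0) c f))) =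
          MulOpposite.op _ * MulOpposite.op _
        rw [GMod.uval_sc, ← MulOpposite.op_mul, MonoidAlgebra.single_mul_single, one_mul, mul_comm])
      (fun σ f => by
        rw [hone σ, GMod.act_one, GMod.act_one])
    have hg : ∀ f, GMod.untLin (g f) = f := fun f => (GMod.unt_eq f).symm
    have hs : Function.Surjective (GMod.untLin (k := k)) := fun f => ⟨_, hg f⟩
    exact ⟨Module.Finite.of_surjective _ hs,
      Module.Projective.of_split g GMod.untLin (LinearMap.ext hg)⟩
  · have : Subsingleton (GMod.unt k n) :=
      subsingleton_of_forall_eq 0 fun x => GMod.unt_zero hn x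
    exact projProp_of_subsingleton _

instance : (sumProp k).IsMonoidal where
  prop_unit := ⟨projProp_unt, 1, fun n hn =>
    subsingleton_of_forall_eq 0 fun x => GMod.unt_zero (k := k) (show n ≠ 0 by omega) x⟩
  prop_tensor X Y hX hY := by
    obtain ⟨N, hN⟩ := hX.2
    obtain ⟨M, hM⟩ := hY.2
    refine ⟨fun n => ⟨GMod.finite_tens (fun n => (hX.1 n).1) (fun n => (hY.1 n).1) n,
      GMod.projective_tens (fun n => (hX.1 n).2) (fun n => (hY.1 n).2) n⟩, N + M, fun n hn => ?_⟩
    refine GMod.subsingleton_tens fun i j hij => ?_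
    by_cases hi : N ≤ i
    · exact Or.inl (hN i hi)
    · exact Or.inr (hM j (by omega))

instance : MonoidalCategory (SumProj k) := inferInstance
instance : SymmetricCategory (SumProj k) := inferInstance
instance : Preadditive (SumProj k) := inferInstance
instance : Linear k (SumProj k) := inferInstance
instance : MonoidalPreadditive (SumProj k) := inferInstance

variable (k) in
/-- The objects of the direct sum that are concentrated in degree `n`. -/
def sumDegree (n : ℕ) : ObjectProperty (SumProj k) := fun X => ∀ i, i ≠ n → Subsingleton (X.obj i)

/-- The component of degree `n`. -/
def comp (n : ℕ) (X : SumProj k) : Proj k n := ⟨X.obj n, X.property.1 n⟩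

/-- A module over the group algebra of `S_n`, as a family of modules. -/
def single {n : ℕ} (P : ModuleCat.{u} (GrpAlg k n)) : GMod k := fun i =>
  if h : n = i then h ▸ P else ModuleCat.of _ PUnit

theorem single_self {n : ℕ} (P : ModuleCat.{u} (GrpAlg k n)) : single P n = P := dif_pos rfl

theorem single_ne {n i : ℕ} (P : ModuleCat.{u} (GrpAlg k n)) (h : n ≠ i) :
    Subsingleton (single P i) := by
  rw [single, dif_neg h]
  exact inferInstanceAs (Subsingleton PUnit)

/-- The object of the direct sum given by an object of the `n`-th summand. -/
def incl {n : ℕ} (P : Proj k n) : SumProj k := ⟨single P.obj, by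
  refine ⟨fun i => ?_, n + 1, fun i hi => single_ne _ (by omega)⟩
  by_cases h : n = i
  · subst h
    rw [single_self]
    exact P.property
  · have := single_ne P.obj h
    exact projProp_of_subsingleton _⟩

theorem sumDegree_incl {n : ℕ} (P : Proj k n) : sumDegree k n (incl P) :=
  fun _ hi => single_ne _ (Ne.symm hi)

theorem comp_incl {n : ℕ} (P : Proj k n) : comp n (incl P) = P :=
  ObjectProperty.FullSubcategory.ext (single_self P.obj)

end Projective

end Deligne

end

section

open CategoryTheory MonoidalCategory

namespace Deligne

section K0

variable {C : Type u} [Category.{v} C] [Preadditive C]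

/-- `Z` is a direct sum of `X` and `Y`. -/
def IsDirectSum (Z X Y : C) : Prop :=
  ∃ (a : X ⟶ Z) (b : Y ⟶ Z) (p : Z ⟶ X) (q : Z ⟶ Y), a ≫ p = 𝟙 X ∧ a ≫ q = 0 ∧ b ≫ p = 0 ∧
    b ≫ q = 𝟙 Y ∧ p ≫ a + q ≫ b = 𝟙 Z

theorem IsDirectSum.map {D : Type u} [Category.{w} D] [Preadditive D] (F : C ⥤ D) [F.Additive]
    {Z X Y : C} (h : IsDirectSum Z X Y) : IsDirectSum (F.obj Z) (F.obj X) (F.obj Y) := by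
  obtain ⟨a, b, p, q, h1, h2, h3, h4, h5⟩ := h
  refine ⟨F.map a, F.map b, F.map p, F.map q, ?_, ?_, ?_, ?_, ?_⟩
  · rw [← F.map_comp, h1, F.map_id]
  · rw [← F.map_comp, h2, F.map_zero]
  · rw [← F.map_comp, h3, F.map_zero]
  · rw [← F.map_comp, h4, F.map_id]
  · rw [← F.map_comp, ← F.map_comp, ← F.map_add, h5, F.map_id]

theorem IsDirectSum.of_iso_zero {X Y O : C} (e : X ≅ Y) (h : Limits.IsZero O) :
    IsDirectSum Y X O :=
  ⟨e.hom, 0, e.inv, 0, e.hom_inv_id, by simp, by simp, h.eq_of_src _ _, by simp⟩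

variable (C) in
/-- The (split) Grothendieck group of an additive category: it is generated by the classes of
objects, and the class of a direct sum is the sum of the classes of the summands. -/
def K0 : Type u :=
  FreeAbelianGroup C ⧸ AddSubgroup.closure
    {x | ∃ Z X Y : C, IsDirectSum Z X Y ∧ x = .of Z - (.of X + .of Y)}

instance : AddCommGroup (K0 C) := QuotientAddGroup.Quotient.addCommGroup _

namespace K0

/-- The class of an object. -/
def cls (X : C) : K0 C := QuotientAddGroup.mk (FreeAbelianGroup.of X)

theorem cls_sum {Z X Y : C} (h : IsDirectSum Z X Y) : cls Z = cls X + cls Y := by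
  rw [← sub_eq_zero]
  exact (QuotientAddGroup.eq_zero_iff _).2 (AddSubgroup.subset_closure ⟨Z, X, Y, h, rfl⟩)

/-- The universal property of the Grothendieck group. -/
def lift {A : Type w} [AddCommGroup A] (f : C → A)
    (h : ∀ Z X Y : C, IsDirectSum Z X Y → f Z = f X + f Y) : K0 C →+ A :=
  QuotientAddGroup.lift _ (FreeAbelianGroup.lift f) (by
    rw [AddSubgroup.closure_le]
    rintro _ ⟨Z, X, Y, hZ, rfl⟩
    change FreeAbelianGroup.lift f _ = 0
    rw [map_sub, map_add, FreeAbelianGroup.lift_apply_of, FreeAbelianGroup.lift_apply_of,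
      FreeAbelianGroup.lift_apply_of, h _ _ _ hZ, sub_self])

theorem lift_cls {A : Type w} [AddCommGroup A] (f : C → A)
    (h : ∀ Z X Y : C, IsDirectSum Z X Y → f Z = f X + f Y) (X : C) : lift f h (cls X) = f X :=
  FreeAbelianGroup.lift_apply_of _ _

theorem hom_ext {A : Type w} [AddCommGroup A] {f g : K0 C →+ A}
    (h : ∀ X, f (cls X) = g (cls X)) : f = g :=
  QuotientAddGroup.addMonoidHom_ext _ (FreeAbelianGroup.lift_ext _ _ h)

theorem induction {P : K0 C → Prop} (h0 : P 0) (hc : ∀ X, P (cls X)) (hn : ∀ x, P x → P (-x))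
    (ha : ∀ x y, P x → P y → P (x + y)) (x : K0 C) : P x := by
  obtain ⟨x, rfl⟩ := QuotientAddGroup.mk_surjective x
  induction x using FreeAbelianGroup.induction_on with
  | zero => exact h0
  | of X => exact hc X
  | neg X h => exact hn _ h
  | add x y hx hy => exact ha _ _ hx hy

theorem cls_zero {O : C} (h : Limits.IsZero O) : cls O = 0 := by
  have := cls_sum (IsDirectSum.of_iso_zero (Iso.refl O) h)
  rwa [left_eq_add] at this

theorem cls_iso [Limits.HasZeroObject C] {X Y : C} (e : X ≅ Y) : cls X = cls Y := by
  have h := Limits.isZero_zero C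
  rw [cls_sum (IsDirectSum.of_iso_zero e h), cls_zero h, add_zero]

section Ring

variable [MonoidalCategory C] [MonoidalPreadditive C]

/-- The product of two classes is the class of the tensor product. -/
def mulHom : K0 C →+ K0 C →+ K0 C :=
  lift (fun X => lift (fun Y => cls (X ⊗ Y)) fun _ _ _ h => cls_sum (h.map (tensorLeft X)))
    fun _ _ _ h =>
    hom_ext fun Y => by
      rw [AddMonoidHom.add_apply, lift_cls, lift_cls, lift_cls]
      exact cls_sum (h.map (tensorRight Y))

theorem mulHom_cls (X Y : C) : mulHom (cls X) (cls Y) = cls (X ⊗ Y) := by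
  exact (DFunLike.congr_fun (lift_cls _ _ X) (cls Y)).trans (lift_cls _ _ Y)

variable [Limits.HasZeroObject C]

theorem mul_one' (x : K0 C) : mulHom x (cls (𝟙_ C)) = x :=
  DFunLike.congr_fun (hom_ext (f := mulHom.flip (cls (𝟙_ C))) (g := AddMonoidHom.id _) fun X =>
    (mulHom_cls _ _).trans (cls_iso (ρ_ X))) x

theorem one_mul' (x : K0 C) : mulHom (cls (𝟙_ C)) x = x :=
  DFunLike.congr_fun (hom_ext (f := mulHom (cls (𝟙_ C))) (g := AddMonoidHom.id _) fun X =>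
    (mulHom_cls _ _).trans (cls_iso (λ_ X))) x

theorem mul_assoc' (x y z : K0 C) : mulHom (mulHom x y) z = mulHom x (mulHom y z) := by
  refine induction (P := fun x => mulHom (mulHom x y) z = mulHom x (mulHom y z)) ?_ ?_ ?_ ?_ x
  · simp
  · intro X
    refine induction (P := fun y => mulHom (mulHom (cls X) y) z = mulHom (cls X) (mulHom y z))
      ?_ ?_ ?_ ?_ y
    · simp
    · intro Y
      refine induction (P := fun z => mulHom (mulHom (cls X) (cls Y)) z =
        mulHom (cls X) (mulHom (cls Y) z)) ?_ ?_ ?_ ?_ z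
      · simp
      · intro Z
        rw [mulHom_cls, mulHom_cls, mulHom_cls, mulHom_cls, cls_iso (α_ X Y Z)]
      · intro z h
        simp [h]
      · intro z z' h h'
        simp [h, h']
    · intro y h
      simp [h]
    · intro y y' h h'
      simp [h, h']
  · intro x h
    simp [h]
  · intro x x' h h'
    simp [h, h']

theorem mul_comm' [BraidedCategory C] (x y : K0 C) : mulHom x y = mulHom y x :=
  DFunLike.congr_fun (DFunLike.congr_fun (hom_ext (f := mulHom) (g := mulHom.flip) fun X =>
    hom_ext fun Y => (mulHom_cls _ _).trans
      ((cls_iso (β_ X Y)).trans (mulHom_cls _ _).symm)) x) y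

instance [BraidedCategory C] : CommRing (K0 C) where
  __ := (inferInstance : AddCommGroup (K0 C))
  mul x y := mulHom x y
  one := cls (𝟙_ C)
  mul_one := mul_one'
  one_mul := one_mul'
  mul_assoc := mul_assoc'
  mul_comm := mul_comm'
  left_distrib x y z := map_add (mulHom x) y z
  right_distrib x y z := by
    change mulHom (x + y) z = mulHom x z + mulHom y z
    rw [map_add, AddMonoidHom.add_apply]
  zero_mul x := by
    change mulHom 0 x = 0
    rw [map_zero, AddMonoidHom.zero_apply]
  mul_zero x := map_zero (mulHom x)

theorem cls_mul [BraidedCategory C] (X Y : C) : cls X * cls Y = cls (X ⊗ Y) := mulHom_cls X Y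

theorem one_eq [BraidedCategory C] : (1 : K0 C) = cls (𝟙_ C) := rfl

end Ring

end K0

end K0

end Deligne

end

section

open CategoryTheory MonoidalCategory

namespace Deligne

/-- An increasing multiplicative filtration of a commutative ring by additive subgroups. -/
structure RingFiltration (R : Type u) [CommRing R] where
  /-- The subgroup in filtration degree `n`. -/
  sub : ℕ → AddSubgroup R
  mono : ∀ {n : ℕ} {x : R}, x ∈ sub n → x ∈ sub (n + 1)
  one : 1 ∈ sub 0
  mul : ∀ {m n : ℕ} {x y : R}, x ∈ sub m → y ∈ sub n → x * y ∈ sub (m + n)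

namespace RingFiltration

variable {R : Type u} [CommRing R] (F : RingFiltration R)

/-- The preceding step of the filtration; step `-1` is zero. -/
def low : ℕ → AddSubgroup R
  | 0 => ⊥
  | n + 1 => F.sub n

/-- The component of degree `n` of the associated graded ring: step `n` of the filtration
modulo step `n - 1`. -/
def gr (n : ℕ) : Type u := F.sub n ⧸ (F.low n).addSubgroupOf (F.sub n)

instance (n : ℕ) : AddCommGroup (F.gr n) := QuotientAddGroup.Quotient.addCommGroup _

variable {F}

/-- The class of an element of step `n`, in degree `n` of the associated graded ring. -/
def toGr (n : ℕ) (x : R) (h : x ∈ F.sub n) : F.gr n := QuotientAddGroup.mk (⟨x, h⟩ : F.sub n)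

theorem toGr_surj {n : ℕ} (a : F.gr n) : ∃ (x : R) (h : x ∈ F.sub n), a = toGr n x h := by
  obtain ⟨⟨x, h⟩, rfl⟩ := QuotientAddGroup.mk_surjective a
  exact ⟨x, h, rfl⟩

theorem toGr_add {n : ℕ} {x y : R} (hx : x ∈ F.sub n) (hy : y ∈ F.sub n) :
    toGr n x hx + toGr n y hy = toGr n (x + y) (add_mem hx hy) := rfl

theorem toGr_zero (n : ℕ) : toGr n (0 : R) (zero_mem (F.sub n)) = 0 := rfl

theorem toGr_congr {n : ℕ} {x y : R} (hx : x ∈ F.sub n) (h : x = y) :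
    toGr n x hx = toGr n y (h ▸ hx) := by
  subst h; rfl

theorem low_mul_left : ∀ {m n : ℕ} {x y : R}, x ∈ F.low m → y ∈ F.sub n → x * y ∈ F.low (m + n)
  | 0, n, x, y, hx, _ => by
    have : x = 0 := hx
    rw [this, zero_mul]
    exact zero_mem _
  | m + 1, n, x, y, hx, hy => by
    rw [show m + 1 + n = m + n + 1 by omega]
    exact F.mul hx hy

theorem low_mul_right {m n : ℕ} {x y : R} (hx : x ∈ F.sub m) (hy : y ∈ F.low n) :
    x * y ∈ F.low (m + n) := by
  rw [mul_comm, add_comm]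
  exact low_mul_left hy hx

/-- Multiplication of the associated graded ring. -/
def mulHom (m n : ℕ) : F.gr m →+ F.gr n →+ F.gr (m + n) :=
  QuotientAddGroup.lift _
    (AddMonoidHom.mk' (fun x : F.sub m => QuotientAddGroup.lift _
      (AddMonoidHom.mk' (fun y : F.sub n => toGr (m + n) (x.1 * y.1) (F.mul x.2 y.2))
        fun y y' => by
          rw [toGr_add]
          exact toGr_congr _ (mul_add _ _ _))
      fun y hy => (QuotientAddGroup.eq_zero_iff _).2 (low_mul_right x.2 hy))
      fun x x' => QuotientAddGroup.addMonoidHom_ext _ (AddMonoidHom.ext fun y =>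
        toGr_congr _ (add_mul _ _ _)))
    fun x hx => QuotientAddGroup.addMonoidHom_ext _ (AddMonoidHom.ext fun y =>
      (QuotientAddGroup.eq_zero_iff _).2 (low_mul_left hx y.2))

theorem mulHom_toGr {m n : ℕ} {x y : R} (hx : x ∈ F.sub m) (hy : y ∈ F.sub n) :
    mulHom m n (toGr m x hx) (toGr n y hy) = toGr (m + n) (x * y) (F.mul hx hy) := rfl

theorem sigma_ext {m n : ℕ} {x y : R} (hx : x ∈ F.sub m) (hy : y ∈ F.sub n) (h : m = n)
    (e : x = y) : (⟨m, toGr m x hx⟩ : GradedMonoid F.gr) = ⟨n, toGr n y hy⟩ := by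
  subst h; subst e; rfl

instance : GradedMonoid.GMul F.gr := ⟨fun x y => mulHom _ _ x y⟩

instance : GradedMonoid.GOne F.gr := ⟨toGr 0 1 F.one⟩

instance : GradedMonoid.GMonoid F.gr where
  one_mul := by
    rintro ⟨n, x⟩
    obtain ⟨x, hx, rfl⟩ := toGr_surj x
    exact sigma_ext (F.mul F.one hx) hx (zero_add n) (one_mul x)
  mul_one := by
    rintro ⟨n, x⟩
    obtain ⟨x, hx, rfl⟩ := toGr_surj x
    exact sigma_ext (F.mul hx F.one) hx (add_zero n) (mul_one x)
  mul_assoc := by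
    rintro ⟨l, x⟩ ⟨m, y⟩ ⟨n, z⟩
    obtain ⟨x, hx, rfl⟩ := toGr_surj x
    obtain ⟨y, hy, rfl⟩ := toGr_surj y
    obtain ⟨z, hz, rfl⟩ := toGr_surj z
    exact sigma_ext (F.mul (F.mul hx hy) hz) (F.mul hx (F.mul hy hz)) (add_assoc l m n)
      (mul_assoc x y z)

instance : DirectSum.GCommRing F.gr where
  __ := (inferInstance : GradedMonoid.GMonoid F.gr)
  mul_zero x := map_zero (mulHom _ _ x)
  zero_mul y := by
    change mulHom _ _ 0 y = 0
    rw [map_zero, AddMonoidHom.zero_apply]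
  mul_add x y z := map_add (mulHom _ _ x) y z
  add_mul x y z := by
    change mulHom _ _ (x + y) z = _
    rw [map_add, AddMonoidHom.add_apply]
    rfl
  mul_comm := by
    rintro ⟨m, x⟩ ⟨n, y⟩
    obtain ⟨x, hx, rfl⟩ := toGr_surj x
    obtain ⟨y, hy, rfl⟩ := toGr_surj y
    exact sigma_ext (F.mul hx hy) (F.mul hy hx) (add_comm m n) (mul_comm x y)
  natCast c := c • toGr 0 1 F.one
  natCast_zero := zero_smul _ _
  natCast_succ c := succ_nsmul _ _
  intCast c := c • toGr 0 1 F.one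
  intCast_ofNat c := natCast_zsmul _ _
  intCast_negSucc_ofNat c := negSucc_zsmul _ _

end RingFiltration

namespace TensorFiltration

variable {C : Type u} [Category.{v} C] [Preadditive C] [Limits.HasFiniteBiproducts C]
  [MonoidalCategory C] [MonoidalPreadditive C] [SymmetricCategory C] (D : TensorFiltration C)

/-- The filtration of the Grothendieck ring: step `n` is the image of the Grothendieck group
of step `n` of the category, that is, the subgroup generated by the classes of its objects. -/
def k0Filtration : RingFiltration (K0 C) where
  sub n := AddSubgroup.closure {x | ∃ X : C, D.sub n X ∧ x = K0.cls X}
  mono {n x} h := by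
    refine AddSubgroup.closure_mono ?_ h
    rintro _ ⟨X, hX, rfl⟩
    exact ⟨X, D.mono (Nat.le_succ n) hX, rfl⟩
  one := AddSubgroup.subset_closure ⟨𝟙_ C, D.unit, rfl⟩
  mul {m n x y} hx hy := by
    induction hx using AddSubgroup.closure_induction with
    | mem x hx =>
      obtain ⟨X, hX, rfl⟩ := hx
      induction hy using AddSubgroup.closure_induction with
      | mem y hy =>
        obtain ⟨Y, hY, rfl⟩ := hy
        rw [K0.cls_mul]
        exact AddSubgroup.subset_closure ⟨_, D.tensor hX hY, rfl⟩
      | zero =>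
        rw [mul_zero]
        exact zero_mem _
      | add y y' _ _ h h' =>
        rw [mul_add]
        exact add_mem h h'
      | neg y _ h =>
        rw [mul_neg]
        exact neg_mem h
    | zero =>
      rw [zero_mul]
      exact zero_mem _
    | add x x' _ _ h h' =>
      rw [add_mul]
      exact add_mem h h'
    | neg x _ h =>
      rw [neg_mul]
      exact neg_mem h

/-- The class of an object of step `n` in degree `n` of the associated graded ring. -/
def grCls (n : ℕ) (X : C) (h : D.sub n X) : D.k0Filtration.gr n :=
  RingFiltration.toGr n (K0.cls X) (AddSubgroup.subset_closure ⟨X, h, rfl⟩)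

end TensorFiltration

section Sym

variable {k : Type u} [Field k]

instance : Limits.HasZeroObject (SumProj k) := by
  refine ⟨⟨⟨fun _ => ModuleCat.of _ PUnit, fun n => ⟨inferInstance, inferInstance⟩, 0,
    fun n _ => inferInstanceAs (Subsingleton PUnit)⟩, ?_⟩⟩
  rw [Limits.IsZero.iff_id_eq_zero]
  apply ObjectProperty.hom_ext
  exact GMod.ap_ext fun n x => rfl

theorem isDirectSum_of_subsingleton {n : ℕ} (X Y Z : ModuleCat.{u} (GrpAlg k n))
    (hX : Subsingleton X) (hY : Subsingleton Y) (hZ : Subsingleton Z) : IsDirectSum Z X Y :=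
  ⟨0, 0, 0, 0, ModuleCat.hom_ext (LinearMap.ext fun _ => Subsingleton.elim _ _),
    ModuleCat.hom_ext (LinearMap.ext fun _ => Subsingleton.elim _ _),
    ModuleCat.hom_ext (LinearMap.ext fun _ => Subsingleton.elim _ _),
    ModuleCat.hom_ext (LinearMap.ext fun _ => Subsingleton.elim _ _),
    ModuleCat.hom_ext (LinearMap.ext fun _ => Subsingleton.elim _ _)⟩

theorem isDirectSum_comp {X Y Z : SumProj k} (h : IsDirectSum Z X Y) (n : ℕ) :
    IsDirectSum (comp n Z) (comp n X) (comp n Y) := by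
  obtain ⟨a, b, p, q, h1, h2, h3, h4, h5⟩ := h
  exact ⟨⟨a.hom n⟩, ⟨b.hom n⟩, ⟨p.hom n⟩, ⟨q.hom n⟩,
    ObjectProperty.hom_ext _ (congrFun (congrArg InducedCategory.Hom.hom h1) n),
    ObjectProperty.hom_ext _ (congrFun (congrArg InducedCategory.Hom.hom h2) n),
    ObjectProperty.hom_ext _ (congrFun (congrArg InducedCategory.Hom.hom h3) n),
    ObjectProperty.hom_ext _ (congrFun (congrArg InducedCategory.Hom.hom h4) n),
    ObjectProperty.hom_ext _ (congrFun (congrArg InducedCategory.Hom.hom h5) n)⟩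

theorem isDirectSum_of_comp {X Y Z : SumProj k}
    (h : ∀ n, IsDirectSum (Z.obj n) (X.obj n) (Y.obj n)) : IsDirectSum Z X Y := by
  choose a b p q h1 h2 h3 h4 h5 using h
  exact ⟨⟨a⟩, ⟨b⟩, ⟨p⟩, ⟨q⟩, ObjectProperty.hom_ext _ (funext h1),
    ObjectProperty.hom_ext _ (funext h2), ObjectProperty.hom_ext _ (funext h3),
    ObjectProperty.hom_ext _ (funext h4), ObjectProperty.hom_ext _ (funext h5)⟩

theorem isDirectSum_incl {n : ℕ} {P Q R : Proj k n} (h : IsDirectSum R P Q) :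
    IsDirectSum (incl R) (incl P) (incl Q) := by
  refine isDirectSum_of_comp fun i => ?_
  change IsDirectSum (single R.obj i) (single P.obj i) (single Q.obj i)
  by_cases hi : n = i
  · subst hi
    rw [single_self, single_self, single_self]
    obtain ⟨a, b, p, q, h1, h2, h3, h4, h5⟩ := h
    exact ⟨a.hom, b.hom, p.hom, q.hom, congrArg InducedCategory.Hom.hom h1,
      congrArg InducedCategory.Hom.hom h2, congrArg InducedCategory.Hom.hom h3,
      congrArg InducedCategory.Hom.hom h4, congrArg InducedCategory.Hom.hom h5⟩
  · exact isDirectSum_of_subsingleton _ _ _ (single_ne _ hi) (single_ne _ hi) (single_ne _ hi)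

theorem cls_incl_comp {n : ℕ} {X : SumProj k} (h : sumDegree k n X) :
    K0.cls (incl (comp n X)) = K0.cls X := by
  have key : ∀ i, Nonempty (single (X.obj n) i ≅ X.obj i) := by
    intro i
    by_cases hi : n = i
    · subst hi
      exact ⟨eqToIso (single_self _)⟩
    · have := single_ne (X.obj n) hi
      have := h i (Ne.symm hi)
      exact ⟨⟨0, 0, ModuleCat.hom_ext (LinearMap.ext fun _ => Subsingleton.elim _ _),
        ModuleCat.hom_ext (LinearMap.ext fun _ => Subsingleton.elim _ _)⟩⟩
  have e := fun i => (key i).some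
  exact K0.cls_iso ⟨⟨fun i => (e i).hom⟩, ⟨fun i => (e i).inv⟩,
    ObjectProperty.hom_ext _ (funext fun i => (e i).hom_inv_id),
    ObjectProperty.hom_ext _ (funext fun i => (e i).inv_hom_id)⟩

theorem sumDegree_tensor {m n : ℕ} {X Y : SumProj k} (hX : sumDegree k m X)
    (hY : sumDegree k n Y) : sumDegree k (m + n) (X ⊗ Y) := fun N hN =>
  GMod.subsingleton_tens fun i j hij => by
    by_cases hi : i = m
    · exact Or.inr (hY j (by omega))
    · exact Or.inl (hX i hi)

theorem sumDegree_unit : sumDegree k 0 (𝟙_ (SumProj k)) := fun _ hi =>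
  subsingleton_of_forall_eq 0 fun x => GMod.unt_zero (k := k) hi x

variable (k) in
/-- The Grothendieck group of the `n`-th summand. -/
abbrev SymK (n : ℕ) : Type (u + 1) := K0 (Proj k n)

/-- The map of Grothendieck groups given by the embedding of the `n`-th summand. -/
def inclK (n : ℕ) : SymK k n →+ K0 (SumProj k) :=
  K0.lift (fun P => K0.cls (incl P)) fun _ _ _ h => K0.cls_sum (isDirectSum_incl h)

/-- The map of Grothendieck groups given by the component of degree `n`. -/
def compK (n : ℕ) : K0 (SumProj k) →+ SymK k n :=
  K0.lift (fun X => K0.cls (comp n X)) fun _ _ _ h => K0.cls_sum (isDirectSum_comp h n)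

theorem inclK_cls {n : ℕ} (P : Proj k n) : inclK n (K0.cls P) = K0.cls (incl P) :=
  K0.lift_cls _ _ P

theorem compK_cls {n : ℕ} (X : SumProj k) : compK n (K0.cls X) = K0.cls (comp n X) :=
  K0.lift_cls _ _ X

theorem compK_inclK {n : ℕ} (x : SymK k n) : compK n (inclK n x) = x :=
  DFunLike.congr_fun (K0.hom_ext (f := (compK n).comp (inclK n)) (g := AddMonoidHom.id _) fun P => by
    change compK n (inclK n (K0.cls P)) = K0.cls P
    rw [inclK_cls, compK_cls, comp_incl]) x

/-- The induction product on Grothendieck groups: the class of `P` in degree `m` times the class of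
`Q` in degree `n` is the class of the component of degree `m + n` of `P ⊗ Q`. -/
def symMul (m n : ℕ) (x : SymK k m) (y : SymK k n) : SymK k (m + n) :=
  compK (m + n) (inclK m x * inclK n y)

theorem inclK_symMul {m n : ℕ} (x : SymK k m) (y : SymK k n) :
    inclK (m + n) (symMul m n x y) = inclK m x * inclK n y := by
  refine K0.induction (P := fun x => inclK (m + n) (symMul m n x y) = inclK m x * inclK n y)
    ?_ ?_ ?_ ?_ x
  · rw [symMul, map_zero, zero_mul, map_zero, map_zero]
  · intro P
    refine K0.induction (P := fun y => inclK (m + n) (symMul m n (K0.cls P) y) =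
      inclK m (K0.cls P) * inclK n y) ?_ ?_ ?_ ?_ y
    · rw [symMul, map_zero, mul_zero, map_zero, map_zero]
    · intro Q
      rw [symMul, inclK_cls, inclK_cls, K0.cls_mul, compK_cls, inclK_cls,
        cls_incl_comp (sumDegree_tensor (sumDegree_incl P) (sumDegree_incl Q))]
    · intro y h
      rw [symMul, map_neg, mul_neg, map_neg, map_neg]
      exact congrArg Neg.neg h
    · intro y y' h h'
      rw [symMul, map_add, mul_add, map_add, map_add]
      exact congrArg₂ (· + ·) h h'
  · intro x h
    rw [symMul, map_neg, neg_mul, map_neg, map_neg]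
    exact congrArg Neg.neg h
  · intro x x' h h'
    rw [symMul, map_add, add_mul, map_add, map_add]
    exact congrArg₂ (· + ·) h h'

variable (k) in
/-- The class of the unit in degree `0`. -/
def symOne : SymK k 0 := K0.cls (comp 0 (𝟙_ (SumProj k)))

theorem inclK_symOne : inclK 0 (symOne k) = 1 := by
  rw [symOne, inclK_cls, cls_incl_comp sumDegree_unit, K0.one_eq]

theorem symK_ext {m n : ℕ} {x : SymK k m} {y : SymK k n} (h : m = n) (e : inclK m x = inclK n y) :
    (⟨m, x⟩ : GradedMonoid (SymK k)) = ⟨n, y⟩ := by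
  subst h
  rw [← compK_inclK x, e, compK_inclK]

instance : GradedMonoid.GMul (SymK k) := ⟨fun x y => symMul _ _ x y⟩

instance : GradedMonoid.GOne (SymK k) := ⟨symOne k⟩

instance : GradedMonoid.GMonoid (SymK k) where
  one_mul := by
    rintro ⟨n, x⟩
    exact symK_ext (zero_add n) ((inclK_symMul (symOne k) x).trans
      ((congrArg (· * inclK n x) inclK_symOne).trans (one_mul _)))
  mul_one := by
    rintro ⟨n, x⟩
    exact symK_ext (add_zero n) ((inclK_symMul x (symOne k)).trans
      ((congrArg (inclK n x * ·) inclK_symOne).trans (mul_one _)))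
  mul_assoc := by
    rintro ⟨l, x⟩ ⟨m, y⟩ ⟨n, z⟩
    refine symK_ext (add_assoc l m n) ((inclK_symMul (symMul l m x y) z).trans
      (Eq.trans ?_ (inclK_symMul x (symMul m n y z)).symm))
    rw [inclK_symMul, inclK_symMul, mul_assoc]

instance : DirectSum.GCommRing (SymK k) where
  __ := (inferInstance : GradedMonoid.GMonoid (SymK k))
  mul_zero x := by
    change symMul _ _ _ _ = _
    rw [symMul, map_zero, mul_zero, map_zero]
  zero_mul y := by
    change symMul _ _ _ _ = _
    rw [symMul, map_zero, zero_mul, map_zero]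
  mul_add x y z := by
    change symMul _ _ _ _ = symMul _ _ _ _ + symMul _ _ _ _
    rw [symMul, map_add, mul_add, map_add]
    rfl
  add_mul x y z := by
    change symMul _ _ _ _ = symMul _ _ _ _ + symMul _ _ _ _
    rw [symMul, map_add, add_mul, map_add]
    rfl
  mul_comm := by
    rintro ⟨m, x⟩ ⟨n, y⟩
    refine symK_ext (add_comm m n) ((inclK_symMul x y).trans
      (Eq.trans (mul_comm _ _) (inclK_symMul y x).symm))
  natCast c := c • symOne k
  natCast_zero := zero_smul _ _
  natCast_succ c := succ_nsmul _ _
  intCast c := c • symOne k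
  intCast_ofNat c := natCast_zsmul _ _
  intCast_negSucc_ofNat c := negSucc_zsmul _ _

end Sym

/-- The graded ring `gr K₀`: the associated graded ring of the filtered Grothendieck ring. -/
abbrev TensorFiltration.GrK0 {C : Type u} [Category.{v} C] [Preadditive C]
    [Limits.HasFiniteBiproducts C] [MonoidalCategory C] [MonoidalPreadditive C]
    [SymmetricCategory C] (D : TensorFiltration C) : Type u :=
  DirectSum ℕ D.k0Filtration.gr

/-- The graded ring given by the direct sum of the Grothendieck groups of the categories of finitely
generated projective right modules over the group algebras of `S_n`, with the induction product. -/
abbrev SymRing (k : Type u) [Field k] : Type (u + 1) := DirectSum ℕ (SymK k)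

/-- A ring isomorphism of direct sums that respects the degrees. -/
def IsGraded {A : ℕ → Type v} {B : ℕ → Type w} [∀ n, AddCommGroup (A n)]
    [∀ n, AddCommGroup (B n)] [DirectSum.GCommRing A] [DirectSum.GCommRing B]
    (φ : DirectSum ℕ A ≃+* DirectSum ℕ B) : Prop :=
  ∀ (n : ℕ) (x : A n), ∃ y : B n, φ (DirectSum.of A n x) = DirectSum.of B n y

end Deligne

end

end

open CategoryTheory Deligne

noncomputable section

/-! Call a partition of {1, …, n} ⊔ {1', …, m'} full if its n source points lie in n different
blocks, each of which meets the target. A composite through [i] with i < n contains no full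
partition, because different source points would have to pass through different points of the middle
layer (`Full.card_le`). Conversely, a partition that is not full factors through [i], where i < n is
the number of blocks that meet both sides, and it does so without closed components, hence without
any power of T (`exists_factor_of_not_full`). So modulo the morphisms that factor through step n -
1, the full partitions form a basis of Hom([n], [m]).

The group S_n permutes the full partitions freely. Therefore `Phi n X`, the space Hom([n], X) modulo
lower morphisms, is a finitely generated projective right k[S_n]-module for every object X
(`projProp_phi`). For m = n the full partitions are the permutations, so End([n]) is the direct sum
of k[S_n] and the lower morphisms, and `Phi n` of [n] is the regular module. An object of step n is,
modulo lower morphisms, a direct summand of copies of [n]; this makes `Phi n` fully faithful on the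
n-th quotient category. It is essentially surjective because k[S_n] is an honest subalgebra of
End([n]), so that idempotent matrices over it split in Rep(S_T).

For the tensor product, a bijection θ of {1, …, N} with {1, …, m} ⊔ {1, …, n} gives an isomorphism
[N] ≅ [m] ⊗ [n], and p ⊗ q ⊗ θ is sent to the class of θ followed by f ⊗ g, where f and g represent
p and q. This map `mu` is compatible with associativity, unit and symmetry because all structure
isomorphisms come from bijections. It is invertible for the family ([n]), where both sides are
understood explicitly, and then in general by naturality and the presentation of objects by copies
of [n] (`isIso_mu`).

For the Grothendieck rings, `Phi n` kills the classes of objects of step n - 1, which gives a map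
from the n-th graded piece to K₀ of the projective modules. The inverse is well defined because
objects X and Y of step n with isomorphic `Phi n` satisfy X ⊕ W ≅ Y ⊕ Z with W and Z of step n - 1
(`grCls_eq`). Multiplicativity is the monoidality of the functor.

For the dependence on k alone through its characteristic, let F be the prime field. The algebras
F[S_n] are split: the division algebras of their simple quotients are F itself. Over a finite field
this follows from Wedderburn's theorem and the fact that traces of group elements are fixed by
Frobenius (`isSplitAlg_zmod`). Over ℚ, traces are rational by an induction on the order of elements,
and the division algebras are commutative by induction on n: each permutation is conjugate to its
inverse under S_{n-1}, so the centraliser of ℚ[S_{n-1}] in ℚ[S_n] is commutative, and a corner cut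
out by a primitive idempotent of ℚ[S_{n-1}] is an image of this centraliser (`isSplitAlg_rat`).
Consequently primitive idempotents over F remain primitive over k, K₀ over k is free on their
classes, and extension of scalars is an isomorphism that respects induction
(`exists_extScal_ringEquiv`). -/

namespace Deligne

/-! ### Full partitions and factorisation through fewer points -/

section FullPartitions

variable {A B C : Type}

/-- Every point of `A` lies in a block that contains no other point of `A` and meets `B`. -/
def Full (p : Setoid (A ⊕ B)) : Prop :=
  (∀ a, ∃ b, p (Sum.inl a) (Sum.inr b)) ∧ ∀ a a', p (Sum.inl a) (Sum.inl a') → a = a'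

theorem glue_left {p : Setoid (A ⊕ B)} (q : Setoid (B ⊕ C)) {x y : A ⊕ B} (h : p x y) :
    glue p q (Sum.map id Sum.inl x) (Sum.map id Sum.inl y) :=
  (le_sup_left : _ ≤ glue p q) (Relation.EqvGen.rel _ _ ⟨x, y, h, rfl, rfl⟩)

theorem glue_right (p : Setoid (A ⊕ B)) {q : Setoid (B ⊕ C)} {x y : B ⊕ C} (h : q x y) :
    glue p q (Sum.inr x) (Sum.inr y) :=
  (le_sup_right : _ ≤ glue p q) (Relation.EqvGen.rel _ _ ⟨x, y, h, rfl, rfl⟩)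

theorem glue_le_ker {D : Type} {p : Setoid (A ⊕ B)} {q : Setoid (B ⊕ C)} {w : A ⊕ (B ⊕ C) → D}
    (hp : p ≤ Setoid.ker (w ∘ Sum.map id Sum.inl)) (hq : q ≤ Setoid.ker (w ∘ Sum.inr)) :
    glue p q ≤ Setoid.ker w :=
  sup_le ((map_le_ker _ _ _).2 hp) ((map_le_ker _ _ _).2 hq)

/-- If the block of `a` missed `B`, it would be a whole component of the stacked diagram and could
not reach `C`. -/
theorem exists_middle {p : Setoid (A ⊕ B)} {q : Setoid (B ⊕ C)} {a : A} {c : C}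
    (h : glue p q (Sum.inl a) (Sum.inr (Sum.inr c))) : ∃ b, p (Sum.inl a) (Sum.inr b) := by
  by_contra hb
  push Not at hb
  -- The test function is the indicator of the points of `A` in the block of `a`, with values in
  -- `Prop`. It is constant on the blocks of `p` and of `q`, hence on components, but it separates
  -- `a` from `c`.
  have := glue_le_ker (p := p) (q := q)
    (w := fun x => Sum.elim (fun a' => p (Sum.inl a) (Sum.inl a')) (fun _ => False) x) ?_ ?_ h
  · exact (cast this (p.refl' _) : False)
  · rintro (x | x) (y | y) hxy
    · exact propext ⟨fun h => p.trans' h hxy, fun h => p.trans' h (p.symm' hxy)⟩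
    · exact propext ⟨fun h => hb y (p.trans' h hxy), False.elim⟩
    · exact propext ⟨False.elim, fun h => hb x (p.trans' h (p.symm' hxy))⟩
    · rfl
  · intro x y _
    rfl

/-- Every source point passes through some middle point. Two source points with a common middle
point would end in the same block, which fullness forbids. -/
theorem Full.card_le [Finite B] {p : Setoid (A ⊕ B)} {q : Setoid (B ⊕ C)}
    (h : Full (compPart p q)) : Nat.card A ≤ Nat.card B := by
  have key : ∀ a, ∃ b, p (Sum.inl a) (Sum.inr b) := fun a => by
    obtain ⟨c, hc⟩ := h.1 a
    exact exists_middle hc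
  choose b hb using key
  refine Nat.card_le_card_of_injective b fun a a' haa => h.2 a a' ?_
  exact glue_left q (x := Sum.inl a) (y := Sum.inl a')
    (p.trans' (hb a) (p.symm' (haa ▸ hb a')))

/-- A partition that is not full factors through fewer points. -/
theorem exists_factor_of_not_full [Finite A] {p : Setoid (A ⊕ B)} (h : ¬ Full p) :
    ∃ m < Nat.card A, ∃ (p' : Setoid (A ⊕ Fin m)) (q' : Setoid (Fin m ⊕ B)),
      compPart p' q' = p ∧ loops p' q' = 0 := by
  -- Only the blocks that meet both sides need a point in the middle layer.
  let M := {c : Quotient p // (∃ a, Quotient.mk p (Sum.inl a) = c) ∧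
    ∃ b, Quotient.mk p (Sum.inr b) = c}
  have hM : ∀ c : M, ∃ a, Quotient.mk p (Sum.inl a) = c.1 := fun c => c.2.1
  choose r hr using hM
  have hinj : Function.Injective r := fun c c' hc => Subtype.ext (by rw [← hr, hc, hr])
  have := Finite.of_injective r hinj
  -- If there were as many such blocks as source points, the choice `r` of a source point in each
  -- would be bijective, and `p` would be full.
  have hlt : Nat.card M < Nat.card A := by
    refine lt_of_le_of_ne (Nat.card_le_card_of_injective r hinj) fun hc => h ?_
    have hs := ((Nat.bijective_iff_injective_and_card r).2 ⟨hinj, hc⟩).2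
    constructor
    · intro a
      obtain ⟨c, rfl⟩ := hs a
      obtain ⟨b, hb⟩ := c.2.2
      exact ⟨b, Quotient.exact ((hr c).trans hb.symm)⟩
    · intro a a' haa
      obtain ⟨c, rfl⟩ := hs a
      obtain ⟨c', rfl⟩ := hs a'
      congr 1
      exact Subtype.ext (by rw [← hr, ← hr]; exact Quotient.sound haa)
  let e := Finite.equivFin M
  let v : Fin (Nat.card M) → Quotient p := fun i => (e.symm i).1
  -- All three layers are labelled by blocks of `p`, and `p'`, `q'` join points with equal labels.
  -- Components of the stacked diagram thus have constant label, so that gluing never merges two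
  -- blocks of `p`.
  let w : A ⊕ (Fin (Nat.card M) ⊕ B) → Quotient p :=
    Sum.elim (fun a => Quotient.mk p (Sum.inl a)) (Sum.elim v fun b => Quotient.mk p (Sum.inr b))
  let p' : Setoid (A ⊕ Fin (Nat.card M)) := Setoid.ker (w ∘ Sum.map id Sum.inl)
  let q' : Setoid (Fin (Nat.card M) ⊕ B) := Setoid.ker (w ∘ Sum.inr)
  have hw : ∀ x : A ⊕ B, w (Sum.map id Sum.inr x) = Quotient.mk p x := by
    rintro (x | x) <;> rfl
  have hle : glue p' q' ≤ Setoid.ker w := glue_le_ker le_rfl le_rfl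
  refine ⟨_, hlt, p', q', ?_, ?_⟩
  · ext x y
    constructor
    · intro hxy
      have := hle hxy
      rw [Setoid.ker_def, hw, hw] at this
      exact Quotient.exact this
    -- Points on the same side are already joined by `p'` or `q'`. A pair on opposite sides is
    -- joined through the middle point that belongs to its block.
    · have mixed : ∀ a b, p (Sum.inl a) (Sum.inr b) → glue p' q' (Sum.inl a) (Sum.inr (Sum.inr b)) := by
        intro a b hab
        let c : M := ⟨Quotient.mk p (Sum.inl a), ⟨a, rfl⟩, b, Quotient.sound (p.symm' hab)⟩
        have hc : v (e c) = Quotient.mk p (Sum.inl a) := by simp [v, c]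
        refine (glue p' q').trans' (glue_left q' (x := Sum.inl a) (y := Sum.inr (e c)) hc.symm)
          (glue_right p' (x := Sum.inl (e c)) (y := Sum.inr b) (hc.trans ?_))
        exact Quotient.sound hab
      intro hxy
      rcases x with a | b <;> rcases y with a' | b'
      · exact glue_left q' (x := Sum.inl a) (y := Sum.inl a') (Quotient.sound hxy)
      · exact mixed _ _ hxy
      · exact (glue p' q').symm' (mixed _ _ (p.symm' hxy))
      · exact glue_right p' (x := Sum.inr b) (y := Sum.inr b') (Quotient.sound hxy)
  -- Each middle point is joined to the representative in `A` of its block, so no component is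
  -- closed and no factor T appears.
  · rw [loops]
    have : IsEmpty {c : Quotient (glue p' q') //
        ∀ x : A ⊕ B, Quotient.mk _ (Sum.map id Sum.inr x) ≠ c} := by
      refine ⟨fun ⟨c, hc⟩ => ?_⟩
      induction c using Quotient.inductionOn with
      | h x =>
        rcases x with a | i | b
        · exact hc (Sum.inl a) rfl
        · refine hc (Sum.inl (r (e.symm i))) (Quotient.sound ?_)
          exact glue_left q' (x := Sum.inl _) (y := Sum.inr i) (hr (e.symm i))
        · exact hc (Sum.inr b) rfl
    exact Nat.card_of_isEmpty

theorem full_permPart (e : A ≃ B) : Full (permPart e) :=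
  ⟨fun a => ⟨e a, rfl⟩, fun _ _ h => e.injective h⟩

/-- Fullness gives an injection from `A` to `B`. Equal cardinalities make it bijective, which leaves
exactly one point of either side in every block. -/
theorem Full.exists_perm [Finite B] {p : Setoid (A ⊕ B)} (h : Full p)
    (hc : Nat.card A = Nat.card B) : ∃ e : A ≃ B, p = permPart e := by
  choose b hb using h.1
  have hinj : Function.Injective b := fun a a' haa =>
    h.2 a a' (p.trans' (hb a) (p.symm' (haa ▸ hb a')))
  let e := Equiv.ofBijective b ((Nat.bijective_iff_injective_and_card b).2 ⟨hinj, hc⟩)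
  have hx : ∀ x : A ⊕ B, p x (Sum.inr (Sum.elim e id x)) := by
    rintro (x | x)
    · exact hb x
    · exact p.refl' _
  refine ⟨e, Setoid.ext fun x y => ⟨fun hxy => ?_, fun hxy => ?_⟩⟩
  · have := p.trans' (p.symm' (hx x)) (p.trans' hxy (hx y))
    obtain ⟨a, ha⟩ := e.surjective (Sum.elim e id x)
    obtain ⟨a', ha'⟩ := e.surjective (Sum.elim e id y)
    rw [← ha, ← ha'] at this
    have := h.2 a a' (p.trans' (hb a) (p.trans' this (p.symm' (hb a'))))
    change Sum.elim e id x = Sum.elim e id y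
    rw [← ha, ← ha', this]
  · have hxy' : Sum.elim e id x = Sum.elim e id y := hxy
    exact p.trans' (hx x) (hxy' ▸ p.symm' (hx y))

theorem permPart_injective : Function.Injective (permPart : A ≃ B → Setoid (A ⊕ B)) := by
  intro e e' h
  ext a
  have : permPart e' (Sum.inl a) (Sum.inr (e a)) := h ▸ (rfl : permPart e (Sum.inl a) (Sum.inr (e a)))
  exact this.symm

/-- Precomposition with a bijection is relabelling of the source points. This turns the module
structure on morphisms into a permutation action on partitions. -/
theorem compPart_permPart {A' : Type} [Finite A] [Finite A'] [Finite B] (e : A' ≃ A)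
    (p : Setoid (A ⊕ B)) :
    compPart (permPart e) p = p.comap (Sum.map e id) ∧ loops (permPart e) p = 0 := by
  refine perm_comp e p _ fun f g => ?_
  have : p ≤ Setoid.ker (Sum.elim (f ∘ e.symm) g) ↔
      p.comap (Sum.map e id) ≤ Setoid.ker (Sum.elim f g) := by
    have h1 : ∀ x, Sum.elim (f ∘ e.symm) g (Sum.map e id x) = Sum.elim f g x := by
      rintro (x | x) <;> simp
    have h2 : ∀ x, Sum.map e id (Sum.map e.symm id x) = (x : A ⊕ B) := by
      rintro (x | x) <;> simp
    constructor
    · intro h x y hxy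
      have := h hxy
      rwa [Setoid.ker_def, h1, h1] at this
    · intro h x y hxy
      have := h (show p _ _ by rwa [h2, h2] : p.comap (Sum.map e id) (Sum.map e.symm id x)
        (Sum.map e.symm id y))
      rwa [Setoid.ker_def, ← h1, ← h1, h2, h2] at this
  simp only [mat]
  split_ifs <;> simp_all

theorem full_comap {A' : Type} (e : A' ≃ A) {p : Setoid (A ⊕ B)} (h : Full p) :
    Full (p.comap (Sum.map e id)) :=
  ⟨fun _ => h.1 _, fun _ _ haa => e.injective (h.2 _ _ haa)⟩

/-- This is the freeness of the action of permutations on full partitions: `σ a` and `a` are joined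
to the same target point `b`, hence lie in one block. -/
theorem Full.perm_eq_one {p : Setoid (A ⊕ B)} (h : Full p) {σ : Equiv.Perm A}
    (hσ : p.comap (Sum.map σ id) = p) : σ = 1 := by
  ext a
  obtain ⟨b, hb⟩ := h.1 a
  have : p (Sum.inl (σ a)) (Sum.inr b) := by
    rw [← hσ] at hb
    exact hb
  exact h.2 _ _ (p.trans' this (p.symm' hb))

end FullPartitions

namespace PMor

variable {k : Type u} [CommRing k] (T : k) {A B C : Type}

/-- By bilinearity the claim concerns two partitions, where it is `Full.card_le`. -/
theorem comp_apply_of_full [Finite B] (hc : Nat.card B < Nat.card A) (f : PMor k A B)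
    (g : PMor k B C) {p : Setoid (A ⊕ C)} (hp : Full p) : comp T f g p = 0 := by
  induction f using Finsupp.induction_linear with
  | zero => simp
  | add f f' hf hf' => simp [hf, hf']
  | single q a =>
  induction g using Finsupp.induction_linear with
  | zero => simp
  | add f f' hf hf' => simp [hf, hf']
  | single r b =>
  rw [comp_single]
  refine Finsupp.single_eq_of_ne fun h => ?_
  exact absurd (Full.card_le (h ▸ hp)) (by omega)

theorem perm_comp_single [Finite A] [Finite C] (σ : Equiv.Perm A) (p : Setoid (A ⊕ C)) (a : k) :
    comp T (perm σ) (Finsupp.single p a) = Finsupp.single (p.comap (Sum.map σ id)) a := by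
  rw [perm, comp_single, (compPart_permPart σ p).1, (compPart_permPart σ p).2]
  simp

end PMor

end Deligne

/-! ### Explicit coordinates for the objects [n] and their tensor products -/

namespace Deligne

open MonoidalCategory Idempotents Limits

namespace PartCat

variable {k : Type u} [CommRing k] {T : k}

/-- The morphism of the category of partitions given by a bijection. -/
def pm {m n : PartCat k T} (e : Fin m ≃ Fin n) : m ⟶ n := ⟨PMor.perm e⟩

theorem pm_comp {l m n : PartCat k T} (e : Fin l ≃ Fin m) (e' : Fin m ≃ Fin n) :
    pm (k := k) (T := T) e ≫ pm e' = pm (e.trans e') :=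
  InducedCategory.hom_ext (PMor.perm_perm T e e')

theorem pm_id (n : PartCat k T) : pm (Equiv.refl (Fin n)) = 𝟙 n := rfl

theorem pm_tensor {m n m' n' : PartCat k T} (e : Fin m ≃ Fin n) (e' : Fin m' ≃ Fin n') :
    pm (k := k) (T := T) e ⊗ₘ pm e' = pm (m := m ⊗ m') (n := n ⊗ n')
      (finSumFinEquiv.symm.trans ((Equiv.sumCongr e e').trans finSumFinEquiv)) := by
  apply InducedCategory.hom_ext
  change PMor.comp T (PMor.perm finSumFinEquiv.symm) (PMor.comp T (PMor.tensor (PMor.perm e)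
    (PMor.perm e')) (PMor.perm finSumFinEquiv)) = PMor.perm _
  rw [PMor.tensor_perm, PMor.perm_perm, PMor.perm_perm]

/-- The structure isomorphisms of the category of partitions all come from bijections. Coherence
statements about decompositions of [N] thereby become identities between bijections. -/
theorem assoc_eq (a b c : PartCat k T) : (α_ a b c).hom = pm (m := (a ⊗ b) ⊗ c) (n := a ⊗ b ⊗ c)
    (finSumFinEquiv.symm.trans ((Equiv.sumCongr finSumFinEquiv.symm (Equiv.refl _)).trans
      ((Equiv.sumAssoc (Fin a) (Fin b) (Fin c)).trans ((Equiv.sumCongr (Equiv.refl _)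
        finSumFinEquiv).trans finSumFinEquiv)))) := by
  apply InducedCategory.hom_ext
  change PMor.comp T (PMor.comp T (PMor.perm finSumFinEquiv.symm) (PMor.tensor
    (PMor.perm finSumFinEquiv.symm) (PMor.perm (Equiv.refl (Fin c)))))
    (PMor.comp T (PMor.perm (Equiv.sumAssoc (Fin a) (Fin b) (Fin c))) (PMor.comp T (PMor.tensor
    (PMor.perm (Equiv.refl (Fin a))) (PMor.perm finSumFinEquiv)) (PMor.perm finSumFinEquiv)))
    = PMor.perm _
  rw [PMor.tensor_perm, PMor.tensor_perm, PMor.perm_perm, PMor.perm_perm, PMor.perm_perm,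
    PMor.perm_perm]
  rfl

theorem left_eq (a : PartCat k T) : (λ_ a).hom = pm (m := 𝟙_ (PartCat k T) ⊗ a) (n := a)
    (finSumFinEquiv.symm.trans (Equiv.emptySum (Fin 0) (Fin a))) := by
  apply InducedCategory.hom_ext
  change PMor.comp T (PMor.comp T (PMor.perm finSumFinEquiv.symm) (PMor.tensor
    (PMor.perm (Equiv.equivOfIsEmpty Empty (Fin 0)).symm) (PMor.perm (Equiv.refl (Fin a)))))
    (PMor.perm (Equiv.emptySum Empty (Fin a))) = PMor.perm _
  rw [PMor.tensor_perm, PMor.perm_perm, PMor.perm_perm]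
  congr 1
  ext i
  simp only [Equiv.trans_apply]
  generalize finSumFinEquiv.symm i = x
  rcases x with x | x
  · exact x.elim0
  · rfl

/-- The symmetry is transported along the fully faithful functor `incl`, so it is computed by
applying `incl` and conjugating with the tensorators. -/
theorem braid_eq (a b : PartCat k T) : (β_ a b).hom = pm (m := a ⊗ b) (n := b ⊗ a)
    (finSumFinEquiv.symm.trans ((Equiv.sumComm (Fin a) (Fin b)).trans finSumFinEquiv)) := by
  apply InducedCategory.hom_ext
  have h : (β_ a b).hom = (incl (k := k) (T := T)).preimage ((Functor.Monoidal.μIso incl a b).inv ≫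
      (β_ (incl.obj a) (incl.obj b)).hom ≫ (Functor.Monoidal.μIso incl b a).hom) := rfl
  have h2 : incl.map (β_ a b).hom = (Functor.Monoidal.μIso incl a b).inv ≫
      (β_ (incl.obj a) (incl.obj b)).hom ≫ (Functor.Monoidal.μIso incl b a).hom := by
    rw [h, Functor.map_preimage]
  refine h2.trans ?_
  change PMor.comp T (PMor.perm finSumFinEquiv.symm) (PMor.comp T (PMor.perm
    (Equiv.sumComm (Fin a) (Fin b))) (PMor.perm finSumFinEquiv)) = PMor.perm _
  rw [PMor.perm_perm, PMor.perm_perm]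

end PartCat

variable {k : Type u} [Field k] {T : k}

/-- The tuple with one entry. -/
abbrev sgl (n : PartCat k T) : Mat_ (PartCat k T) := ⟨PUnit, fun _ => n⟩

variable (k T) in
/-- The object `[n]` of `Rep(S_T)`, with its data made explicit. -/
abbrev pt (n : ℕ) : RepS k T := ⟨sgl (k := k) (T := T) n, 𝟙 _, Category.id_comp _⟩

variable (k T) in
/-- The object `[n]` of the category of partitions. -/
abbrev PartCat.of (n : ℕ) : PartCat k T := n

/-- A morphism of the category of partitions, as a morphism of `Rep(S_T)`. -/
def em {m n : ℕ} (f : PartCat.of k T m ⟶ PartCat.of k T n) : pt k T m ⟶ pt k T n :=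
  KarCat.ofComm (MatCat.mono (M := sgl (k := k) (T := T) m) (N := sgl (k := k) (T := T) n)
    (fun _ => PUnit.unit) fun _ => f) (by rw [Category.id_comp, Category.comp_id])

/-- The morphism of `Rep(S_T)` given by a bijection. -/
def pr {m n : ℕ} (e : Fin m ≃ Fin n) : pt k T m ⟶ pt k T n :=
  em (PartCat.pm e)

theorem em_comp {l m n : ℕ} (f : PartCat.of k T l ⟶ PartCat.of k T m)
    (g : PartCat.of k T m ⟶ PartCat.of k T n) : em f ≫ em g = em (f ≫ g) := by
  rw [em, em, em, KarCat.ofComm_comp]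
  refine KarCat.ofComm_congr _ _ ?_
  rw [MatCat.mono_mono]

theorem em_id (n : ℕ) : em (𝟙 (PartCat.of k T n)) = 𝟙 (pt k T n) := by
  rw [em, KarCat.id_eq_ofComm]
  refine KarCat.ofComm_congr _ _ ?_
  rw [MatCat.id_eq_mono]

/-- The tuple `sgl n` has one entry, so a morphism is a one-by-one matrix; its entry recovers the
combination of partitions. -/
theorem em_f {m n : ℕ} (f : PartCat.of k T m ⟶ PartCat.of k T n) : (em f).f = fun _ _ => f := by
  refine (Category.id_comp (X := sgl (k := k) (T := T) m) (Y := sgl (k := k) (T := T) n) _).trans ?_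
  funext i j
  refine (congrArg (f ≫ ·) (Mat_.id_apply_self (sgl (k := k) (T := T) n) _)).trans ?_
  exact Category.comp_id _

/-- Morphisms between the objects `[n]` are morphisms of the category of partitions. -/
def emEquiv (m n : ℕ) : (PartCat.of k T m ⟶ PartCat.of k T n) ≃+ (pt k T m ⟶ pt k T n) where
  toFun := em
  invFun f := f.f PUnit.unit PUnit.unit
  left_inv f := congrFun (congrFun (em_f f) PUnit.unit) PUnit.unit
  right_inv f := by
    ext1
    exact em_f _
  map_add' f g := by
    ext1
    exact (em_f _).trans (congrArg₂ (· + ·) (em_f f).symm (em_f g).symm)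

theorem em_smul {m n : ℕ} (c : k) (f : PartCat.of k T m ⟶ PartCat.of k T n) :
    em (c • f) = c • em f := by
  ext1
  exact (em_f _).trans (congrArg (c • ·) (em_f f).symm)

theorem pr_pr {l m n : ℕ} (e : Fin l ≃ Fin m) (e' : Fin m ≃ Fin n) :
    pr (k := k) (T := T) e ≫ pr e' = pr (e.trans e') := by
  rw [pr, pr, em_comp, PartCat.pm_comp, pr]

theorem pr_refl (n : ℕ) : pr (Equiv.refl (Fin n)) = 𝟙 (pt k T n) := em_id n

/-- The idempotents that define [a] and [b] ⊗ [c] are both identities, the latter after an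
application of functoriality of the tensor product. Hence every matrix between them is a morphism of
the idempotent completion. -/
theorem id_tens_comm {a b c : ℕ} (f : sgl (k := k) (T := T) a ⟶ sgl (k := k) (T := T) b ⊗ sgl (k := k) (T := T) c) :
    (pt k T a).p ≫ f = f ≫ (pt k T b ⊗ pt k T c).p := by
  have : (pt k T b ⊗ pt k T c).p = 𝟙 (sgl (k := k) (T := T) b ⊗ sgl (k := k) (T := T) c) := id_tensorHom_id _ _
  rw [this, Category.id_comp, Category.comp_id]

/-- The decomposition `[N] ≅ [m] ⊗ [n]` given by a bijection. -/
def om {N m n : ℕ} (θ : Fin N ≃ Fin m ⊕ Fin n) : pt k T N ⟶ pt k T m ⊗ pt k T n :=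
  KarCat.ofComm (P := pt k T N) (Q := pt k T m ⊗ pt k T n) (MatCat.mono (M := sgl (k := k) (T := T) N)
    (N := sgl (k := k) (T := T) m ⊗ sgl (k := k) (T := T) n)
    (fun _ => (PUnit.unit, PUnit.unit)) fun _ =>
      PartCat.pm (k := k) (T := T) (m := N) (n := PartCat.of k T m ⊗ PartCat.of k T n) (θ.trans finSumFinEquiv))
    (id_tens_comm _)

theorem pr_om {N N' m n : ℕ} (π : Fin N' ≃ Fin N) (θ : Fin N ≃ Fin m ⊕ Fin n) :
    pr π ≫ om (k := k) (T := T) θ = om (π.trans θ) := by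
  rw [pr, em, om, om, KarCat.ofComm_comp]
  refine KarCat.ofComm_congr _ _ ?_
  rw [MatCat.mono_mono]
  refine MatCat.mono_congr _ _ _ fun i => ?_
  rw [PartCat.pm_comp]
  rfl

theorem om_tensor {N m n m' n' : ℕ} (θ : Fin N ≃ Fin m ⊕ Fin n) (σ : Fin m ≃ Fin m')
    (τ : Fin n ≃ Fin n') :
    om (k := k) (T := T) θ ≫ (pr σ ⊗ₘ pr τ) = om (θ.trans (Equiv.sumCongr σ τ)) := by
  rw [pr, pr, em, em, om, om, KarCat.ofComm_tensor, KarCat.ofComm_comp]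
  refine KarCat.ofComm_congr _ _ ?_
  rw [MatCat.mono_tensor, MatCat.mono_mono]
  refine MatCat.mono_congr _ _ _ fun i => ?_
  rw [PartCat.pm_tensor, PartCat.pm_comp]
  congr 1
  ext i
  simp

theorem om_braid {N m n : ℕ} (θ : Fin N ≃ Fin m ⊕ Fin n) :
    om (k := k) (T := T) θ ≫ (β_ (pt k T m) (pt k T n)).hom = om (θ.trans (Equiv.sumComm _ _)) := by
  change om θ ≫ (KarCat.braid _ _).hom = _
  rw [om, om, KarCat.braid_eq, KarCat.ofComm_comp]
  refine KarCat.ofComm_congr _ _ ?_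
  change _ ≫ (MatCat.braid _ _).hom = _
  rw [MatCat.braid, MatCat.mono_mono]
  refine MatCat.mono_congr _ _ _ fun i => ?_
  rw [PartCat.braid_eq, PartCat.pm_comp]
  congr 1
  ext i
  simp

/-- The hypothesis says that the two iterated decompositions of {1, …, N} into three parts are the
same bijection up to associativity. The equality of morphisms is then an equality of composed
bijections. -/
theorem om_assoc {N L L' a b c : ℕ} (θ : Fin N ≃ Fin L ⊕ Fin c) (ψ : Fin L ≃ Fin a ⊕ Fin b)
    (θ' : Fin N ≃ Fin a ⊕ Fin L') (ψ' : Fin L' ≃ Fin b ⊕ Fin c)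
    (h : (θ.trans (Equiv.sumCongr ψ (Equiv.refl _))).trans (Equiv.sumAssoc _ _ _) =
      θ'.trans (Equiv.sumCongr (Equiv.refl _) ψ')) :
    om (k := k) (T := T) θ ≫ (om ψ ⊗ₘ 𝟙 _) ≫ (α_ _ _ _).hom = om θ' ≫ (𝟙 _ ⊗ₘ om ψ') := by
  rw [om, om, om, om, KarCat.assoc_eq, KarCat.id_eq_ofComm, KarCat.id_eq_ofComm,
    KarCat.ofComm_tensor, KarCat.ofComm_tensor, KarCat.ofComm_comp, KarCat.ofComm_comp,
    KarCat.ofComm_comp]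
  refine KarCat.ofComm_congr _ _ ?_
  rw [MatCat.id_eq_mono, MatCat.id_eq_mono, MatCat.assoc_eq, MatCat.mono_tensor,
    MatCat.mono_tensor, MatCat.mono_mono, MatCat.mono_mono, MatCat.mono_mono]
  refine MatCat.mono_congr _ _ _ fun i => ?_
  rw [PartCat.assoc_eq, ← PartCat.pm_id, ← PartCat.pm_id, PartCat.pm_tensor, PartCat.pm_tensor,
    PartCat.pm_comp, PartCat.pm_comp, PartCat.pm_comp]
  congr 1
  ext i
  have := DFunLike.congr_fun h i
  simp only [Equiv.trans_apply, Equiv.sumCongr_apply] at this ⊢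
  simp only [Equiv.symm_apply_apply]
  have h1 : ∀ x : Fin L ⊕ Fin c, Sum.map finSumFinEquiv.symm (Equiv.refl (Fin c))
      (Sum.map (ψ.trans finSumFinEquiv) (Equiv.refl (Fin c)) x) = Sum.map ψ (Equiv.refl (Fin c)) x := by
    rintro (x | x) <;> simp
  have h2 : ∀ x : Fin a ⊕ Fin L', Sum.map (Equiv.refl (Fin a)) (ψ'.trans finSumFinEquiv) x =
      Sum.map (Equiv.refl (Fin a)) finSumFinEquiv (Sum.map (Equiv.refl (Fin a)) ψ' x) := by
    rintro (x | x) <;> simp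
  rw [h1, h2, this]

theorem om_left {N n : ℕ} (θ : Fin N ≃ Fin 0 ⊕ Fin n) :
    om (k := k) (T := T) θ ≫ (λ_ (pt k T n)).hom = pr (θ.trans (Equiv.emptySum _ _)) := by
  rw [om, KarCat.left_eq, pr, em]
  refine (KarCat.ofComm_comp (P := pt k T N) (Q := 𝟙_ _ ⊗ pt k T n) _ _ _ _).trans ?_
  refine KarCat.ofComm_congr _ _ ?_
  rw [MatCat.left_eq]
  refine (MatCat.mono_mono (N := 𝟙_ _ ⊗ sgl (k := k) (T := T) n) _ _ _ _).trans ?_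
  refine MatCat.mono_congr _ _ _ fun i => ?_
  rw [PartCat.left_eq]
  refine (PartCat.pm_comp _ _).trans ?_
  congr 1
  ext i
  simp

instance {N m n : ℕ} (θ : Fin N ≃ Fin m ⊕ Fin n) : IsIso (om (k := k) (T := T) θ) := by
  refine ⟨KarCat.ofComm (Q := pt k T N) (P := pt k T m ⊗ pt k T n) (MatCat.mono (N := sgl (k := k) (T := T) N)
    (M := sgl (k := k) (T := T) m ⊗ sgl (k := k) (T := T) n)
    (fun _ => PUnit.unit) fun _ =>
      PartCat.pm (k := k) (T := T) (n := N) (m := PartCat.of k T m ⊗ PartCat.of k T n)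
        (θ.trans finSumFinEquiv).symm) ?_, ?_, ?_⟩
  · have : (pt k T m ⊗ pt k T n).p = 𝟙 (sgl (k := k) (T := T) m ⊗ sgl (k := k) (T := T) n) :=
      id_tensorHom_id _ _
    rw [this]
    exact (Category.id_comp _).trans (Category.comp_id _).symm
  · rw [om, KarCat.ofComm_comp, KarCat.id_eq_ofComm]
    refine KarCat.ofComm_congr _ _ ?_
    rw [MatCat.mono_mono, MatCat.id_eq_mono]
    refine MatCat.mono_congr _ _ _ fun i => ?_
    rw [PartCat.pm_comp, Equiv.self_trans_symm]
    rfl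
  · rw [om, KarCat.ofComm_comp, KarCat.id_eq_ofComm]
    refine KarCat.ofComm_congr _ _ ?_
    rw [MatCat.mono_mono, MatCat.id_eq_mono]
    refine MatCat.mono_congr _ _ _ fun i => ?_
    rw [PartCat.pm_comp, Equiv.symm_trans_self]
    rfl

end Deligne

/-! ### Morphisms that factor through a lower step -/

namespace Deligne

open MonoidalCategory Idempotents Limits

variable {k : Type u} [Field k] {T : k}

section Low

theorem factors_of_pt {i n : ℕ} (h : i < n) {X Y : RepS k T} (a : X ⟶ pt k T i) (b : pt k T i ⟶ Y) :
    FactorsThrough ((repFiltration k T).low n) (a ≫ b) := by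
  obtain ⟨n, rfl⟩ := Nat.exists_eq_succ_of_ne_zero (show n ≠ 0 by omega)
  have h' : summands (fun X => ∃ i ≤ n, X = ob k T i) (pt k T i) :=
    summands_of_mem ⟨i, by omega, rfl⟩
  exact ⟨pt k T i, a, b, h', rfl⟩

/-- The identity of an object of step n - 1 is a sum of endomorphisms that pass through some [i]
with i < n. -/
theorem exists_sum_of_factors {n : ℕ} {X Y : RepS k T} {f : X ⟶ Y}
    (h : FactorsThrough ((repFiltration k T).low n) f) :
    ∃ (J : Type) (_ : Fintype J) (i : J → ℕ) (a : ∀ j, X ⟶ pt k T (i j)) (b : ∀ j, pt k T (i j) ⟶ Y),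
      (∀ j, i j < n) ∧ f = ∑ j, a j ≫ b j := by
  obtain ⟨Z, a, b, hZ, rfl⟩ := h
  cases n with
  -- Step -1 consists of zero objects, so the empty sum serves.
  | zero =>
    refine ⟨Empty, inferInstance, fun j => j.elim, fun j => j.elim, fun j => j.elim,
      fun j => j.elim, ?_⟩
    rw [IsZero.eq_of_tgt hZ a 0, zero_comp]
    rfl
  | succ n =>
    have hZ' : summands (fun X => ∃ i ≤ n, X = ob k T i) Z := hZ
    obtain ⟨J, hJ, f, c, d, hf, e⟩ := summands_elim hZ'
    choose i hi hfi using hf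
    obtain rfl : f = fun j => ob k T (i j) := funext hfi
    refine ⟨J, hJ, i, fun j => a ≫ c j, fun j => d j ≫ b, fun j => Nat.lt_succ_of_le (hi j), ?_⟩
    calc a ≫ b = a ≫ (∑ j, c j ≫ d j) ≫ b := by rw [e, Category.id_comp]
      _ = _ := by
        rw [Preadditive.sum_comp, Preadditive.comp_sum]
        refine Finset.sum_congr rfl fun j _ => ?_
        exact (congrArg (a ≫ ·) (Category.assoc _ _ _)).trans (Category.assoc _ _ _).symm

/-- Modulo the preceding step of the filtration, an object of step `n` is a direct summand of a
finite direct sum of copies of `[n]`. -/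
theorem exists_resolution_mod_low {n : ℕ} {X : RepS k T} (h : (repFiltration k T).sub n X) :
    ∃ (c : ℕ) (a : ℕ → (X ⟶ pt k T n)) (b : ℕ → (pt k T n ⟶ X)), (∀ s, c ≤ s → a s = 0) ∧
      FactorsThrough ((repFiltration k T).low n) (𝟙 X - ∑ s ∈ Finset.range c, a s ≫ b s) := by
  classical
  have h' : summands (fun X => ∃ i ≤ n, X = ob k T i) X := h
  obtain ⟨J, hJ, f, c, d, hf, e⟩ := summands_elim h'
  -- Summands [i] with i < n contribute only lower morphisms and are replaced by zero; summands [n]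
  -- are kept.
  have key : ∀ j, ∃ (a : X ⟶ pt k T n) (b : pt k T n ⟶ X),
      FactorsThrough ((repFiltration k T).low n) (c j ≫ d j - a ≫ b) := by
    intro j
    obtain ⟨i, hi, e⟩ := hf j
    generalize c j = c, d j = d at *
    generalize f j = Y at *
    subst e
    rcases hi.lt_or_eq with hi | rfl
    · refine ⟨0, 0, ?_⟩
      rw [comp_zero, sub_zero]
      exact factors_of_pt hi c d
    · refine ⟨c, d, ?_⟩
      have h0 : FactorsThrough ((repFiltration k T).low i) (0 : X ⟶ X) :=
        TensorFiltration.factors_zero _ _ _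
      exact (congrArg (FactorsThrough _) (sub_self (c ≫ d))).mpr h0
  choose a b hab using key
  let E := Fintype.equivFin J
  -- Both families are extended by zero to all of `ℕ`, so that the resolutions of different degrees
  -- can be summed over one common range.
  refine ⟨Fintype.card J, fun s => if h : s < Fintype.card J then a (E.symm ⟨s, h⟩) else 0,
    fun s => if h : s < Fintype.card J then b (E.symm ⟨s, h⟩) else 0,
    fun s hs => dif_neg (by omega), ?_⟩
  rw [Finset.sum_range]
  have : ∑ s : Fin (Fintype.card J), (if h : s.1 < Fintype.card J then a (E.symm ⟨s, h⟩) else 0) ≫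
      (if h : s.1 < Fintype.card J then b (E.symm ⟨s, h⟩) else 0) = ∑ j, a j ≫ b j := by
    rw [← E.symm.sum_comp]
    exact Finset.sum_congr rfl fun s _ => by rw [dif_pos s.2, dif_pos s.2]
  rw [this, ← e, ← Finset.sum_sub_distrib]
  exact Finset.sum_induction _ (fun f => FactorsThrough ((repFiltration k T).low n) f)
    (fun _ _ => TensorFiltration.factors_add) (TensorFiltration.factors_zero _ _ _)
    fun j _ => hab j

/-- The linear combination of partitions that a morphism between the objects `[m]`, `[n]` is. -/
def coef {m n : ℕ} (f : pt k T m ⟶ pt k T n) : PMor k (Fin m) (Fin n) :=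
  ((emEquiv m n).symm f).hom

theorem em_coef {m n : ℕ} (f : pt k T m ⟶ pt k T n) : em ⟨coef f⟩ = f :=
  (emEquiv m n).apply_symm_apply f

theorem coef_em {m n : ℕ} (f : PMor k (Fin m) (Fin n)) : coef (T := T) (em ⟨f⟩) = f :=
  congrArg InducedCategory.Hom.hom ((emEquiv m n).symm_apply_apply (⟨f⟩ : PartCat.of k T m ⟶ PartCat.of k T n))

theorem coef_add {m n : ℕ} (f g : pt k T m ⟶ pt k T n) : coef (f + g) = coef f + coef g :=
  congrArg InducedCategory.Hom.hom ((emEquiv m n).symm.map_add f g)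

theorem coef_smul {m n : ℕ} (c : k) (f : pt k T m ⟶ pt k T n) : coef (c • f) = c • coef f := by
  conv_lhs => rw [← em_coef f, ← em_smul]
  exact coef_em _

theorem coef_comp {l m n : ℕ} (f : pt k T l ⟶ pt k T m) (g : pt k T m ⟶ pt k T n) :
    coef (f ≫ g) = PMor.comp T (coef f) (coef g) := by
  conv_lhs => rw [← em_coef f, ← em_coef g, em_comp]
  exact coef_em _

theorem coef_pr {m n : ℕ} (e : Fin m ≃ Fin n) : coef (pr (k := k) (T := T) e) = PMor.perm e :=
  coef_em _

/-- Additive map version of `coef`. -/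
def coefHom (k : Type u) [Field k] (T : k) (m n : ℕ) : (pt k T m ⟶ pt k T n) →+ PMor k (Fin m) (Fin n) :=
  AddMonoidHom.mk' coef coef_add

/-- Together with `factors_em_single`, this identifies the lower morphisms out of [n] with the span
of the partitions that are not full. -/
theorem coef_eq_zero_of_factors {m n : ℕ} {f : pt k T n ⟶ pt k T m}
    (h : FactorsThrough ((repFiltration k T).low n) f) {p : Setoid (Fin n ⊕ Fin m)} (hp : Full p) :
    coef f p = 0 := by
  obtain ⟨J, _, i, a, b, hi, rfl⟩ := exists_sum_of_factors h
  have : coef (∑ j, a j ≫ b j) = ∑ j, PMor.comp T (coef (a j)) (coef (b j)) := by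
    refine (map_sum (coefHom k T n m) _ _).trans ?_
    exact Finset.sum_congr rfl fun j _ => coef_comp _ _
  rw [this, Finsupp.finsetSum_apply]
  refine Finset.sum_eq_zero fun j _ => PMor.comp_apply_of_full T ?_ _ _ hp
  rw [Nat.card_fin, Nat.card_fin]
  exact hi j

/-- The factorisation of the partition through fewer points has no closed component, so it holds for
morphisms without dividing by a power of T. -/
theorem factors_em_single {m n : ℕ} {p : Setoid (Fin n ⊕ Fin m)} (hp : ¬ Full p) (c : k) :
    FactorsThrough ((repFiltration k T).low n) (em (T := T) ⟨(Finsupp.single p c : PMor k _ _)⟩ :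
      pt k T n ⟶ pt k T m) := by
  obtain ⟨i, hi, p', q', h1, h2⟩ := exists_factor_of_not_full hp
  rw [Nat.card_fin] at hi
  have : (em (T := T) ⟨(Finsupp.single p c : PMor k _ _)⟩ : pt k T n ⟶ pt k T m) =
      (em ⟨(Finsupp.single p' c : PMor k _ _)⟩ : pt k T n ⟶ pt k T i) ≫
        em ⟨(Finsupp.single q' 1 : PMor k _ _)⟩ := by
    rw [em_comp]
    congr 1
    apply InducedCategory.hom_ext
    refine Eq.trans ?_ (PMor.comp_single T p' q' c 1).symm
    rw [h1, h2, pow_zero, mul_one, mul_one]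
  rw [this]
  exact factors_of_pt hi _ _

/-- Modulo the preceding step of the filtration, the endomorphisms of `[n]` are spanned by
permutations. -/
theorem pt_induction {m n : ℕ} {P : (pt k T n ⟶ pt k T m) → Prop} (hmn : n = m)
    (hlow : ∀ f, FactorsThrough ((repFiltration k T).low n) f → P f)
    (hadd : ∀ f g, P f → P g → P (f + g)) (hpr : ∀ (e : Fin n ≃ Fin m) (c : k), P (c • pr e))
    (f : pt k T n ⟶ pt k T m) : P f := by
  rw [← em_coef f]
  generalize coef f = f
  induction f using Finsupp.induction_linear with
  | zero =>
    have h : (em ⟨0⟩ : pt k T n ⟶ pt k T m) = 0 := (emEquiv n m).map_zero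
    exact h ▸ hlow _ (TensorFiltration.factors_zero _ _ _)
  | add f g hf hg =>
    have h : (em ⟨f + g⟩ : pt k T n ⟶ pt k T m) = em ⟨f⟩ + em ⟨g⟩ :=
      (emEquiv n m).map_add ⟨f⟩ ⟨g⟩
    exact h ▸ hadd _ _ hf hg
  | single p c =>
    by_cases hp : Full p
    · obtain ⟨e, rfl⟩ := hp.exists_perm (by rw [Nat.card_fin, Nat.card_fin, hmn])
      have := hpr e c
      rw [pr, ← em_smul] at this
      convert this using 2
      apply InducedCategory.hom_ext
      refine Eq.trans ?_ (Finsupp.smul_single c (permPart e) (1 : k)).symm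
      rw [smul_eq_mul, mul_one]
    · exact hlow _ (factors_em_single hp c)

end Low

/-! ### The modules of morphisms from [n] modulo lower morphisms -/

section Phi

/-- The group algebra acts on `[n]`. -/
def permAlg (k : Type u) [Field k] (T : k) (n : ℕ) :
    MonoidAlgebra k (Equiv.Perm (Fin n)) →ₐ[k] End (pt k T n) :=
  MonoidAlgebra.lift k _ _
    -- Products in `End` and of permutations both follow the order of composition of maps, opposite
    -- to `≫`. Precomposition therefore becomes a right action.
    { toFun := fun σ => End.of (pr σ)
      map_one' := pr_refl n
      map_mul' := fun σ τ => (pr_pr τ σ).symm }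

theorem permAlg_single {n : ℕ} (σ : Equiv.Perm (Fin n)) (c : k) :
    permAlg k T n (MonoidAlgebra.single σ c) = c • pr σ := by
  rw [permAlg, MonoidAlgebra.lift_single]
  rfl

/-- The morphisms from `[n]` to `X`, as a right module over the group algebra. -/
def HomPt (n : ℕ) (X : RepS k T) : Type u := pt k T n ⟶ X

instance (n : ℕ) (X : RepS k T) : AddCommGroup (HomPt n X) :=
  inferInstanceAs (AddCommGroup (pt k T n ⟶ X))

instance (n : ℕ) (X : RepS k T) : Module (End (pt k T n))ᵐᵒᵖ (HomPt n X) :=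
  inferInstanceAs (Module (End (pt k T n))ᵐᵒᵖ (pt k T n ⟶ X))

instance (n : ℕ) (X : RepS k T) : Module (GrpAlg k n) (HomPt n X) :=
  Module.compHom _ (RingHom.op (permAlg k T n).toRingHom)

/-- A morphism as an element of the module. -/
def HomPt.mk {n : ℕ} {X : RepS k T} (f : pt k T n ⟶ X) : HomPt n X := f

theorem homPt_smul {n : ℕ} {X : RepS k T} (σ : Equiv.Perm (Fin n)) (c : k) (f : pt k T n ⟶ X) :
    (MulOpposite.op (MonoidAlgebra.single σ c) : GrpAlg k n) • HomPt.mk f =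
      HomPt.mk ((c • pr σ) ≫ f) :=
  congrArg (fun a : End (pt k T n) => HomPt.mk ((show pt k T n ⟶ pt k T n from a) ≫ f))
    (permAlg_single σ c)

theorem sc_homPt {n : ℕ} {X : RepS k T} (c : k) (f : pt k T n ⟶ X) :
    GMod.sc (n := n) c (HomPt.mk f) = HomPt.mk (c • f) := by
  refine (homPt_smul 1 c f).trans ?_
  change HomPt.mk ((c • pr (Equiv.refl _)) ≫ f) = _
  rw [pr_refl, Linear.smul_comp, Category.id_comp]

theorem act_homPt {n : ℕ} {X : RepS k T} (σ : Equiv.Perm (Fin n)) (f : pt k T n ⟶ X) :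
    GMod.act (k := k) σ (HomPt.mk f) = HomPt.mk (pr σ ≫ f) := by
  refine (homPt_smul σ 1 f).trans ?_
  rw [one_smul]

/-- The morphisms that factor through the preceding step of the filtration. -/
def lowSub (n : ℕ) (X : RepS k T) : Submodule (GrpAlg k n) (HomPt n X) where
  carrier := {f | FactorsThrough ((repFiltration k T).low n) (show pt k T n ⟶ X from f)}
  add_mem' := TensorFiltration.factors_add
  zero_mem' := TensorFiltration.factors_zero _ _ _
  smul_mem' a f h := by
    change FactorsThrough _ (permAlg k T n a.unop ≫ (show pt k T n ⟶ X from f))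
    exact TensorFiltration.factors_comp_left _ h

/-- The morphisms from `[n]` to `X` modulo those that factor through the preceding step of the
filtration. -/
abbrev Phi (n : ℕ) (X : RepS k T) : Type u := HomPt n X ⧸ lowSub n X

/-- The class of a morphism. -/
def cl {n : ℕ} {X : RepS k T} (f : pt k T n ⟶ X) : Phi n X := (lowSub n X).mkQ (HomPt.mk f)

theorem cl_surj {n : ℕ} {X : RepS k T} (x : Phi n X) : ∃ f, cl f = x :=
  (lowSub n X).mkQ_surjective x

theorem cl_add {n : ℕ} {X : RepS k T} (f g : pt k T n ⟶ X) : cl (f + g) = cl f + cl g := rfl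

theorem cl_zero {n : ℕ} {X : RepS k T} : cl (0 : pt k T n ⟶ X) = 0 := rfl

theorem cl_sum {n : ℕ} {X : RepS k T} {J : Type w} (s : Finset J) (f : J → (pt k T n ⟶ X)) :
    cl (∑ j ∈ s, f j) = ∑ j ∈ s, cl (f j) :=
  map_sum (lowSub n X).mkQ (fun j => (f j : HomPt n X)) s

theorem cl_eq_zero {n : ℕ} {X : RepS k T} (f : pt k T n ⟶ X) :
    cl f = 0 ↔ FactorsThrough ((repFiltration k T).low n) f :=
  Submodule.Quotient.mk_eq_zero _

theorem cl_eq {n : ℕ} {X : RepS k T} (f g : pt k T n ⟶ X) :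
    cl f = cl g ↔ FactorsThrough ((repFiltration k T).low n) (f - g) :=
  Submodule.Quotient.eq _

theorem sc_cl {n : ℕ} {X : RepS k T} (c : k) (f : pt k T n ⟶ X) :
    GMod.sc (n := n) c (cl f) = cl (c • f) := congrArg (lowSub n X).mkQ (sc_homPt c f)

theorem act_cl {n : ℕ} {X : RepS k T} (σ : Equiv.Perm (Fin n)) (f : pt k T n ⟶ X) :
    GMod.act (k := k) σ (cl f) = cl (pr σ ≫ f) := congrArg (lowSub n X).mkQ (act_homPt σ f)

/-- Postcomposition. -/
def phiMap (n : ℕ) {X Y : RepS k T} (g : X ⟶ Y) : Phi n X →ₗ[GrpAlg k n] Phi n Y :=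
  Submodule.mapQ _ _
    { toFun := fun f => (f ≫ g : pt k T n ⟶ Y)
      map_add' := fun _ _ => Preadditive.add_comp _ _ _ _ _ _
      map_smul' := fun _ _ => Category.assoc _ _ _ }
    fun _ h => TensorFiltration.factors_comp_right g h

theorem phiMap_cl {n : ℕ} {X Y : RepS k T} (g : X ⟶ Y) (f : pt k T n ⟶ X) :
    phiMap n g (cl f) = cl (f ≫ g) := rfl

variable (k T) in
/-- The functor that takes an object `X` to the morphisms from `[n]` to `X`, modulo those that factor
through the preceding step of the filtration. -/
def phi (n : ℕ) : RepS k T ⥤ ModuleCat.{u} (GrpAlg k n) where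
  obj X := ModuleCat.of _ (Phi n X)
  map g := ModuleCat.ofHom (phiMap n g)
  map_id X := ModuleCat.hom_ext (LinearMap.ext fun x => by
    obtain ⟨f, rfl⟩ := cl_surj x
    exact congrArg cl (Category.comp_id f))
  map_comp g h := ModuleCat.hom_ext (LinearMap.ext fun x => by
    obtain ⟨f, rfl⟩ := cl_surj x
    exact congrArg cl (Category.assoc f g h).symm)

instance (n : ℕ) : (phi k T n).Additive where
  map_add {X Y f g} := ModuleCat.hom_ext (LinearMap.ext fun x => by
    obtain ⟨h, rfl⟩ := cl_surj x
    exact congrArg cl (Preadditive.comp_add _ _ _ h f g))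

/-- This is what lets the functor descend from Rep(S_T) to the associated graded category. -/
theorem phiMap_eq_of_factors {n : ℕ} {X Y : RepS k T} {f g : X ⟶ Y}
    (h : FactorsThrough ((repFiltration k T).low n) (f - g)) : phiMap n f = phiMap n g :=
  LinearMap.ext fun x => by
    obtain ⟨e, rfl⟩ := cl_surj x
    rw [phiMap_cl, phiMap_cl, cl_eq, ← Preadditive.comp_sub]
    exact TensorFiltration.factors_comp_left e h

end Phi

end Deligne

/-! ### Projectivity, from the free action on full partitions -/

namespace Deligne

open MonoidalCategory Idempotents Limits

variable {k : Type u} [Field k] {T : k}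

section Orbits

variable {A B : Type}

/-- Partitions that differ by a permutation of the source. -/
def orbRel (A B : Type) : Setoid (Setoid (A ⊕ B)) where
  r p q := ∃ σ : Equiv.Perm A, q = p.comap (Sum.map σ id)
  iseqv :=
    { refl := fun p => ⟨1, by
        ext x y
        rcases x with x | x <;> rcases y with y | y <;> rfl⟩
      symm := by
        rintro p _ ⟨σ, rfl⟩
        refine ⟨σ⁻¹, ?_⟩
        ext x y
        rcases x with x | x <;> rcases y with y | y <;> simp [Setoid.comap_rel]
      trans := by
        rintro p _ _ ⟨σ, rfl⟩ ⟨τ, rfl⟩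
        refine ⟨σ * τ, ?_⟩
        ext x y
        rcases x with x | x <;> rcases y with y | y <;> rfl }

/-- A representative of the orbit of a partition. -/
def orbRep (p : Setoid (A ⊕ B)) : Setoid (A ⊕ B) := (Quotient.mk (orbRel A B) p).out

theorem orbRep_rel (p : Setoid (A ⊕ B)) : ∃ σ : Equiv.Perm A, p = (orbRep p).comap (Sum.map σ id) :=
  Quotient.mk_out (s := orbRel A B) p

/-- The permutation that takes a partition to the representative of its orbit. -/
def orbPerm (p : Setoid (A ⊕ B)) : Equiv.Perm A := (orbRep_rel p).choose

theorem orbPerm_spec (p : Setoid (A ⊕ B)) : p = (orbRep p).comap (Sum.map (orbPerm p) id) :=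
  (orbRep_rel p).choose_spec

theorem comap_comap_perm (p : Setoid (A ⊕ B)) (σ τ : Equiv.Perm A) :
    (p.comap (Sum.map σ id)).comap (Sum.map τ id) = p.comap (Sum.map (σ * τ : Equiv.Perm A) id) := by
  ext x y
  rcases x with x | x <;> rcases y with y | y <;> rfl

theorem orbRep_comap (p : Setoid (A ⊕ B)) (σ : Equiv.Perm A) :
    orbRep (p.comap (Sum.map σ id)) = orbRep p :=
  congrArg Quotient.out (Quotient.sound (s := orbRel A B) ((orbRel A B).symm' ⟨σ, rfl⟩))

theorem comap_one_perm (p : Setoid (A ⊕ B)) : p.comap (Sum.map (1 : Equiv.Perm A) id) = p := by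
  ext x y
  rcases x with x | x <;> rcases y with y | y <;> rfl

theorem full_orbRep {p : Setoid (A ⊕ B)} (h : Full p) : Full (orbRep p) := by
  have := full_comap (orbPerm p)⁻¹ ((orbPerm_spec p) ▸ h)
  rwa [comap_comap_perm, mul_inv_cancel, comap_one_perm] at this

/-- By freeness, a full partition is obtained from the representative of its orbit by a unique
permutation. Both sides of the equation do this for the relabelled partition. -/
theorem orbPerm_comap {p : Setoid (A ⊕ B)} (h : Full p) (σ : Equiv.Perm A) :
    orbPerm (p.comap (Sum.map σ id)) = orbPerm p * σ := by
  have h1 := orbPerm_spec (p.comap (Sum.map σ id))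
  rw [orbRep_comap] at h1
  have h2 : p.comap (Sum.map σ id) = (orbRep p).comap (Sum.map (orbPerm p * σ : Equiv.Perm A) id) := by
    rw [← comap_comap_perm, ← orbPerm_spec]
  rw [h1] at h2
  have h3 := congrArg (fun q : Setoid (A ⊕ B) => q.comap (Sum.map ((orbPerm p * σ)⁻¹ : Equiv.Perm A) id)) h2
  simp only [comap_comap_perm, mul_inv_cancel] at h3
  rw [comap_one_perm] at h3
  have := (full_orbRep h).perm_eq_one h3
  rwa [mul_inv_eq_one] at this

end Orbits

section Projective

open scoped Classical in
/-- A full partition, as an element of the free module over the set of partitions. -/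
def orbTerm (k : Type u) [Field k] {n m : ℕ} (p : Setoid (Fin n ⊕ Fin m)) :
    k →+ (Setoid (Fin n ⊕ Fin m) →₀ GrpAlg k n) :=
  if Full p then (Finsupp.singleAddHom (orbRep p)).comp
    (AddMonoidHom.mk' (fun c => MulOpposite.op (MonoidAlgebra.single (orbPerm p) c)) fun c d => by
      rw [MonoidAlgebra.single_add, MulOpposite.op_add])
  else 0

theorem orbTerm_full {n m : ℕ} {p : Setoid (Fin n ⊕ Fin m)} (h : Full p) (c : k) :
    orbTerm k p c = Finsupp.single (orbRep p) (MulOpposite.op (MonoidAlgebra.single (orbPerm p) c)) := by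
  rw [orbTerm, if_pos h]
  rfl

theorem orbTerm_not_full {n m : ℕ} {p : Setoid (Fin n ⊕ Fin m)} (h : ¬ Full p) (c : k) :
    orbTerm k p c = 0 := by
  rw [orbTerm, if_neg h]
  rfl

/-- The full partitions form a free module over the group algebra. -/
def orbSum (k : Type u) [Field k] (n m : ℕ) :
    PMor k (Fin n) (Fin m) →+ (Setoid (Fin n ⊕ Fin m) →₀ GrpAlg k n) :=
  Finsupp.liftAddHom (orbTerm k)

theorem orbSum_single {n m : ℕ} (p : Setoid (Fin n ⊕ Fin m)) (c : k) :
    orbSum k n m (Finsupp.single p c) = orbTerm k p c :=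
  Finsupp.liftAddHom_apply_single _ _ _

theorem orbSum_smul {n m : ℕ} (c : k) (f : PMor k (Fin n) (Fin m)) :
    orbSum k n m (c • f) = GMod.sc (n := n) c (orbSum k n m f) := by
  induction f using Finsupp.induction_linear with
  | zero => rw [smul_zero, map_zero, GMod.sc_zero]
  | add f g hf hg => rw [smul_add, map_add, map_add, GMod.sc_add, hf, hg]
  | single p d =>
    rw [Finsupp.smul_single, orbSum_single, orbSum_single]
    by_cases hp : Full p
    · rw [orbTerm_full hp, orbTerm_full hp, GMod.sc_single, GMod.sc,
        smul_eq_mul (a := MulOpposite.op _), ← MulOpposite.op_mul, MonoidAlgebra.single_mul_single,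
        mul_one, smul_eq_mul, mul_comm]
    · rw [orbTerm_not_full hp, orbTerm_not_full hp, GMod.sc_zero]

/-- On a full partition, relabelling by `σ` keeps the orbit representative and multiplies the
permutation by `σ`. Partitions that are not full stay so and contribute zero on both sides. -/
theorem orbSum_perm {n m : ℕ} (σ : Equiv.Perm (Fin n)) (f : PMor k (Fin n) (Fin m)) :
    orbSum k n m (PMor.comp T (PMor.perm σ) f) = GMod.act (k := k) σ (orbSum k n m f) := by
  induction f using Finsupp.induction_linear with
  | zero => rw [map_zero, map_zero, GMod.act_zero]
  | add f g hf hg => rw [map_add, map_add, map_add, GMod.act_add, hf, hg]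
  | single p d =>
    rw [PMor.perm_comp_single, orbSum_single, orbSum_single]
    by_cases hp : Full p
    · rw [orbTerm_full hp, orbTerm_full (full_comap σ hp), GMod.act_single, GMod.act, smul_eq_mul,
        ← MulOpposite.op_mul, MonoidAlgebra.single_mul_single, mul_one, orbRep_comap,
        orbPerm_comap hp]
    · have hp' : ¬ Full (p.comap (Sum.map σ id)) := fun h => hp (by
        have := full_comap σ⁻¹ h
        rwa [comap_comap_perm, mul_inv_cancel, comap_one_perm] at this)
      rw [orbTerm_not_full hp, orbTerm_not_full hp', GMod.act_zero]

/-- The section of the presentation of the module of morphisms modulo lower ones. -/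
def phiSect (n m : ℕ) : Phi n (pt k T m) →ₗ[GrpAlg k n] (Setoid (Fin n ⊕ Fin m) →₀ GrpAlg k n) :=
  (lowSub n (pt k T m)).liftQ
    (GMod.linMk (M := HomPt n (pt k T m)) ((orbSum k n m).comp (coefHom k T n m))
      (fun c f => (congrArg (fun f => orbSum k n m (coefHom k T n m f))
        (sc_homPt c (show pt k T n ⟶ pt k T m from f))).trans
          ((congrArg (orbSum k n m) (coef_smul c f)).trans (orbSum_smul c _)))
      (fun σ f => (congrArg (fun f => orbSum k n m (coefHom k T n m f))
        (act_homPt σ (show pt k T n ⟶ pt k T m from f))).trans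
          ((congrArg (orbSum k n m) ((coef_comp _ f).trans
            (congrArg (fun a => PMor.comp T a (coef f)) (coef_pr σ)))).trans (orbSum_perm σ _))))
    -- A lower morphism has coefficient zero at every full partition, and `orbTerm` vanishes at all
    -- others; hence the map descends to the quotient.
    (fun f hf => by
      change Finsupp.sum (coef f) (fun p c => orbTerm k p c) = 0
      refine Finset.sum_eq_zero fun p _ => ?_
      change orbTerm k p (coef f p) = 0
      by_cases hp : Full p
      · rw [coef_eq_zero_of_factors hf hp, map_zero]
      · exact orbTerm_not_full hp _)

theorem phiSect_cl {n m : ℕ} (f : pt k T n ⟶ pt k T m) :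
    phiSect n m (cl f) = orbSum k n m (coef f) := rfl

/-- The presentation of the module of morphisms modulo lower ones. -/
def phiPres (k : Type u) [Field k] (T : k) (n m : ℕ) :
    (Setoid (Fin n ⊕ Fin m) →₀ GrpAlg k n) →ₗ[GrpAlg k n] Phi n (pt k T m) :=
  Finsupp.linearCombination _ fun p => cl (em ⟨Finsupp.single p 1⟩)

/-- A full partition equals its permutation followed by its orbit representative, and a partition
that is not full has class zero. So `Phi n` of [m] is a direct summand of a free module of finite
rank. -/
theorem phiPres_phiSect {n m : ℕ} (x : Phi n (pt k T m)) : phiPres k T n m (phiSect n m x) = x := by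
  obtain ⟨f, rfl⟩ := cl_surj x
  rw [phiSect_cl, ← em_coef f, coef_em]
  generalize coef f = f
  induction f using Finsupp.induction_linear with
  | zero =>
    rw [map_zero, map_zero]
    exact (congrArg cl (emEquiv n m).map_zero).symm
  | add f g hf hg =>
    rw [map_add, map_add, hf, hg]
    exact (congrArg cl ((emEquiv n m).map_add ⟨f⟩ ⟨g⟩)).symm
  | single p c =>
    rw [orbSum_single]
    by_cases hp : Full p
    · rw [orbTerm_full hp, phiPres, Finsupp.linearCombination_single, ← GMod.sc_act, act_cl, sc_cl,
        pr, em_comp, ← em_smul]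
      congr 2
      apply InducedCategory.hom_ext
      refine (congrArg (c • ·) (PMor.perm_comp_single T (orbPerm p) (orbRep p) 1)).trans ?_
      rw [← orbPerm_spec, Finsupp.smul_single, smul_eq_mul, mul_one]
    · rw [orbTerm_not_full hp, map_zero]
      exact ((cl_eq_zero _).2 (factors_em_single hp c)).symm

instance finite_setoid (X : Type) [Finite X] : Finite (Setoid X) :=
  Finite.of_injective (fun p : Setoid X => p.r) fun _ _ h => Setoid.ext fun x y =>
    iff_of_eq (congrFun (congrFun h x) y)

instance finite_phi_pt (n m : ℕ) : Module.Finite (GrpAlg k n) (Phi n (pt k T m)) :=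
  Module.Finite.of_surjective (phiPres k T n m) fun x => ⟨_, phiPres_phiSect x⟩

instance projective_phi_pt (n m : ℕ) : Module.Projective (GrpAlg k n) (Phi n (pt k T m)) :=
  Module.Projective.of_split (phiSect n m) (phiPres k T n m) (LinearMap.ext phiPres_phiSect)

theorem phiMap_sum {n : ℕ} {X Y : RepS k T} {J : Type} (s : Finset J) (f : J → (X ⟶ Y)) (x : Phi n X) :
    phiMap n (∑ j ∈ s, f j) x = ∑ j ∈ s, phiMap n (f j) x := by
  obtain ⟨g, rfl⟩ := cl_surj x
  rw [phiMap_cl, Preadditive.comp_sum, cl_sum]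
  rfl

theorem phiMap_comp {n : ℕ} {X Y Z : RepS k T} (f : X ⟶ Y) (g : Y ⟶ Z) (x : Phi n X) :
    phiMap n (f ≫ g) x = phiMap n g (phiMap n f x) := by
  obtain ⟨h, rfl⟩ := cl_surj x
  rw [phiMap_cl, phiMap_cl, phiMap_cl, Category.assoc]

theorem phiMap_id {n : ℕ} {X : RepS k T} (x : Phi n X) : phiMap n (𝟙 X) x = x := by
  obtain ⟨h, rfl⟩ := cl_surj x
  rw [phiMap_cl, Category.comp_id]

/-- No relation between n and the step of X is needed: X is a direct summand of a finite sum of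
objects [i], and the passage to `Phi n` is additive, so the case of [i] suffices. -/
theorem projProp_phi (n : ℕ) (X : RepS k T) : projProp k n ((phi k T n).obj X) := by
  obtain ⟨N, hN⟩ := (repFiltration k T).exhaustive X
  have hN' : summands (fun X => ∃ i ≤ N, X = ob k T i) X := hN
  obtain ⟨J, hJ, f, a, b, hf, e⟩ := summands_elim hN'
  have h1 : ∀ j, Module.Finite (GrpAlg k n) (Phi n (f j)) := fun j => by
    obtain ⟨i, _, h⟩ := hf j
    rw [h]
    exact finite_phi_pt n i
  have h2 : ∀ j, Module.Projective (GrpAlg k n) (Phi n (f j)) := fun j => by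
    obtain ⟨i, _, h⟩ := hf j
    rw [h]
    exact projective_phi_pt n i
  classical
  let s : Phi n X →ₗ[GrpAlg k n] (DirectSum J fun j => Phi n (f j)) :=
    ∑ j, (DirectSum.lof _ J (fun j => Phi n (f j)) j) ∘ₗ phiMap n (a j)
  let r : (DirectSum J fun j => Phi n (f j)) →ₗ[GrpAlg k n] Phi n X :=
    DirectSum.toModule _ _ _ fun j => phiMap n (b j)
  have hrs : ∀ x, r (s x) = x := by
    intro x
    rw [LinearMap.sum_apply, map_sum]
    calc _ = ∑ j, phiMap n (a j ≫ b j) x := Finset.sum_congr rfl fun j _ => by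
          rw [phiMap_comp]
          exact DirectSum.toModule_lof _ _ _
      _ = x := by rw [← phiMap_sum, e, phiMap_id]
  exact ⟨Module.Finite.of_surjective r fun x => ⟨_, hrs x⟩,
    Module.Projective.of_split s r (LinearMap.ext hrs)⟩

end Projective

end Deligne

/-! ### The tensor product of graded objects and the tensorator -/

namespace Deligne

open MonoidalCategory Idempotents Limits

section Graded

variable {C : Type u} [Category.{v} C] [Preadditive C] [HasFiniteBiproducts C]
  [MonoidalCategory C] [MonoidalPreadditive C]

/-- The inclusion of a summand of the tensor product of graded objects. -/
def io (X Y : GradedObject ℕ C) {i j n : ℕ} (h : i + j = n) :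
    X i ⊗ Y j ⟶ (X ⊗ Y : GradedObject ℕ C) n :=
  GradedObject.Monoidal.ιTensorObj X Y i j n h

theorem io_ext {X Y : GradedObject ℕ C} {n : ℕ} {A : C} {f g : (X ⊗ Y : GradedObject ℕ C) n ⟶ A}
    (h : ∀ {i j : ℕ} (h : i + j = n), io X Y h ≫ f = io X Y h ≫ g) : f = g :=
  GradedObject.Monoidal.tensorObj_ext _ _ fun _ _ hij => h hij

theorem io_tensor {X Y X' Y' : GradedObject ℕ C} (f : X ⟶ X') (g : Y ⟶ Y') {i j n : ℕ}
    (h : i + j = n) : io X Y h ≫ (f ⊗ₘ g) n = (f i ⊗ₘ g j) ≫ io X' Y' h :=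
  GradedObject.Monoidal.ι_tensorHom _ _ _ _ _ _

/-- These are the two routes by which the summand of degrees a, b, c enters the threefold tensor
product; the associator of graded objects is defined to match them. -/
theorem io_assoc (X Y Z : GradedObject ℕ C) {a b c l l' n : ℕ} (h₁ : a + b = l) (h₂ : l + c = n)
    (h₃ : b + c = l') (h₄ : a + l' = n) :
    (io X Y h₁ ⊗ₘ 𝟙 (Z c)) ≫ io (X ⊗ Y) Z h₂ ≫ (α_ X Y Z).hom n =
      (α_ (X a) (Y b) (Z c)).hom ≫ (𝟙 (X a) ⊗ₘ io Y Z h₃) ≫ io X (Y ⊗ Z) h₄ := by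
  have h : a + b + c = n := by omega
  rw [tensorHom_id, id_tensorHom]
  have e := GradedObject.Monoidal.ιTensorObj₃'_associator_hom X Y Z a b c n h
  rw [GradedObject.Monoidal.ιTensorObj₃'_eq X Y Z a b c n h l h₁,
    GradedObject.Monoidal.ιTensorObj₃_eq X Y Z a b c n h l' h₃, Category.assoc] at e
  exact e

theorem io_braid [SymmetricCategory C] (X Y : GradedObject ℕ C) {i j n : ℕ} (h : i + j = n) :
    io X Y h ≫ (β_ X Y).hom n = (β_ (X i) (Y j)).hom ≫ io Y X (by rwa [add_comm]) :=
  GradedObject.Monoidal.ι_tensorObjDesc (fun i j hij => (β_ (X i) (Y j)).hom ≫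
    GradedObject.Monoidal.ιTensorObj Y X j i n (by omega)) i j h

/-- The unit is the component of degree zero of the graded unit. -/
def unitInv (C : Type u) [Category.{v} C] [Preadditive C] [HasFiniteBiproducts C]
    [MonoidalCategory C] [MonoidalPreadditive C] : 𝟙_ C ⟶ (𝟙_ (GradedObject ℕ C)) 0 :=
  (GradedObject.Monoidal.tensorUnit₀ (I := ℕ) (C := C)).inv

theorem io_left (X : GradedObject ℕ C) (n : ℕ) :
    (unitInv C ⊗ₘ 𝟙 (X n)) ≫ io (𝟙_ _) X (zero_add n) ≫ (λ_ X).hom n = (λ_ (X n)).hom := by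
  have e := GradedObject.Monoidal.leftUnitor_inv_apply X n
  have e2 : (λ_ X).inv n ≫ (λ_ X).hom n = 𝟙 (X n) := congrFun (λ_ X).inv_hom_id n
  rw [← cancel_epi (λ_ (X n)).inv, Iso.inv_hom_id, tensorHom_id]
  refine Eq.trans ?_ e2
  have e3 : (λ_ X).inv n = (λ_ (X n)).inv ≫ (unitInv C ▷ X n) ≫ io (𝟙_ _) X (zero_add n) := e
  rw [e3, Category.assoc, Category.assoc]

open scoped Classical in
/-- The projection to a summand of the tensor product of graded objects. -/
def po (X Y : GradedObject ℕ C) {i j n : ℕ} (h : i + j = n) :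
    (X ⊗ Y : GradedObject ℕ C) n ⟶ X i ⊗ Y j :=
  GradedObject.Monoidal.tensorObjDesc fun a b hab =>
    -- Since a + b = n, the first index determines the second and only it has to be compared.
    if e : a = i then eqToHom (by rw [e, show b = j by omega]) else 0

theorem io_po (X Y : GradedObject ℕ C) {i j n : ℕ} (h : i + j = n) : io X Y h ≫ po X Y h = 𝟙 _ := by
  refine (GradedObject.Monoidal.ι_tensorObjDesc _ _ _ _).trans ?_
  rw [dif_pos rfl, eqToHom_refl]

theorem io_po_ne (X Y : GradedObject ℕ C) {a b i j n : ℕ} (h : i + j = n) (hab : a + b = n) (e : a ≠ i) :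
    io X Y hab ≫ po X Y h = 0 := by
  refine (GradedObject.Monoidal.ι_tensorObjDesc _ _ _ _).trans ?_
  rw [dif_neg e]

theorem sum_po_io (X Y : GradedObject ℕ C) (n : ℕ) :
    ∑ i : Fin (n + 1), po X Y (show i.1 + (n - i.1) = n by omega) ≫
        io X Y (show i.1 + (n - i.1) = n by omega) =
      𝟙 ((X ⊗ Y : GradedObject ℕ C) n) := by
  refine io_ext fun {i j} h => ?_
  rw [Preadditive.comp_sum, Category.comp_id, Finset.sum_eq_single ⟨i, by omega⟩]
  · obtain rfl : j = n - i := by omega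
    exact (Category.assoc _ _ _).symm.trans ((congrArg (· ≫ _) (io_po X Y h)).trans (Category.id_comp _))
  · intro b _ hb
    rw [← Category.assoc, io_po_ne, zero_comp]
    rintro rfl
    exact hb rfl
  · simp

end Graded

variable {k : Type u} [Field k] {T : k}

/-- The product of two morphisms out of the objects `[m]` and `[n]`, at a decomposition. -/
def tm {N m n : ℕ} (θ : Fin N ≃ Fin m ⊕ Fin n) {X Y : RepS k T} (f : pt k T m ⟶ X)
    (g : pt k T n ⟶ Y) : pt k T N ⟶ X ⊗ Y := om θ ≫ (f ⊗ₘ g)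

section tm

variable {N m n : ℕ} (θ : Fin N ≃ Fin m ⊕ Fin n) {X Y : RepS k T}

theorem tm_add_left (f f' : pt k T m ⟶ X) (g : pt k T n ⟶ Y) :
    tm θ (f + f') g = tm θ f g + tm θ f' g := by
  rw [tm, MonoidalPreadditive.add_tensor, Preadditive.comp_add]; rfl

theorem tm_add_right (f : pt k T m ⟶ X) (g g' : pt k T n ⟶ Y) :
    tm θ f (g + g') = tm θ f g + tm θ f g' := by
  rw [tm, MonoidalPreadditive.tensor_add, Preadditive.comp_add]; rfl

theorem tm_sub_left (f f' : pt k T m ⟶ X) (g : pt k T n ⟶ Y) :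
    tm θ (f - f') g = tm θ f g - tm θ f' g := by
  rw [eq_sub_iff_add_eq, ← tm_add_left, sub_add_cancel]

theorem tm_sub_right (f : pt k T m ⟶ X) (g g' : pt k T n ⟶ Y) :
    tm θ f (g - g') = tm θ f g - tm θ f g' := by
  rw [eq_sub_iff_add_eq, ← tm_add_right, sub_add_cancel]

theorem tm_smul_left (c : k) (f : pt k T m ⟶ X) (g : pt k T n ⟶ Y) :
    tm θ (c • f) g = c • tm θ f g := by
  rw [tm, MonoidalCategory.tensorHom_def, MonoidalLinear.smul_whiskerRight, Linear.smul_comp,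
    Linear.comp_smul, ← MonoidalCategory.tensorHom_def]; rfl

theorem tm_smul_right (c : k) (f : pt k T m ⟶ X) (g : pt k T n ⟶ Y) :
    tm θ f (c • g) = c • tm θ f g := by
  rw [tm, MonoidalCategory.tensorHom_def, MonoidalLinear.whiskerLeft_smul, Linear.comp_smul,
    Linear.comp_smul, ← MonoidalCategory.tensorHom_def]; rfl

theorem tm_pr {m' n' : ℕ} (σ : Fin m ≃ Fin m') (τ : Fin n ≃ Fin n') (f : pt k T m' ⟶ X)
    (g : pt k T n' ⟶ Y) :
    tm θ (pr σ ≫ f) (pr τ ≫ g) = tm (θ.trans (Equiv.sumCongr σ τ)) f g := by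
  rw [tm, ← tensorHom_comp_tensorHom, ← Category.assoc, om_tensor, tm]

theorem pr_tm {N' : ℕ} (π : Fin N' ≃ Fin N) (f : pt k T m ⟶ X) (g : pt k T n ⟶ Y) :
    pr π ≫ tm θ f g = tm (π.trans θ) f g := by
  rw [tm, ← Category.assoc, pr_om, tm]

theorem tm_comp {X' Y' : RepS k T} (f : pt k T m ⟶ X) (g : pt k T n ⟶ Y) (a : X ⟶ X') (b : Y ⟶ Y') :
    tm θ f g ≫ (a ⊗ₘ b) = tm θ (f ≫ a) (g ≫ b) := by
  rw [tm, Category.assoc, tensorHom_comp_tensorHom, tm]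

theorem sub_pt (n : ℕ) : (repFiltration k T).sub n (pt k T n) := by
  have h : summands (fun X => ∃ i ≤ n, X = ob k T i) (pt k T n) := summands_of_mem ⟨n, le_rfl, rfl⟩
  exact h

/-- Tensoring step m - 1 with [n] lands in step m + n - 1. This makes the product of classes
independent of the representatives. -/
theorem tm_factors_left {f : pt k T m ⟶ X} (g : pt k T n ⟶ Y)
    (h : FactorsThrough ((repFiltration k T).low m) f) :
    FactorsThrough ((repFiltration k T).low N) (tm θ f g) := by
  obtain ⟨Z, a, b, hZ, rfl⟩ := h
  refine ⟨Z ⊗ pt k T n, tm θ a (𝟙 _), b ⊗ₘ g, ?_, ?_⟩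
  · rw [← GMod.card_eq θ]
    exact TensorFiltration.low_tensor_left (sub_pt n) hZ
  · rw [tm_comp, Category.id_comp]

theorem tm_factors_right (f : pt k T m ⟶ X) {g : pt k T n ⟶ Y}
    (h : FactorsThrough ((repFiltration k T).low n) g) :
    FactorsThrough ((repFiltration k T).low N) (tm θ f g) := by
  obtain ⟨Z, a, b, hZ, rfl⟩ := h
  refine ⟨pt k T m ⊗ Z, tm θ (𝟙 _) a, f ⊗ₘ b, ?_, ?_⟩
  · rw [← GMod.card_eq θ]
    exact TensorFiltration.low_tensor_right (sub_pt m) hZ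
  · rw [tm_comp, Category.id_comp]

end tm

variable (k T) in
/-- The functor `(Xₙ) ↦ (Phi n Xₙ)`. -/
def grPhi : GradedObject ℕ (RepS k T) ⥤ GMod k where
  obj X n := (phi k T n).obj (X n)
  map f n := (phi k T n).map (f n)
  map_id _ := funext fun n => (phi k T n).map_id _
  map_comp _ _ := funext fun n => (phi k T n).map_comp _ _

variable {X Y Z X' Y' : GradedObject ℕ (RepS k T)}

/-- The class of a morphism, as an element of the value of `grPhi`. -/
def gc (X : GradedObject ℕ (RepS k T)) {n : ℕ} (f : pt k T n ⟶ X n) : (grPhi k T).obj X n := cl f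

theorem gc_surj {n : ℕ} (x : (grPhi k T).obj X n) : ∃ f, gc X f = x := cl_surj x

theorem gc_add {n : ℕ} (f g : pt k T n ⟶ X n) : gc X (f + g) = gc X f + gc X g := rfl

theorem gc_eq {n : ℕ} (f g : pt k T n ⟶ X n) :
    gc X f = gc X g ↔ FactorsThrough ((repFiltration k T).low n) (f - g) := cl_eq f g

theorem act_gc {n : ℕ} (σ : Equiv.Perm (Fin n)) (f : pt k T n ⟶ X n) :
    GMod.act (k := k) σ (gc X f) = gc X (pr σ ≫ f) := act_cl σ f

theorem sc_gc {n : ℕ} (c : k) (f : pt k T n ⟶ X n) :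
    GMod.sc (n := n) c (gc X f) = gc X (c • f) := sc_cl c f

theorem ap_gc (f : X ⟶ Y) {n : ℕ} (g : pt k T n ⟶ X n) :
    GMod.ap ((grPhi k T).map f) (gc X g) = gc Y (g ≫ f n) := rfl

open scoped Classical in
/-- The tensorator of `grPhi` on generators. -/
def muGen (X Y : GradedObject ℕ (RepS k T)) {N m n : ℕ} (θ : Fin N ≃ Fin m ⊕ Fin n)
    (p : (grPhi k T).obj X m) (q : (grPhi k T).obj Y n) : (grPhi k T).obj (X ⊗ Y) N :=
  gc (X ⊗ Y) (tm θ (gc_surj p).choose (gc_surj q).choose ≫ io X Y (GMod.card_eq θ))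

/-- The chosen representatives may be replaced by `f` and `g` one at a time; each replacement
changes the product by a lower morphism. -/
theorem muGen_gc {N m n : ℕ} (θ : Fin N ≃ Fin m ⊕ Fin n) (f : pt k T m ⟶ X m) (g : pt k T n ⟶ Y n) :
    muGen X Y θ (gc X f) (gc Y g) = gc (X ⊗ Y) (tm θ f g ≫ io X Y (GMod.card_eq θ)) := by
  have hf := (gc_eq _ _).1 (gc_surj (gc X f)).choose_spec
  have hg := (gc_eq _ _).1 (gc_surj (gc Y g)).choose_spec
  rw [muGen, gc_eq, ← Preadditive.sub_comp]
  refine TensorFiltration.factors_comp_right _ ?_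
  rw [← sub_add_sub_cancel _ (tm θ f (gc_surj (gc Y g)).choose), ← tm_sub_left, ← tm_sub_right]
  exact TensorFiltration.factors_add (tm_factors_left θ _ hf) (tm_factors_right θ _ hg)

variable (X Y) in
/-- The tensorator of `grPhi`. -/
def mu : GMod.tens ((grPhi k T).obj X) ((grPhi k T).obj Y) ⟶ (grPhi k T).obj (X ⊗ Y) :=
  GMod.homDesc (fun θ p q => muGen X Y θ p q)
    (fun N =>
      { add_left := fun θ p p' q => by
          obtain ⟨f, rfl⟩ := gc_surj p
          obtain ⟨f', rfl⟩ := gc_surj p'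
          obtain ⟨g, rfl⟩ := gc_surj q
          rw [← gc_add, muGen_gc, muGen_gc, muGen_gc, tm_add_left, Preadditive.add_comp, gc_add]
        add_right := fun θ p q q' => by
          obtain ⟨f, rfl⟩ := gc_surj p
          obtain ⟨g', rfl⟩ := gc_surj q'
          obtain ⟨g, rfl⟩ := gc_surj q
          rw [← gc_add, muGen_gc, muGen_gc, muGen_gc, tm_add_right, Preadditive.add_comp, gc_add]
        scalar := fun θ c p q => by
          obtain ⟨f, rfl⟩ := gc_surj p
          obtain ⟨g, rfl⟩ := gc_surj q
          rw [sc_gc, sc_gc, muGen_gc, muGen_gc, tm_smul_left, tm_smul_right]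
        perm := fun θ σ τ p q => by
          obtain ⟨f, rfl⟩ := gc_surj p
          obtain ⟨g, rfl⟩ := gc_surj q
          rw [act_gc, act_gc, muGen_gc, muGen_gc, tm_pr] })
    (fun c θ p q => by
      obtain ⟨f, rfl⟩ := gc_surj p
      obtain ⟨g, rfl⟩ := gc_surj q
      rw [sc_gc, muGen_gc, muGen_gc, tm_smul_left, Linear.smul_comp]
      exact (sc_gc _ _).symm)
    (fun π θ p q => by
      obtain ⟨f, rfl⟩ := gc_surj p
      obtain ⟨g, rfl⟩ := gc_surj q
      rw [muGen_gc, muGen_gc, ← pr_tm, Category.assoc]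
      exact (act_gc _ _).symm)

theorem mu_el {N m n : ℕ} (θ : Fin N ≃ Fin m ⊕ Fin n) (f : pt k T m ⟶ X m) (g : pt k T n ⟶ Y n) :
    GMod.ap (mu X Y) (GMod.el θ (gc X f) (gc Y g)) =
      gc (X ⊗ Y) (tm θ f g ≫ io X Y (GMod.card_eq θ)) :=
  (GMod.homDesc_el _ _ _ _ _ _ _).trans (muGen_gc θ f g)

theorem mu_natural (f : X ⟶ X') (g : Y ⟶ Y') :
    GMod.map ((grPhi k T).map f) ((grPhi k T).map g) ≫ mu X' Y' =
      mu X Y ≫ (grPhi k T).map (f ⊗ₘ g) := GMod.hom_ext fun θ p q => by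
  obtain ⟨a, rfl⟩ := gc_surj p
  obtain ⟨b, rfl⟩ := gc_surj q
  rw [GMod.ap_comp, GMod.ap_comp, GMod.map_el, ap_gc, ap_gc, mu_el, mu_el, ap_gc, Category.assoc,
    io_tensor, ← Category.assoc, tm_comp]

theorem mu_braid : mu X Y ≫ (grPhi k T).map (β_ X Y).hom =
    GMod.swap ((grPhi k T).obj X) ((grPhi k T).obj Y) ≫ mu Y X := GMod.hom_ext fun θ p q => by
  obtain ⟨a, rfl⟩ := gc_surj p
  obtain ⟨b, rfl⟩ := gc_surj q
  rw [GMod.ap_comp, GMod.ap_comp, GMod.swap_el, mu_el, mu_el, ap_gc, Category.assoc, io_braid,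
    ← Category.assoc]
  congr 2
  rw [tm, Category.assoc, BraidedCategory.braiding_naturality, ← Category.assoc, om_braid, tm]

/-- On (p ⊗ q) ⊗ r both sides are the class of a decomposition of [N] into three parts, followed by
representatives f, g, h and the inclusion of a summand. The decompositions agree by `om_assoc`, the
inclusions by `io_assoc`. -/
theorem mu_assoc : GMod.map (mu X Y) (𝟙 ((grPhi k T).obj Z)) ≫ mu (X ⊗ Y) Z ≫
    (grPhi k T).map (α_ X Y Z).hom = GMod.assocHom ((grPhi k T).obj X) ((grPhi k T).obj Y)
      ((grPhi k T).obj Z) ≫ GMod.map (𝟙 ((grPhi k T).obj X)) (mu Y Z) ≫ mu X (Y ⊗ Z) :=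
  GMod.hom_ext_left fun {N L c a b} θ ψ p q r => by
  obtain ⟨f, rfl⟩ := gc_surj p
  obtain ⟨g, rfl⟩ := gc_surj q
  obtain ⟨h, rfl⟩ := gc_surj r
  rw [GMod.ap_comp, GMod.ap_comp, GMod.ap_comp, GMod.ap_comp, GMod.map_el, GMod.assocHom_el,
    GMod.elr, GMod.map_el, GMod.ap_id, GMod.ap_id, mu_el, mu_el, mu_el, mu_el, ap_gc]
  congr 1
  -- The iterated product is separated into its three layers: decomposition of [N], the morphisms f,
  -- g, h, and inclusion into the graded tensor product.
  have e1 : tm θ (tm ψ f g ≫ io X Y (GMod.card_eq ψ)) h =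
      om θ ≫ (om ψ ⊗ₘ 𝟙 _) ≫ ((f ⊗ₘ g) ⊗ₘ h) ≫ (io X Y (GMod.card_eq ψ) ⊗ₘ 𝟙 _) := by
    rw [tensorHom_comp_tensorHom, tensorHom_comp_tensorHom, Category.id_comp, Category.comp_id, tm,
      tm, Category.assoc]
  have e2 : ∀ {L' : ℕ} (θ' : Fin N ≃ Fin a ⊕ Fin L') (ψ' : Fin L' ≃ Fin b ⊕ Fin c),
      tm θ' f (tm ψ' g h ≫ io Y Z (GMod.card_eq ψ')) =
      om θ' ≫ (𝟙 _ ⊗ₘ om ψ') ≫ (f ⊗ₘ (g ⊗ₘ h)) ≫ (𝟙 _ ⊗ₘ io Y Z (GMod.card_eq ψ')) := fun θ' ψ' => by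
    rw [tensorHom_comp_tensorHom, tensorHom_comp_tensorHom, Category.id_comp, Category.comp_id, tm,
      tm, Category.assoc]
  rw [e1, e2, Category.assoc, Category.assoc, Category.assoc, Category.assoc,
    io_assoc X Y Z _ _ (GMod.card_eq (finSumFinEquiv.symm : _ ≃ Fin _ ⊕ Fin _))
      (by have := GMod.card_eq θ; have := GMod.card_eq ψ; omega),
    associator_naturality_assoc, Category.assoc, Category.assoc]
  -- The second decomposition is the one built into `GMod.elr`: the first part is split off, and the
  -- remaining b + c points are split in the standard way.
  have e3 := om_assoc (k := k) (T := T) θ ψ (((θ.trans (ψ.sumCongr (Equiv.refl (Fin c)))).trans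
    (Equiv.sumAssoc (Fin a) (Fin b) (Fin c))).trans
      ((Equiv.refl (Fin a)).sumCongr finSumFinEquiv)) finSumFinEquiv.symm (by
    ext i : 1
    obtain x | x := θ i <;> simp)
  have e4 := congrArg (· ≫ (f ⊗ₘ g ⊗ₘ h) ≫ (𝟙 _ ⊗ₘ io Y Z
    (GMod.card_eq (finSumFinEquiv.symm : Fin (b + c) ≃ Fin b ⊕ Fin c))) ≫
    io X (Y ⊗ Z) (show a + (b + c) = N by
      have := GMod.card_eq θ; have := GMod.card_eq ψ; omega)) e3
  simp only [Category.assoc] at e4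
  exact e4.trans (by simp only [Category.assoc])

end Deligne

/-! ### The regular module of [n], and invertibility of the tensorator -/

namespace Deligne

open MonoidalCategory Idempotents Limits

variable {k : Type u} [Field k] {T : k}

theorem GMod.ap_smul {X Y : GMod k} (f : X ⟶ Y) {n : ℕ} (r : GrpAlg k n) (x : X n) :
    GMod.ap f (r • x) = r • GMod.ap f x := map_smul (f n).hom r x

theorem GMod.ap_sum {X Y : GMod k} (f : X ⟶ Y) {n : ℕ} {J : Type w} (s : Finset J) (x : J → X n) :
    GMod.ap f (∑ j ∈ s, x j) = ∑ j ∈ s, GMod.ap f (x j) := map_sum (f n).hom x s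

theorem GMod.ap_zero {X Y : GMod k} (f : X ⟶ Y) {n : ℕ} : GMod.ap f (0 : X n) = 0 :=
  map_zero (f n).hom

theorem GMod.isIso_of_bijective {X Y : GMod k} (f : X ⟶ Y)
    (h : ∀ n, Function.Bijective fun x : X n => GMod.ap f x) : IsIso f :=
  (isIso_pi_iff f).mpr fun n => (ConcreteCategory.isIso_iff_bijective (f n)).mpr (h n)

theorem GMod.el_induction {X Y : GMod k} {N : ℕ} (S : AddSubgroup (GMod.tens X Y N))
    (h : ∀ {m n : ℕ} (θ : Fin N ≃ Fin m ⊕ Fin n) (p : X m) (q : Y n), GMod.el θ p q ∈ S)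
    (x : GMod.tens X Y N) : x ∈ S := by
  have := GMod.el_ext (f := QuotientAddGroup.mk' S) (g := 0) fun θ p q =>
    (QuotientAddGroup.eq_zero_iff _).2 (h θ p q)
  exact (QuotientAddGroup.eq_zero_iff x).1 (DFunLike.congr_fun this x)

/-- The endomorphism of `[n]` given by an element of the group algebra. -/
def pa {n : ℕ} (a : MonoidAlgebra k (Equiv.Perm (Fin n))) : pt k T n ⟶ pt k T n := permAlg k T n a

theorem pa_add {n : ℕ} (a b : MonoidAlgebra k (Equiv.Perm (Fin n))) :
    pa (T := T) (a + b) = pa a + pa b := map_add (permAlg k T n) a b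

theorem pa_zero {n : ℕ} : pa (T := T) (0 : MonoidAlgebra k (Equiv.Perm (Fin n))) = 0 :=
  map_zero (permAlg k T n)

theorem pa_comp {n : ℕ} (a b : MonoidAlgebra k (Equiv.Perm (Fin n))) :
    pa (T := T) a ≫ pa b = pa (b * a) := (map_mul (permAlg k T n) b a).symm

theorem pa_single {n : ℕ} (σ : Equiv.Perm (Fin n)) (c : k) :
    pa (T := T) (MonoidAlgebra.single σ c) = c • pr σ := permAlg_single σ c

theorem op_smul_cl {n : ℕ} {X : RepS k T} (a : MonoidAlgebra k (Equiv.Perm (Fin n)))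
    (f : pt k T n ⟶ X) : (MulOpposite.op a : GrpAlg k n) • cl f = cl (pa a ≫ f) := rfl

/-- This is the spanning half of the decomposition of End([n]) into k[S_n] and lower morphisms. -/
theorem exists_pa {n : ℕ} (f : pt k T n ⟶ pt k T n) :
    ∃ a, FactorsThrough ((repFiltration k T).low n) (f - pa a) := by
  refine pt_induction (P := fun f => ∃ a, FactorsThrough ((repFiltration k T).low n)
    (f - pa a)) rfl (fun f hf => ⟨0, ?_⟩) (fun f g hf hg => ?_)
    (fun e c => ⟨MonoidAlgebra.single e c, ?_⟩) f
  · rwa [pa_zero, sub_zero]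
  · obtain ⟨a, ha⟩ := hf
    obtain ⟨b, hb⟩ := hg
    refine ⟨a + b, ?_⟩
    rw [pa_add, add_sub_add_comm]
    exact TensorFiltration.factors_add ha hb
  · rw [pa_single, sub_self]
    exact TensorFiltration.factors_zero _ _ _

theorem coef_pa {n : ℕ} (a : MonoidAlgebra k (Equiv.Perm (Fin n))) (σ : Equiv.Perm (Fin n)) :
    coef (pa (T := T) a) (permPart σ) = a.coeff σ := by
  classical
  induction a using MonoidAlgebra.induction_linear with
  | zero =>
    rw [pa_zero]
    exact congrArg (fun f : PMor k (Fin n) (Fin n) => f (permPart σ)) (coefHom k T n n).map_zero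
  | add f g hf hg =>
    rw [pa_add, coef_add]
    exact congrArg₂ (· + ·) hf hg
  | single τ c =>
    rw [pa_single, coef_smul, coef_pr]
    refine (congrArg (c * ·) Finsupp.single_apply).trans ?_
    refine Eq.trans ?_ Finsupp.single_apply.symm
    simp only [permPart_injective.eq_iff, mul_ite, mul_one, mul_zero]

/-- This is the independence half: coefficients at permutations are coefficients at full partitions,
and those vanish on lower morphisms. -/
theorem pa_eq_zero {n : ℕ} {a : MonoidAlgebra k (Equiv.Perm (Fin n))}
    (h : FactorsThrough ((repFiltration k T).low n) (pa (T := T) a)) : a = 0 := by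
  ext σ
  rw [← coef_pa (T := T)]
  exact coef_eq_zero_of_factors h (full_permPart σ)

/-- Together with `exists_smul_cl_one`, it says that `Phi n` of [n] is free of rank one on the class
of the identity. -/
theorem smul_cl_one_eq_zero {n : ℕ} {r : GrpAlg k n} (h : r • cl (𝟙 (pt k T n)) = 0) : r = 0 := by
  obtain ⟨a, rfl⟩ := MulOpposite.op_surjective r
  rw [op_smul_cl, Category.comp_id, cl_eq_zero] at h
  rw [pa_eq_zero h, MulOpposite.op_zero]

theorem exists_smul_cl_one {n : ℕ} (x : Phi n (pt k T n)) :
    ∃ r : GrpAlg k n, r • cl (𝟙 (pt k T n)) = x := by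
  obtain ⟨f, rfl⟩ := cl_surj x
  obtain ⟨a, ha⟩ := exists_pa f
  refine ⟨MulOpposite.op a, ?_⟩
  rw [op_smul_cl, Category.comp_id]
  exact ((cl_eq _ _).2 ha).symm

section Mu

theorem tensor_sub_left {A B A' B' : RepS k T} (f f' : A ⟶ B) (g : A' ⟶ B') :
    (f - f') ⊗ₘ g = (f ⊗ₘ g) - (f' ⊗ₘ g) := by
  rw [eq_sub_iff_add_eq, ← MonoidalPreadditive.add_tensor, sub_add_cancel]

theorem tensor_sub_right {A B A' B' : RepS k T} (f : A ⟶ B) (g g' : A' ⟶ B') :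
    f ⊗ₘ (g - g') = (f ⊗ₘ g) - (f ⊗ₘ g') := by
  rw [eq_sub_iff_add_eq, ← MonoidalPreadditive.tensor_add, sub_add_cancel]

theorem tm_one {N m n : ℕ} (θ : Fin N ≃ Fin m ⊕ Fin n) :
    tm θ (𝟙 (pt k T m)) (𝟙 (pt k T n)) = om θ := by
  rw [tm, id_tensorHom_id, Category.comp_id]

/-- The difference telescopes as (1 - f) ⊗ 1 + f ⊗ (1 - g), and each term is a tensor product with a
lower factor. -/
theorem factors_tensor_sub {i j N : ℕ} (h : i + j = N) {A B : RepS k T}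
    (hA : (repFiltration k T).sub i A) (hB : (repFiltration k T).sub j B) {f : A ⟶ A} {g : B ⟶ B}
    (hf : FactorsThrough ((repFiltration k T).low i) (𝟙 A - f))
    (hg : FactorsThrough ((repFiltration k T).low j) (𝟙 B - g)) :
    FactorsThrough ((repFiltration k T).low N) (𝟙 (A ⊗ B) - (f ⊗ₘ g)) := by
  subst h
  have e : 𝟙 (A ⊗ B) - (f ⊗ₘ g) = ((𝟙 A - f) ⊗ₘ 𝟙 B) + (f ⊗ₘ (𝟙 B - g)) := by
    rw [tensor_sub_left, tensor_sub_right, id_tensorHom_id]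
    abel
  rw [e]
  obtain ⟨Z, a, b, hZ, e⟩ := hf
  obtain ⟨Z', a', b', hZ', e'⟩ := hg
  rw [← e, ← e']
  refine TensorFiltration.factors_add
    ⟨Z ⊗ B, a ⊗ₘ 𝟙 B, b ⊗ₘ 𝟙 B, TensorFiltration.low_tensor_left hB hZ, ?_⟩
    ⟨A ⊗ Z', 𝟙 A ⊗ₘ a', f ⊗ₘ b', TensorFiltration.low_tensor_right hA hZ', ?_⟩
  · rw [tensorHom_comp_tensorHom, Category.comp_id]
  · rw [tensorHom_comp_tensorHom, Category.id_comp]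

variable {X Y : GradedObject ℕ (RepS k T)}

/-- A morphism into the tensor product is a sum over its components. Resolving both factors by
copies of [i] and [j] writes each component through [i] ⊗ [j] ≅ [N], that is, as a group algebra
multiple of the image of a pure tensor. -/
theorem mu_surjective (hX : ∀ i, (repFiltration k T).sub i (X i))
    (hY : ∀ i, (repFiltration k T).sub i (Y i)) (N : ℕ) :
    Function.Surjective fun x => GMod.ap (mu X Y) (n := N) x := by
  intro x
  obtain ⟨f, rfl⟩ := gc_surj x
  let S : AddSubgroup ((grPhi k T).obj (X ⊗ Y) N) := ((mu X Y) N).hom.toAddMonoidHom.range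
  change gc _ f ∈ S
  have hf : f = ∑ i : Fin (N + 1), (f ≫ po X Y (show i.1 + (N - i.1) = N by omega)) ≫
      io X Y (show i.1 + (N - i.1) = N by omega) := by
    conv_lhs => rw [← Category.comp_id f]
    refine (congrArg (f ≫ ·) (sum_po_io X Y N).symm).trans ?_
    rw [Preadditive.comp_sum]
    exact Finset.sum_congr rfl fun i _ => (Category.assoc _ _ _).symm
  have key : ∀ {i j : ℕ} (h : i + j = N) (g : pt k T N ⟶ X i ⊗ Y j), gc _ (g ≫ io X Y h) ∈ S := by
    intro i j h g
    obtain ⟨c, a, b, -, hab⟩ := exists_resolution_mod_low (hX i)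
    obtain ⟨d, a', b', -, hab'⟩ := exists_resolution_mod_low (hY j)
    have hlow : FactorsThrough ((repFiltration k T).low N) (𝟙 (X i ⊗ Y j) -
        ((∑ s ∈ Finset.range c, a s ≫ b s) ⊗ₘ (∑ s ∈ Finset.range d, a' s ≫ b' s))) :=
      factors_tensor_sub h (hX i) (hY j) hab hab'
    have e : gc _ (g ≫ io X Y h) = ∑ s ∈ Finset.range c, ∑ t ∈ Finset.range d,
        gc _ (((g ≫ (a s ⊗ₘ a' t)) ≫ (b s ⊗ₘ b' t)) ≫ io X Y h) := by
      have e1 : cl g = ∑ s ∈ Finset.range c, ∑ t ∈ Finset.range d,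
          cl ((g ≫ (a s ⊗ₘ a' t)) ≫ (b s ⊗ₘ b' t)) := by
        have e2 := LinearMap.congr_fun (phiMap_eq_of_factors hlow) (cl g)
        rw [phiMap_cl, phiMap_cl, Category.comp_id] at e2
        rw [e2, sum_tensor, Preadditive.comp_sum, cl_sum]
        refine Finset.sum_congr rfl fun s _ => ?_
        rw [tensor_sum, Preadditive.comp_sum, cl_sum]
        exact Finset.sum_congr rfl fun t _ => by
          rw [Category.assoc, tensorHom_comp_tensorHom]
      have e3 := congrArg (phiMap N (io X Y h)) e1
      rw [map_sum, phiMap_cl] at e3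
      refine e3.trans (Finset.sum_congr rfl fun s _ => ?_)
      rw [map_sum]
      exact Finset.sum_congr rfl fun t _ => phiMap_cl _ _
    rw [e]
    refine sum_mem fun s _ => sum_mem fun t _ => ?_
    -- After the identification of [i] ⊗ [j] with [N], what precedes the two resolution maps is an
    -- endomorphism of [N], so modulo lower morphisms it is an element `r` of the group algebra.
    obtain ⟨r, hr⟩ := exists_smul_cl_one (cl ((g ≫ (a s ⊗ₘ a' t)) ≫ inv (om (GMod.std h))))
    have e : gc _ (((g ≫ (a s ⊗ₘ a' t)) ≫ (b s ⊗ₘ b' t)) ≫ io X Y h) =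
        r • GMod.ap (mu X Y) (GMod.el (GMod.std h) (gc X (b s)) (gc Y (b' t))) := by
      rw [mu_el]
      have := congrArg (phiMap N (tm (GMod.std h) (b s) (b' t) ≫ io X Y h)) hr
      rw [map_smul, phiMap_cl, phiMap_cl, Category.id_comp] at this
      refine Eq.trans ?_ this.symm
      change cl _ = cl _
      simp only [tm, Category.assoc, IsIso.inv_hom_id_assoc]
    rw [e, ← GMod.ap_smul]
    exact ⟨_, rfl⟩
  rw [hf]
  change cl _ ∈ S
  rw [cl_sum]
  exact sum_mem fun i _ => key _ _

/-- The graded object with components `[n]`. -/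
abbrev ptGr (k : Type u) [Field k] (T : k) : GradedObject ℕ (RepS k T) := fun n => pt k T n

/-- All factors are regular modules, so every generator is a multiple of 1 ⊗ 1 at the standard
decomposition of its type; there is one such element for each i ≤ N. -/
theorem exists_tens_ptGr {N : ℕ} (x : GMod.tens ((grPhi k T).obj (ptGr k T)) ((grPhi k T).obj (ptGr k T)) N) :
    ∃ r : Fin (N + 1) → GrpAlg k N, x = ∑ i : Fin (N + 1), r i •
      GMod.el (GMod.std (show i.1 + (N - i.1) = N by omega)) (gc (ptGr k T) (𝟙 (pt k T _)))
        (gc (ptGr k T) (𝟙 (pt k T _))) := by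
  let g : ∀ i : Fin (N + 1), GMod.tens ((grPhi k T).obj (ptGr k T)) ((grPhi k T).obj (ptGr k T)) N :=
    fun i => GMod.el (GMod.std (show i.1 + (N - i.1) = N by omega)) (gc (ptGr k T) (𝟙 (pt k T _)))
        (gc (ptGr k T) (𝟙 (pt k T _)))
  have : x ∈ (Submodule.span (GrpAlg k N) (Set.range g)).toAddSubgroup := by
    refine GMod.el_induction _ (fun {m n} θ p q => ?_) x
    obtain ⟨a, rfl⟩ := exists_smul_cl_one p
    obtain ⟨b, rfl⟩ := exists_smul_cl_one q
    refine (congrArg (· ∈ _) (GMod.reg_smul θ a b _ _)).mp ?_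
    refine Submodule.smul_mem _ _ (Submodule.subset_span ?_)
    have := GMod.card_eq θ
    obtain rfl : n = N - m := by omega
    exact ⟨⟨m, by omega⟩, rfl⟩
  obtain ⟨r, hr⟩ := (Submodule.mem_span_range_iff_exists_fun (GrpAlg k N)).1 this
  exact ⟨r, hr.symm⟩

/-- Postcomposition with a morphism out of a component. -/
def cut {X : GradedObject ℕ (RepS k T)} {N : ℕ} {A : RepS k T} (w : X N ⟶ A) :
    (grPhi k T).obj X N →ₗ[GrpAlg k N] Phi N A := phiMap N w

theorem cut_gc {X : GradedObject ℕ (RepS k T)} {N : ℕ} {A : RepS k T} (w : X N ⟶ A)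
    (f : pt k T N ⟶ X N) : cut w (gc X f) = cl (f ≫ w) := rfl

/-- The generators with different i have images in different summands, and projecting to the summand
of degrees (i, N - i), identified with [N], turns the image into `r i` times the class of the
identity, which is free. -/
theorem mu_ptGr {N : ℕ} (x : GMod.tens ((grPhi k T).obj (ptGr k T)) ((grPhi k T).obj (ptGr k T)) N)
    (h : GMod.ap (mu (ptGr k T) (ptGr k T)) x = 0) : x = 0 := by
  obtain ⟨r, rfl⟩ := exists_tens_ptGr x
  refine Finset.sum_eq_zero fun i _ => ?_
  have hi : r i = 0 := by
    let θ : Fin N ≃ Fin i.1 ⊕ Fin (N - i.1) := GMod.std (by omega)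
    let v : ptGr k T i.1 ⊗ ptGr k T (N - i.1) ⟶ pt k T N := inv (om θ)
    have h1 := congrArg (cut (po (ptGr k T) (ptGr k T) (GMod.card_eq θ) ≫ v)) h
    rw [GMod.ap_sum, map_sum, map_zero, Finset.sum_eq_single i] at h1
    · rw [GMod.ap_smul, map_smul, mu_el, cut_gc] at h1
      refine smul_cl_one_eq_zero (Eq.trans (congrArg (r i • ·) (congrArg cl ?_)) h1)
      have e1 : io (ptGr k T) (ptGr k T) (GMod.card_eq θ) ≫ po (ptGr k T) (ptGr k T) (GMod.card_eq θ) ≫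
          v = v := by
        rw [← Category.assoc, io_po, Category.id_comp]
      rw [Category.assoc]
      refine Eq.trans ?_ (congrArg (tm θ _ _ ≫ ·) e1).symm
      exact ((congrArg (· ≫ inv (om θ)) (tm_one θ)).trans (IsIso.hom_inv_id _)).symm
    · intro j _ hj
      rw [GMod.ap_smul, map_smul, mu_el, cut_gc]
      refine (congrArg (r j • ·) ((congrArg cl ?_).trans cl_zero)).trans (smul_zero _)
      have e1 : io (ptGr k T) (ptGr k T) (show j.1 + (N - j.1) = N by omega) ≫
          po (ptGr k T) (ptGr k T) (GMod.card_eq θ) ≫ v = 0 := by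
        rw [← Category.assoc, io_po_ne _ _ _ _ (fun e => hj (Fin.ext e)), zero_comp]
      rw [Category.assoc]
      exact (congrArg (_ ≫ ·) e1).trans comp_zero
    · simp
  rw [hi, zero_smul]

theorem el_sum_left {U V : GMod k} {N m n : ℕ} (θ : Fin N ≃ Fin m ⊕ Fin n) {J : Type w} (s : Finset J)
    (p : J → U m) (q : V n) : GMod.el θ (∑ j ∈ s, p j) q = ∑ j ∈ s, GMod.el θ (p j) q :=
  map_sum (AddMonoidHom.mk' (fun p => GMod.el θ p q) fun _ _ => GMod.el_add_left _ _ _ _) p s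

theorem el_sum_right {U V : GMod k} {N m n : ℕ} (θ : Fin N ≃ Fin m ⊕ Fin n) {J : Type w} (s : Finset J)
    (p : U m) (q : J → V n) : GMod.el θ p (∑ j ∈ s, q j) = ∑ j ∈ s, GMod.el θ p (q j) :=
  map_sum (AddMonoidHom.mk' (fun q => GMod.el θ p q) fun _ _ => GMod.el_add_right _ _ _ _) q s

theorem sum_ap_of_resolution {n c C : ℕ} {X : RepS k T} {a : ℕ → (X ⟶ pt k T n)} {b : ℕ → (pt k T n ⟶ X)}
    (ha : ∀ s, c ≤ s → a s = 0)
    (hab : FactorsThrough ((repFiltration k T).low n) (𝟙 X - ∑ s ∈ Finset.range c, a s ≫ b s))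
    (h : c ≤ C) (p : Phi n X) : ∑ s ∈ Finset.range C, phiMap n (a s ≫ b s) p = p := by
  obtain ⟨f, rfl⟩ := cl_surj p
  have e := LinearMap.congr_fun (phiMap_eq_of_factors hab) (cl f)
  rw [phiMap_cl, phiMap_cl, Category.comp_id, Preadditive.comp_sum, cl_sum] at e
  rw [← Finset.sum_subset (Finset.range_mono h)]
  · exact e.symm
  · intro s _ hs
    rw [ha s (by simpa using hs), zero_comp, phiMap_cl, comp_zero, cl_zero]

/-- The resolutions exhibit both families, as far as `Phi` sees them, as retracts of copies of the
family ([n]). By naturality of `mu` an element of the kernel is mapped into the kernel for ([n]),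
which is zero by `mu_ptGr`, and it is recovered from these images. -/
theorem mu_injective (hX : ∀ i, (repFiltration k T).sub i (X i))
    (hY : ∀ i, (repFiltration k T).sub i (Y i)) (N : ℕ) :
    Function.Injective fun x => GMod.ap (mu X Y) (n := N) x := by
  choose c a b ha hab using fun i => exists_resolution_mod_low (hX i)
  choose d a' b' ha' hab' using fun i => exists_resolution_mod_low (hY i)
  let A (s : ℕ) : X ⟶ ptGr k T := fun i => a i s
  let B (s : ℕ) : ptGr k T ⟶ X := fun i => b i s
  let A' (s : ℕ) : Y ⟶ ptGr k T := fun i => a' i s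
  let B' (s : ℕ) : ptGr k T ⟶ Y := fun i => b' i s
  -- Only degrees up to N occur in degree N of the product. The sums `C` and `D` bound the number of
  -- terms of all their resolutions at once, the surplus terms being zero.
  let C := ∑ i ∈ Finset.range (N + 1), c i
  let D := ∑ i ∈ Finset.range (N + 1), d i
  have hA : ∀ i ≤ N, ∀ p : (grPhi k T).obj X i,
      ∑ s ∈ Finset.range C, GMod.ap ((grPhi k T).map (A s ≫ B s)) p = p := by
    intro i hi p
    exact sum_ap_of_resolution (ha i) (hab i) (Finset.single_le_sum
      (fun _ _ => Nat.zero_le _) (Finset.mem_range.2 (Nat.lt_succ_of_le hi))) p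
  have hA' : ∀ i ≤ N, ∀ p : (grPhi k T).obj Y i,
      ∑ s ∈ Finset.range D, GMod.ap ((grPhi k T).map (A' s ≫ B' s)) p = p := by
    intro i hi p
    exact sum_ap_of_resolution (ha' i) (hab' i) (Finset.single_le_sum
      (fun _ _ => Nat.zero_le _) (Finset.mem_range.2 (Nat.lt_succ_of_le hi))) p
  refine (injective_iff_map_eq_zero ((mu X Y) N).hom).2 fun x hx => ?_
  have e : x = ∑ s ∈ Finset.range C, ∑ t ∈ Finset.range D,
      GMod.ap (GMod.map ((grPhi k T).map (B s)) ((grPhi k T).map (B' t)))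
        (GMod.ap (GMod.map ((grPhi k T).map (A s)) ((grPhi k T).map (A' t))) x) := by
    refine DFunLike.congr_fun (GMod.el_ext (f := AddMonoidHom.id _)
      (g := ∑ s ∈ Finset.range C, ∑ t ∈ Finset.range D,
        ((GMod.map ((grPhi k T).map (A s)) ((grPhi k T).map (A' t)) ≫
          GMod.map ((grPhi k T).map (B s)) ((grPhi k T).map (B' t))) N).hom.toAddMonoidHom)
      fun {m n} θ p q => ?_) x |>.trans ?_
    · have hN := GMod.card_eq θ
      rw [AddMonoidHom.finsetSum_apply]
      refine (congrArg₂ (GMod.el θ) (hA m (by omega) p).symm (hA' n (by omega) q).symm).trans ?_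
      rw [el_sum_left]
      refine Finset.sum_congr rfl fun s _ => ?_
      rw [el_sum_right, AddMonoidHom.finsetSum_apply]
      refine Finset.sum_congr rfl fun t _ => ?_
      change _ = GMod.ap (GMod.map ((grPhi k T).map (A s)) ((grPhi k T).map (A' t)) ≫
          GMod.map ((grPhi k T).map (B s)) ((grPhi k T).map (B' t))) (GMod.el θ p q)
      rw [GMod.ap_comp, GMod.map_el, GMod.map_el, Functor.map_comp, Functor.map_comp, GMod.ap_comp,
        GMod.ap_comp]
    · rw [AddMonoidHom.finsetSum_apply]
      exact Finset.sum_congr rfl fun s _ => AddMonoidHom.finsetSum_apply _ _ _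
  rw [e]
  refine Finset.sum_eq_zero fun s _ => Finset.sum_eq_zero fun t _ => ?_
  have h0 := mu_ptGr (GMod.ap (GMod.map ((grPhi k T).map (A s)) ((grPhi k T).map (A' t))) x) (by
    rw [← GMod.ap_comp, mu_natural, GMod.ap_comp]
    exact (congrArg _ hx).trans (GMod.ap_zero _))
  rw [h0, GMod.ap_zero]

theorem isIso_mu (hX : ∀ i, (repFiltration k T).sub i (X i))
    (hY : ∀ i, (repFiltration k T).sub i (Y i)) : IsIso (mu X Y) :=
  GMod.isIso_of_bijective _ fun N => ⟨mu_injective hX hY N, mu_surjective hX hY N⟩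

end Mu

/-! ### The unit isomorphism -/

section Unit

variable (k T) in
/-- The class that generates the value of `grPhi` at the unit. -/
def unitCl : (grPhi k T).obj (𝟙_ (GradedObject ℕ (RepS k T))) 0 :=
  gc _ (unitInv (RepS k T) : pt k T 0 ⟶ _)

variable (k T) in
/-- The inverse of `unitInv`. -/
def unitFwd : (𝟙_ (GradedObject ℕ (RepS k T))) 0 ⟶ pt k T 0 :=
  (GradedObject.Monoidal.tensorUnit₀ (I := ℕ) (C := RepS k T)).hom

variable (k T) in
theorem unitInv_unitFwd : unitInv (RepS k T) ≫ unitFwd k T = 𝟙 (pt k T 0) :=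
  (GradedObject.Monoidal.tensorUnit₀ (I := ℕ) (C := RepS k T)).inv_hom_id

variable (k T) in
theorem unitFwd_unitInv : unitFwd k T ≫ unitInv (RepS k T) = 𝟙 _ :=
  (GradedObject.Monoidal.tensorUnit₀ (I := ℕ) (C := RepS k T)).hom_inv_id

variable (k T) in
/-- The unit morphism of `grPhi`. -/
def eps : GMod.unt k ⟶ (grPhi k T).obj (𝟙_ (GradedObject ℕ (RepS k T))) :=
  GMod.homMk
    (fun
      | 0 => AddMonoidHom.mk' (fun f => GMod.sc (n := 0) (GMod.uval rfl f) (unitCl k T))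
          fun f g => by rw [GMod.uval_add, GMod.add_sc]
      | _ + 1 => 0)
    (fun
      | 0 => fun c f => by
        change GMod.sc (n := 0) _ _ = GMod.sc (n := 0) c (GMod.sc (n := 0) _ _)
        rw [GMod.uval_sc, GMod.sc_sc]
      | n + 1 => fun c f => (GMod.sc_zero (n := n + 1) c).symm)
    (fun
      | 0 => fun σ f => by
        change GMod.sc (n := 0) _ _ = GMod.act σ (GMod.sc (n := 0) _ _)
        rw [GMod.uval_act, Subsingleton.elim σ 1]
        exact (GMod.act_one _).symm
      | n + 1 => fun σ f => (GMod.act_zero σ).symm)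

theorem eps_u1 : GMod.ap (eps k T) (GMod.u1 (k := k)) = unitCl k T :=
  GMod.one_sc (k := k) (n := 0) (unitCl k T)

/-- In degree 0 both sides are free of rank one over k[S_0] = k, and the generator `u1` is sent to
the generator `unitCl`. In all other degrees both sides vanish. -/
theorem isIso_eps : IsIso (eps k T) := GMod.isIso_of_bijective _ fun
  | 0 => by
    constructor
    · refine (injective_iff_map_eq_zero ((eps k T) 0).hom).2 fun f hf => ?_
      rw [GMod.unt_eq f] at hf ⊢
      have hf' : GMod.ap (eps k T) (GMod.sc (n := 0) (GMod.uval rfl f) GMod.u1) = 0 := hf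
      rw [GMod.ap_sc, eps_u1] at hf'
      -- Postcomposition with `unitFwd` moves the relation into `Phi 0` of [0], where the class of
      -- the identity is free.
      have h1 : GMod.sc (n := 0) (M := Phi 0 (pt k T 0)) (GMod.uval rfl f) (cl (𝟙 (pt k T 0))) = 0 := by
        have h := congrArg (cut (unitFwd k T)) hf'
        rw [map_zero] at h
        refine Eq.trans ?_ h
        refine Eq.trans ?_ (map_smul (cut (unitFwd k T)) _ _).symm
        exact congrArg (fun x => GMod.sc (n := 0) (GMod.uval rfl f) (cl x)) (unitInv_unitFwd k T).symm
      have h2 := MulOpposite.op_injective (smul_cl_one_eq_zero h1)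
      have h3 : GMod.uval rfl f = 0 := MonoidAlgebra.single_eq_zero.1 h2
      rw [h3]
      exact GMod.zero_sc (n := 0) _
    · intro x
      obtain ⟨f, rfl⟩ := gc_surj x
      obtain ⟨r, hr⟩ := exists_smul_cl_one (cl (f ≫ unitFwd k T))
      obtain ⟨a, rfl⟩ := MulOpposite.op_surjective r
      have ha : a = MonoidAlgebra.single 1 (a.coeff 1) := by
        refine MonoidAlgebra.ext (Finsupp.ext fun σ => ?_)
        rw [Subsingleton.elim σ 1]
        exact (Finsupp.single_eq_same).symm
      refine ⟨GMod.sc (n := 0) (a.coeff 1) GMod.u1, ?_⟩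
      refine (GMod.ap_sc _ _ _).trans ?_
      rw [eps_u1]
      have h := congrArg (phiMap 0 (unitInv (RepS k T))) hr
      rw [map_smul, phiMap_cl, phiMap_cl, Category.assoc] at h
      rw [ha] at h
      refine Eq.trans ?_ (h.trans ?_)
      · exact congrArg (fun x => GMod.sc (n := 0) (a.coeff 1) (cl x)) (Category.id_comp _).symm
      · exact congrArg cl ((congrArg (f ≫ ·) (unitFwd_unitInv k T)).trans (Category.comp_id _))
  | n + 1 => by
    have : Subsingleton (GMod.unt k (n + 1)) := ⟨fun f g => by
      rw [GMod.unt_zero n.succ_ne_zero f, GMod.unt_zero n.succ_ne_zero g]⟩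
    -- The graded unit is initial in positive degrees, hence zero there.
    have : Subsingleton ((grPhi k T).obj (𝟙_ (GradedObject ℕ (RepS k T))) (n + 1)) := ⟨fun x y => by
      obtain ⟨f, rfl⟩ := gc_surj x
      obtain ⟨g, rfl⟩ := gc_surj y
      refine congrArg (gc _) ?_
      have hz : IsZero ((𝟙_ (GradedObject ℕ (RepS k T))) (n + 1)) :=
        (initialIsInitial.isZero).of_iso ((GradedObject.Monoidal.isInitialTensorUnitApply (n + 1)
          n.succ_ne_zero).uniqueUpToIso initialIsInitial)
      exact hz.eq_of_tgt f g⟩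
    exact ⟨fun _ _ _ => Subsingleton.elim _ _, fun y => ⟨0, Subsingleton.elim _ _⟩⟩

theorem om_left_pr {n : ℕ} (θ : Fin n ≃ Fin 0 ⊕ Fin n) {A : RepS k T} (f : pt k T n ⟶ A) :
    om θ ≫ (𝟙 (𝟙_ (RepS k T)) ⊗ₘ f) ≫ (λ_ A).hom = pr (GMod.dropLeft rfl θ) ≫ f := by
  have e : (𝟙 (𝟙_ (RepS k T)) ⊗ₘ f) ≫ (λ_ A).hom = (λ_ _).hom ≫ f := by
    rw [id_tensorHom, leftUnitor_naturality]
  exact (congrArg (om θ ≫ ·) e).trans ((Category.assoc _ _ _).symm.trans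
    (congrArg (· ≫ f) (om_left θ)))

/-- It suffices to test elements 1 ⊗ q. On these, `io_left` removes the graded unit and `om_left`
the empty part of the decomposition, which leaves the action of a bijection on q. -/
theorem mu_left (X : GradedObject ℕ (RepS k T)) :
    GMod.map (eps k T) (𝟙 ((grPhi k T).obj X)) ≫ mu (𝟙_ _) X ≫ (grPhi k T).map (λ_ X).hom =
      GMod.leftHom ((grPhi k T).obj X) := GMod.hom_ext_unit fun {N n} θ q => by
  obtain ⟨f, rfl⟩ := gc_surj q
  rw [GMod.leftHom_el, GMod.ap_comp, GMod.ap_comp, GMod.map_el, GMod.ap_id, eps_u1, unitCl, mu_el,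
    ap_gc]
  obtain rfl : n = N := by rw [← GMod.card_eq θ, zero_add]
  refine Eq.trans ?_ (GMod.one_sc _).symm
  rw [GMod.move_self, act_gc]
  congr 1
  have e := io_left X n
  rw [← om_left_pr θ f, ← e]
  simp only [tm, Category.assoc]
  have e2 : (unitInv (RepS k T) ⊗ₘ f) = (𝟙 (𝟙_ (RepS k T)) ⊗ₘ f) ≫ (unitInv (RepS k T) ⊗ₘ 𝟙 (X n)) := by
    rw [tensorHom_comp_tensorHom, Category.id_comp, Category.comp_id]
  refine congrArg (om θ ≫ ·) ?_
  exact (congrArg (· ≫ _) e2).trans (Category.assoc _ _ _)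

end Unit

end Deligne

/-! ### The symmetric monoidal functor -/

namespace Deligne

open MonoidalCategory Idempotents Limits

variable {k : Type u} [Field k] {T : k}

variable (k T) in
/-- The functor on families of objects. -/
def grFamily : (repFiltration k T).IsGrObject.FullSubcategory ⥤ SumProj k where
  obj X := ⟨(grPhi k T).obj X.obj, fun n => projProp_phi n _, by
    obtain ⟨N, hN⟩ := X.property.2
    refine ⟨N, fun n hn => subsingleton_of_forall_eq 0 fun x => ?_⟩
    obtain ⟨f, rfl⟩ := gc_surj x
    refine (cl_eq_zero _).2 ?_
    rw [← Category.comp_id f]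
    -- Where the identity of the component is itself lower, every morphism into it is lower, so
    -- almost all modules of the family vanish.
    exact TensorFiltration.factors_comp_left f (hN n hn)⟩
  map f := ObjectProperty.homMk ((grPhi k T).map f.hom)
  map_id _ := ObjectProperty.hom_ext _ ((grPhi k T).map_id _)
  map_comp _ _ := ObjectProperty.hom_ext _ ((grPhi k T).map_comp _ _)

variable (k T) in
/-- The functor from the associated graded category to families of projective modules. -/
def grFunctor : (repFiltration k T).Gr ⥤ SumProj k :=
  CategoryTheory.Quotient.lift _ (grFamily k T) fun _ _ _ _ h =>
    ObjectProperty.hom_ext _ (funext fun n => ModuleCat.hom_ext (phiMap_eq_of_factors (h n)))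

abbrev GrCls {X Y : (repFiltration k T).Gr} (f : X.as ⟶ Y.as) : X ⟶ Y :=
  (CategoryTheory.Quotient.functor _).map f

instance : (grFunctor k T).Additive where
  map_add {X Y f g} := by
    obtain ⟨f⟩ := f
    obtain ⟨g⟩ := g
    exact ObjectProperty.hom_ext _ (funext fun n => (phi k T n).map_add)

instance : (grFunctor k T).Linear k where
  map_smul {X Y} f c := by
    obtain ⟨f⟩ := f
    refine ObjectProperty.hom_ext _ (funext fun n => ?_)
    refine ModuleCat.hom_ext (LinearMap.ext fun x => ?_)
    obtain ⟨h, rfl⟩ := cl_surj x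
    -- Scalars act on homomorphisms of modules through the centre of the opposite group algebra,
    -- which here is multiplication by c at the identity permutation.
    have e : algebraMap k (GrpAlg k n) c = MulOpposite.op (MonoidAlgebra.single 1 c) := by
      rw [MulOpposite.algebraMap_apply]
      simp
    refine Eq.trans (congrArg cl (Linear.comp_smul _ _ _ h c (f.hom n))) ((sc_cl c (h ≫ f.hom n)).symm.trans ?_)
    exact congrArg (· • cl (h ≫ f.hom n)) e.symm

variable (k T) in
/-- `eps` as an isomorphism. -/
def epsGrIso : GMod.unt k ≅ (grPhi k T).obj (𝟙_ (GradedObject ℕ (RepS k T))) :=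
  @asIso _ _ _ _ (eps k T) isIso_eps

/-- `mu` as an isomorphism. -/
def muGrIso (X Y : (repFiltration k T).Gr) :
    GMod.tens ((grPhi k T).obj X.as.obj) ((grPhi k T).obj Y.as.obj) ≅
      (grPhi k T).obj (X.as.obj ⊗ Y.as.obj) :=
  @asIso _ _ _ _ (mu X.as.obj Y.as.obj) (isIso_mu X.as.property.1 Y.as.property.1)

variable (k T) in
/-- The unit isomorphism. -/
def epsIso : 𝟙_ (SumProj k) ≅ (grFunctor k T).obj (𝟙_ _) := (sumProp k).isoMk (epsGrIso k T)

/-- The tensorator. -/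
def muIso (X Y : (repFiltration k T).Gr) :
    (grFunctor k T).obj X ⊗ (grFunctor k T).obj Y ≅ (grFunctor k T).obj (X ⊗ Y) :=
  (sumProp k).isoMk (muGrIso X Y)

/-- The right unitor of `GMod k` is the symmetry followed by the left unitor, so this follows from
`mu_left` and compatibility with the symmetry. -/
theorem mu_right (X : GradedObject ℕ (RepS k T)) :
    GMod.map (𝟙 ((grPhi k T).obj X)) (eps k T) ≫ mu X (𝟙_ _) ≫ (grPhi k T).map (ρ_ X).hom =
      (ρ_ ((grPhi k T).obj X)).hom := by
  rw [← braiding_leftUnitor X, CategoryTheory.Functor.map_comp, ← Category.assoc (mu X _), mu_braid,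
    Category.assoc]
  have h : GMod.map (𝟙 ((grPhi k T).obj X)) (eps k T) ≫ GMod.swap _ _ =
      GMod.swap _ _ ≫ GMod.map (eps k T) (𝟙 ((grPhi k T).obj X)) :=
    GMod.hom_ext fun θ p q => by
      rw [GMod.ap_comp, GMod.ap_comp, GMod.map_el, GMod.swap_el, GMod.swap_el, GMod.map_el]
  rw [← Category.assoc, h, Category.assoc, mu_left]
  rfl

variable (k T) in
/-- The monoidal structure. -/
def grMonoidalCore : (grFunctor k T).CoreMonoidal where
  εIso := epsIso k T
  μIso := muIso
  μIso_hom_natural_left := by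
    rintro X Y ⟨f⟩ Z
    refine ObjectProperty.hom_ext _ ?_
    have h := mu_natural f.hom (𝟙 Z.as.obj)
    rw [CategoryTheory.Functor.map_id, tensorHom_id] at h
    exact h
  μIso_hom_natural_right := by
    rintro X Y Z ⟨f⟩
    refine ObjectProperty.hom_ext _ ?_
    have h := mu_natural (𝟙 Z.as.obj) f.hom
    rw [CategoryTheory.Functor.map_id, id_tensorHom] at h
    exact h
  associativity X Y Z := ObjectProperty.hom_ext _ (mu_assoc (X := X.as.obj) (Y := Y.as.obj))
  left_unitality X := ObjectProperty.hom_ext _ (mu_left X.as.obj).symm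
  right_unitality X := ObjectProperty.hom_ext _ (mu_right X.as.obj).symm

instance : (grFunctor k T).Monoidal := (grMonoidalCore k T).toMonoidal

instance : (grFunctor k T).Braided where
  braided X Y := by
    have h : (muIso X Y).hom ≫ (grFunctor k T).map (β_ X Y).hom = (β_ _ _).hom ≫ (muIso Y X).hom :=
      ObjectProperty.hom_ext _ (mu_braid (X := X.as.obj) (Y := Y.as.obj))
    exact h

end Deligne

/-! ### Full faithfulness and essential surjectivity -/

namespace Deligne

open MonoidalCategory Idempotents Limits

variable {k : Type u} [Field k] {T : k}

section PhiFull

variable {n : ℕ} {X Y : RepS k T}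

/-- A morphism out of an object of step `n` factors through the preceding step if it does so on the
morphisms from `[n]`. -/
theorem factors_of_phiMap_eq (hX : (repFiltration k T).sub n X) {f g : X ⟶ Y}
    (h : phiMap n f = phiMap n g) : FactorsThrough ((repFiltration k T).low n) (f - g) := by
  obtain ⟨c, a, b, -, hab⟩ := exists_resolution_mod_low hX
  -- The resolution splits f - g into a part that starts with a lower morphism and terms a_s ≫ b_s ≫
  -- (f - g); each b_s ≫ (f - g) is lower because b_s starts at [n] and f, g agree on `Phi n`.
  have e : f - g = (𝟙 X - ∑ s ∈ Finset.range c, a s ≫ b s) ≫ (f - g) +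
      ∑ s ∈ Finset.range c, a s ≫ b s ≫ (f - g) := by
    rw [Preadditive.sub_comp, Category.id_comp, Preadditive.sum_comp]
    simp only [Category.assoc, sub_add_cancel]
  rw [e]
  refine TensorFiltration.factors_add (TensorFiltration.factors_comp_right _ hab) ?_
  refine Finset.sum_induction _ (fun f => FactorsThrough ((repFiltration k T).low n) f)
    (fun _ _ => TensorFiltration.factors_add) (TensorFiltration.factors_zero _ _ _)
    fun s _ => TensorFiltration.factors_comp_left _ ?_
  rw [Preadditive.comp_sub, ← cl_eq, ← phiMap_cl, ← phiMap_cl, h]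

/-- It matches being zero in the n-th quotient category with vanishing of the module, which gives
the compatibility with the gradings. -/
theorem factors_one_iff (hX : (repFiltration k T).sub n X) :
    FactorsThrough ((repFiltration k T).low n) (𝟙 X) ↔ Subsingleton (Phi n X) := by
  constructor
  · refine fun h => subsingleton_of_forall_eq 0 fun x => ?_
    obtain ⟨f, rfl⟩ := cl_surj x
    rw [cl_eq_zero, ← Category.comp_id f]
    exact TensorFiltration.factors_comp_left f h
  · intro h
    rw [← sub_zero (𝟙 X)]
    exact factors_of_phiMap_eq hX (LinearMap.ext fun x => Subsingleton.elim _ _)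

/-- X is resolved by maps a_s to and b_s from [n]. The wanted morphism is determined by where the
b_s should go: it is the sum of a_s ≫ y_s, where y_s represents φ of the class of b_s. -/
theorem exists_phiMap_eq (hX : (repFiltration k T).sub n X)
    (φ : Phi n X →ₗ[GrpAlg k n] Phi n Y) : ∃ f : X ⟶ Y, phiMap n f = φ := by
  obtain ⟨c, a, b, -, hab⟩ := exists_resolution_mod_low hX
  choose y hy using fun s => cl_surj (φ (cl (b s)))
  refine ⟨∑ s ∈ Finset.range c, a s ≫ y s, LinearMap.ext fun x => ?_⟩
  obtain ⟨f, rfl⟩ := cl_surj x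
  have e := LinearMap.congr_fun (phiMap_eq_of_factors hab) (cl f)
  rw [phiMap_cl, phiMap_cl, Category.comp_id, Preadditive.comp_sum, cl_sum] at e
  rw [phiMap_cl, Preadditive.comp_sum, cl_sum, e, map_sum]
  refine Finset.sum_congr rfl fun s _ => ?_
  -- The endomorphism f ≫ a_s of [n] acts, modulo lower morphisms, as an element `r` of the group
  -- algebra, and φ is linear over it.
  obtain ⟨r, hr⟩ := exists_smul_cl_one (cl (f ≫ a s))
  have e1 : ∀ {Z : RepS k T} (g : pt k T n ⟶ Z), cl (f ≫ a s ≫ g) = r • cl g := fun g => by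
    have := congrArg (phiMap n g) hr
    rw [map_smul, phiMap_cl, phiMap_cl, Category.id_comp, Category.assoc] at this
    exact this.symm
  rw [e1, e1, hy, map_smul]

end PhiFull

instance : (grFunctor k T).Faithful where
  map_injective {X Y f g} h := by
    obtain ⟨f⟩ := f
    obtain ⟨g⟩ := g
    refine CategoryTheory.Quotient.sound _ fun n => factors_of_phiMap_eq (X.as.property.1 n) ?_
    have h' : (grPhi k T).map f.hom = (grPhi k T).map g.hom := congrArg (·.hom) h
    exact congrArg ModuleCat.Hom.hom (congrFun h' n)

instance : (grFunctor k T).Full where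
  map_surjective {X Y} φ := by
    choose f hf using fun n => exists_phiMap_eq (X.as.property.1 n) (Y := Y.as.obj n)
      (φ.hom n).hom
    exact ⟨GrCls (ObjectProperty.homMk f),
      ObjectProperty.hom_ext _ (funext fun n => ModuleCat.hom_ext (hf n))⟩

theorem grDegree_iff (n : ℕ) (X : (repFiltration k T).Gr) :
    (repFiltration k T).grDegree n X ↔ sumDegree k n ((grFunctor k T).obj X) :=
  forall_congr' fun i => forall_congr' fun _ => factors_one_iff (X.as.property.1 i)

section EssSurj

/-- The endomorphism of `[n]` given by an element of the opposite of the group algebra. -/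
def rp {n : ℕ} (r : GrpAlg k n) : pt k T n ⟶ pt k T n := pa r.unop

theorem rp_comp {n : ℕ} (r r' : GrpAlg k n) : rp (T := T) r ≫ rp r' = rp (r * r') := pa_comp _ _

theorem rp_sum {n : ℕ} {J : Type w} (s : Finset J) (r : J → GrpAlg k n) :
    rp (T := T) (∑ j ∈ s, r j) = ∑ j ∈ s, rp (r j) :=
  map_sum (AddMonoidHom.mk' (fun r : GrpAlg k n => rp (T := T) r) fun _ _ => pa_add _ _) r s

theorem smul_cl {n : ℕ} {X : RepS k T} (r : GrpAlg k n) (f : pt k T n ⟶ X) :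
    r • cl f = cl (rp r ≫ f) := rfl

theorem rp_eq_zero {n : ℕ} {r : GrpAlg k n}
    (h : FactorsThrough ((repFiltration k T).low n) (rp (T := T) r)) : r = 0 :=
  MulOpposite.unop_injective (pa_eq_zero h)

/-- Every finitely generated projective module is obtained from an object of step `n`. -/
theorem exists_phi_iso {n : ℕ} (P : Type u) [AddCommGroup P] [Module (GrpAlg k n) P]
    [Module.Finite (GrpAlg k n) P] [Module.Projective (GrpAlg k n) P] :
    ∃ X : RepS k T, (repFiltration k T).sub n X ∧ Nonempty (P ≃ₗ[GrpAlg k n] Phi n X) := by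
  -- P is presented as a retract of a free module by `r` and `i`; the matrix `e` is the resulting
  -- idempotent in standard coordinates.
  obtain ⟨m, r, hr⟩ := Module.Finite.exists_fin' (GrpAlg k n) P
  obtain ⟨i, hi⟩ := Module.projective_lifting_property r LinearMap.id hr
  let p (s : Fin m) : P := r (Pi.single s 1)
  let e (s t : Fin m) : GrpAlg k n := i (p s) t
  have hp : ∀ x, ∑ s, i x s • p s = x := fun x => by
    have h1 : r (i x) = x := LinearMap.congr_fun hi x
    conv_rhs => rw [← h1, ← Finset.univ_sum_single (i x), map_sum]
    refine Finset.sum_congr rfl fun s _ => ?_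
    rw [← map_smul, ← Pi.single_smul, smul_eq_mul, mul_one]
  have he : ∀ x t, ∑ s, i x s * e s t = i x t := fun x t => by
    conv_rhs => rw [← hp x, map_sum, Finset.sum_apply]
    refine Finset.sum_congr rfl fun s _ => ?_
    rw [map_smul]
    rfl
  let Q : RepS k T := ⨁ fun _ : Fin m => pt k T n
  -- Elements of the group algebra compose in End([n]) exactly, not only modulo lower morphisms. So
  -- `E` is a genuine idempotent of the sum of m copies of [n] and splits in the idempotent
  -- completion.
  let E : Q ⟶ Q := biproduct.matrix fun s t => rp (e s t)
  have hιE : ∀ s, biproduct.ι (fun _ : Fin m => pt k T n) s ≫ E =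
      ∑ t, rp (e s t) ≫ biproduct.ι (fun _ : Fin m => pt k T n) t := fun s => by
    rw [biproduct.ι_matrix, biproduct.lift_eq]
  have hE : E ≫ E = E := biproduct.hom_ext' _ _ fun s => by
    rw [← Category.assoc, hιE, Preadditive.sum_comp]
    simp only [Category.assoc, hιE, Preadditive.comp_sum]
    rw [Finset.sum_comm]
    refine Finset.sum_congr rfl fun t _ => ?_
    rw [← show _ = e s t from he (p s) t, rp_sum, Preadditive.sum_comp]
    exact Finset.sum_congr rfl fun v _ => by rw [← Category.assoc, rp_comp]
  obtain ⟨X, ι, π, h1, h2⟩ := IsIdempotentComplete.idempotents_split Q E hE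
  have hX : (repFiltration k T).sub n X := (repFiltration k T).retract ⟨ι, π, h1⟩
    ((repFiltration k T).sum _ fun _ => sub_pt n)
  let u (s : Fin m) : pt k T n ⟶ X := biproduct.ι (fun _ : Fin m => pt k T n) s ≫ π
  have hu : ∀ s, ∑ t, rp (e s t) ≫ u t = u s := fun s => by
    have h3 := congrArg (· ≫ π) (hιE s)
    simp only [Preadditive.sum_comp, Category.assoc, ← h2, h1, Category.comp_id] at h3
    exact h3.symm
  -- The standard generator p_s of P is to correspond to the class of the s-th copy of [n] projected
  -- to the image of `E`.
  let α : P →ₗ[GrpAlg k n] Phi n X :=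
    (Fintype.linearCombination (GrpAlg k n) fun s => cl (u s)) ∘ₗ i
  have hα : ∀ x, α x = ∑ s, i x s • cl (u s) := fun x => rfl
  have hαp : ∀ s, α (p s) = cl (u s) := fun s => by
    rw [hα, ← hu, cl_sum]
    exact Finset.sum_congr rfl fun t _ => smul_cl _ _
  refine ⟨X, hX, ⟨LinearEquiv.ofBijective α ⟨?_, ?_⟩⟩⟩
  -- Including X back into the sum of copies of [n] and projecting to the t-th copy recovers the
  -- coordinate `i x t` as an endomorphism of [n], and the group algebra meets the lower morphisms
  -- in zero.
  · refine (injective_iff_map_eq_zero α).2 fun x hx => ?_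
    have : i x = 0 := funext fun t => rp_eq_zero (T := T) (by
      have h3 := congrArg (phiMap n (ι ≫ biproduct.π _ t)) hx
      rw [hα, map_sum, map_zero] at h3
      rw [← cl_eq_zero, ← h3, ← he, rp_sum, cl_sum]
      refine Finset.sum_congr rfl fun s _ => ?_
      rw [map_smul, phiMap_cl, smul_cl, ← rp_comp]
      refine congrArg cl (congrArg (rp (i x s) ≫ ·) ?_)
      have h4 := congrArg (· ≫ biproduct.π _ t) (hιE s)
      simp only [Preadditive.sum_comp, Category.assoc, biproduct.ι_π] at h4
      rw [Finset.sum_eq_single t (fun v _ hv => by rw [dif_neg hv, comp_zero]) (by simp)] at h4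
      rw [dif_pos rfl, eqToHom_refl, Category.comp_id, ← h2] at h4
      simp only [Category.assoc] at h4 ⊢
      exact h4.symm.trans (Category.assoc _ _ _).symm)
    rw [← hp x, this]
    simp
  · intro x
    obtain ⟨f, rfl⟩ := cl_surj x
    -- The coordinates of f in the sum of copies of [n] are, modulo lower morphisms, elements of the
    -- group algebra; they are the coefficients of a preimage.
    choose a ha using fun t => exists_smul_cl_one (cl (f ≫ ι ≫ biproduct.π (fun _ : Fin m => pt k T n) t))
    refine ⟨∑ t, a t • p t, ?_⟩
    rw [map_sum]
    have : cl f = ∑ t, cl ((f ≫ ι ≫ biproduct.π (fun _ : Fin m => pt k T n) t) ≫ u t) := by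
      rw [← cl_sum]
      refine congrArg cl ?_
      have h3 := congrArg (fun g => f ≫ ι ≫ g ≫ π) (biproduct.total (f := fun _ : Fin m => pt k T n))
      simp only [Preadditive.sum_comp, Preadditive.comp_sum, Category.assoc] at h3
      refine Eq.trans ?_ (h3.symm.trans ?_)
      · rw [Category.id_comp, h1, Category.comp_id]
      · exact Finset.sum_congr rfl fun t _ => by simp only [u, Category.assoc]
    rw [this]
    refine Finset.sum_congr rfl fun t _ => ?_
    rw [map_smul, hαp, ← phiMap_cl (u t), ← ha, map_smul, phiMap_cl, Category.id_comp]

end EssSurj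

instance : (grFunctor k T).EssSurj where
  mem_essImage P := by
    have := fun n => (P.property.1 n).1
    have := fun n => (P.property.1 n).2
    choose X hX e using fun n => exists_phi_iso (T := T) (n := n) (P.obj n)
    let Y : (repFiltration k T).Gr := ⟨⟨X, hX, by
      obtain ⟨N, hN⟩ := P.property.2
      refine ⟨N, fun n hn => (factors_one_iff (hX n)).2 ?_⟩
      have := hN n hn
      exact (e n).some.symm.toEquiv.subsingleton⟩⟩
    exact ⟨Y, ⟨(sumProp k).isoMk (Pi.isoMk fun n => (e n).some.symm.toModuleIso)⟩⟩

instance : (grFunctor k T).IsEquivalence where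

end Deligne

/-! ### The associated graded Grothendieck group -/

namespace Deligne

open MonoidalCategory Idempotents Limits

/-- A family of additive isomorphisms that respects products is a ring isomorphism of the direct
sums. -/
def directSumRingEquiv {A : ℕ → Type v} {B : ℕ → Type w} [∀ n, AddCommGroup (A n)]
    [∀ n, AddCommGroup (B n)] [DirectSum.GCommRing A] [DirectSum.GCommRing B] (e : ∀ n, A n ≃+ B n)
    (h : ∀ m n (x : A m) (y : A n), e (m + n) (GradedMonoid.GMul.mul x y) =
      GradedMonoid.GMul.mul (e m x) (e n y)) : DirectSum ℕ A ≃+* DirectSum ℕ B :=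
  { DFinsupp.mapRange.addEquiv e with
    map_mul' := by
      let f : DirectSum ℕ A →+ DirectSum ℕ B := (DFinsupp.mapRange.addEquiv e).toAddMonoidHom
      have hf : ∀ n x, f (DirectSum.of A n x) = DirectSum.of B n (e n x) := fun n x =>
        DFinsupp.mapRange_single (hf := fun i => map_zero (e i))
      intro x y
      refine DFunLike.congr_fun (DFunLike.congr_fun (DirectSum.addHom_ext'
        (f := (AddMonoidHom.mul (R := DirectSum ℕ A)).compr₂ f)
        (g := ((AddMonoidHom.mul (R := DirectSum ℕ B)).comp f).compl₂ f) fun m => AddMonoidHom.ext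
        fun x => DirectSum.addHom_ext' fun n => AddMonoidHom.ext fun y => ?_) x) y
      change f (DirectSum.of A m x * DirectSum.of A n y) = f (DirectSum.of A m x) * f (DirectSum.of A n y)
      rw [DirectSum.of_mul_of, hf, hf, hf, DirectSum.of_mul_of, h] }

theorem directSumRingEquiv_of {A : ℕ → Type v} {B : ℕ → Type w} [∀ n, AddCommGroup (A n)]
    [∀ n, AddCommGroup (B n)] [DirectSum.GCommRing A] [DirectSum.GCommRing B] (e : ∀ n, A n ≃+ B n)
    (h) (n : ℕ) (x : A n) : directSumRingEquiv e h (DirectSum.of A n x) =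
      DirectSum.of B n (e n x) :=
  DFinsupp.mapRange_single (hf := fun i => map_zero (e i))

variable {k : Type u} [Field k] {T : k}

theorem hasZeroObject_proj (n : ℕ) : HasZeroObject (Proj k n) := by
  refine ⟨⟨⟨ModuleCat.of _ PUnit, inferInstance, inferInstance⟩, ?_⟩⟩
  rw [IsZero.iff_id_eq_zero]
  apply ObjectProperty.hom_ext
  exact ModuleCat.hom_ext (LinearMap.ext fun x => rfl)

instance (n : ℕ) : HasZeroObject (Proj k n) := hasZeroObject_proj n

variable (k T) in
/-- The functor `phi`, with values in projective modules. -/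
def phiProj (n : ℕ) : RepS k T ⥤ Proj k n := (projProp k n).lift (phi k T n) (projProp_phi n)

instance (n : ℕ) : (phiProj k T n).Additive where
  map_add := ObjectProperty.hom_ext _ (phi k T n).map_add

theorem isDirectSum_map {C : Type v} [Category.{w} C] [Preadditive C] {D : Type u} [Category.{w} D]
    [Preadditive D] (F : C ⥤ D) [F.Additive] {Z X Y : C} (h : IsDirectSum Z X Y) :
    IsDirectSum (F.obj Z) (F.obj X) (F.obj Y) := by
  obtain ⟨a, b, p, q, h1, h2, h3, h4, h5⟩ := h
  refine ⟨F.map a, F.map b, F.map p, F.map q, ?_, ?_, ?_, ?_, ?_⟩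
  · rw [← F.map_comp, h1, F.map_id]
  · rw [← F.map_comp, h2, F.map_zero]
  · rw [← F.map_comp, h3, F.map_zero]
  · rw [← F.map_comp, h4, F.map_id]
  · rw [← F.map_comp, ← F.map_comp, ← F.map_add, h5, F.map_id]

variable (k T) in
/-- The map of Grothendieck groups induced by `phi`. -/
def phiK (n : ℕ) : K0 (RepS k T) →+ SymK k n :=
  K0.lift (fun X => K0.cls ((phiProj k T n).obj X)) fun _ _ _ h => K0.cls_sum (isDirectSum_map _ h)

theorem phiK_cls (n : ℕ) (X : RepS k T) : phiK k T n (K0.cls X) = K0.cls ((phiProj k T n).obj X) :=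
  K0.lift_cls _ _ X

theorem cls_proj_eq_zero {n : ℕ} (P : Proj k n) (h : Subsingleton P.obj) : K0.cls P = 0 :=
  K0.cls_zero ((IsZero.iff_id_eq_zero _).2 (ObjectProperty.hom_ext _
    (ModuleCat.hom_ext (LinearMap.ext fun _ => Subsingleton.elim (α := P.obj) _ _))))

theorem subsingleton_phi_of_low {n : ℕ} {X : RepS k T} (h : (repFiltration k T).low n X) :
    Subsingleton (Phi n X) := by
  refine subsingleton_of_forall_eq 0 fun x => ?_
  obtain ⟨f, rfl⟩ := cl_surj x
  exact (cl_eq_zero _).2 ⟨X, f, 𝟙 X, h, Category.comp_id _⟩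

/-- Morphisms from [n] into an object of step n - 1 are all lower, so `Phi n` of such an object is
zero. Hence `phiK` passes to the graded piece. -/
theorem phiK_low {n : ℕ} {x : K0 (RepS k T)} (h : x ∈ (repFiltration k T).k0Filtration.low n) :
    phiK k T n x = 0 := by
  cases n with
  | zero =>
    have h' : x = 0 := h
    rw [h', map_zero]
  | succ n =>
    refine (AddSubgroup.closure_le (K := (phiK k T (n + 1)).ker)).2 ?_ h
    rintro _ ⟨X, hX, rfl⟩
    exact (phiK_cls _ _).trans (cls_proj_eq_zero _ (subsingleton_phi_of_low hX))

theorem cls_mem_low {n : ℕ} {X : RepS k T} (h : (repFiltration k T).low n X) :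
    K0.cls X ∈ (repFiltration k T).k0Filtration.low n := by
  cases n with
  | zero =>
    rw [K0.cls_zero h]
    exact zero_mem _
  | succ n => exact AddSubgroup.subset_closure ⟨X, h, rfl⟩

theorem toGr_eq {n : ℕ} {x y : K0 (RepS k T)} (hx : x ∈ (repFiltration k T).k0Filtration.sub n)
    (hy : y ∈ (repFiltration k T).k0Filtration.sub n)
    (h : x - y ∈ (repFiltration k T).k0Filtration.low n) :
    RingFiltration.toGr n x hx = RingFiltration.toGr n y hy := by
  refine ((QuotientAddGroup.eq (s := ((repFiltration k T).k0Filtration.low n).addSubgroupOf _)).2 ?_).symm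
  change -y + x ∈ (repFiltration k T).k0Filtration.low n
  rwa [neg_add_eq_sub]

theorem sub_of_low {n : ℕ} {X : RepS k T} (h : (repFiltration k T).low n X) :
    (repFiltration k T).sub n X := by
  cases n with
  | zero => exact TensorFiltration.sub_of_isZero h
  | succ n => exact (repFiltration k T).mono n.le_succ h

theorem sub_of_isDirectSum {n : ℕ} {X Y Z : RepS k T} (h : IsDirectSum Z X Y)
    (hX : (repFiltration k T).sub n X) (hY : (repFiltration k T).sub n Y) :
    (repFiltration k T).sub n Z := by
  obtain ⟨a, b, p, q, -, -, -, -, h5⟩ := h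
  have hX' : summands (fun X => ∃ i ≤ n, X = ob k T i) X := hX
  have hY' : summands (fun X => ∃ i ≤ n, X = ob k T i) Y := hY
  have h' : summands (summands (fun X => ∃ i ≤ n, X = ob k T i)) Z :=
    summands_intro (J := Bool) (fun j => cond j X Y) (fun | true => hX' | false => hY')
      (fun | true => p | false => q) (fun | true => a | false => b)
      ((Fintype.sum_bool _).trans h5)
  exact summands_summands h'

theorem nonempty_iso_of_isDirectSum {C : Type v} [Category.{w} C] [Preadditive C]
    {X Y Z X' Y' Z' : C} (h : IsDirectSum Z X Y) (h' : IsDirectSum Z' X' Y') (e : X ≅ X')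
    (e' : Y ≅ Y') : Nonempty (Z ≅ Z') := by
  obtain ⟨a, b, p, q, h1, h2, h3, h4, h5⟩ := h
  obtain ⟨a', b', p', q', h1', h2', h3', h4', h5'⟩ := h'
  refine ⟨⟨p ≫ e.hom ≫ a' + q ≫ e'.hom ≫ b', p' ≫ e.inv ≫ a + q' ≫ e'.inv ≫ b, ?_, ?_⟩⟩
  · simp only [Preadditive.add_comp, Preadditive.comp_add, Category.assoc, reassoc_of% h1',
      reassoc_of% h2', reassoc_of% h3', reassoc_of% h4', Iso.hom_inv_id_assoc, zero_comp, comp_zero,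
      add_zero, zero_add, h5]
  · simp only [Preadditive.add_comp, Preadditive.comp_add, Category.assoc, reassoc_of% h1,
      reassoc_of% h2, reassoc_of% h3, reassoc_of% h4, Iso.inv_hom_id_assoc, zero_comp, comp_zero,
      add_zero, zero_add, h5']

theorem isDirectSum_biprod {C : Type v} [Category.{w} C] [Preadditive C] (X Y : C)
    [HasBinaryBiproduct X Y] : IsDirectSum (X ⊞ Y) X Y :=
  ⟨biprod.inl, biprod.inr, biprod.fst, biprod.snd, biprod.inl_fst, biprod.inl_snd, biprod.inr_fst,
    biprod.inr_snd, biprod.total⟩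

/-- Objects of step `n` with isomorphic values under `phi` have the same class in the associated
graded ring. -/
theorem grCls_eq {n : ℕ} {X Y : RepS k T} (hX : (repFiltration k T).sub n X)
    (hY : (repFiltration k T).sub n Y) (e : Phi n X ≃ₗ[GrpAlg k n] Phi n Y) :
    (repFiltration k T).grCls n X hX = (repFiltration k T).grCls n Y hY := by
  obtain ⟨f, hf⟩ := exists_phiMap_eq (Y := Y) hX e.toLinearMap
  obtain ⟨g, hg⟩ := exists_phiMap_eq (Y := X) hY e.symm.toLinearMap
  -- The lifts f and g of the two inverse isomorphisms are inverse only modulo lower morphisms; the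
  -- error 1 - f ≫ g passes through a lower object Z.
  have hlow : FactorsThrough ((repFiltration k T).low n) (𝟙 X - f ≫ g) := by
    refine factors_of_phiMap_eq hX (LinearMap.ext fun x => ?_)
    rw [phiMap_id, phiMap_comp, hf, hg]
    exact (e.symm_apply_apply x).symm
  obtain ⟨Z, a, b, hZ, hab⟩ := hlow
  have := hasBinaryBiproducts_of_finite_biproducts (RepS k T)
  -- Adding Z to Y absorbs the error, so that X becomes an honest direct summand of Y ⊞ Z. The
  -- complement W is the image of 1 - r ≫ s.
  let s : X ⟶ Y ⊞ Z := biprod.lift f a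
  let r : Y ⊞ Z ⟶ X := biprod.desc g b
  have hsr : s ≫ r = 𝟙 X := by
    rw [biprod.lift_desc, hab]
    abel
  obtain ⟨W, i, p, h1, h2⟩ := IsIdempotentComplete.idempotents_split (Y ⊞ Z) (𝟙 _ - r ≫ s) (by
    simp only [Preadditive.comp_sub, Preadditive.sub_comp, Category.id_comp, Category.comp_id,
      Category.assoc, reassoc_of% hsr, sub_self, sub_zero])
  have hsp : s ≫ p = 0 := by
    have h3 := congrArg (s ≫ · ≫ p) h2
    simp only [Category.assoc, h1, Category.comp_id, Preadditive.sub_comp, Preadditive.comp_sub,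
      Category.id_comp, reassoc_of% hsr, sub_self] at h3
    exact h3
  have hir : i ≫ r = 0 := by
    have h3 := congrArg (i ≫ · ≫ r) h2
    simp only [Category.assoc, reassoc_of% h1, Preadditive.sub_comp,
      Category.id_comp, hsr, Category.comp_id, sub_self] at h3
    exact h3.trans comp_zero
  have hW : IsDirectSum (Y ⊞ Z) X W := ⟨s, i, r, p, hsr, hsp, hir, h1, by rw [h2]; abel⟩
  have hYZ := isDirectSum_biprod Y Z
  have hZ0 := subsingleton_phi_of_low hZ
  -- Since `Phi n` of Z vanishes, elements of `Phi n` of Y ⊞ Z come from Y.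
  have hx : ∀ x : Phi n (Y ⊞ Z), phiMap n biprod.inl (phiMap n biprod.fst x) = x := fun x => by
    obtain ⟨h, rfl⟩ := cl_surj x
    have h3 : cl (h ≫ biprod.snd) = 0 := Subsingleton.elim _ _
    conv_rhs => rw [← Category.comp_id h, ← biprod.total, Preadditive.comp_add, cl_add,
      ← Category.assoc, ← Category.assoc, ← phiMap_cl biprod.inr, h3, map_zero, add_zero]
    rfl
  have hlow' : FactorsThrough ((repFiltration k T).low n) (𝟙 (Y ⊞ Z) - r ≫ s) := by
    refine factors_of_phiMap_eq ?_ (LinearMap.ext fun x => ?_)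
    · exact sub_of_isDirectSum hYZ hY (sub_of_low hZ)
    · rw [phiMap_id, ← hx x]
      generalize phiMap n biprod.fst x = y
      have h4 : phiMap n r (phiMap n biprod.inl y) = e.symm y := by
        rw [← phiMap_comp]
        exact (congrArg (fun g => phiMap n g y) (biprod.inl_desc g b)).trans (LinearMap.congr_fun hg y)
      have h5 : phiMap n biprod.fst (phiMap n s (e.symm y)) = y := by
        rw [← phiMap_comp]
        refine (congrArg (fun g => phiMap n g (e.symm y)) (biprod.lift_fst f a)).trans
          ((LinearMap.congr_fun hf _).trans (e.apply_symm_apply y))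
      rw [phiMap_comp, h4, ← hx (phiMap n s _), h5]
  -- On `Phi n` the composite r ≫ s is the identity, so 1 - r ≫ s is lower and its image W is a
  -- summand of a lower object.
  have hWlow : (repFiltration k T).low n W := by
    obtain ⟨V, a', b', hV, h3⟩ := hlow'
    refine TensorFiltration.low_retract ⟨i ≫ a', b' ≫ p, ?_⟩ hV
    rw [Category.assoc, reassoc_of% h3, ← h2, Category.assoc, reassoc_of% h1, h1]
  refine toGr_eq _ _ ?_
  -- The two decompositions of Y ⊞ Z give [X] - [Y] = [Z] - [W], and both classes on the right are
  -- lower.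
  have e1 := (K0.cls_sum hYZ).symm.trans (K0.cls_sum hW)
  have e2 : K0.cls X - K0.cls Y = K0.cls Z - K0.cls W := by
    rw [sub_eq_sub_iff_add_eq_add, ← e1, add_comm]
  rw [e2]
  exact sub_mem (cls_mem_low hZ) (cls_mem_low hWlow)

variable (k T) in
/-- The map from the associated graded group induced by `phi`. -/
def grToSym (n : ℕ) : (repFiltration k T).k0Filtration.gr n →+ SymK k n :=
  QuotientAddGroup.lift _ ((phiK k T n).comp (AddSubgroup.subtype _)) fun _ hx => phiK_low hx

theorem grToSym_grCls {n : ℕ} {X : RepS k T} (h : (repFiltration k T).sub n X) :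
    grToSym k T n ((repFiltration k T).grCls n X h) = K0.cls ((phiProj k T n).obj X) :=
  phiK_cls n X

variable (T) in
theorem exists_phiProj_iso {n : ℕ} (P : Proj k n) :
    ∃ X : RepS k T, (repFiltration k T).sub n X ∧ Nonempty (P.obj ≃ₗ[GrpAlg k n] Phi n X) := by
  have := P.property.1
  have := P.property.2
  exact exists_phi_iso P.obj

variable (T) in
/-- The inverse map. -/
def symToGr (n : ℕ) : SymK k n →+ (repFiltration k T).k0Filtration.gr n :=
  K0.lift (fun P => (repFiltration k T).grCls n _ (exists_phiProj_iso T P).choose_spec.1)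
    fun R P Q h => by
      have := hasBinaryBiproducts_of_finite_biproducts (RepS k T)
      have hP := (exists_phiProj_iso T P).choose_spec
      have hQ := (exists_phiProj_iso T Q).choose_spec
      have hR := (exists_phiProj_iso T R).choose_spec
      -- The direct sum of the objects chosen for P and Q represents R as well, so by `grCls_eq` it
      -- has the same graded class as the object chosen for R.
      have hS := isDirectSum_biprod (exists_phiProj_iso T P).choose (exists_phiProj_iso T Q).choose
      obtain ⟨e⟩ := nonempty_iso_of_isDirectSum (isDirectSum_map (phiProj k T n) hS) h
        ((projProp k n).isoMk hP.2.some.symm.toModuleIso)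
        ((projProp k n).isoMk hQ.2.some.symm.toModuleIso)
      have e' := ((projProp k n).ι.mapIso e).toLinearEquiv
      refine (grCls_eq hR.1 (sub_of_isDirectSum hS hP.1 hQ.1)
        (hR.2.some.symm.trans e'.symm)).trans ?_
      exact (RingFiltration.toGr_congr _ (K0.cls_sum hS)).trans
        (RingFiltration.toGr_add (F := (repFiltration k T).k0Filtration) _ _).symm

/-- Any object of step n that represents P may be used in place of the chosen one, by `grCls_eq`. -/
theorem symToGr_cls {n : ℕ} {P : Proj k n} {X : RepS k T} (hX : (repFiltration k T).sub n X)
    (e : P.obj ≃ₗ[GrpAlg k n] Phi n X) :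
    symToGr T n (K0.cls P) = (repFiltration k T).grCls n X hX :=
  (K0.lift_cls _ _ P).trans (grCls_eq _ _
    ((exists_phiProj_iso T P).choose_spec.2.some.symm.trans e))

theorem gr_hom_ext {n : ℕ} {A : Type w} [AddCommGroup A]
    {f g : (repFiltration k T).k0Filtration.gr n →+ A}
    (h : ∀ X hX, f ((repFiltration k T).grCls n X hX) = g ((repFiltration k T).grCls n X hX)) :
    f = g := by
  refine QuotientAddGroup.addMonoidHom_ext _ (AddMonoidHom.ext fun ⟨x, hx⟩ => ?_)
  refine AddSubgroup.closure_induction (p := fun x hx => f (RingFiltration.toGr n x hx) =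
    g (RingFiltration.toGr n x hx)) ?_ ?_ ?_ ?_ hx
  · rintro _ ⟨X, hX, rfl⟩
    exact h X hX
  · exact f.map_zero.trans g.map_zero.symm
  · intro x y hx hy h h'
    exact (f.map_add _ _).trans ((congrArg₂ (· + ·) h h').trans (g.map_add _ _).symm)
  · intro x hx h
    exact (f.map_neg _).trans ((congrArg Neg.neg h).trans (g.map_neg _).symm)

variable (k T) in
/-- The isomorphism in each degree. -/
def grEquiv (n : ℕ) : (repFiltration k T).k0Filtration.gr n ≃+ SymK k n :=
  AddMonoidHom.toAddEquiv (grToSym k T n) (symToGr T n)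
    (gr_hom_ext fun X hX => by
      rw [AddMonoidHom.comp_apply, grToSym_grCls]
      exact symToGr_cls hX (LinearEquiv.refl _ _))
    (K0.hom_ext fun P => by
      obtain ⟨X, hX, ⟨e⟩⟩ := exists_phiProj_iso T P
      rw [AddMonoidHom.comp_apply, symToGr_cls hX e, grToSym_grCls]
      exact K0.cls_iso ((projProp k n).isoMk e.symm.toModuleIso))

end Deligne

/-! ### Multiplicativity of the graded isomorphism -/

namespace Deligne

open MonoidalCategory Idempotents Limits
open scoped ZeroObject

variable {k : Type u} [Field k] {T : k}

open scoped Classical in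
/-- An object of step `n`, as a family concentrated in degree `n`. -/
def concentrated {n : ℕ} (X : RepS k T) (hX : (repFiltration k T).sub n X) : (repFiltration k T).Gr :=
  ⟨⟨fun i => if i = n then X else 0, fun i => by
      by_cases h : i = n
      · subst h
        exact (congrArg _ (if_pos rfl)).mpr hX
      · refine (congrArg _ (if_neg h)).mpr ?_
        exact TensorFiltration.sub_of_isZero (isZero_zero _), n + 1, fun i hi => by
      have : (fun i => if i = n then X else 0) i = (0 : RepS k T) := if_neg (by omega)
      rw [(isZero_zero (RepS k T)).of_iso (eqToIso this) |>.eq_of_tgt (𝟙 _) 0]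
      exact TensorFiltration.factors_zero _ _ _⟩⟩

theorem concentrated_self {n : ℕ} (X : RepS k T) (hX : (repFiltration k T).sub n X) :
    (concentrated X hX).as.obj n = X := if_pos rfl

theorem isZero_concentrated {n i : ℕ} (X : RepS k T) (hX : (repFiltration k T).sub n X) (h : i ≠ n) :
    IsZero ((concentrated X hX).as.obj i) :=
  (isZero_zero (RepS k T)).of_iso (eqToIso (if_neg h))

theorem sumDegree_concentrated {n : ℕ} (X : RepS k T) (hX : (repFiltration k T).sub n X) :
    sumDegree k n ((grFunctor k T).obj (concentrated X hX)) := fun _ hi =>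
  subsingleton_phi_of_low (TensorFiltration.low_of_isZero (isZero_concentrated X hX hi))

theorem compK_grFunctor (n : ℕ) (X : (repFiltration k T).Gr) :
    compK n (K0.cls ((grFunctor k T).obj X)) = phiK k T n (K0.cls (X.as.obj n)) :=
  (compK_cls _).trans (phiK_cls n _).symm

theorem inclK_phiK {n : ℕ} (X : RepS k T) (hX : (repFiltration k T).sub n X) :
    inclK n (phiK k T n (K0.cls X)) = K0.cls ((grFunctor k T).obj (concentrated X hX)) := by
  have h : phiK k T n (K0.cls X) =
      K0.cls (comp n ((grFunctor k T).obj (concentrated X hX))) := by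
    rw [← compK_cls, compK_grFunctor, concentrated_self]
  rw [h, inclK_cls, cls_incl_comp (sumDegree_concentrated X hX)]

/-- The tensor product of two concentrated families. -/
def tensorConcentratedIso {m n : ℕ} {X Y : GradedObject ℕ (RepS k T)} (hX : ∀ i, i ≠ m → IsZero (X i))
    (hY : ∀ i, i ≠ n → IsZero (Y i)) : (X ⊗ Y : GradedObject ℕ (RepS k T)) (m + n) ≅ X m ⊗ Y n where
  hom := po X Y rfl
  inv := io X Y rfl
  hom_inv_id := io_ext fun {i j} h => by
    by_cases hi : i = m
    · subst hi
      obtain rfl : j = n := by omega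
      refine (Category.assoc _ _ _).symm.trans ?_
      rw [io_po, Category.id_comp, Category.comp_id]
    · have hz : IsZero (X i ⊗ Y j) := (IsZero.iff_id_eq_zero _).2 (by
        rw [← id_tensorHom_id, (hX i hi).eq_of_src (𝟙 (X i)) 0, MonoidalPreadditive.zero_tensor])
      exact hz.eq_of_src _ _
  inv_hom_id := io_po X Y rfl

/-- X and Y are viewed as families concentrated in degrees m and n. The component of degree m + n of
their tensor product is X ⊗ Y, and the tensorator of `grFunctor` turns it into the induction
product. -/
theorem phiK_mul {m n : ℕ} {X Y : RepS k T} (hX : (repFiltration k T).sub m X)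
    (hY : (repFiltration k T).sub n Y) : phiK k T (m + n) (K0.cls X * K0.cls Y) =
      symMul m n (phiK k T m (K0.cls X)) (phiK k T n (K0.cls Y)) := by
  rw [symMul, inclK_phiK X hX, inclK_phiK Y hY, K0.cls_mul, K0.cls_mul,
    K0.cls_iso (Functor.Monoidal.μIso (grFunctor k T) _ _), compK_grFunctor]
  refine congrArg _ (Eq.trans ?_ (K0.cls_iso (tensorConcentratedIso
    (fun _ => isZero_concentrated X hX) (fun _ => isZero_concentrated Y hY))).symm)
  rw [concentrated_self, concentrated_self]

theorem grEquiv_mul (m n : ℕ) (x : (repFiltration k T).k0Filtration.gr m)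
    (y : (repFiltration k T).k0Filtration.gr n) : grEquiv k T (m + n) (GradedMonoid.GMul.mul x y) =
      GradedMonoid.GMul.mul (grEquiv k T m x) (grEquiv k T n y) := by
  have key : ((RingFiltration.mulHom m n).compr₂ (grToSym k T (m + n)) :
      (repFiltration k T).k0Filtration.gr m →+ (repFiltration k T).k0Filtration.gr n →+ _) =
      ((DirectSum.gMulHom (SymK k) (i := m) (j := n)).comp (grToSym k T m)).compl₂ (grToSym k T n) :=
    gr_hom_ext fun X hX => gr_hom_ext fun Y hY => phiK_mul hX hY
  exact DFunLike.congr_fun (DFunLike.congr_fun key x) y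

variable (k T) in
/-- The isomorphism of graded rings induced by the equivalence. -/
def grK0Equiv : (repFiltration k T).GrK0 ≃+* SymRing k :=
  directSumRingEquiv (grEquiv k T) grEquiv_mul

theorem isGraded_grK0Equiv : IsGraded (grK0Equiv k T) := fun n x =>
  ⟨grEquiv k T n x, directSumRingEquiv_of _ _ n x⟩

theorem grK0Equiv_grCls (n : ℕ) (X : (repFiltration k T).Gr) : grK0Equiv k T
    (DirectSum.of _ n ((repFiltration k T).grCls n (X.as.obj n) (X.as.property.1 n))) =
      DirectSum.of (SymK k) n (K0.cls (comp n ((grFunctor k T).obj X))) :=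
  (directSumRingEquiv_of _ _ n _).trans (congrArg _ (grToSym_grCls (X.as.property.1 n)))

end Deligne

/-! ### Powers and inverses of permutations up to conjugacy -/

namespace Deligne

section Perm

variable {α : Type} [Fintype α] [DecidableEq α]

/-- For a single cycle, a power coprime to its order is a cycle with the same support. For disjoint
products the order is the least common multiple, so coprimality passes to the factors. -/
theorem cycleType_pow_of_coprime (σ : Equiv.Perm α) :
    ∀ i : ℕ, i.Coprime (orderOf σ) → (σ ^ i).cycleType = σ.cycleType := by
  induction σ using Equiv.Perm.cycle_induction_on with
  | base_one => intro i _; rw [one_pow]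
  | base_cycles σ hσ =>
    intro i hi
    rw [(hσ.pow_iff.2 hi).cycleType, hσ.cycleType, Equiv.Perm.support_pow_coprime hi]
  | induction_disjoint σ τ h _ hσ hτ =>
    intro i hi
    rw [h.orderOf] at hi
    rw [h.commute.mul_pow, (h.pow_disjoint_pow i i).cycleType_mul, h.cycleType_mul,
      hσ i (hi.coprime_dvd_right (Nat.dvd_lcm_left _ _)),
      hτ i (hi.coprime_dvd_right (Nat.dvd_lcm_right _ _))]

theorem isConj_pow_of_coprime {σ : Equiv.Perm α} {i : ℕ} (h : i.Coprime (orderOf σ)) :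
    IsConj σ (σ ^ i) :=
  Equiv.Perm.isConj_of_cycleType_eq (cycleType_pow_of_coprime σ i h).symm

/-- A permutation is conjugate to its inverse by a permutation that fixes a given point. -/
theorem exists_conj_inv (a : α) (g : Equiv.Perm α) :
    ∃ h : Equiv.Perm α, h a = a ∧ h * g * h⁻¹ = g⁻¹ := by
  classical
  -- A base point is chosen in every cycle, with `a` as the base point of its own cycle.
  have hr : ∀ x, ∃ r : α, g.SameCycle r x ∧ (g.SameCycle a x → r = a) := fun x => by
    by_cases h : g.SameCycle a x
    · exact ⟨a, h, fun _ => rfl⟩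
    · exact ⟨x, Equiv.Perm.SameCycle.refl _ _, fun h' => (h h').elim⟩
  let s : Setoid α := Equiv.Perm.SameCycle.setoid g
  choose r0 hr0 ha0 using hr
  let r : α → α := fun x => r0 (Quotient.out (Quotient.mk s x))
  have hout : ∀ x, g.SameCycle (Quotient.out (Quotient.mk s x)) x := fun x => Quotient.mk_out x
  have hrx : ∀ x, g.SameCycle (r x) x := fun x => (hr0 _).trans (hout x)
  have hrc : ∀ x y, g.SameCycle x y → r x = r y := fun x y h => by
    simp only [r, show Quotient.mk s x = Quotient.mk s y from Quotient.sound h]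
  have hra : r a = a := ha0 _ (hout a).symm
  choose i hi using hrx
  -- The conjugating permutation reflects each cycle at its base point: it sends the j-th successor
  -- of the base point to the j-th predecessor. Thus it fixes `a` and reverses `g`.
  let h : α → α := fun x => (g ^ (-i x)) (r x)
  have key : ∀ x (j : ℤ), r x = x → h ((g ^ j) x) = (g ^ (-j)) x := by
    intro x j hx
    have h1 : r ((g ^ j) x) = x := (hrc _ _ ⟨j, rfl⟩).symm.trans hx
    have h2 := hi ((g ^ j) x)
    rw [h1] at h2
    simp only [h, h1]
    generalize i ((g ^ j) x) = n at h2 ⊢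
    have h3 := congrArg (g ^ (-n + -j)) h2
    rwa [← Equiv.Perm.mul_apply, ← Equiv.Perm.mul_apply, ← zpow_add, ← zpow_add,
      neg_add_cancel_right, neg_add_cancel_comm, eq_comm] at h3
  have hrr : ∀ x, r (r x) = r x := fun x => hrc _ _ ⟨i x, hi x⟩
  have hinv : ∀ x, h (h x) = x := fun x => (key (r x) (-i x) (hrr x)).trans (by rw [neg_neg, hi])
  refine ⟨⟨h, h, hinv, hinv⟩, ?_, ?_⟩
  · exact key a 0 hra
  · rw [mul_inv_eq_iff_eq_mul]
    ext x
    change h (g x) = g⁻¹ (h x)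
    obtain ⟨y, j, hy, rfl⟩ : ∃ y, ∃ j : ℤ, r y = y ∧ (g ^ j) y = x := ⟨r x, i x, hrr x, hi x⟩
    rw [key y j hy, ← Equiv.Perm.mul_apply, ← zpow_one_add, key y _ hy, neg_add, zpow_add,
      zpow_neg_one, Equiv.Perm.mul_apply]

end Perm

end Deligne

/-! ### Group algebras of symmetric groups split over prime fields: traces -/

namespace Deligne

/-- Every surjection from `A` onto a matrix ring over a finite-dimensional division algebra over `F`
has `F` itself as its division algebra. -/
def IsSplitAlg (F A : Type) [Field F] [Ring A] [Algebra F A] : Prop :=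
  ∀ (d : ℕ) (_ : NeZero d) (D : Type) (_ : DivisionRing D) (_ : Algebra F D)
    (_ : Module.Finite F D) (ρ : A →ₐ[F] Matrix (Fin d) (Fin d) D),
    Function.Surjective ρ → Function.Surjective (algebraMap F D)

section Trace

/-- Over an algebraic closure this is the additivity of Frobenius on eigenvalues; here it is read
off from characteristic polynomials. -/
theorem trace_pow_char {K n : Type} [Field K] [Fintype n] [DecidableEq n] (p : ℕ)
    [Fact p.Prime] [CharP K p] (N : Matrix n n K) :
    (N ^ p).trace = N.trace ^ p := by
  open Polynomial in
  rcases isEmpty_or_nonempty n with h | h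
  · simp [Matrix.trace, (Fact.out : p.Prime).ne_zero]
  -- In characteristic p one has X^p - N^p = (X - N)^p, and the determinant gives the identity.
  have h1 : expand K p (N ^ p).charpoly = N.charpoly ^ p := by
    unfold Matrix.charpoly
    rw [AlgHom.map_det, ← Matrix.coe_detMonoidHom, ← (Matrix.detMonoidHom : Matrix n n K[X] →* K[X]).map_pow]
    apply congrArg Matrix.det
    refine matPolyEquiv.injective ?_
    rw [map_pow, Matrix.matPolyEquiv_charmatrix, sub_pow_char_of_commute, ← C_pow]
    · exact (id (matPolyEquiv_eq_X_pow_sub_C p N) :)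
    · exact (C N).commute_X
  have h2 : (N ^ p).charpoly = N.charpoly.map (frobenius K p) := by
    apply expand_injective (Fact.out : p.Prime).pos
    rw [h1, ← map_frobenius_expand, map_expand]
  rw [Matrix.trace_eq_neg_charpoly_coeff, Matrix.trace_eq_neg_charpoly_coeff, h2, coeff_map,
    frobenius_def, ← frobenius_def, ← frobenius_def, ← map_neg]

variable {F L G : Type} [Field F] [Field L] [Algebra F L] [Group G] {d : ℕ}

theorem trace_eq_of_isConj (ρ : MonoidAlgebra F G →ₐ[F] Matrix (Fin d) (Fin d) L) {g h : G}
    (H : IsConj g h) :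
    (ρ (.single g 1)).trace = (ρ (.single h 1)).trace := by
  obtain ⟨c, rfl⟩ := isConj_iff.1 H
  have h1 : (MonoidAlgebra.single (c * g * c⁻¹) 1 : MonoidAlgebra F G) =
      .single c 1 * (.single g 1 * .single c⁻¹ 1) := by
    rw [MonoidAlgebra.single_mul_single, MonoidAlgebra.single_mul_single]
    simp [mul_assoc]
  rw [h1, map_mul, Matrix.trace_mul_comm, ← map_mul, mul_assoc, MonoidAlgebra.single_mul_single]
  simp [← MonoidAlgebra.one_def]

theorem trace_map_smul (ρ : MonoidAlgebra F G →ₐ[F] Matrix (Fin d) (Fin d) L) (c : F)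
    (a : MonoidAlgebra F G) : (ρ (c • a)).trace = algebraMap F L c * (ρ a).trace := by
  rw [map_smul, Matrix.trace_smul, Algebra.smul_def]

/-- An arbitrary x in L is the trace of a matrix with the single entry x. By surjectivity this
matrix is in the F-span of images of group elements, whose traces lie in F. -/
theorem surjective_algebraMap_of_trace [NeZero d] (ρ : MonoidAlgebra F G →ₐ[F] Matrix (Fin d) (Fin d) L)
    (hρ : Function.Surjective ρ)
    (h : ∀ g : G, (ρ (.single g 1)).trace ∈ (algebraMap F L).range) :
    Function.Surjective (algebraMap F L) := by
  intro x
  obtain ⟨a, ha⟩ := hρ (Matrix.single 0 0 x)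
  have key : ∀ a, (ρ a).trace ∈ (algebraMap F L).range := by
    intro a
    induction a using MonoidAlgebra.induction_linear with
    | zero => simp
    | add a b ha hb => rw [map_add, Matrix.trace_add]; exact add_mem ha hb
    | single g c =>
      have : (MonoidAlgebra.single g c : MonoidAlgebra F G) = c • .single g 1 := by simp
      rw [this, trace_map_smul]
      exact mul_mem ⟨c, rfl⟩ (h g)
  have := key a
  rw [ha, Matrix.trace_single_eq_same] at this
  exact this

end Trace

/-- A finite division algebra is a field by Wedderburn's theorem. If g has order prime to p, then g
and g^p are conjugate, so its trace is fixed by Frobenius and lies in the prime field; the general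
case reduces to this one by p-th powers. -/
theorem isSplitAlg_zmod (p : ℕ) [Fact p.Prime] (α : Type) [Fintype α] [DecidableEq α] :
    IsSplitAlg (ZMod p) (MonoidAlgebra (ZMod p) (Equiv.Perm α)) := by
  intro d _ D _ _ _ ρ hρ
  have : Finite D := Module.finite_of_finite (ZMod p)
  let _ : Field D := { ‹DivisionRing D› with mul_comm := (littleWedderburn D).mul_comm }
  have : CharP D p := charP_of_injective_algebraMap (algebraMap (ZMod p) D).injective p
  refine surjective_algebraMap_of_trace ρ hρ fun g => ?_
  suffices h : (ρ (.single g 1)).trace ^ p = (ρ (.single g 1)).trace by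
    have h1 := (Subfield.mem_bot_iff_pow_eq_self D p).2 h
    exact (bot_le : (⊥ : Subfield D) ≤ (algebraMap (ZMod p) D).fieldRange) h1
  have h1 : ∀ j : ℕ, (ρ (.single g 1)).trace ^ p ^ j = (ρ (.single (g ^ p ^ j) 1)).trace := by
    intro j
    induction j with
    | zero => simp
    | succ j ih =>
      rw [pow_succ, pow_mul, ih, pow_mul, ← trace_pow_char, ← map_pow, MonoidAlgebra.single_pow,
        one_pow]
  -- With p^j the p-part of the order of g, the element g^(p^j) has order prime to p.
  obtain ⟨j, m, hm, hj⟩ := Nat.exists_eq_pow_mul_and_not_dvd (orderOf_pos g).ne' p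
    (Fact.out : p.Prime).ne_one
  have hc : p.Coprime (orderOf (g ^ p ^ j)) := by
    rw [(Nat.Prime.coprime_iff_not_dvd Fact.out), orderOf_pow, hj, Nat.gcd_eq_right (Dvd.intro _ rfl),
      Nat.mul_div_cancel_left _ (pow_pos (Fact.out : p.Prime).pos _)]
    exact hm
  have h2 : (ρ (.single (g ^ p ^ j) 1)).trace ^ p = (ρ (.single (g ^ p ^ j) 1)).trace := by
    rw [← trace_pow_char, ← map_pow, MonoidAlgebra.single_pow, one_pow]
    exact (trace_eq_of_isConj ρ (isConj_pow_of_coprime hc)).symm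
  -- The trace of g^(p^j) is the p^j-th power of the trace of g, so injectivity of the j-fold
  -- Frobenius carries the fixed-point property back to g.
  rw [← h1, ← pow_mul, mul_comm, pow_mul] at h2
  refine (frobenius_inj D p).iterate j ?_
  simpa only [iterate_frobenius] using h2

/-- Induction on the order m of g. The powers of g sum to m times an idempotent, whose trace is an
integer. Exponents prime to m contribute the trace of g, by conjugacy, and the others contribute
traces of elements of smaller order; so a positive multiple of the trace of g is rational. -/
theorem surjective_algebraMap_rat {α L : Type} [Fintype α] [DecidableEq α] [Field L] [Algebra ℚ L]
    {d : ℕ} [NeZero d] (ρ : MonoidAlgebra ℚ (Equiv.Perm α) →ₐ[ℚ] Matrix (Fin d) (Fin d) L)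
    (hρ : Function.Surjective ρ) : Function.Surjective (algebraMap ℚ L) := by
  refine surjective_algebraMap_of_trace ρ hρ fun g => ?_
  have : CharZero L := algebraRat.charZero L
  induction hm : orderOf g using Nat.strong_induction_on generalizing g with
  | _ m ih =>
  have hm0 : 0 < m := hm ▸ orderOf_pos g
  set N : MonoidAlgebra ℚ (Equiv.Perm α) := ∑ i ∈ Finset.range m, .single (g ^ i) 1 with hN
  have hgN : ∀ i, (.single (g ^ i) 1 : MonoidAlgebra ℚ (Equiv.Perm α)) * N = N := by
    have h1 : (.single g 1 : MonoidAlgebra ℚ (Equiv.Perm α)) * N = N := by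
      have h0 := Finset.sum_range_succ' (fun i => (.single (g ^ i) 1 : MonoidAlgebra ℚ (Equiv.Perm α))) m
      rw [Finset.sum_range_succ, ← hN, ← hm, pow_orderOf_eq_one, pow_zero, add_left_inj] at h0
      rw [hm] at h0
      rw [hN, Finset.mul_sum]
      simp only [MonoidAlgebra.single_mul_single, one_mul, ← pow_succ']
      rw [← h0]
    intro i
    induction i with
    | zero => rw [pow_zero, ← MonoidAlgebra.one_def, one_mul]
    | succ i ih =>
      have : (.single (g ^ (i + 1)) 1 : MonoidAlgebra ℚ (Equiv.Perm α)) =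
        .single (g ^ i) 1 * .single g 1 := by rw [MonoidAlgebra.single_mul_single, pow_succ, one_mul]
      rw [this, mul_assoc, h1, ih]
  have hNN : N * N = (m : ℚ) • N := by
    conv_lhs => enter [1]; rw [hN]
    rw [Finset.sum_mul, Finset.sum_congr rfl fun i _ => hgN i, Finset.sum_const, Finset.card_range,
      Nat.cast_smul_eq_nsmul]
  have hmQ : (m : ℚ) ≠ 0 := Nat.cast_ne_zero.2 hm0.ne'
  have hE : IsIdempotentElem (ρ ((m : ℚ)⁻¹ • N)) := by
    rw [IsIdempotentElem, ← map_mul, smul_mul_smul_comm, hNN, smul_smul]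
    congr 2
    field_simp
  have hT : (ρ N).trace ∈ (algebraMap ℚ L).range := by
    have h1 : IsIdempotentElem (Matrix.toLin' (ρ ((m : ℚ)⁻¹ • N))) := by
      rw [IsIdempotentElem, Module.End.mul_eq_comp, ← Matrix.toLin'_mul, hE.eq]
    have h2 := (LinearMap.IsIdempotentElem.isProj_range _ h1).trace
    rw [Matrix.trace_toLin'_eq] at h2
    have h3 : N = (m : ℚ) • ((m : ℚ)⁻¹ • N) := by rw [smul_smul, mul_inv_cancel₀ hmQ, one_smul]
    rw [h3, trace_map_smul, h2]
    exact mul_mem ⟨_, rfl⟩ (natCast_mem _ _)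
  have hsum : (ρ N).trace = ∑ i ∈ Finset.range m, (ρ (.single (g ^ i) 1)).trace := by
    rw [hN, map_sum, Matrix.trace_sum]
  rw [← Finset.sum_filter_add_sum_filter_not _ (fun i => i.Coprime m),
    Finset.sum_congr rfl fun i hi => (trace_eq_of_isConj ρ (isConj_pow_of_coprime (σ := g) (i := i)
      (by rw [hm]; exact (Finset.mem_filter.1 hi).2))).symm, Finset.sum_const] at hsum
  -- For an exponent that shares a factor with m, the order of g^i is a proper divisor of m and the
  -- induction hypothesis applies.
  have h4 : ∑ i ∈ Finset.range m with ¬ i.Coprime m, (ρ (.single (g ^ i) 1)).trace ∈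
      (algebraMap ℚ L).range := by
    refine sum_mem fun i hi => ih (orderOf (g ^ i)) ?_ _ rfl
    rw [orderOf_pow, hm]
    refine Nat.div_lt_self hm0 ?_
    have h5 := (Finset.mem_filter.1 hi).2
    rw [Nat.coprime_comm, Nat.coprime_iff_gcd_eq_one] at h5
    have := Nat.gcd_pos_of_pos_left i hm0
    omega
  have h6 := sub_mem hT h4
  rw [hsum, add_sub_cancel_right] at h6
  set c := (Finset.filter (fun i => i.Coprime m) (Finset.range m)).card
  have hc : 0 < c := by
    -- The witness is 1, except for m = 1, where it is the only available exponent 0.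
    refine Finset.card_pos.2 ⟨1 % m, Finset.mem_filter.2 ⟨Finset.mem_range.2 (Nat.mod_lt _ hm0), ?_⟩⟩
    rw [Nat.Coprime, ← Nat.gcd_rec, Nat.gcd_one_right]
  rw [← Nat.cast_smul_eq_nsmul ℚ, Algebra.smul_def] at h6
  have hcQ : (c : ℚ) ≠ 0 := Nat.cast_ne_zero.2 hc.ne'
  have h7 := mul_mem (⟨(c : ℚ)⁻¹, rfl⟩ : algebraMap ℚ L (c : ℚ)⁻¹ ∈ (algebraMap ℚ L).range) h6
  rwa [← mul_assoc, ← map_mul, inv_mul_cancel₀ hcQ, map_one, one_mul] at h7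

end Deligne

/-! ### Lifting idempotents from the semisimple quotient -/

namespace Deligne

/-- Matrix representations of an algebra that are surjective modulo a nilpotent ideal, together with
primitive idempotents that represent the projective indecomposable modules. -/
structure SplitData (F A : Type) [Field F] [Ring A] [Algebra F A] where
  /-- number of simple modules -/
  N : ℕ
  /-- dimensions of the simple modules -/
  m : Fin N → ℕ
  [ne : ∀ i, NeZero (m i)]
  /-- matrix representations -/
  ρ : ∀ i, A →ₐ[F] Matrix (Fin (m i)) (Fin (m i)) F
  /-- idempotents -/
  e : Fin N → A
  idem : ∀ i, IsIdempotentElem (e i)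
  ρ_self : ∀ i, ρ i (e i) = Matrix.single 0 0 1
  ρ_ne : ∀ i j, i ≠ j → ρ j (e i) = 0
  /-- the radical -/
  rad : Submodule F A
  /-- a vanishing power of the radical -/
  t : ℕ
  rad_pow : rad ^ t = ⊥
  corner : ∀ i a, ∃ c : F, e i * a * e i - c • e i ∈ rad
  full : 1 ∈ AddSubgroup.closure {x | ∃ i a b, x = a * e i * b}

attribute [instance] SplitData.ne

section

variable {F A : Type} [Field F] [Ring A] [Algebra F A]

theorem one_eq_sum_single {n : ℕ} [NeZero n] :
    (1 : Matrix (Fin n) (Fin n) F) = ∑ r, Matrix.single r 0 1 * Matrix.single 0 0 1 * Matrix.single 0 r 1 := by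
  simp only [Matrix.single_mul_single_same, mul_one]
  ext a b
  rw [Matrix.sum_apply]
  simp [Matrix.single_apply, Matrix.one_apply, ite_and]

/-- The quotient of A by its Jacobson radical is a product of matrix rings, over F itself because A
is split. The matrix units at position (0, 0) lift to idempotents of A, as the radical is nilpotent.
-/
theorem exists_splitData [Module.Finite F A] (hA : IsSplitAlg F A) :
    ∃ S : SplitData F A, S.rad = (Ring.jacobson A).restrictScalars F := by
  have : IsArtinianRing A := IsArtinianRing.of_finite F A
  let J := Ring.jacobson A
  obtain ⟨N, D, d, i1, i2, i3, hd, ⟨Φ⟩⟩ :=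
    IsSemisimpleRing.exists_algEquiv_pi_matrix_divisionRing_finite F (A ⧸ J)
  let mk : A →ₐ[F] A ⧸ J := Ideal.Quotient.mkₐ F J
  have hmk : Function.Surjective mk := Ideal.Quotient.mkₐ_surjective F J
  have hsurj : ∀ i, Function.Surjective (algebraMap F (D i)) := fun i => by
    refine hA (d i) (hd i) (D i) _ _ inferInstance
      ((Pi.evalAlgHom F (fun i => Matrix (Fin (d i)) (Fin (d i)) (D i)) i).comp
        (Φ.toAlgHom.comp mk)) ?_
    exact (Function.surjective_eval i).comp (Φ.surjective.comp hmk)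
  let ε : ∀ i, F ≃ₐ[F] D i := fun i => AlgEquiv.ofBijective (Algebra.ofId F (D i))
    ⟨(algebraMap F (D i)).injective, hsurj i⟩
  let Ψ : (A ⧸ J) ≃ₐ[F] (∀ i, Matrix (Fin (d i)) (Fin (d i)) F) :=
    Φ.trans (AlgEquiv.piCongrRight fun i => ((ε i).mapMatrix (m := Fin (d i))).symm)
  let Θ : A →ₐ[F] (∀ i, Matrix (Fin (d i)) (Fin (d i)) F) := Ψ.toAlgHom.comp mk
  have hΘ : Function.Surjective Θ := Ψ.surjective.comp hmk
  have hker : ∀ x, Θ x = 0 ↔ x ∈ J := fun x => by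
    change Ψ (mk x) = 0 ↔ _
    rw [map_eq_zero_iff _ Ψ.injective]
    exact Ideal.Quotient.eq_zero_iff_mem
  obtain ⟨t, ht⟩ : IsNilpotent J := IsSemiprimaryRing.isNilpotent
  -- The exponent is raised by one so that it is nonzero, since restriction of scalars does not
  -- preserve the zeroth power of an ideal.
  have hrad : (J.restrictScalars F) ^ (t + 1) = ⊥ := by
    rw [← Submodule.restrictScalars_pow (Nat.succ_ne_zero t), Submodule.pow_succ, ht,
      Submodule.zero_eq_bot, Submodule.bot_mul, Submodule.restrictScalars_bot]
  have hnil : ∀ x ∈ J, IsNilpotent x := fun x hx => ⟨t + 1, by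
    have := Submodule.pow_mem_pow (J.restrictScalars F) (x := x) hx (t + 1)
    rwa [hrad, Submodule.mem_bot] at this⟩
  let E : ∀ i, ∀ j, Matrix (Fin (d j)) (Fin (d j)) F := fun i => Pi.single i (Matrix.single 0 0 1)
  have hE : ∀ i, IsIdempotentElem (E i) := fun i => by
    rw [IsIdempotentElem, ← Pi.single_mul, Matrix.single_mul_single_same, mul_one]
  have hlift : ∀ i, ∃ e : A, IsIdempotentElem e ∧ Θ e = E i := fun i =>
    exists_isIdempotentElem_eq_of_ker_isNilpotent Θ.toRingHom
      (fun x hx => hnil x ((hker x).1 hx)) (E i) (hΘ (E i)) (hE i)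
  choose e he hΘe using hlift
  refine ⟨⟨N, d, fun i => (Pi.evalAlgHom F _ i).comp Θ, e, he, fun i => ?_, fun i j hij => ?_,
    J.restrictScalars F, t + 1, hrad, fun i a => ⟨Θ a i 0 0, ?_⟩, ?_⟩, rfl⟩
  · change Θ (e i) i = _
    rw [hΘe]
    exact Pi.single_eq_same _ _
  · change Θ (e i) j = _
    rw [hΘe]
    exact Pi.single_eq_of_ne (Ne.symm hij) _
  -- Cutting a matrix with the matrix unit at (0, 0) on both sides leaves its (0, 0) entry; this is
  -- the scalar c.
  · rw [Submodule.restrictScalars_mem, ← hker, map_sub, map_smul, map_mul, map_mul, hΘe]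
    ext j : 1
    rcases eq_or_ne i j with rfl | hij
    · simp [E]
    · simp [E, Pi.single_eq_of_ne (Ne.symm hij)]
  -- Modulo the radical the e_i generate every block identity. So the generated ideal contains an
  -- element that differs from 1 by a nilpotent one; this is a unit, and the ideal is everything.
  · set S := {x : A | ∃ i a b, x = a * e i * b}
    have hmul : ∀ y, ∀ x ∈ AddSubgroup.closure S, x * y ∈ AddSubgroup.closure S := by
      intro y x hx
      induction hx using AddSubgroup.closure_induction with
      | mem x hx =>
        obtain ⟨i, a, b, rfl⟩ := hx
        exact AddSubgroup.subset_closure ⟨i, a, b * y, mul_assoc _ _ _⟩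
      | zero => rw [zero_mul]; exact zero_mem _
      | add a b _ _ ha hb => rw [add_mul]; exact add_mem ha hb
      | neg a _ ha => rw [neg_mul]; exact neg_mem ha
    have hex : ∀ i, ∃ x ∈ AddSubgroup.closure S, Θ x = Pi.single i 1 := by
      intro i
      choose l hl using fun r => hΘ (Pi.single i (Matrix.single r 0 1))
      choose l' hl' using fun r => hΘ (Pi.single i (Matrix.single 0 r 1))
      refine ⟨∑ r, l r * e i * l' r,
        sum_mem fun r _ => AddSubgroup.subset_closure ⟨i, _, _, rfl⟩, ?_⟩
      rw [one_eq_sum_single, map_sum]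
      simp only [map_mul, hl, hl', hΘe, E, ← Pi.single_mul]
      exact (map_sum (AddMonoidHom.single (fun j => Matrix (Fin (d j)) (Fin (d j)) F) i) _ _).symm
    choose x hx hΘx using hex
    have h1 : Θ (1 - ∑ i, x i) = 0 := by
      rw [map_sub, map_one, map_sum, Finset.sum_congr rfl fun i _ => hΘx i,
        show ∑ i, Pi.single i 1 = (1 : ∀ j, Matrix (Fin (d j)) (Fin (d j)) F) from
          Finset.univ_sum_single 1, sub_self]
    have h2 := (hnil _ ((hker _).1 h1)).isUnit_one_sub
    rw [sub_sub_cancel] at h2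
    obtain ⟨u, hu⟩ := h2
    rw [← u.mul_inv, hu]
    exact hmul _ _ (sum_mem fun i _ => hx i)

end

end Deligne

/-! ### Commutativity of the division algebras over ℚ -/

namespace Deligne

section Centralizer

variable {F G H : Type} [Field F] [Group G] [Group H]

/-- The antiautomorphism of a group algebra given by inversion. -/
def invAlg (F G : Type) [Field F] [Group G] : MonoidAlgebra F G →ₐ[F] (MonoidAlgebra F G)ᵐᵒᵖ :=
  MonoidAlgebra.lift F _ G
    { toFun := fun g => MulOpposite.op (.single g⁻¹ 1)
      map_one' := by rw [inv_one]; rfl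
      map_mul' := fun g h => by
        rw [← MulOpposite.op_mul, MonoidAlgebra.single_mul_single, mul_inv_rev, one_mul] }

theorem invAlg_single (g : G) (c : F) :
    invAlg F G (.single g c) = MulOpposite.op (.single g⁻¹ c) := by
  rw [invAlg, MonoidAlgebra.lift_single]
  change c • MulOpposite.op _ = _
  rw [← MulOpposite.op_smul]
  simp

/-- The coefficient at 1 is a trace form, since gg' = 1 and g'g = 1 are equivalent. -/
theorem coeff_one_mul_comm (x y : MonoidAlgebra F H) :
    (x * y).coeff 1 = (y * x).coeff 1 := by
  classical
  induction x using MonoidAlgebra.induction_linear with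
  | zero => simp
  | add x x' hx hx' => simp [add_mul, mul_add, hx, hx']
  | single g c =>
    induction y using MonoidAlgebra.induction_linear with
    | zero => simp
    | add x x' hx hx' => simp [add_mul, mul_add, hx, hx']
    | single g' c' =>
      simp only [MonoidAlgebra.single_mul_single, MonoidAlgebra.coeff_single, Finsupp.single_apply,
        mul_eq_one_iff_eq_inv, mul_comm c c']
      congr 1
      rw [eq_iff_iff, ← inv_eq_iff_eq_inv, eq_comm]

variable [Fintype H] (ι : H →* G)

/-- The sum of the conjugates of an element of `F[G]` under `H`. -/
def conjSum (x : MonoidAlgebra F G) : MonoidAlgebra F G :=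
  ∑ h : H, .single (ι h) 1 * x * .single (ι h)⁻¹ 1

theorem conjSum_add (x y : MonoidAlgebra F G) :
    conjSum ι (x + y) = conjSum ι x + conjSum ι y := by
  simp only [conjSum, mul_add, add_mul, Finset.sum_add_distrib]

theorem commute_conjSum (h' : H) (x : MonoidAlgebra F G) :
    Commute (.single (ι h') 1) (conjSum ι x) := by
  rw [Commute, SemiconjBy, conjSum, Finset.mul_sum, Finset.sum_mul]
  refine Fintype.sum_equiv (Equiv.mulLeft h') _ _ fun h => ?_
  simp only [Equiv.coe_mulLeft, mul_assoc, MonoidAlgebra.single_mul_single, mul_one, map_mul,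
    mul_inv_rev, inv_mul_cancel]
  simp only [← mul_assoc, MonoidAlgebra.single_mul_single, mul_one]

/-- Since g and its inverse are conjugate under H, they have the same sum of conjugates; inversion
exchanges the two. -/
theorem invAlg_conjSum (hG : ∀ g : G, ∃ h : H, ι h * g * (ι h)⁻¹ = g⁻¹) (x : MonoidAlgebra F G) :
    invAlg F G (conjSum ι x) = MulOpposite.op (conjSum ι x) := by
  induction x using MonoidAlgebra.induction_linear with
  | zero => simp [conjSum]
  | add x y hx hy => rw [conjSum_add, map_add, hx, hy, MulOpposite.op_add]
  | single g c =>
    obtain ⟨k, hk⟩ := hG g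
    simp only [conjSum, MonoidAlgebra.single_mul_single, mul_one, one_mul, map_sum, invAlg_single]
    rw [Finset.op_sum]
    refine Fintype.sum_equiv (Equiv.mulRight k) _ _ fun h => ?_
    simp only [Equiv.coe_mulRight, map_mul, mul_inv_rev, inv_inv, ← hk, mul_assoc]

/-- A product z of two such sums commutes with H, so that |H| z is again a sum of conjugates. Hence
z is fixed by the inversion antiautomorphism, which fixes both factors and reverses their order. -/
theorem conjSum_mul_comm [CharZero F] (hG : ∀ g : G, ∃ h : H, ι h * g * (ι h)⁻¹ = g⁻¹)
    (x y : MonoidAlgebra F G) : conjSum ι x * conjSum ι y = conjSum ι y * conjSum ι x := by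
  set z := conjSum ι x * conjSum ι y with hz
  have h1 : conjSum ι z = (Fintype.card H : F) • z := by
    rw [conjSum, Finset.sum_congr rfl fun h _ => ?_, Finset.sum_const, Finset.card_univ,
      Nat.cast_smul_eq_nsmul]
    rw [((commute_conjSum ι h x).mul_right (commute_conjSum ι h y)).eq, mul_assoc,
      MonoidAlgebra.single_mul_single, mul_inv_cancel, one_mul, ← MonoidAlgebra.one_def, mul_one]
  have h2 := invAlg_conjSum ι hG z
  have hc : (Fintype.card H : F) ≠ 0 := Nat.cast_ne_zero.2 Fintype.card_ne_zero
  rw [h1, map_smul, MulOpposite.op_smul] at h2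
  have h3 := smul_right_injective _ hc h2
  rw [hz, map_mul, invAlg_conjSum ι hG, invAlg_conjSum ι hG, ← MulOpposite.op_mul] at h3
  exact (MulOpposite.op_injective h3).symm

theorem trace_mulLeft (x : MonoidAlgebra F H) :
    LinearMap.trace F _ (LinearMap.mulLeft F x) = Fintype.card H * x.coeff 1 := by
  classical
  rw [LinearMap.trace_eq_matrix_trace F (MonoidAlgebra.basis H F), Matrix.trace,
    Finset.sum_congr rfl fun h _ => ?_, Finset.sum_const, Finset.card_univ, nsmul_eq_mul]
  rw [Matrix.diag_apply, LinearMap.toMatrix_apply, MonoidAlgebra.basis_apply,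
    LinearMap.mulLeft_apply]
  change (x * .single h 1).coeff h = _
  simp

/-- Left multiplication by e is a nonzero projection, whose trace is its rank in characteristic
zero; this trace is |H| times the coefficient at 1. -/
theorem coeff_one_ne_zero [CharZero F] {e : MonoidAlgebra F H} (he : IsIdempotentElem e)
    (h0 : e ≠ 0) : e.coeff 1 ≠ 0 := by
  have : Module.Finite F (MonoidAlgebra F H) := inferInstance
  have h1 : IsIdempotentElem (LinearMap.mulLeft F e) := by
    rw [IsIdempotentElem, Module.End.mul_eq_comp, ← LinearMap.mulLeft_mul, he.eq]
  intro h
  have h2 := (LinearMap.IsIdempotentElem.trace_eq_zero_iff h1).1 (by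
    rw [trace_mulLeft, h, mul_zero])
  exact h0 (by simpa using LinearMap.congr_fun h2 1)

/-- The corner of F[G] cut out by a primitive idempotent e of F[H] consists of multiples by e of
sums of H-conjugates. These sums commute with each other and with e, so the corner is commutative.
-/
theorem corner_comm [CharZero F] (hG : ∀ g : G, ∃ h : H, ι h * g * (ι h)⁻¹ = g⁻¹)
    {e : MonoidAlgebra F H} (he : IsIdempotentElem e) (h0 : e ≠ 0)
    (hc : ∀ b, ∃ c : F, e * b * e = c • e) (j : MonoidAlgebra F H →ₐ[F] MonoidAlgebra F G)
    (hj : ∀ h, j (.single h 1) = .single (ι h) 1) (x y : MonoidAlgebra F G) :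
    (j e * x * j e) * (j e * y * j e) = (j e * y * j e) * (j e * x * j e) := by
  have hE : j e * j e = j e := by rw [← map_mul, he.eq]
  set τ := e.coeff 1 with hτ
  have hτ0 : τ ≠ 0 := coeff_one_ne_zero he h0
  -- The scalars are defined by e h⁻¹ e = c(h) e. Comparing coefficients at 1 gives τ c(h) = e_h, so
  -- that e is recovered as τ times the sum of all c(h) h.
  choose c hc using fun h : H => hc (.single h⁻¹ 1)
  have hcτ : ∀ h, τ * c h = e.coeff h := by
    intro h
    have h1 := congrArg (fun x => x.coeff 1) (hc h)
    simp only [MonoidAlgebra.coeff_smul, Finsupp.smul_apply, smul_eq_mul] at h1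
    rw [mul_comm, ← h1, coeff_one_mul_comm, ← mul_assoc, he.eq]
    simp
  have hu : τ • ∑ h, MonoidAlgebra.single h (c h) = e := by
    apply MonoidAlgebra.ext
    ext h
    simp only [Finset.smul_sum, MonoidAlgebra.coeff_sum, MonoidAlgebra.smul_single, smul_eq_mul,
      hcτ, MonoidAlgebra.coeff_single, Finsupp.finsetSum_apply]
    classical
    simp [Finsupp.single_apply]
  have hcomm : ∀ b z, Commute (j b) (conjSum ι z) := by
    intro b z
    induction b using MonoidAlgebra.induction_linear with
    | zero => rw [map_zero]; exact Commute.zero_left _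
    | add b b' hb hb' => rw [map_add]; exact hb.add_left hb'
    | single h c =>
      have : (MonoidAlgebra.single h c : MonoidAlgebra F H) = c • .single h 1 := by simp
      rw [this, map_smul, hj]
      exact (commute_conjSum ι h z).smul_left c
  -- For X in the corner, h X h⁻¹ e = h X (e h⁻¹ e) = c(h) h X; summing over h and multiplying by τ
  -- gives e X = X.
  have key : ∀ x, τ • (conjSum ι (j e * x * j e) * j e) = j e * x * j e := by
    intro x
    set X := j e * x * j e with hX
    have hXr : X * j e = X := by rw [hX, mul_assoc, hE]
    have hXl : j e * X = X := by rw [hX, ← mul_assoc, ← mul_assoc, hE]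
    have h1 : conjSum ι X * j e = j (∑ h, MonoidAlgebra.single h (c h)) * X := by
      rw [conjSum, Finset.sum_mul, map_sum, Finset.sum_mul]
      refine Finset.sum_congr rfl fun h _ => ?_
      have h2 : j e * .single (ι h)⁻¹ 1 * j e = c h • j e := by
        rw [← map_inv, ← hj, ← map_mul, ← map_mul, hc, map_smul]
      have h3 : (MonoidAlgebra.single h (c h) : MonoidAlgebra F H) = c h • .single h 1 := by simp
      rw [← hXr, mul_assoc, mul_assoc, mul_assoc, ← mul_assoc (j e), h2, h3, map_smul, hj, hXr,
        mul_smul_comm, mul_smul_comm, hXr, smul_mul_assoc]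
    have h4 : conjSum ι X * j e = j e * (conjSum ι X * j e) := by
      rw [← mul_assoc, (hcomm e X).eq, mul_assoc, hE]
    rw [h4, h1, ← hXl, ← mul_assoc (j _) (j e), ← map_mul, ← mul_assoc, ← map_mul, ← smul_mul_assoc, ← map_smul,
      ← mul_smul_comm, ← smul_mul_assoc, hu, he.eq, he.eq, hXl]
  rw [← key x, ← key y, smul_mul_smul_comm, smul_mul_smul_comm, (hcomm e _).mul_mul_mul_comm,
    (hcomm e _).mul_mul_mul_comm, conjSum_mul_comm ι hG]

end Centralizer

/-- With c a nonzero entry of f at (a, b), matrices X and Y with single entries x and y at (b, a)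
produce c x c y c at (a, b). Replacing x, y by c⁻¹x, c⁻¹y and cancelling gives commutativity of D.
-/
theorem mul_comm_of_corner_comm {D : Type} [DivisionRing D] {d : ℕ}
    {f : Matrix (Fin d) (Fin d) D} (h0 : f ≠ 0) (hf : f * f = f)
    (h : ∀ X Y, (f * X * f) * (f * Y * f) = (f * Y * f) * (f * X * f)) (x y : D) :
    x * y = y * x := by
  obtain ⟨a, b, hab⟩ : ∃ a b, f a b ≠ 0 := by
    by_contra! hne
    exact h0 (Matrix.ext hne)
  set c := f a b
  have h1 : ∀ x y : D, ((f * Matrix.single b a x * f) * (f * Matrix.single b a y * f)) a b =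
      c * (x * c * y) * c := by
    intro x y
    have : (f * Matrix.single b a x * f) * (f * Matrix.single b a y * f) =
        f * (Matrix.single b a x * f * Matrix.single b a y) * f := by
      simp only [mul_assoc]
      rw [← mul_assoc f f, hf]
    rw [this, Matrix.single_mul_mul_single, Matrix.mul_apply, Finset.sum_eq_single a,
      Matrix.mul_single_apply_same]
    · intro i _ hi
      rw [Matrix.mul_single_apply_of_ne _ _ _ _ _ hi, zero_mul]
    · exact fun h => (h (Finset.mem_univ _)).elim
  have h2 := (h1 (c⁻¹ * x) (c⁻¹ * y)).symm.trans ((congrFun (congrFun (h _ _) a) b).trans (h1 _ _))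
  have h3 := mul_left_cancel₀ hab (mul_right_cancel₀ hab h2)
  simp only [mul_assoc, mul_inv_cancel_left₀ hab] at h3
  exact mul_left_cancel₀ (inv_ne_zero hab) h3

section

variable {F : Type} [Field F]

theorem IsSplitAlg.of_surjective {A B : Type} [Ring A] [Algebra F A] [Ring B] [Algebra F B]
    (h : IsSplitAlg F A) (e : A →ₐ[F] B) (he : Function.Surjective e) : IsSplitAlg F B :=
  fun d hd D i1 i2 i3 ρ hρ => h d hd D i1 i2 i3 (ρ.comp e) (hρ.comp he)

/-- The permutations of `α ∪ {none}` that come from permutations of `α`. -/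
def optionCongrHom (α : Type) : Equiv.Perm α →* Equiv.Perm (Option α) where
  toFun := Equiv.optionCongr
  map_one' := Equiv.optionCongr_one
  map_mul' g h := by ext x; cases x <;> rfl

/-- This is the induction step from S_n to S_{n+1}: a primitive idempotent of the smaller group
algebra that survives in the matrix ring cuts out a nonzero commutative corner there. -/
theorem mul_comm_of_surjective_option [CharZero F] {α : Type} [Fintype α]
    (hα : IsSplitAlg F (MonoidAlgebra F (Equiv.Perm α))) {d : ℕ} [NeZero d] {D : Type}
    [DivisionRing D] [Algebra F D]
    (ρ : MonoidAlgebra F (Equiv.Perm (Option α)) →ₐ[F] Matrix (Fin d) (Fin d) D)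
    (hρ : Function.Surjective ρ) (x y : D) : x * y = y * x := by
  classical
  -- By Maschke's theorem the radical is zero, so the corners e b e are exactly scalar multiples of
  -- e.
  have : NeZero (Nat.card (Equiv.Perm α) : F) := ⟨Nat.cast_ne_zero.2 Nat.card_pos.ne'⟩
  obtain ⟨S, hS⟩ := exists_splitData hα
  have : IsArtinianRing (MonoidAlgebra F (Equiv.Perm α)) := IsArtinianRing.of_finite F _
  rw [IsArtinianRing.isSemisimpleRing_iff_jacobson.1 inferInstance,
    Submodule.restrictScalars_bot] at hS
  let j : MonoidAlgebra F (Equiv.Perm α) →ₐ[F] MonoidAlgebra F (Equiv.Perm (Option α)) :=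
    MonoidAlgebra.mapDomainAlgHom F F (optionCongrHom α)
  -- The idempotents generate the unit ideal, so they cannot all be killed by a map to a nonzero
  -- ring.
  obtain ⟨i, hi⟩ : ∃ i, ρ (j (S.e i)) ≠ 0 := by
    by_contra! h
    have h1 : ∀ x ∈ AddSubgroup.closure {x | ∃ i a b, x = a * S.e i * b}, ρ (j x) = 0 := by
      intro x hx
      induction hx using AddSubgroup.closure_induction with
      | mem x hx =>
        obtain ⟨i, a, b, rfl⟩ := hx
        rw [map_mul, map_mul, map_mul, map_mul, h, mul_zero, zero_mul]
      | zero => rw [map_zero, map_zero]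
      | add a b _ _ ha hb => rw [map_add, map_add, ha, hb, add_zero]
      | neg a _ ha => rw [map_neg, map_neg, ha, neg_zero]
    have h2 := h1 1 S.full
    rw [map_one, map_one] at h2
    exact one_ne_zero h2
  refine mul_comm_of_corner_comm hi (by rw [← map_mul, ← map_mul, (S.idem i).eq]) (fun X Y => ?_) x y
  obtain ⟨X, rfl⟩ := hρ X
  obtain ⟨Y, rfl⟩ := hρ Y
  simp only [← map_mul]
  congr 1
  refine corner_comm (optionCongrHom α) (fun g => ?_) (S.idem i) (fun h => hi (by rw [h, map_zero, map_zero]))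
    (fun b => ?_) j (fun h => MonoidAlgebra.mapDomain_single) X Y
  -- A conjugating permutation that fixes the added point comes from a permutation of `α`.
  · obtain ⟨h, h1, h2⟩ := exists_conj_inv none g
    refine ⟨Equiv.removeNone h, ?_⟩
    have : optionCongrHom α (Equiv.removeNone h) = h := by
      change (Equiv.removeNone h).optionCongr = h
      rw [map_equiv_removeNone, h1, Equiv.swap_self]
      rfl
    rw [this, h2]
  · obtain ⟨c, hc⟩ := S.corner i b
    rw [hS, Submodule.mem_bot, sub_eq_zero] at hc
    exact ⟨c, hc⟩

end

theorem isSplitAlg_rat_of_mul_comm {α : Type} [Fintype α]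
    (h : ∀ (d : ℕ) (_ : NeZero d) (D : Type) (_ : DivisionRing D) (_ : Algebra ℚ D)
      (ρ : MonoidAlgebra ℚ (Equiv.Perm α) →ₐ[ℚ] Matrix (Fin d) (Fin d) D),
      Function.Surjective ρ → ∀ x y : D, x * y = y * x) :
    IsSplitAlg ℚ (MonoidAlgebra ℚ (Equiv.Perm α)) := by
  classical
  intro d hd D i1 i2 _ ρ hρ
  let _ : Field D := { i1 with mul_comm := h d hd D i1 i2 ρ hρ }
  exact surjective_algebraMap_rat ρ hρ

/-- Induction over finite sets by adding one point. For the empty set the group is trivial and the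
group algebra commutative. -/
theorem isSplitAlg_rat (α : Type) [Fintype α] :
    IsSplitAlg ℚ (MonoidAlgebra ℚ (Equiv.Perm α)) := by
  refine Fintype.induction_empty_option
    (P := fun α _ => IsSplitAlg ℚ (MonoidAlgebra ℚ (Equiv.Perm α))) ?_ ?_ ?_ α
  · intro α β _ e h
    exact h.of_surjective (MonoidAlgebra.domCongr ℚ ℚ e.permCongrHom).toAlgHom
      (MonoidAlgebra.domCongr ℚ ℚ e.permCongrHom).surjective
  · refine isSplitAlg_rat_of_mul_comm fun d hd D _ _ ρ hρ => ?_
    refine mul_comm_of_corner_comm (f := (1 : Matrix (Fin d) (Fin d) D)) one_ne_zero (one_mul _) fun X Y => ?_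
    obtain ⟨X, rfl⟩ := hρ X
    obtain ⟨Y, rfl⟩ := hρ Y
    have : X * Y = Y * X := by
      let _ : CommMonoid (Equiv.Perm PEmpty) := { mul_comm := fun g h => Subsingleton.elim _ _ }
      exact mul_comm (X : MonoidAlgebra ℚ (Equiv.Perm PEmpty)) Y
    simp only [one_mul, mul_one, ← map_mul, this]
  · intro α _ h
    exact isSplitAlg_rat_of_mul_comm fun d hd D _ _ ρ hρ => mul_comm_of_surjective_option h ρ hρ

end Deligne

/-! ### Generation of Grothendieck groups by objects with local endomorphisms -/

namespace Deligne

section Spanning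

variable {C : Type v} [Category.{w} C] [Preadditive C] {I : Type} (E : I → C)

/-- A sum of `n` morphisms that factor through objects of the family `E`. -/
def SumFactors : ℕ → ∀ {X Y : C}, (X ⟶ Y) → Prop
  | 0, _, _, f => f = 0
  | n + 1, X, Y, f => ∃ (l : I) (a : X ⟶ E l) (b : E l ⟶ Y) (g : X ⟶ Y),
      SumFactors n g ∧ f = g + a ≫ b

variable {E}

theorem SumFactors.comp {n : ℕ} {X Y X' Y' : C} {f : X ⟶ Y} (h : SumFactors E n f) (a : X' ⟶ X)
    (b : Y ⟶ Y') : SumFactors E n (a ≫ f ≫ b) := by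
  induction n generalizing f with
  | zero =>
    have h : f = 0 := h
    change _ = 0
    rw [h, Limits.zero_comp, Limits.comp_zero]
  | succ n ih =>
    obtain ⟨l, r, s, g, hg, rfl⟩ := h
    refine ⟨l, a ≫ r, s ≫ b, _, ih hg, ?_⟩
    simp

theorem SumFactors.add {m n : ℕ} {X Y : C} {f g : X ⟶ Y} (hf : SumFactors E m f)
    (hg : SumFactors E n g) : SumFactors E (m + n) (f + g) := by
  induction n generalizing g with
  | zero =>
    have h : g = 0 := hg
    subst h
    exact (add_zero f).symm ▸ hf
  | succ n ih =>
    obtain ⟨l, r, s, g, hg, rfl⟩ := hg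
    exact ⟨l, r, s, _, ih hg, (add_assoc _ _ _).symm⟩

theorem SumFactors.neg {n : ℕ} {X Y : C} {f : X ⟶ Y} (hf : SumFactors E n f) :
    SumFactors E n (-f) := by
  simpa using hf.comp (-𝟙 X) (𝟙 Y)

variable [IsIdempotentComplete C]

/-- This is the generation half of a Krull-Schmidt argument: one factor E_l is removed at a time
from an expression of the identity of X as a sum of composites. -/
theorem cls_mem_closure (hE : ∀ (l : I) (f : End (E l)), IsUnit f ∨ IsNilpotent f)
    {n : ℕ} {X : C} (h : SumFactors E n (𝟙 X)) :
    K0.cls X ∈ AddSubgroup.closure (Set.range fun l => K0.cls (E l)) := by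
  induction n generalizing X with
  | zero =>
    rw [K0.cls_zero ((Limits.IsZero.iff_id_eq_zero X).2 h)]
    exact zero_mem _
  | succ n ih =>
    obtain ⟨l, a, b, g, hg, hX⟩ := h
    rcases hE l (b ≫ a) with hu | ⟨t, ht⟩
    -- If b ≫ a is invertible, E_l is a direct summand of X, and X' is its complement.
    · obtain ⟨v, hv1, hv2⟩ : ∃ v : E l ⟶ E l, v ≫ b ≫ a = 𝟙 _ ∧ (b ≫ a) ≫ v = 𝟙 _ := by
        obtain ⟨u, hu⟩ := hu
        exact ⟨((u⁻¹ : (End (E l))ˣ) : End (E l)), by rw [← hu]; exact u.mul_inv, by rw [← hu]; exact u.inv_mul⟩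
      obtain ⟨X', i, p, hip, hpi⟩ := IsIdempotentComplete.idempotents_split X (𝟙 X - a ≫ v ≫ b) (by
        have : (a ≫ v ≫ b) ≫ a ≫ v ≫ b = a ≫ v ≫ b := by
          have := reassoc_of% hv1
          simp only [Category.assoc]
          rw [this]
        simp only [Preadditive.sub_comp, Preadditive.comp_sub, Category.id_comp, Category.comp_id,
          this, sub_self, sub_zero])
      have hia : i ≫ a = 0 := by
        have h1 : i ≫ p ≫ i ≫ a = i ≫ a := by rw [reassoc_of% hip]
        rw [← h1, reassoc_of% hpi, Preadditive.sub_comp, Category.id_comp, Category.assoc,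
          Category.assoc, hv1, Category.comp_id, sub_self, Limits.comp_zero]
      have hbp : b ≫ p = 0 := by
        have h1 : b ≫ p ≫ i ≫ p = b ≫ p := by rw [hip, Category.comp_id]
        rw [← h1, reassoc_of% hpi, Preadditive.sub_comp, Category.id_comp, Preadditive.comp_sub,
          Category.assoc, Category.assoc, ← Category.assoc b a, ← Category.assoc (b ≫ a), hv2,
          Category.id_comp, sub_self]
      have hsum : IsDirectSum X X' (E l) := ⟨i, b, p, a ≫ v, hip,
        by rw [← Category.assoc, hia, Limits.zero_comp], hbp, by rw [← Category.assoc, hv2], by rw [hpi, Category.assoc, sub_add_cancel]⟩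
      rw [K0.cls_sum hsum]
      refine add_mem (ih ?_) (AddSubgroup.subset_closure ⟨l, rfl⟩)
      -- Since i ≫ a = 0, the identity of X' equals i ≫ g ≫ p and needs one factor fewer.
      have h1 := hg.comp i p
      have h2 : 𝟙 X' = i ≫ 𝟙 X ≫ p := by rw [Category.id_comp, hip]
      rw [hX, Preadditive.add_comp, Preadditive.comp_add, Category.assoc, reassoc_of% hia,
        Limits.zero_comp, add_zero] at h2
      rwa [← h2] at h1
    -- If b ≫ a is nilpotent, so is a ≫ b. Then g = 1 - a ≫ b is invertible, and composing with its
    -- inverse expresses the identity of X itself by n terms.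
    · let x : End X := a ≫ b
      let c : End (E l) := b ≫ a
      have hw : ∀ s : ℕ, x ^ (s + 1) = a ≫ (c ^ s) ≫ b := by
        intro s
        induction s with
        | zero =>
          rw [zero_add, pow_one, pow_zero, End.one_def, Category.id_comp]
        | succ s ih =>
          rw [pow_succ, End.mul_def, ih, pow_succ, End.mul_def]
          simp [x, c]
      have hnil : IsNilpotent x := ⟨t + 1, by
        rw [hw t, show c ^ t = 0 from ht, Limits.zero_comp, Limits.comp_zero]⟩
      obtain ⟨u, hu⟩ := hnil.isUnit_one_sub
      have hg' : g = (u : End X) := by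
        rw [hu, eq_sub_iff_add_eq]
        exact hX.symm
      have h1 := hg.comp (𝟙 X) ((u⁻¹ : (End X)ˣ) : End X)
      have h2 : 𝟙 X ≫ g ≫ ((u⁻¹ : (End X)ˣ) : End X) = 𝟙 X := by
        rw [Category.id_comp, hg']
        exact u.inv_mul
      rw [h2] at h1
      exact ih h1

end Spanning

end Deligne

/-! ### Images of idempotents, ranks and freeness -/

namespace Deligne

section Splits

variable {R : Type u} [Ring R]

/-- `X` is the image of the right multiplication by the idempotent `e`. -/
def Splits (e : R) (X : Type v) [AddCommGroup X] [Module R X] : Prop :=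
  ∃ (i : X →ₗ[R] R) (p : R →ₗ[R] X), (∀ x, p (i x) = x) ∧ ∀ r, i (p r) = r * e

theorem exists_splits {e : R} (he : IsIdempotentElem e) :
    Splits e (LinearMap.range (LinearMap.toSpanSingleton R R e)) := by
  refine ⟨Submodule.subtype _, LinearMap.rangeRestrict _, ?_, fun r => rfl⟩
  rintro ⟨_, r, rfl⟩
  refine Subtype.ext ?_
  change r * e * e = r * e
  rw [mul_assoc, he.eq]

theorem Splits.finite {e : R} {X : Type v} [AddCommGroup X] [Module R X] (h : Splits e X) :
    Module.Finite R X := by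
  obtain ⟨i, p, h1, -⟩ := h
  exact Module.Finite.of_surjective p fun x => ⟨i x, h1 x⟩

theorem Splits.projective {e : R} {X : Type v} [AddCommGroup X] [Module R X] (h : Splits e X) :
    Module.Projective R X := by
  obtain ⟨i, p, h1, -⟩ := h
  exact Module.Projective.of_split i p (LinearMap.ext h1)

/-- Endomorphisms of X correspond to elements of the corner e R e, which are of the form c e plus a
nilpotent element. So an endomorphism is a scalar plus a nilpotent one. -/
theorem Splits.isUnit_or_isNilpotent {k : Type w} [Field k] [Algebra k R] {e : R}
    {J : Submodule k R} (hJ : ∀ x ∈ J, IsNilpotent x)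
    (hc : ∀ r, ∃ c : k, e * r * e - c • e ∈ J) {X : Type v} [AddCommGroup X] [Module R X]
    (h : Splits e X) (f : Module.End R X) : IsUnit f ∨ IsNilpotent f := by
  obtain ⟨i, p, h1, h2⟩ := h
  let _ : Module k X := Module.compHom X (algebraMap k R)
  have : IsScalarTower k R X := ⟨fun c r x => by rw [Algebra.smul_def, mul_smul]; rfl⟩
  have : SMulCommClass R k X := IsScalarTower.to_smulCommClass'
  -- An endomorphism is right multiplication by its value on the generator p 1, so nilpotency can be
  -- tested on that value.
  have hmul : ∀ (g : Module.End R X) x, i (g x) = i x * i (g (p 1)) := fun g x => by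
    conv_lhs => rw [← h1 x, ← mul_one (i x), ← smul_eq_mul, map_smul, map_smul, map_smul]
    rfl
  have hip : i (p 1) = e := by rw [h2, one_mul]
  have hie : ∀ x, i x * e = i x := fun x => by rw [← h2, h1]
  have hnil : ∀ g : Module.End R X, i (g (p 1)) ∈ J → IsNilpotent g := by
    intro g hg
    obtain ⟨t, ht⟩ := hJ _ hg
    refine ⟨t, LinearMap.ext fun x => ?_⟩
    have h3 : ∀ s, i ((g ^ s) x) = i x * i (g (p 1)) ^ s := by
      intro s
      induction s with
      | zero => rw [pow_zero, pow_zero, mul_one]; rfl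
      | succ s ih => rw [pow_succ', Module.End.mul_apply, hmul, ih, pow_succ, mul_assoc]
    have h4 := h3 t
    rw [ht, mul_zero] at h4
    rw [← h1 ((g ^ t) x), h4, map_zero]
    rfl
  set a := i (f (p 1)) with ha
  obtain ⟨c, hc⟩ := hc a
  have hea : e * a * e = a := by
    rw [mul_assoc, ha, hie, ← hip, ← hmul]
  rw [hea] at hc
  have hg : IsNilpotent (f - algebraMap k (Module.End R X) c) := by
    refine hnil _ ?_
    rw [LinearMap.sub_apply, map_sub, Module.algebraMap_end_apply]
    have : i (c • p 1) = c • e := by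
      rw [← hip, ← algebraMap_smul R c (p 1), map_smul, algebraMap_smul]
    rwa [this]
  rcases eq_or_ne c 0 with rfl | hc0
  · right
    rwa [map_zero, sub_zero] at hg
  · left
    have hu : IsUnit (algebraMap k (Module.End R X) c) := (isUnit_iff_ne_zero.2 hc0).map _
    have := hg.isUnit_add_left_of_commute hu (Algebra.commutes c _).symm
    rwa [add_sub_cancel] at this

end Splits

section Fixed

variable {k : Type u} [Field k] {m r : Type} [Fintype m] [Fintype r] [DecidableEq r]

/-- The vectors fixed by a matrix. -/
def fixedSpace (E : Matrix m m k) : Submodule k (m → k) :=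
  LinearMap.eqLocus (Matrix.mulVecLin E) LinearMap.id

theorem mem_fixedSpace {E : Matrix m m k} {v : m → k} : v ∈ fixedSpace E ↔ E.mulVec v = v := Iff.rfl

/-- If V U = 1, then U and V give inverse bijections between vectors of length r and the fixed
vectors of U V. -/
theorem finrank_fixedSpace (U : Matrix m r k) (V : Matrix r m k) (h : V * U = 1) :
    Module.finrank k (fixedSpace (U * V)) = Fintype.card r := by
  have e : (r → k) ≃ₗ[k] fixedSpace (U * V) :=
    { toFun := fun w => ⟨U.mulVec w, by
        rw [mem_fixedSpace, Matrix.mulVec_mulVec, Matrix.mul_assoc, h, Matrix.mul_one]⟩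
      map_add' := fun w w' => Subtype.ext (Matrix.mulVec_add _ _ _)
      map_smul' := fun c w => Subtype.ext (Matrix.mulVec_smul _ _ _)
      invFun := fun v => V.mulVec v.1
      left_inv := fun w => by
        change V.mulVec (U.mulVec w) = w
        rw [Matrix.mulVec_mulVec, h, Matrix.one_mulVec]
      right_inv := fun v => Subtype.ext (by
        change U.mulVec (V.mulVec v.1) = v.1
        rw [Matrix.mulVec_mulVec]
        exact v.2) }
  rw [← e.finrank_eq, Module.finrank_fintype_fun_eq_card]

theorem exists_factorization [DecidableEq m] {E : Matrix m m k} (hE : E * E = E) :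
    ∃ (r : ℕ) (U : Matrix m (Fin r) k) (V : Matrix (Fin r) m k), U * V = E ∧ V * U = 1 := by
  let b := Module.finBasis k (fixedSpace E)
  let q : (m → k) →ₗ[k] fixedSpace E := (Matrix.mulVecLin E).codRestrict _ fun v => by
    rw [mem_fixedSpace, Matrix.mulVecLin_apply, Matrix.mulVec_mulVec, hE]
  let u : (Fin _ → k) →ₗ[k] (m → k) := (fixedSpace E).subtype ∘ₗ b.equivFun.symm.toLinearMap
  let w : (m → k) →ₗ[k] (Fin _ → k) := b.equivFun.toLinearMap ∘ₗ q
  refine ⟨_, LinearMap.toMatrix' u, LinearMap.toMatrix' w, ?_, ?_⟩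
  · rw [← LinearMap.toMatrix'_comp]
    have : u ∘ₗ w = Matrix.mulVecLin E := LinearMap.ext fun v => by simp [u, w, q]
    rw [this]
    exact LinearMap.toMatrix'_toLin' E
  · rw [← LinearMap.toMatrix'_comp]
    have : w ∘ₗ u = LinearMap.id := LinearMap.ext fun v => by
      have : ∀ x : fixedSpace E, q x = x := fun x => Subtype.ext x.2
      simp only [w, u, LinearMap.comp_apply, LinearEquiv.coe_coe, Submodule.subtype_apply, this,
        LinearEquiv.apply_symm_apply, LinearMap.id_apply]
    rw [this, LinearMap.toMatrix'_id]

/-- A factorisation of the idempotent matrix as U V with V U = 1 remains one after extension of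
scalars, and its inner size is the rank. -/
theorem finrank_fixedSpace_map [DecidableEq m] {F : Type w} [Field F] [Algebra F k] {E : Matrix m m F}
    (hE : E * E = E) :
    Module.finrank k (fixedSpace (E.map (algebraMap F k))) = Module.finrank F (fixedSpace E) := by
  obtain ⟨r, U, V, rfl, hVU⟩ := exists_factorization hE
  rw [finrank_fixedSpace U V hVU, Matrix.map_mul, finrank_fixedSpace]
  rw [← Matrix.map_mul, hVU]
  exact Matrix.map_one _ (map_zero _) (map_one _)

end Fixed

/-- Generators with a dual family of integral functionals are a basis. This turns generation by the
projectives and their ranks into freeness of K₀. -/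
theorem bijective_of_closure {A : Type v} [AddCommGroup A] {N : ℕ} (x : Fin N → A)
    (hx : ∀ a, a ∈ AddSubgroup.closure (Set.range x)) (d : A →+ (Fin N → ℤ))
    (hd : ∀ i, d (x i) = Pi.single i 1) : Function.Bijective d := by
  have h1 : ∀ a, a = ∑ i, d a i • x i := fun a => by
    induction hx a using AddSubgroup.closure_induction with
    | mem a ha =>
      obtain ⟨i, rfl⟩ := ha
      rw [hd, Finset.sum_eq_single i]
      · rw [Pi.single_eq_same, one_smul]
      · intro j _ hj
        rw [Pi.single_eq_of_ne hj, zero_smul]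
      · exact fun h => (h (Finset.mem_univ _)).elim
    | zero => simp
    | add a b _ _ ha hb => 
      simp only [map_add, Pi.add_apply, add_smul, Finset.sum_add_distrib, ← ha, ← hb]
    | neg a _ ha => simp only [map_neg, Pi.neg_apply, neg_smul, Finset.sum_neg_distrib, ← ha]
  refine ⟨fun a b hab => ?_, fun n => ⟨∑ i, n i • x i, ?_⟩⟩
  · rw [h1 a, h1 b, hab]
  · rw [map_sum]
    simp only [map_zsmul, hd]
    ext j
    simp [Finset.sum_apply, Pi.single_apply]

end Deligne

/-! ### Matrix representations and extension of scalars -/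

namespace Deligne

section VecMod

variable {R : Type u} [Ring R] {k : Type w} [Field k] [Algebra k R] {m : Type} [Fintype m]
  [DecidableEq m]

/-- The column vectors, with the action of `R` by a matrix representation. -/
def VecMod (_ : R →ₐ[k] Matrix m m k) : Type w := m → k

variable (φ : R →ₐ[k] Matrix m m k)

instance : AddCommGroup (VecMod φ) := inferInstanceAs (AddCommGroup (m → k))

instance : Module k (VecMod φ) := inferInstanceAs (Module k (m → k))

instance : Module.Finite k (VecMod φ) := inferInstanceAs (Module.Finite k (m → k))

instance : Module R (VecMod φ) where
  smul r v := (φ r).mulVec v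
  one_smul v := (congrArg (fun M => Matrix.mulVec M v) (map_one φ)).trans (Matrix.one_mulVec _)
  mul_smul r s v := (congrArg (fun M => Matrix.mulVec M v) (map_mul φ r s)).trans
    (Matrix.mulVec_mulVec _ _ _).symm
  smul_zero _ := Matrix.mulVec_zero _
  smul_add _ _ _ := Matrix.mulVec_add _ _ _
  add_smul r s v := (congrArg (fun M => Matrix.mulVec M v) (map_add φ r s)).trans
    (Matrix.add_mulVec _ _ _)
  zero_smul v := (congrArg (fun M => Matrix.mulVec M v) (map_zero φ)).trans (Matrix.zero_mulVec _)

instance : SMulCommClass R k (VecMod φ) := ⟨fun _ _ _ => Matrix.mulVec_smul _ _ _⟩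

theorem finite_hom_vecMod (X : Type v) [AddCommGroup X] [Module R X] [Module.Finite R X] :
    Module.Finite k (X →ₗ[R] VecMod φ) := by
  obtain ⟨n, s, hs⟩ := Module.Finite.exists_fin (R := R) (M := X)
  let g : (X →ₗ[R] VecMod φ) →ₗ[k] (Fin n → VecMod φ) :=
    { toFun := fun f i => f (s i)
      map_add' := fun f f' => rfl
      map_smul' := fun c f => rfl }
  exact Module.Finite.of_injective g fun f f' h =>
    LinearMap.ext_on_range hs fun i => congrFun h i

/-- A homomorphism from the image of e is determined by the value on the generator p 1, which can be
any vector fixed by e. -/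
theorem Splits.finrank_hom {e : R} {X : Type v} [AddCommGroup X] [Module R X] (h : Splits e X) :
    Module.finrank k (X →ₗ[R] VecMod φ) = Module.finrank k (fixedSpace (φ e)) := by
  obtain ⟨i, p, h1, h2⟩ := h
  have hp : ∀ x, e • p x = p (e * x) := fun x => by rw [← smul_eq_mul, map_smul]
  have hpe : p e = p 1 := by
    rw [← one_mul e, ← h2, h1]
  refine LinearEquiv.finrank_eq
    { toFun := fun f => ⟨f (p 1), ?_⟩
      map_add' := fun f f' => rfl
      map_smul' := fun c f => rfl
      invFun := fun v => (LinearMap.toSpanSingleton R (VecMod φ) v.1) ∘ₗ i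
      left_inv := fun f => ?_
      right_inv := fun v => Subtype.ext ?_ }
  · change e • f (p 1) = f (p 1)
    rw [← map_smul, hp, mul_one, hpe]
  · ext x
    change i x • f (p 1) = f x
    rw [← map_smul, ← map_smul, smul_eq_mul, mul_one, h1]
  · change i (p 1) • (show VecMod φ from v.1) = v.1
    rw [h2, one_mul]
    exact v.2

end VecMod

section Scalars

variable {F : Type} [Field F] {k : Type u} [Field k] [Algebra F k] {n : ℕ}

variable (k) in
/-- Extension of scalars of group algebras. -/
def extScal (n : ℕ) : GrpAlg F n →+* GrpAlg k n :=
  RingHom.op (MonoidAlgebra.mapRingHom _ (algebraMap F k))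

theorem extScal_single (σ : Equiv.Perm (Fin n)) (c : F) :
    extScal k n (MulOpposite.op (MonoidAlgebra.single σ c)) =
      MulOpposite.op (MonoidAlgebra.single σ (algebraMap F k c)) := by
  simp [extScal]

variable (k) in
/-- Extension of scalars of a matrix representation. -/
def extRep {m : Type} [Fintype m] [DecidableEq m] (ρ : GrpAlg F n →ₐ[F] Matrix m m F) :
    GrpAlg k n →ₐ[k] Matrix m m k :=
  AlgHom.opComm (MonoidAlgebra.lift k (Matrix m m k)ᵐᵒᵖ (Equiv.Perm (Fin n))
    { toFun := fun σ => MulOpposite.op ((ρ (MulOpposite.op (.single σ 1))).map (algebraMap F k))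
      map_one' := by
        rw [← MonoidAlgebra.one_def, MulOpposite.op_one, map_one,
          Matrix.map_one _ (map_zero _) (map_one _), MulOpposite.op_one]
      map_mul' := fun σ τ => by
        rw [← MulOpposite.op_mul, ← Matrix.map_mul, ← map_mul, ← MulOpposite.op_mul,
          MonoidAlgebra.single_mul_single, one_mul] })

theorem extRep_single {m : Type} [Fintype m] [DecidableEq m] (ρ : GrpAlg F n →ₐ[F] Matrix m m F)
    (σ : Equiv.Perm (Fin n)) (c : k) : extRep k ρ (MulOpposite.op (.single σ c)) =
      c • (ρ (MulOpposite.op (.single σ 1))).map (algebraMap F k) := by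
  simp [extRep, AlgHom.opComm]

theorem extRep_extScal {m : Type} [Fintype m] [DecidableEq m] (ρ : GrpAlg F n →ₐ[F] Matrix m m F)
    (a : GrpAlg F n) : extRep k ρ (extScal k n a) = (ρ a).map (algebraMap F k) := by
  refine GMod.algInd (P := fun a => extRep k ρ (extScal k n a) = (ρ a).map (algebraMap F k)) a
    ?_ ?_ ?_
  · simp
  · intro a b ha hb
    simp [ha, hb, Matrix.map_add]
  · intro σ c
    rw [extScal_single, extRep_single]
    have : (MulOpposite.op (MonoidAlgebra.single σ c) : GrpAlg F n) = c • MulOpposite.op (.single σ 1) := by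
      rw [← MulOpposite.op_smul]; simp
    rw [this, map_smul]
    ext i j
    simp

end Scalars

end Deligne

/-! ### The category of projective modules and the rank functionals -/

namespace Deligne

section Proj

variable {k : Type u} [Field k] {n : ℕ}

/-- The morphism of projective modules given by a linear map. -/
def projHom {P Q : Proj k n} (f : P.obj →ₗ[GrpAlg k n] Q.obj) : P ⟶ Q := ⟨ModuleCat.ofHom f⟩

theorem projHom_comp {P Q R : Proj k n} (f : P.obj →ₗ[GrpAlg k n] Q.obj)
    (g : Q.obj →ₗ[GrpAlg k n] R.obj) : projHom f ≫ projHom g = projHom (P := P) (Q := R) (g ∘ₗ f) := rfl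

/-- Linear endomorphisms as endomorphisms in the category of projective modules. -/
def projEnd (P : Proj k n) : Module.End (GrpAlg k n) P.obj →+* End P where
  toFun f := projHom f
  map_one' := rfl
  map_mul' _ _ := rfl
  map_zero' := rfl
  map_add' _ _ := rfl

instance : IsIdempotentComplete (Proj k n) where
  idempotents_split P e he := by
    let f : P.obj →ₗ[GrpAlg k n] P.obj := e.hom.hom
    have hf : ∀ x, f (f x) = f x := fun x =>
      LinearMap.congr_fun (congrArg (fun e : P ⟶ P => e.hom.hom) he) x
    have h1 : ∀ x : LinearMap.range f, f.rangeRestrict x.1 = x := by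
      rintro ⟨_, x, rfl⟩
      exact Subtype.ext (hf x)
    have := P.property.1
    have := P.property.2
    let Q : Proj k n := ⟨ModuleCat.of _ (LinearMap.range f),
      Module.Finite.of_surjective f.rangeRestrict f.surjective_rangeRestrict,
      Module.Projective.of_split (Submodule.subtype _) f.rangeRestrict (LinearMap.ext h1)⟩
    refine ⟨Q, projHom (P := Q) (Q := P) (Submodule.subtype _),
      projHom (P := P) (Q := Q) f.rangeRestrict, ?_, ?_⟩
    · exact congrArg (projHom (P := Q) (Q := Q)) (LinearMap.ext h1)
    · rfl

theorem exists_proj_splits {e : GrpAlg k n} (he : IsIdempotentElem e) :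
    ∃ P : Proj k n, Splits e P.obj :=
  ⟨⟨ModuleCat.of _ _, (exists_splits he).finite, (exists_splits he).projective⟩, exists_splits he⟩

/-- The identity of P factors through a free module of finite rank, and writing 1 as a sum of
elements a e_l b makes the identity of each free summand a sum of maps through the modules E_l. -/
theorem exists_sumFactors {I : Type} {e : I → GrpAlg k n} {E : I → Proj k n}
    (hE : ∀ l, Splits (e l) (E l).obj)
    (h1 : 1 ∈ AddSubgroup.closure {x | ∃ i a b, x = a * e i * b}) (P : Proj k n) :
    ∃ N, SumFactors E N (𝟙 P) := by
  have := P.property.1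
  have := P.property.2
  obtain ⟨N, f, g, -, -, hfg⟩ := Module.Finite.exists_comp_eq_id_of_projective (GrpAlg k n) P.obj
  have key : ∀ x ∈ AddSubgroup.closure {x | ∃ i a b, x = a * e i * b},
      ∀ s : Fin N, ∃ M, SumFactors E M (projHom (P := P) (Q := P)
        (LinearMap.toSpanSingleton _ _ (f (Pi.single s 1)) ∘ₗ
          LinearMap.toSpanSingleton _ _ x ∘ₗ LinearMap.proj s ∘ₗ g)) := by
    intro x hx s
    induction hx using AddSubgroup.closure_induction with
    | mem x hx =>
      obtain ⟨l, a, b, rfl⟩ := hx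
      -- Right multiplication by a e_l b is right multiplication by a, projection to E_l, inclusion,
      -- and right multiplication by b.
      obtain ⟨i, p, h2, h3⟩ := hE l
      refine ⟨1, l, projHom (P := P) (Q := E l)
        (p ∘ₗ LinearMap.toSpanSingleton _ _ a ∘ₗ LinearMap.proj s ∘ₗ g),
        projHom (P := E l) (Q := P) (LinearMap.toSpanSingleton _ _ (f (Pi.single s 1)) ∘ₗ
          LinearMap.toSpanSingleton _ _ b ∘ₗ i), 0, rfl, ?_⟩
      rw [zero_add, projHom_comp]
      congr 1
      ext y
      change (g y s * (a * e l * b)) • f (Pi.single s 1) =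
        (i (p (g y s * a)) * b) • f (Pi.single s 1)
      rw [h3, mul_assoc, mul_assoc, mul_assoc]
    | zero =>
      refine ⟨0, ?_⟩
      change projHom _ = 0
      rw [LinearMap.toSpanSingleton_zero, LinearMap.zero_comp, LinearMap.comp_zero]
      rfl
    | add x y _ _ hx hy =>
      obtain ⟨M, hM⟩ := hx
      obtain ⟨M', hM'⟩ := hy
      refine ⟨M + M', ?_⟩
      rw [LinearMap.toSpanSingleton_add, LinearMap.add_comp, LinearMap.comp_add]
      exact hM.add hM'
    | neg x _ hx =>
      obtain ⟨M, hM⟩ := hx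
      refine ⟨M, ?_⟩
      have : LinearMap.toSpanSingleton (GrpAlg k n) _ (-x) = - LinearMap.toSpanSingleton _ _ x :=
        LinearMap.ext fun r => smul_neg _ _
      rw [this, LinearMap.neg_comp, LinearMap.comp_neg]
      exact hM.neg
  have hsum : ∀ t : Finset (Fin N), ∃ M, SumFactors E M (projHom (P := P) (Q := P)
      (∑ s ∈ t, LinearMap.toSpanSingleton _ _ (f (Pi.single s 1)) ∘ₗ
        LinearMap.toSpanSingleton _ _ 1 ∘ₗ LinearMap.proj s ∘ₗ g)) := by
    classical
    intro t
    induction t using Finset.induction_on with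
    | empty => exact ⟨0, rfl⟩
    | insert s t hs ih =>
      obtain ⟨M, hM⟩ := ih
      obtain ⟨M', hM'⟩ := key 1 h1 s
      refine ⟨M' + M, ?_⟩
      rw [Finset.sum_insert hs]
      exact hM'.add hM
  obtain ⟨M, hM⟩ := hsum Finset.univ
  refine ⟨M, ?_⟩
  convert hM
  change projHom (P := P) (Q := P) LinearMap.id = _
  congr 1
  rw [← hfg]
  ext y
  rw [LinearMap.sum_apply]
  change f (g y) = ∑ s, (g y s * 1) • f (Pi.single s 1)
  conv_lhs => rw [← Finset.univ_sum_single (g y), map_sum]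
  refine Finset.sum_congr rfl fun s _ => ?_
  rw [mul_one, ← map_smul, ← Pi.single_smul, smul_eq_mul, mul_one]

/-- The dimension of the space of homomorphisms to the module of a matrix representation, as a
function on the Grothendieck group. -/
def homRank {m : Type} [Fintype m] [DecidableEq m] (φ : GrpAlg k n →ₐ[k] Matrix m m k) :
    SymK k n →+ ℤ :=
  K0.lift (fun P => (Module.finrank k (P.obj →ₗ[GrpAlg k n] VecMod φ) : ℤ)) (by
    rintro Z X Y ⟨a, b, p, q, h1, h2, h3, h4, h5⟩
    have := X.property.1
    have := Y.property.1
    have := finite_hom_vecMod φ X.obj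
    have := finite_hom_vecMod φ Y.obj
    have h1 := fun x => LinearMap.congr_fun (congrArg (fun e : X ⟶ X => e.hom.hom) h1) x
    have h2 := fun x => LinearMap.congr_fun (congrArg (fun e : X ⟶ Y => e.hom.hom) h2) x
    have h3 := fun x => LinearMap.congr_fun (congrArg (fun e : Y ⟶ X => e.hom.hom) h3) x
    have h4 := fun x => LinearMap.congr_fun (congrArg (fun e : Y ⟶ Y => e.hom.hom) h4) x
    have h5 := fun x => LinearMap.congr_fun (congrArg (fun e : Z ⟶ Z => e.hom.hom) h5) x
    change ∀ x, p.hom.hom (a.hom.hom x) = x at h1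
    change ∀ x, q.hom.hom (a.hom.hom x) = 0 at h2
    change ∀ x, p.hom.hom (b.hom.hom x) = 0 at h3
    change ∀ x, q.hom.hom (b.hom.hom x) = x at h4
    change ∀ x, a.hom.hom (p.hom.hom x) + b.hom.hom (q.hom.hom x) = x at h5
    have e : (Z.obj →ₗ[GrpAlg k n] VecMod φ) ≃ₗ[k]
        (X.obj →ₗ[GrpAlg k n] VecMod φ) × (Y.obj →ₗ[GrpAlg k n] VecMod φ) :=
      { toFun := fun f => (f ∘ₗ a.hom.hom, f ∘ₗ b.hom.hom)
        map_add' := fun f f' => rfl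
        map_smul' := fun c f => rfl
        invFun := fun f => f.1 ∘ₗ p.hom.hom + f.2 ∘ₗ q.hom.hom
        left_inv := fun f => by
          ext x
          change f (a.hom.hom (p.hom.hom x)) + f (b.hom.hom (q.hom.hom x)) = f x
          rw [← map_add, h5]
        right_inv := fun f => by
          refine Prod.ext (LinearMap.ext fun x => ?_) (LinearMap.ext fun x => ?_)
          · change f.1 (p.hom.hom (a.hom.hom x)) + f.2 (q.hom.hom (a.hom.hom x)) = f.1 x
            rw [h1, h2, map_zero, add_zero]
          · change f.1 (p.hom.hom (b.hom.hom x)) + f.2 (q.hom.hom (b.hom.hom x)) = f.2 x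
            rw [h3, h4, map_zero, zero_add] }
    rw [e.finrank_eq, Module.finrank_prod, Nat.cast_add])

theorem homRank_cls {m : Type} [Fintype m] [DecidableEq m] (φ : GrpAlg k n →ₐ[k] Matrix m m k)
    {e : GrpAlg k n} {P : Proj k n} (h : Splits e P.obj) :
    homRank φ (K0.cls P) = Module.finrank k (fixedSpace (φ e)) :=
  (K0.lift_cls _ _ P).trans (congrArg Nat.cast (h.finrank_hom φ))

end Proj

end Deligne

/-! ### Independence of the Grothendieck group from the extension field -/

namespace Deligne

theorem AddMonoidHom.map_mem_closure_image {A B : Type*} [AddGroup A] [AddGroup B] (f : A →+ B)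
    {s : Set A} {t : Set B} (h : ∀ x ∈ s, f x ∈ t) {x : A} (hx : x ∈ AddSubgroup.closure s) :
    f x ∈ AddSubgroup.closure t :=
  (AddSubgroup.closure_le (K := (AddSubgroup.closure t).comap f)).2
    (fun x hx => AddSubgroup.subset_closure (h x hx)) hx

namespace SplitData

variable {F : Type} [Field F] {n : ℕ} (S : SplitData F (GrpAlg F n)) (k : Type u) [Field k]
  [Algebra F k]

/-- The radical over an extension field. -/
def extRad : Submodule k (GrpAlg k n) := Submodule.span k (extScal (F := F) k n '' (S.rad : Set (GrpAlg F n)))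

open Pointwise in
-- The t-th power of the span is the span of the t-fold products of the extended radical, and these
-- products are already zero over F.
theorem isNilpotent_of_mem_extRad {x : GrpAlg k n} (hx : x ∈ S.extRad k) : IsNilpotent x := by
  refine ⟨S.t, ?_⟩
  have h1 := Submodule.pow_mem_pow _ hx S.t
  rw [extRad, Submodule.span_pow, ← Set.image_pow] at h1
  have h2 : extScal (F := F) k n '' ((S.rad : Set (GrpAlg F n)) ^ S.t) ⊆ {0} := by
    rintro _ ⟨y, hy, rfl⟩
    have h3 : y ∈ S.rad ^ S.t := Submodule.pow_subset_pow _ hy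
    rw [S.rad_pow, Submodule.mem_bot] at h3
    rw [h3, map_zero]
    rfl
  have h3 := Submodule.span_mono (R := k) h2 h1
  rwa [Submodule.span_zero_singleton, Submodule.mem_bot] at h3

theorem extScal_smul (c : F) (a : GrpAlg F n) :
    extScal k n (c • a) = algebraMap F k c • extScal k n a := by
  refine GMod.algInd (P := fun a => extScal k n (c • a) = algebraMap F k c • extScal k n a) a ?_ ?_ ?_
  · simp
  · intro a b ha hb
    rw [smul_add, map_add, map_add, smul_add, ha, hb]
  · intro σ d
    rw [← MulOpposite.op_smul, MonoidAlgebra.smul_single, extScal_single, extScal_single,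
      ← MulOpposite.op_smul, MonoidAlgebra.smul_single, smul_eq_mul, smul_eq_mul, map_mul]

/-- The condition is linear in r, so r may be a scalar multiple of a permutation, which is defined
over F. Thus the e_i stay primitive over k. -/
theorem extRad_corner (i : Fin S.N) (r : GrpAlg k n) :
    ∃ c : k, extScal k n (S.e i) * r * extScal k n (S.e i) - c • extScal k n (S.e i) ∈
      S.extRad k := by
  refine GMod.algInd (P := fun r => ∃ c : k, extScal k n (S.e i) * r * extScal k n (S.e i) -
    c • extScal k n (S.e i) ∈ S.extRad k) r ?_ ?_ ?_
  · exact ⟨0, by simp⟩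
  · rintro a b ⟨c, hc⟩ ⟨d, hd⟩
    refine ⟨c + d, ?_⟩
    have := add_mem hc hd
    rwa [← add_sub_add_comm, ← add_smul, ← add_mul, ← mul_add] at this
  · intro σ d
    obtain ⟨c, hc⟩ := S.corner i (MulOpposite.op (.single σ 1))
    have h1 : extScal k n (S.e i * MulOpposite.op (.single σ 1) * S.e i - c • S.e i) ∈ S.extRad k :=
      Submodule.subset_span ⟨_, hc, rfl⟩
    refine ⟨d * algebraMap F k c, ?_⟩
    have h2 := Submodule.smul_mem _ d h1
    rw [map_sub, map_mul, map_mul, extScal_smul, extScal_single, map_one, smul_sub, smul_smul] at h2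
    have h3 : (MulOpposite.op (MonoidAlgebra.single σ d) : GrpAlg k n) =
        d • MulOpposite.op (.single σ 1) := by
      rw [← MulOpposite.op_smul, MonoidAlgebra.smul_single, smul_eq_mul, mul_one]
    rwa [h3, mul_smul_comm, smul_mul_assoc]

theorem idem_extScal {f : GrpAlg F n} (hf : IsIdempotentElem f) :
    IsIdempotentElem (extScal k n f) := hf.map _

/-- The indecomposable projective modules. -/
def proj (i : Fin S.N) : Proj k n := (exists_proj_splits (idem_extScal k (S.idem i))).choose

theorem splits_proj (i : Fin S.N) : Splits (extScal k n (S.e i)) (S.proj k i).obj :=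
  (exists_proj_splits (idem_extScal k (S.idem i))).choose_spec

/-- The ideal generated by the e_i still contains 1 over k, and the endomorphisms of their modules
are invertible or nilpotent, so `cls_mem_closure` applies. -/
theorem mem_closure_proj (x : SymK k n) :
    x ∈ AddSubgroup.closure (Set.range fun i => K0.cls (S.proj k i)) := by
  refine K0.induction (P := fun x => x ∈ AddSubgroup.closure (Set.range fun i =>
    K0.cls (S.proj k i))) (zero_mem _) (fun P => ?_) (fun x hx => neg_mem hx)
    (fun x y hx hy => add_mem hx hy) x
  obtain ⟨N, hN⟩ := exists_sumFactors (S.splits_proj k) (by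
    have h1 := AddMonoidHom.map_mem_closure_image (extScal (F := F) k n).toAddMonoidHom
      (t := {x | ∃ i a b, x = a * extScal k n (S.e i) * b}) ?_ S.full
    · rwa [show (extScal (F := F) k n).toAddMonoidHom 1 = 1 from map_one (extScal (F := F) k n)] at h1
    · rintro _ ⟨i, a, b, rfl⟩
      exact ⟨i, extScal k n a, extScal k n b, by simp⟩) P
  refine cls_mem_closure (fun l f => ?_) hN
  have h2 := (S.splits_proj k l).isUnit_or_isNilpotent (fun x hx => S.isNilpotent_of_mem_extRad k hx)
    (S.extRad_corner k l) f.hom.hom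
  rw [← show projEnd _ f.hom.hom = f from rfl]
  exact h2.imp (fun h => h.map _) (fun h => h.map _)

/-- The ranks of the spaces of homomorphisms to the simple modules. -/
def rankVec : SymK k n →+ (Fin S.N → ℤ) := AddMonoidHom.pi fun j => homRank (extRep k (S.ρ j))

/-- The rank of an idempotent matrix over F does not change over k. So an idempotent defined over F
has the same rank vector over both fields. -/
theorem rankVec_cls {f : GrpAlg F n} (hf : IsIdempotentElem f) {P : Proj k n}
    (h : Splits (extScal k n f) P.obj) :
    S.rankVec k (K0.cls P) = fun j => (Module.finrank F (fixedSpace (S.ρ j f)) : ℤ) := by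
  ext j
  refine (homRank_cls (extRep k (S.ρ j)) h).trans (congrArg Nat.cast ?_)
  rw [extRep_extScal, finrank_fixedSpace_map]
  rw [← map_mul, hf.eq]

/-- In the j-th representation e_i becomes a matrix unit, of rank one, if i = j, and zero otherwise.
-/
theorem rankVec_proj (i : Fin S.N) : S.rankVec k (K0.cls (S.proj k i)) = Pi.single i 1 := by
  rw [S.rankVec_cls k (S.idem i) (S.splits_proj k i)]
  ext j
  rcases eq_or_ne i j with rfl | hij
  · rw [Pi.single_eq_same, S.ρ_self]
    have := finrank_fixedSpace (k := F) (r := Fin 1) (Matrix.single (0 : Fin (S.m i)) (0 : Fin 1) 1)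
      (Matrix.single (0 : Fin 1) (0 : Fin (S.m i)) 1) (by
        rw [Matrix.single_mul_single_same]
        ext a b
        rw [Subsingleton.elim a 0, Subsingleton.elim b 0]
        simp)
    rw [Matrix.single_mul_single_same, mul_one] at this
    rw [this]
    rfl
  · rw [Pi.single_eq_of_ne (Ne.symm hij), S.ρ_ne i j hij]
    have := finrank_fixedSpace (k := F) (m := Fin (S.m j)) (r := Fin 0) 0 0 (Subsingleton.elim _ _)
    rw [Matrix.zero_mul] at this
    rw [this]
    rfl

theorem bijective_rankVec : Function.Bijective (S.rankVec k) :=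
  bijective_of_closure _ (S.mem_closure_proj k) _ (S.rankVec_proj k)

end SplitData

section

variable {F : Type} [Field F] {n : ℕ}

theorem extScal_self (a : GrpAlg F n) : extScal F n a = a := by
  refine GMod.algInd (P := fun a => extScal F n a = a) a (map_zero _) (fun a b ha hb => ?_)
    fun σ c => ?_
  · rw [map_add, ha, hb]
  · rw [extScal_single]
    rfl

variable (k : Type u) [Field k] [Algebra F k]

/-- Over F and over k the rank vector identifies K₀ with the same free abelian group. The resulting
isomorphism is extension of scalars, since idempotents over F have the same rank vector on both
sides. -/
theorem exists_extScal_equiv (S : SplitData F (GrpAlg F n)) : ∃ ψ : SymK F n ≃+ SymK k n,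
    ∀ (f : GrpAlg F n), IsIdempotentElem f → ∀ (P : Proj F n) (Q : Proj k n), Splits f P.obj →
      Splits (extScal k n f) Q.obj → ψ (K0.cls P) = K0.cls Q := by
  let d := AddEquiv.ofBijective _ (S.bijective_rankVec F)
  let d' := AddEquiv.ofBijective _ (S.bijective_rankVec k)
  refine ⟨d.trans d'.symm, fun f hf P Q hP hQ => ?_⟩
  rw [AddEquiv.trans_apply, AddEquiv.symm_apply_eq]
  refine (S.rankVec_cls F hf ?_).trans (S.rankVec_cls k hf hQ).symm
  rwa [extScal_self]

theorem closure_splits_eq_top (S : SplitData F (GrpAlg F n)) (x : SymK F n) :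
    x ∈ AddSubgroup.closure {x | ∃ (f : GrpAlg F n) (P : Proj F n), IsIdempotentElem f ∧
      Splits f P.obj ∧ x = K0.cls P} := by
  refine AddSubgroup.closure_mono ?_ (S.mem_closure_proj F x)
  rintro _ ⟨i, rfl⟩
  exact ⟨_, _, S.idem i, by simpa only [extScal_self] using S.splits_proj F i, rfl⟩

end

end Deligne

/-! ### Compatibility with induction, and dependence on the characteristic alone -/

namespace Deligne
open MonoidalCategory

variable {k : Type u} [Field k]

theorem Splits.isIdempotentElem {R : Type u} [Ring R] {e : R} {X : Type v} [AddCommGroup X]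
    [Module R X] (h : Splits e X) : IsIdempotentElem e := by
  obtain ⟨i, p, h1, h2⟩ := h
  have h3 : i (p 1) = e := by rw [h2, one_mul]
  rw [IsIdempotentElem]
  conv_lhs => enter [1]; rw [← h3]
  rw [← h2, h1, h3]

theorem reg_std {m n : ℕ} (a : GrpAlg k m) (b : GrpAlg k n) :
    GMod.reg (GMod.std (rfl : m + n = m + n)) a b = GMod.algRight rfl b * GMod.algLeft rfl a := by
  rw [GMod.reg, Equiv.self_trans_symm]
  exact GMod.act_one _

/-- The induction product of the modules cut out by e and f is cut out by the product of the
commuting images of e and f in the group algebra of S_{m+n}. An explicit idempotent is needed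
because it can be compared under extension of scalars. -/
theorem Splits.tens {X Y : GMod k} {m n : ℕ} (hX : ∀ j, j ≠ m → Subsingleton (X j))
    (hY : ∀ j, j ≠ n → Subsingleton (Y j)) {e : GrpAlg k m} {f : GrpAlg k n}
    (he : Splits e (X m)) (hf : Splits f (Y n)) :
    Splits (GMod.algRight (rfl : m + n = m + n) f * GMod.algLeft rfl e)
      (GMod.tens X Y (m + n)) := by
  obtain ⟨i, p, h1, h2⟩ := he
  obtain ⟨i', p', h1', h2'⟩ := hf
  -- The inclusions are extended by zero to the other degrees, where the modules vanish, so that the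
  -- universal property of the product applies.
  let iX : ∀ j, X j →ₗ[GrpAlg k j] GrpAlg k j := Function.update (fun _ => 0) m i
  let iY : ∀ j, Y j →ₗ[GrpAlg k j] GrpAlg k j := Function.update (fun _ => 0) n i'
  have hiX : iX m = i := Function.update_self _ _ _
  have hiY : iY n = i' := Function.update_self _ _ _
  have hsX : ∀ {j} c x, iX j (GMod.sc c x) = GMod.sc c (iX j x) := fun c x => map_smul _ _ _
  have hsY : ∀ {j} c x, iY j (GMod.sc c x) = GMod.sc c (iY j x) := fun c x => map_smul _ _ _
  have haX : ∀ {j} c x, iX j (GMod.act (k := k) c x) = GMod.act (k := k) c (iX j x) := fun c x => map_smul _ _ _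
  have haY : ∀ {j} c x, iY j (GMod.act (k := k) c x) = GMod.act (k := k) c (iY j x) := fun c x => map_smul _ _ _
  let I : GMod.tens X Y ⟶ (fun N => ModuleCat.of (GrpAlg k N) (GrpAlg k N) : GMod k) :=
    GMod.homDesc (fun {N a b} θ x y => GMod.reg θ (iX a x) (iY b y))
      (fun N =>
        { add_left := fun θ x x' y => by rw [map_add, GMod.reg_add_left]
          add_right := fun θ x y y' => by rw [map_add, GMod.reg_add_right]
          scalar := fun θ c x y => by
            rw [hsX, hsY, GMod.reg_sc_left, GMod.reg_sc_right]
          perm := fun θ σ τ x y => by rw [haX, haY, GMod.reg_act] })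
      (fun c θ x y => by rw [hsX, GMod.reg_sc_left])
      (fun π θ x y => GMod.reg_trans _ _ _ _)
  have hI : ∀ {a b} (θ : Fin (m + n) ≃ Fin a ⊕ Fin b) (x : X a) (y : Y b),
      (I (m + n)).hom (GMod.el θ x y) = GMod.reg θ (iX a x) (iY b y) := fun θ x y =>
    GMod.homDesc_el _ _ _ _ θ x y
  refine ⟨(I (m + n)).hom, LinearMap.toSpanSingleton _ _ (GMod.el (GMod.std rfl) (p 1) (p' 1)), ?_, ?_⟩
  · have hp : ∀ x, i x • p 1 = x := fun x => by rw [← map_smul, smul_eq_mul, mul_one, h1]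
    have hp' : ∀ x, i' x • p' 1 = x := fun x => by rw [← map_smul, smul_eq_mul, mul_one, h1']
    -- The elements on which projection after inclusion is the identity form a subgroup, so pure
    -- tensors suffice; only those of degrees m and n are nonzero.
    let S : AddSubgroup (GMod.tens X Y (m + n)) := ((LinearMap.toSpanSingleton _ _
      (GMod.el (GMod.std rfl) (p 1) (p' 1)) ∘ₗ (I (m + n)).hom) - LinearMap.id).toAddMonoidHom.ker
    have hS : ∀ x, x ∈ S ↔ LinearMap.toSpanSingleton (GrpAlg k (m + n)) _
        (GMod.el (GMod.std rfl) (p 1) (p' 1)) ((I (m + n)).hom x) = x := fun x => sub_eq_zero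
    refine fun x => (hS x).1 (GMod.el_induction S (fun {a b} θ x y => ?_) x)
    rw [hS]
    by_cases ha : a = m
    · by_cases hb : b = n
      · subst ha
        subst hb
        rw [hI, hiX, hiY]
        refine (GMod.reg_smul θ _ _ _ _).trans ?_
        rw [hp, hp']
      · have := hY b hb
        rw [Subsingleton.elim y 0, GMod.el_zero_right, map_zero, map_zero]
    · have := hX a ha
      rw [Subsingleton.elim x 0, GMod.el_zero_left, map_zero, map_zero]
  · intro r
    change (I (m + n)).hom (r • GMod.el (GMod.std rfl) (p 1) (p' 1)) = _
    rw [map_smul, hI, hiX, hiY, h2, h2', one_mul, one_mul, reg_std]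
    rfl

theorem splits_single {n : ℕ} {e : GrpAlg k n} {P : ModuleCat.{u} (GrpAlg k n)} (h : Splits e P) :
    Splits e (single P n) := by
  rwa [single_self]

/-- The induction product as a biadditive map. -/
def symMulHom (m n : ℕ) : SymK k m →+ SymK k n →+ SymK k (m + n) :=
  (((AddMonoidHom.mul (R := K0 (SumProj k))).comp (inclK m)).compl₂ (inclK n)).compr₂ (compK (m + n))

theorem symMulHom_apply {m n : ℕ} (x : SymK k m) (y : SymK k n) :
    symMulHom m n x y = symMul m n x y := rfl

theorem symMul_cls {m n : ℕ} (P : Proj k m) (Q : Proj k n) :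
    symMul m n (K0.cls P) (K0.cls Q) = K0.cls (comp (m + n) (incl P ⊗ incl Q)) := by
  rw [symMul, inclK_cls, inclK_cls, K0.cls_mul, compK_cls]

theorem splits_tensor {m n : ℕ} {P : Proj k m} {Q : Proj k n} {e : GrpAlg k m} {f : GrpAlg k n}
    (hP : Splits e P.obj) (hQ : Splits f Q.obj) :
    Splits (GMod.algRight (rfl : m + n = m + n) f * GMod.algLeft rfl e)
      (comp (m + n) (incl P ⊗ incl Q)).obj :=
  Splits.tens (fun _ hj => single_ne P.obj (Ne.symm hj)) (fun _ hj => single_ne Q.obj (Ne.symm hj))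
    (splits_single hP) (splits_single hQ)

section

variable {F : Type} [Field F] [Algebra F k]

theorem extScal_algLeft {m n N : ℕ} (h : m + n = N) (a : GrpAlg F m) :
    extScal k N (GMod.algLeft h a) = GMod.algLeft h (extScal k m a) := by
  refine GMod.algInd (P := fun a => extScal k N (GMod.algLeft h a) =
    GMod.algLeft h (extScal k m a)) a ?_ (fun a b ha hb => ?_) fun σ c => ?_
  · simp only [map_zero]
  · simp only [map_add, ha, hb]
  · simp only [extScal_single, GMod.algLeft_single]

theorem extScal_algRight {m n N : ℕ} (h : m + n = N) (a : GrpAlg F n) :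
    extScal k N (GMod.algRight h a) = GMod.algRight h (extScal k n a) := by
  refine GMod.algInd (P := fun a => extScal k N (GMod.algRight h a) =
    GMod.algRight h (extScal k n a)) a ?_ (fun a b ha hb => ?_) fun σ c => ?_
  · simp only [map_zero]
  · simp only [map_add, ha, hb]
  · simp only [extScal_single, GMod.algRight_single]

variable (k) in
-- By biadditivity multiplicativity is checked on modules cut out by idempotents over F. The
-- idempotent of their induction product is built from embeddings of symmetric groups, which commute
-- with extension of scalars.
theorem exists_extScal_ringEquiv (S : ∀ n, SplitData F (GrpAlg F n)) :
    ∃ (ψ : ∀ n, SymK F n ≃+ SymK k n) (Ψ : SymRing F ≃+* SymRing k),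
      ∀ n x, Ψ (DirectSum.of _ n x) = DirectSum.of _ n (ψ n x) := by
  choose ψ hψ using fun n => exists_extScal_equiv k (S n)
  have hmul : ∀ m n (x : SymK F m) (y : SymK F n),
      ψ (m + n) (symMul m n x y) = symMul m n (ψ m x) (ψ n y) := by
    intro m n x y
    simp only [← symMulHom_apply]
    induction closure_splits_eq_top (S m) x using AddSubgroup.closure_induction with
    | mem x hx =>
      obtain ⟨e, P, he, hP, rfl⟩ := hx
      induction closure_splits_eq_top (S n) y using AddSubgroup.closure_induction with
      | mem y hy =>
        obtain ⟨f, Q, hf, hQ, rfl⟩ := hy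
        obtain ⟨P', hP'⟩ := exists_proj_splits (SplitData.idem_extScal k he)
        obtain ⟨Q', hQ'⟩ := exists_proj_splits (SplitData.idem_extScal k hf)
        have h1 := splits_tensor hP hQ
        have h2 := splits_tensor hP' hQ'
        rw [← extScal_algLeft, ← extScal_algRight, ← map_mul] at h2
        rw [hψ m e he P P' hP hP', hψ n f hf Q Q' hQ hQ', symMulHom_apply, symMulHom_apply,
          symMul_cls, symMul_cls]
        exact hψ (m + n) _ h1.isIdempotentElem _ _ h1 h2
      | zero => simp only [map_zero]
      | add y y' _ _ hy hy' => simp only [map_add, hy, hy']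
      | neg y _ hy => simp only [map_neg, hy]
    | zero => simp only [map_zero, AddMonoidHom.zero_apply]
    | add x x' _ _ hx hx' => simp only [map_add, AddMonoidHom.add_apply, hx, hx']
    | neg x _ hx => simp only [map_neg, AddMonoidHom.neg_apply, hx]
  exact ⟨ψ, directSumRingEquiv ψ hmul, directSumRingEquiv_of _ _⟩

end

/-- `GrpAlg F n` is the opposite of the group algebra, and inversion of permutations identifies the
two. -/
theorem nonempty_splitData {F : Type} [Field F]
    (h : ∀ n, IsSplitAlg F (MonoidAlgebra F (Equiv.Perm (Fin n)))) (n : ℕ) :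
    Nonempty (SplitData F (GrpAlg F n)) := by
  have hsurj : Function.Surjective (invAlg F (Equiv.Perm (Fin n))) := fun a => by
    refine GMod.algInd (P := fun a => ∃ b, invAlg F (Equiv.Perm (Fin n)) b = a) a
      ⟨0, map_zero _⟩ ?_ fun σ c => ⟨.single σ⁻¹ c, by rw [invAlg_single, inv_inv]⟩
    rintro _ _ ⟨a, rfl⟩ ⟨b, rfl⟩
    exact ⟨a + b, map_add _ _ _⟩
  have := Module.Finite.of_surjective (invAlg F (Equiv.Perm (Fin n))).toLinearMap hsurj
  exact ⟨(exists_splitData ((h n).of_surjective _ hsurj)).choose⟩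

theorem exists_symRing_equiv {F : Type} [Field F] {k : Type u} [Field k] {k' : Type v} [Field k']
    [Algebra F k] [Algebra F k'] (h : ∀ n, IsSplitAlg F (MonoidAlgebra F (Equiv.Perm (Fin n)))) :
    ∃ ψ : SymRing k ≃+* SymRing k', IsGraded ψ := by
  have S := fun n => (nonempty_splitData h n).some
  obtain ⟨ψ, Ψ, hΨ⟩ := exists_extScal_ringEquiv k S
  obtain ⟨ψ', Ψ', hΨ'⟩ := exists_extScal_ringEquiv k' S
  refine ⟨Ψ.symm.trans Ψ', fun n x => ⟨ψ' n ((ψ n).symm x), ?_⟩⟩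
  rw [RingEquiv.trans_apply, ← hΨ', ← Ψ.symm_apply_apply (DirectSum.of _ n ((ψ n).symm x)), hΨ,
    AddEquiv.apply_symm_apply]

/-- Both fields contain the same prime field, `ZMod p` or `ℚ`, over which the group algebras are
split; both graded rings are compared with that of the prime field. -/
theorem exists_symRing_equiv_of_ringChar_eq {k : Type u} [Field k] {k' : Type v} [Field k']
    (h : ringChar k' = ringChar k) : ∃ ψ : SymRing k ≃+* SymRing k', IsGraded ψ := by
  obtain ⟨p, hp⟩ := CharP.exists k
  have hpk : ringChar k = p := ringChar.eq k p
  have hp' : CharP k' p := by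
    rw [← hpk, ← h]
    exact ringChar.charP k'
  rcases CharP.char_is_prime_or_zero k p with hprime | rfl
  · have : Fact p.Prime := ⟨hprime⟩
    let _ := ZMod.algebra k p
    let _ := ZMod.algebra k' p
    exact exists_symRing_equiv fun n => isSplitAlg_zmod p (Fin n)
  · have := CharP.charP_to_charZero k
    have := CharP.charP_to_charZero k'
    exact exists_symRing_equiv fun n => isSplitAlg_rat (Fin n)

end Deligne

end

theorem mainTheorem9 (k : Type u) [Field k] (T : k) :
    (∃ F : (repFiltration k T).Gr ⥤ SumProj k,
      F.IsEquivalence ∧ F.Additive ∧ F.Linear k ∧ Nonempty F.Braided ∧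
      (∀ (n : ℕ) (X : (repFiltration k T).Gr),
        (repFiltration k T).grDegree n X ↔ sumDegree k n (F.obj X)) ∧
      ∃ φ : (repFiltration k T).GrK0 ≃+* SymRing k, IsGraded φ ∧
        ∀ (n : ℕ) (X : (repFiltration k T).Gr),
          φ (DirectSum.of _ n ((repFiltration k T).grCls n (X.as.obj n) (X.as.property.1 n))) =
            DirectSum.of (SymK k) n (K0.cls (comp n (F.obj X)))) ∧
    ∀ (k' : Type v) [Field k'], ringChar k' = ringChar k →
      ∃ ψ : SymRing k ≃+* SymRing k', IsGraded ψ := by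
  refine ⟨⟨grFunctor k T, inferInstance, inferInstance, inferInstance, ⟨inferInstance⟩,
    grDegree_iff, grK0Equiv k T, isGraded_grK0Equiv, grK0Equiv_grCls⟩,
    fun _ _ h => exists_symRing_equiv_of_ringChar_eq h⟩
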